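/- **Setting.** Let $\mathsf g>0$ (gravity), $h_0>0$, $R>0$. For $v=(\zeta,q)\in\mathbb R^2$ put $h=h_0+\zeta$ and $$A(v)=\begin{pmatrix}0&1\\ \mathsf g h-\frac{q^2}{h^2}&\frac{2q}{h}\end{pmatrix},\qquad B(v,r)=\begin{pmatrix}0&\frac1r\\ 0&\frac{q}{rh}\end{pmatrix}.$$ $L^2_r$ and $H^m_r$ denote the $\mathbb R^2$-valued Lebesgue and Sobolev spaces on $(R,\infty)$, or on $(0,T)\times(R,\infty)$, with weight $r$ (measure $r\,dr$, resp. $r\,dr\,dt$). Let $X^k(T)=\bigcap_{j=0}^kC^j([0,T],H^{k-j}_r((R,\infty)))$, $\|v(t)\|_{X^k}=\sum_{j=0}^k\|\partial_t^jv(t)\|_{H^{k-j}_r}$ and $\|v\|_{X^k(T)}=\sup_{t\in[0,T]}\|v(t)\|_{X^k}$. Continuous representatives on $[0,T]\times[R,\infty)$ are used for $u$ and $\bar u$ below. Consider the linear mixed problem $$\partial_tu+A(\bar u)\partial_ru+B(\bar u,r)u=f\ \text{ in }(0,T)\times(R,\infty),\qquad \mathbf e_2\cdot u|_{r=R}=g,\qquad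 u|_{t=0}=u_0 .\tag{L}$$ $\bar u=(\bar\zeta,\bar q)$ is *subsonic* if $\bar q^2/\bar h^2<\mathsf g\bar h$ on $[0,T]\times[R,\infty)$, where $\bar h=h_0+\bar\zeta$; it is subsonic *with margin* $\delta>0$ if $\mathsf g\bar h-\bar q^2/\bar h^2\ge\delta$ there. With $\lambda_\pm(v)=\pm\sqrt{\mathsf gh}+q/h$, let $P_\pm(v)$ be the projectors on the eigenspaces of $A(v)$ for $\lambda_\pm(v)$, i.e. $P_+=\frac{A-\lambda_-\mathrm{Id}}{\lambda_+-\lambda_-}$, $P_-=-\frac{A-\lambda_+\mathrm{Id}}{\lambda_+-\lambda_-}$, and for $M>0$ let $S=S_M(v)=M P_-^TP_-+P_+^TP_+$. Call $(M,\alpha,c_1,c_2)$, all positive, *symmetrizer data* for $\bar u$ on $[0,T]\times[R,\infty)$ if, at each point there, $S(\bar u)$ and $S(\bar u)A(\bar u)$ are symmetric, $S(\bar u)\ge\alpha\,\mathrm{Id}$ and $S(\bar u)A(\bar u)$ is negative definite on $\mathbf e_2^\perp$, and if at each point of $[0,T]\times\{R\}$, $-(S(\bar u)A(\bar u)x,x)\ge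 c_1|x|^2-c_2|\mathbf e_2\cdot x|^2$ for all $x\in\mathbb R^2$. **Proposition.** (a) If $T>0$ and $\bar u\in X^2(T)$ is subsonic, then $\bar u$ is subsonic with some margin $\delta>0$ and has symmetrizer data. (b) Let $\delta>0$. There is a non-decreasing function $C_R:[0,\infty)\to[0,\infty)$, and for each integer $k\ge1$ there are non-decreasing functions $c,\,C_{1,k,R},\,C_{2,k,R}:[0,\infty)\to[0,\infty)$, such that the following holds for all $T>0$, with $s=\max(k,2)$; these functions depend only on $\mathsf g,h_0,R,\delta$ and (except $C_R$) on $k$. Let $\bar u\in X^s(T)$ be subsonic with margin $\delta$, let $(M,\alpha,c_1,c_2)$ be symmetrizer data for $\bar u$, and let $f\in H^k_r((0,T)\times(R,\infty))$ and $g\in H^k((0,T))$. Then every solution $u\in H^{k+1}_r((0,T)\times(R,\infty))$ of (L) belongs to $X^k(T)$, its trace $u|_{r=R}$ belongs to $H^k((0,T))$, and for all $t\in[0,T]$ $$\|u(t)\|_{X^k}^2+\|u|_{r=R}\|_{H^k((0,t))}^2\le c_{\alpha,R}\,e^{t\,C_{\alpha,R,k}}\Big(\|u_0\|_{X^k}^2+\|g\|_{H^k((0,t))}^2+K_{k,R}\int_0^t\|f(\tau)\|_{X^k}^2\,d\tau\Big),$$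 where $\|u_0\|_{X^k}:=\|u(0)\|_{X^k}=\sum_{j=0}^k\|\partial_t^ju|_{t=0}\|_{H^{k-j}_r}$ and $$c_{\alpha,R}=\frac{\max(c(\|\bar u(0)\|_{X^2}),c_2R)}{\min(\alpha,c_1R)},\qquad K_{k,R}=\frac{C_{2,k,R}(\|\bar u\|_{X^s(T)})}{\max(c(\|\bar u(0)\|_{X^2}),c_2R)},$$ $$C_{\alpha,R,k}=1+\alpha^{-1}C_R(\|\bar u\|_{X^2(T)})+\alpha^{-1}(k+1)\,C_{1,k,R}(\|\bar u\|_{X^s(T)}).$$ -/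

import Mathlib

open MeasureTheory Set
open scoped ContDiff Matrix

/-- State vectors `(ζ, q)` (elevation, radial discharge), with the Euclidean norm. -/
abbrev State : Type := EuclideanSpace ℝ (Fin 2)

namespace FloatingSW

/-! ### Weighted Lebesgue and Sobolev spaces -/

/-- The measure `r dr` on `(R, ∞)`. -/
noncomputable def radialMeasure (R : ℝ) : Measure ℝ :=
  (volume.restrict (Ioi R)).withDensity (fun r => ENNReal.ofReal r)

/-- The weighted space `L²_r((R, ∞))`. -/
abbrev L2r (R : ℝ) : Type := Lp State 2 (radialMeasure R)

/-- The strip `(0, T) × (R, ∞)`; a point is `(t, r)`. -/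
def strip (T R : ℝ) : Set (ℝ × ℝ) := Ioo 0 T ×ˢ Ioi R

/-- The closed strip `[0, T] × [R, ∞)`. -/
def closedStrip (T R : ℝ) : Set (ℝ × ℝ) := Icc 0 T ×ˢ Ici R

/-- The measure `r dr dt` on `(0, T) × (R, ∞)`. -/
noncomputable def stripMeasure (T R : ℝ) : Measure (ℝ × ℝ) :=
  (volume.restrict (strip T R)).withDensity (fun p => ENNReal.ofReal p.2)

/-- `w` is the weak derivative of `v` on the open set `Ω ⊆ ℝ`. -/
def IsWeakDeriv {F : Type*} [NormedAddCommGroup F] [NormedSpace ℝ F]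
    (Ω : Set ℝ) (v w : ℝ → F) : Prop :=
  ∀ φ : ℝ → ℝ, ContDiff ℝ ∞ φ → HasCompactSupport φ → tsupport φ ⊆ Ω →
    ∫ x in Ω, deriv φ x • v x = - ∫ x in Ω, φ x • w x

/-- `w` is the weak derivative of `v` on the open set `Ω ⊆ ℝ × ℝ` in the direction `e`. -/
def IsWeakPartialDeriv (Ω : Set (ℝ × ℝ)) (e : ℝ × ℝ) (v w : ℝ × ℝ → State) : Prop :=
  ∀ φ : ℝ × ℝ → ℝ, ContDiff ℝ ∞ φ → HasCompactSupport φ → tsupport φ ⊆ Ω →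
    ∫ p in Ω, (fderiv ℝ φ p e) • v p = - ∫ p in Ω, φ p • w p

/-- `v ∈ H^k((0, T))`, and `d i` is its `i`-th weak derivative for `i ≤ k`. -/
structure IsHFamily {F : Type*} [NormedAddCommGroup F] [NormedSpace ℝ F]
    (k : ℕ) (T : ℝ) (v : ℝ → F) (d : ℕ → ℝ → F) : Prop where
  repr : d 0 =ᵐ[volume.restrict (Ioo 0 T)] v
  memLp : ∀ i, i ≤ k → MemLp (d i) 2 (volume.restrict (Ioo 0 T))
  deriv : ∀ i, i < k → IsWeakDeriv (Ioo 0 T) (d i) (d (i + 1))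

/-- The square of the norm of `H^k((0, t))`, from the family of derivatives. -/
noncomputable def hNormSq {F : Type*} [NormedAddCommGroup F] [NormedSpace ℝ F]
    (k : ℕ) (d : ℕ → ℝ → F) (t : ℝ) : ℝ :=
  ∑ i ∈ Finset.range (k + 1), ∫ τ in Ioo 0 t, ‖d i τ‖ ^ 2

/-- `v ∈ H^k_r((0, T) × (R, ∞))`, and `d i j` is its weak derivative `∂_t^i ∂_r^j v`
for `i + j ≤ k`. -/
structure IsStripFamily (k : ℕ) (T R : ℝ) (v : ℝ × ℝ → State)
    (d : ℕ → ℕ → ℝ × ℝ → State) : Prop where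
  repr : d 0 0 =ᵐ[volume.restrict (strip T R)] v
  memLp : ∀ i j, i + j ≤ k → MemLp (d i j) 2 (stripMeasure T R)
  dt : ∀ i j, i + j < k → IsWeakPartialDeriv (strip T R) (1, 0) (d i j) (d (i + 1) j)
  dr : ∀ i j, i + j < k → IsWeakPartialDeriv (strip T R) (0, 1) (d i j) (d i (j + 1))

/-- `‖v(t)‖_{X^k} = ∑_{i ≤ k} ‖∂_t^i v(t)‖_{H_r^{k-i}}` for the family `d i j = ∂_t^i ∂_r^j v`
of functions on the strip (meaningful for almost every `t`). -/
noncomputable def stripXNorm (k : ℕ) (R : ℝ) (d : ℕ → ℕ → ℝ × ℝ → State) (t : ℝ) : ℝ :=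
  ∑ i ∈ Finset.range (k + 1),
    √(∑ j ∈ Finset.range (k - i + 1), ∫ r, ‖d i j (t, r)‖ ^ 2 ∂(radialMeasure R))

/-- `v ∈ X^k(T) = ⋂_{i ≤ k} C^i([0, T], H_r^{k-i}((R, ∞)))`, and for `i + j ≤ k` the curve
`V i j` in `L²_r((R, ∞))` is `∂_t^i ∂_r^j v`. Time derivatives are derivatives of curves in
`L²_r((R, ∞))`, one-sided at the end points; membership of `v` in `C^i([0, T], H_r^{k-i})` says
that all the curves `∂_r^j v`, `j ≤ k - i`, are of class `C^i` in `L²_r((R, ∞))`. -/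
structure IsXFamily (k : ℕ) (T R : ℝ) (v : ℝ × ℝ → State) (V : ℕ → ℕ → ℝ → L2r R) : Prop where
  repr : ∀ t ∈ Icc 0 T, (V 0 0 t : ℝ → State) =ᵐ[radialMeasure R] fun r => v (t, r)
  cont : ∀ i j, i + j ≤ k → ContinuousOn (V i j) (Icc 0 T)
  dt : ∀ i j, i + j < k → ∀ t ∈ Icc 0 T,
    HasDerivWithinAt (V i j) (V (i + 1) j t) (Icc 0 T) t
  dr : ∀ i j, i + j < k → ∀ t ∈ Icc 0 T, IsWeakDeriv (Ioi R) (V i j t) (V i (j + 1) t)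

/-- `‖v(t)‖_{X^k} = ∑_{i ≤ k} ‖∂_t^i v(t)‖_{H_r^{k-i}}`. -/
noncomputable def xNorm (k : ℕ) {R : ℝ} (V : ℕ → ℕ → ℝ → L2r R) (t : ℝ) : ℝ :=
  ∑ i ∈ Finset.range (k + 1), √(∑ j ∈ Finset.range (k - i + 1), ‖V i j t‖ ^ 2)

/-- `‖v‖_{X^k(T)} = sup_{t ∈ [0, T]} ‖v(t)‖_{X^k}`. -/
noncomputable def xNormSup (k : ℕ) (T : ℝ) {R : ℝ} (V : ℕ → ℕ → ℝ → L2r R) : ℝ :=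
  sSup (xNorm k V '' Icc 0 T)

/-! ### The linearized shallow water system -/

/-- The fluid height `h = h₀ + ζ`. -/
noncomputable def height (h₀ : ℝ) (v : State) : ℝ := h₀ + v 0

/-- The matrix `A(v)`. -/
noncomputable def matA (grav h₀ : ℝ) (v : State) : Matrix (Fin 2) (Fin 2) ℝ :=
  !![0, 1;
     grav * height h₀ v - v 1 ^ 2 / height h₀ v ^ 2, 2 * v 1 / height h₀ v]

/-- The matrix `B(v, r)`. -/
noncomputable def matB (h₀ : ℝ) (v : State) (r : ℝ) : Matrix (Fin 2) (Fin 2) ℝ :=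
  !![0, 1 / r;
     0, v 1 / (r * height h₀ v)]

/-- `u`, with weak derivatives `U i j = ∂_t^i ∂_r^j u`, solves the mixed problem
`∂_t u + A(ū) ∂_r u + B(ū, r) u = f`, `e₂ · u|_{r=R} = gb`, `u|_{t=0} = u₀`.
It is used for `u` continuous on the closed strip, so that the traces are values. -/
structure IsSolution (grav h₀ T R : ℝ) (ubar : ℝ × ℝ → State) (f : ℝ × ℝ → State)
    (gb : ℝ → ℝ) (u₀ : ℝ → State) (u : ℝ × ℝ → State) (U : ℕ → ℕ → ℝ × ℝ → State) : Prop where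
  pde : ∀ᵐ p ∂(volume.restrict (strip T R)),
    U 1 0 p + Matrix.toEuclideanLin (matA grav h₀ (ubar p)) (U 0 1 p)
      + Matrix.toEuclideanLin (matB h₀ (ubar p) p.2) (u p) = f p
  boundary : ∀ᵐ t ∂(volume.restrict (Ioo 0 T)), u (t, R) 1 = gb t
  initial : ∀ᵐ r ∂(volume.restrict (Ioi R)), u (0, r) = u₀ r

/-- The subsonic condition `q² / h² < g h` on `[0, T] × [R, ∞)`. It forces `h > 0`. -/
def Subsonic (grav h₀ T R : ℝ) (v : ℝ × ℝ → State) : Prop :=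
  ∀ p ∈ closedStrip T R, v p 1 ^ 2 / height h₀ (v p) ^ 2 < grav * height h₀ (v p)

/-- The subsonic condition with margin `δ`: `g h - q² / h² ≥ δ` on `[0, T] × [R, ∞)`. -/
def SubsonicWith (grav h₀ T R δ : ℝ) (v : ℝ × ℝ → State) : Prop :=
  ∀ p ∈ closedStrip T R,
    δ ≤ grav * height h₀ (v p) - v p 1 ^ 2 / height h₀ (v p) ^ 2

/-! ### The symmetrizer -/

/-- The eigenvalue `λ₊ = √(g h) + q / h` of `A(v)`. -/
noncomputable def lamPlus (grav h₀ : ℝ) (v : State) : ℝ :=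
  √(grav * height h₀ v) + v 1 / height h₀ v

/-- The eigenvalue `λ₋ = -√(g h) + q / h` of `A(v)`. -/
noncomputable def lamMinus (grav h₀ : ℝ) (v : State) : ℝ :=
  -√(grav * height h₀ v) + v 1 / height h₀ v

/-- The projector on the eigenspace of `λ₊`. -/
noncomputable def projPlus (grav h₀ : ℝ) (v : State) : Matrix (Fin 2) (Fin 2) ℝ :=
  (lamPlus grav h₀ v - lamMinus grav h₀ v)⁻¹ • (matA grav h₀ v - lamMinus grav h₀ v • 1)

/-- The projector on the eigenspace of `λ₋`. -/
noncomputable def projMinus (grav h₀ : ℝ) (v : State) : Matrix (Fin 2) (Fin 2) ℝ :=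
  -((lamPlus grav h₀ v - lamMinus grav h₀ v)⁻¹ • (matA grav h₀ v - lamPlus grav h₀ v • 1))

/-- The symmetrizer `S(v) = M P₋ᵀ P₋ + P₊ᵀ P₊`. -/
noncomputable def matS (grav h₀ M : ℝ) (v : State) : Matrix (Fin 2) (Fin 2) ℝ :=
  M • ((projMinus grav h₀ v)ᵀ * projMinus grav h₀ v)
    + (projPlus grav h₀ v)ᵀ * projPlus grav h₀ v

/-- `α` is an ellipticity constant of the symmetrizer `S(ū)` with parameter `M`, for which `S(ū)`
is a Friedrichs symmetrizer and the boundary condition is maximally dissipative, and `c₁`, `c₂`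
are constants of dissipativity: `-(S(ū)A(ū) x, x) ≥ c₁ |x|² - c₂ (e₂ · x)²` on `r = R`. -/
structure IsSymmetrizerData (grav h₀ T R M α c₁ c₂ : ℝ) (ubar : ℝ × ℝ → State) : Prop where
  M_pos : 0 < M
  α_pos : 0 < α
  c₁_pos : 0 < c₁
  c₂_pos : 0 < c₂
  symm : ∀ p ∈ closedStrip T R, (matS grav h₀ M (ubar p)).IsSymm
  symm_mul : ∀ p ∈ closedStrip T R,
    (matS grav h₀ M (ubar p) * matA grav h₀ (ubar p)).IsSymm
  coercive : ∀ p ∈ closedStrip T R, ∀ x : Fin 2 → ℝ,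
    α * (x ⬝ᵥ x) ≤ x ⬝ᵥ (matS grav h₀ M (ubar p) *ᵥ x)
  dissipative : ∀ p ∈ closedStrip T R, ∀ x : Fin 2 → ℝ, x 1 = 0 → x ≠ 0 →
    x ⬝ᵥ ((matS grav h₀ M (ubar p) * matA grav h₀ (ubar p)) *ᵥ x) < 0
  boundary : ∀ t ∈ Icc 0 T, ∀ x : Fin 2 → ℝ,
    c₁ * (x ⬝ᵥ x) - c₂ * x 1 ^ 2
      ≤ -(x ⬝ᵥ ((matS grav h₀ M (ubar (t, R)) * matA grav h₀ (ubar (t, R))) *ᵥ x))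

/-- A non-decreasing function `[0, ∞) → [0, ∞)`. -/
def IsNondecreasing (C : ℝ → ℝ) : Prop :=
  MonotoneOn C (Ici 0) ∧ ∀ x ∈ Ici (0 : ℝ), 0 ≤ C x

end FloatingSW

/-! Part (a). A flow of class `X¹` tends to rest as `r → ∞`, uniformly on `[0, T]`, because the
tails of a continuous curve in `L²_r` are uniformly small (`exists_uniform_tail_le`). Far out the
margin is therefore at least `g h₀ / 4`, and on the remaining compact set it attains a positive
minimum (`exists_margin`). In coordinates along the eigenvectors `(1, λ₋)` and `(1, λ₊)` the forms
of `S` and `S A` are diagonal. A large weight `M` on the `λ₋` component, where `-S A` is positive,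
gives dissipativity up to a multiple of the square of the second component (`matS_apply`,
`dissipation_le`).

Part (b). The estimate does not use `S_M`. The momentum equation is multiplied by `h²`, so that its
coefficients become the polynomials `a₀ = h²`, `a₁ = g h³ - q²`, `a₂ = 2 q h` of the given flow. The
energy density of a solution `(z, q)` is the form `a₀a₁ z² - 2 ε a₀a₁ z q + (a₀² - ε a₀a₂) q²`,
again with polynomial coefficients. Its flux contains `-ε a₁² z²`. For `ε` small in terms of an
upper bound of `h` (`epsOf`), the density is positive definite and the flux at `r = R` is at most `C
q² - c z²` (`energy_ge`, `flux_le`). The boundary term thus controls the whole trace by the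
prescribed component. As everything is polynomial, the Leibniz rule handles all commutators
(`CoefAt.leib`, `exists_rhs_bound`).

The boundary condition can be differentiated in `t` but not in `r`, so the energy estimate is
applied to `∂_t^i u` only (`est_energy`). Derivatives in `r` are recovered from `z_t + q_r` and `a₀
q_t + a₁ z_r + a₂ q_r`, where `a₁` is bounded below by the margin. Reading these combinations off
the equations at time `t` would put norms of derivatives of the coefficients in front of the
estimate. Instead they are bounded by their initial value plus the time integral of their growth,
and the equations are used only under that integral (`nsq_growth`, `est_red1`, `est_red2`).
Induction on the number of `r`-derivatives gives `est_deriv`.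

This is recorded by `Est`: the prefactor is polynomial in a sup bound `Λ` of the coefficients, while
bounds of their derivatives multiply time integrals only. Since `Λ` at time `t` is at most a
constant times `(1 + K₀)(1 + K t)`, with `K₀` an initial norm, the power of `Λ` is at most `C (1 +
K₀)^n exp (n K t)`, and its growth moves into the exponential (`prefactor_le`, `gronwall_le`).
Finally, coercivity of `S` on the eigenvector of `λ₊` forces `α ≤ 1`, so that the constants of the
statement dominate those obtained, even with `C_R = 0` (`final_bound`).

Regularity. Weak derivatives on the strip are replaced by absolute continuity on almost every line.
A countable family of tests suffices for this, so that one null set of lines is discarded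
(`exists_prim`, `exists_prim_ae`). In this form the product rule needs no integrability of the
products, identities can be differentiated (`Fam.zero`), and traces at `t = 0` and `r = R` are
values at left end points. The same description turns `H^{k+1}` into `X^k` and gives traces in `H^k`
(`IsStripFamily.exists_XFamily`, `IsStripFamily.exists_trace`). -/

namespace FloatingSW

open Filter Topology

/-! ### Absolutely continuous functions on an interval, with their value at the left end point -/

/-- `s` is a nonempty open interval with left end point `a`. -/
structure IsLeft (s : Set ℝ) (a : ℝ) : Prop where
  isOpen : IsOpen s
  nonempty : s.Nonempty
  lt : ∀ x ∈ s, a < x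
  sub : ∀ x ∈ s, Ioc a x ⊆ s

lemma isLeft_Ioo {T : ℝ} (hT : 0 < T) : IsLeft (Ioo 0 T) 0 :=
  ⟨isOpen_Ioo, ⟨T / 2, by constructor <;> linarith⟩, fun _ h => h.1,
    fun _ h _ hy => ⟨hy.1, hy.2.trans_lt h.2⟩⟩

lemma isLeft_Ioi (R : ℝ) : IsLeft (Ioi R) R :=
  ⟨isOpen_Ioi, ⟨R + 1, by simp⟩, fun _ h => h, fun _ _ _ hy => hy.1⟩

/-- On `s`, the function `f` is almost everywhere equal to `x ↦ c + ∫_a^x g`. -/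
structure Prim (s : Set ℝ) (a : ℝ) (f g : ℝ → ℝ) (c : ℝ) : Prop where
  int : ∀ x ∈ s, IntervalIntegrable g volume a x
  eq : ∀ᵐ x ∂(volume.restrict s), f x = c + ∫ y in a..x, g y

lemma ac_primitive {g : ℝ → ℝ} {a b : ℝ} (c : ℝ) (hg : IntervalIntegrable g volume a b) :
    AbsolutelyContinuousOnInterval (fun x => c + ∫ y in a..x, g y) a b := by
  have h1 := hg.absolutelyContinuousOnInterval_intervalIntegral (c := a) left_mem_uIcc
  have h2 : AbsolutelyContinuousOnInterval (fun _ : ℝ => c) a b :=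
    (LipschitzWith.const c).lipschitzOnWith.absolutelyContinuousOnInterval
  exact h2.fun_add h1

lemma deriv_primitive_ae {g : ℝ → ℝ} {a b : ℝ} (c : ℝ) (hg : IntervalIntegrable g volume a b) :
    ∀ᵐ x, x ∈ uIcc a b → deriv (fun x => c + ∫ y in a..x, g y) x = g x := by
  filter_upwards [hg.ae_hasDerivAt_integral] with x hx hxm
  exact ((hx hxm a left_mem_uIcc).const_add c).deriv

lemma intervalIntegrable_primitive_mul {g₁ g₂ : ℝ → ℝ} {a b : ℝ} (c : ℝ)
    (h₁ : IntervalIntegrable g₁ volume a b) (h₂ : IntervalIntegrable g₂ volume a b) :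
    IntervalIntegrable (fun x => (c + ∫ y in a..x, g₁ y) * g₂ x) volume a b :=
  h₂.continuousOn_mul (ac_primitive c h₁).continuousOn

/-- Integration by parts for primitives of integrable functions. -/
lemma integral_primitive_mul {g₁ g₂ : ℝ → ℝ} {a b : ℝ} (c₁ c₂ : ℝ)
    (h₁ : IntervalIntegrable g₁ volume a b) (h₂ : IntervalIntegrable g₂ volume a b) :
    c₁ * c₂ + ∫ x in a..b, (g₁ x * (c₂ + ∫ y in a..x, g₂ y) + (c₁ + ∫ y in a..x, g₁ y) * g₂ x) =
      (c₁ + ∫ y in a..b, g₁ y) * (c₂ + ∫ y in a..b, g₂ y) := by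
  have h := (ac_primitive c₁ h₁).integral_deriv_mul_eq_sub (ac_primitive c₂ h₂)
  have e : ∫ x in a..b, (g₁ x * (c₂ + ∫ y in a..x, g₂ y) + (c₁ + ∫ y in a..x, g₁ y) * g₂ x)
      = ∫ x in a..b, deriv (fun x => c₁ + ∫ y in a..x, g₁ y) x * (c₂ + ∫ y in a..x, g₂ y)
        + (c₁ + ∫ y in a..x, g₁ y) * deriv (fun x => c₂ + ∫ y in a..x, g₂ y) x := by
    apply intervalIntegral.integral_congr_ae
    filter_upwards [deriv_primitive_ae c₁ h₁, deriv_primitive_ae c₂ h₂] with x k₁ k₂ hx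
    rw [k₁ (uIoc_subset_uIcc hx), k₂ (uIoc_subset_uIcc hx)]
  rw [e, h]
  simp

/-! ### Calculus of primitives with a prescribed left value. -/

namespace Prim

variable {s : Set ℝ} {a : ℝ} {f g f₁ g₁ f₂ g₂ : ℝ → ℝ} {c c₁ c₂ : ℝ}

lemma ae_interval (hs : IsLeft s a) {p : ℝ → Prop} (h : ∀ᵐ x ∂(volume.restrict s), p x) {b : ℝ}
    (hb : b ∈ s) : ∀ᵐ x, x ∈ uIoc a b → p x := by
  rw [ae_restrict_iff' hs.isOpen.measurableSet] at h
  filter_upwards [h] with x hx hxm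
  rw [uIoc_of_le (hs.lt b hb).le] at hxm
  exact hx (hs.sub b hb hxm)

lemma congr (hs : IsLeft s a) (h : Prim s a f g c) (hf : f =ᵐ[volume.restrict s] f₁)
    (hg : g =ᵐ[volume.restrict s] g₁) : Prim s a f₁ g₁ c := by
  refine ⟨fun x hx => (h.int x hx).congr_ae ?_, ?_⟩
  · rw [Filter.EventuallyEq, ae_restrict_iff' measurableSet_uIoc]
    exact ae_interval hs hg hx
  · filter_upwards [h.eq, hf, ae_restrict_mem hs.isOpen.measurableSet] with x h1 h2 hx
    rw [← h2, h1]
    congr 1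
    exact intervalIntegral.integral_congr_ae (ae_interval hs hg hx)

lemma add (h₁ : Prim s a f₁ g₁ c₁) (h₂ : Prim s a f₂ g₂ c₂) (hs : IsLeft s a) :
    Prim s a (fun x => f₁ x + f₂ x) (fun x => g₁ x + g₂ x) (c₁ + c₂) := by
  refine ⟨fun x hx => (h₁.int x hx).add (h₂.int x hx), ?_⟩
  filter_upwards [h₁.eq, h₂.eq, ae_restrict_mem hs.isOpen.measurableSet] with x e1 e2 hx
  rw [e1, e2, intervalIntegral.integral_add (h₁.int x hx) (h₂.int x hx)]
  ring

lemma const_mul (h₁ : Prim s a f₁ g₁ c₁) (k : ℝ) :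
    Prim s a (fun x => k * f₁ x) (fun x => k * g₁ x) (k * c₁) := by
  refine ⟨fun x hx => (h₁.int x hx).const_mul k, ?_⟩
  filter_upwards [h₁.eq] with x e1
  rw [e1, intervalIntegral.integral_const_mul]
  ring

lemma const (k : ℝ) : Prim s a (fun _ => k) (fun _ => 0) k :=
  ⟨fun _ _ => by simp, by simp⟩

/-- Integration by parts applies to the two absolutely continuous primitives themselves; they are
then replaced by `f₁` and `f₂`, to which they are equal almost everywhere. -/
lemma mul (h₁ : Prim s a f₁ g₁ c₁) (h₂ : Prim s a f₂ g₂ c₂) (hs : IsLeft s a) :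
    Prim s a (fun x => f₁ x * f₂ x) (fun x => g₁ x * f₂ x + f₁ x * g₂ x) (c₁ * c₂) := by
  have key : Prim s a (fun x => f₁ x * f₂ x)
      (fun x => g₁ x * (c₂ + ∫ y in a..x, g₂ y) + (c₁ + ∫ y in a..x, g₁ y) * g₂ x) (c₁ * c₂) := by
    refine ⟨fun x hx => ?_, ?_⟩
    · refine IntervalIntegrable.add ?_
        (intervalIntegrable_primitive_mul c₁ (h₁.int x hx) (h₂.int x hx))
      simpa [mul_comm] using intervalIntegrable_primitive_mul c₂ (h₂.int x hx) (h₁.int x hx)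
    · filter_upwards [h₁.eq, h₂.eq, ae_restrict_mem hs.isOpen.measurableSet] with x e1 e2 hx
      rw [e1, e2, integral_primitive_mul c₁ c₂ (h₁.int x hx) (h₂.int x hx)]
  refine key.congr hs (Filter.EventuallyEq.refl _ _) ?_
  filter_upwards [h₁.eq, h₂.eq] with x e1 e2
  rw [e1, e2]

/-- The primitive is continuous and zero almost everywhere, hence zero everywhere, and Lebesgue
differentiation returns `g`. This is uniqueness of derivatives on a line. -/
lemma deriv_eq_zero (hs : IsLeft s a) (h : Prim s a f g c) (hf : f =ᵐ[volume.restrict s] 0) :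
    g =ᵐ[volume.restrict s] 0 := by
  have hc : ∀ b ∈ s, ∀ x ∈ Icc a b, c + ∫ y in a..x, g y = 0 := by
    intro b hb
    have hcont : ContinuousOn (fun x => c + ∫ y in a..x, g y) (Icc a b) := by
      have := (ac_primitive c (h.int b hb)).continuousOn
      rwa [uIcc_of_le (hs.lt b hb).le] at this
    have hz : EqOn (fun x => c + ∫ y in a..x, g y) (fun _ => 0) (Icc a b) := by
      refine Measure.eqOn_Icc_of_ae_eq volume (hs.lt b hb).ne ?_ hcont continuousOn_const
      have : ∀ᵐ x ∂(volume.restrict s), (c + ∫ y in a..x, g y) = 0 := by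
        filter_upwards [h.eq, hf] with x e1 e2
        rw [← e1, e2]; rfl
      have h3 := ae_interval hs this hb
      rw [uIoc_of_le (hs.lt b hb).le] at h3
      rw [Measure.restrict_congr_set Ioc_ae_eq_Icc.symm]
      exact (ae_restrict_iff' measurableSet_Ioc).2 h3
    intro x hx
    exact hz hx
  have hloc : ∀ b : ℝ, b ∈ s → ∀ᵐ x, x ∈ Ioo a b → g x = 0 := by
    intro b hb
    filter_upwards [(h.int b hb).ae_hasDerivAt_integral] with x hx hxm
    have h1 := hx (by rw [uIcc_of_le (hs.lt b hb).le]; exact Ioo_subset_Icc_self hxm) a left_mem_uIcc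
    have h2 : HasDerivAt (fun x => ∫ (t : ℝ) in a..x, g t) 0 x := by
      refine (hasDerivAt_const x (-c)).congr_of_eventuallyEq ?_
      filter_upwards [Ioo_mem_nhds hxm.1 hxm.2] with y hy
      have := hc b hb y (Ioo_subset_Icc_self hy)
      linarith
    exact h1.unique h2
  -- The null set in `hloc` depends on the right end point `b`; a countable dense set of end points
  -- leaves a single null set.
  obtain ⟨t, ht, htd⟩ := (TopologicalSpace.exists_countable_dense s)
  have : ∀ᵐ x, ∀ b ∈ t, x ∈ Ioo a (b : ℝ) → g x = 0 :=
    (ae_ball_iff ht).2 fun b _ => hloc b b.2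
  rw [Filter.EventuallyEq, ae_restrict_iff' hs.isOpen.measurableSet]
  filter_upwards [this] with x hx hxs
  have hop : IsOpen {b : s | x < b} := isOpen_lt continuous_const continuous_subtype_val
  have hne : {b : s | x < b}.Nonempty := by
    obtain ⟨e, he, hb⟩ := Metric.isOpen_iff.1 hs.isOpen x hxs
    exact ⟨⟨x + e / 2, hb (by simp [abs_of_pos he]; linarith)⟩, by simp; linarith⟩
  obtain ⟨b, hb, hbt⟩ := htd.exists_mem_open hop hne
  exact hx b hb ⟨hs.lt x hxs, hbt⟩

end Prim

/-! ### One-dimensional weak derivatives tested on a countable family -/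

/-- A bump function of radius `1 / (n + 1)` around `0`. -/
noncomputable def bump (n : ℕ) : ContDiffBump (0 : ℝ) where
  rIn := 1 / (2 * (n + 1))
  rOut := 1 / (n + 1)
  rIn_pos := by positivity
  rIn_lt_rOut := by
    apply one_div_lt_one_div_of_lt <;> [positivity; linarith [(Nat.cast_nonneg n : (0 : ℝ) ≤ n)]]

/-- The mollifier of radius `1 / (n + 1)`. -/
noncomputable def moll (n : ℕ) : ℝ → ℝ := (bump n).normed volume

lemma contDiff_moll (n : ℕ) : ContDiff ℝ ∞ (moll n) := (bump n).contDiff_normed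

lemma moll_neg (n : ℕ) (x : ℝ) : moll n (-x) = moll n x := (bump n).normed_neg x

lemma integral_moll_sub (n : ℕ) (p : ℝ) : ∫ x, moll n (x - p) = 1 := by
  rw [integral_sub_right_eq_self (moll n) p]
  exact (bump n).integral_normed

lemma integrable_moll_sub (n : ℕ) (p : ℝ) : Integrable fun x => moll n (x - p) :=
  ((bump n).integrable_normed (μ := volume)).comp_sub_right p

lemma moll_eq_zero {n : ℕ} {x : ℝ} (h : 1 / ((n : ℝ) + 1) < |x|) : moll n x = 0 := by
  have : x ∉ tsupport (moll n) := by
    unfold moll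
    rw [(bump n).tsupport_normed_eq]
    simpa [bump] using h
  exact image_eq_zero_of_notMem_tsupport this

/-- A smooth function which is `1` between `p` and `q`, with derivative
`moll n (x - p) - moll n (x - q)`. -/
noncomputable def testFn (n : ℕ) (p q : ℝ) (x : ℝ) : ℝ :=
  ∫ y in (min p q - 1 / (n + 1))..x, (moll n (y - p) - moll n (y - q))

lemma contDiff_moll_sub (n : ℕ) (p : ℝ) : ContDiff ℝ ∞ fun x => moll n (x - p) :=
  (contDiff_moll n).comp (contDiff_id.sub contDiff_const)

lemma hasDerivAt_testFn (n : ℕ) (p q x : ℝ) :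
    HasDerivAt (testFn n p q) (moll n (x - p) - moll n (x - q)) x := by
  have hc : Continuous fun y => moll n (y - p) - moll n (y - q) :=
    (contDiff_moll_sub n p).continuous.sub (contDiff_moll_sub n q).continuous
  exact intervalIntegral.integral_hasDerivAt_right (hc.intervalIntegrable _ _)
    (hc.stronglyMeasurableAtFilter _ _) hc.continuousAt

lemma deriv_testFn (n : ℕ) (p q : ℝ) :
    deriv (testFn n p q) = fun x => moll n (x - p) - moll n (x - q) :=
  funext fun x => (hasDerivAt_testFn n p q x).deriv

lemma contDiff_testFn (n : ℕ) (p q : ℝ) : ContDiff ℝ ∞ (testFn n p q) := by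
  rw [contDiff_infty_iff_deriv]
  refine ⟨fun x => (hasDerivAt_testFn n p q x).differentiableAt, ?_⟩
  rw [deriv_testFn]
  exact (contDiff_moll_sub n p).sub (contDiff_moll_sub n q)

/-- To the left of both bumps nothing has been integrated yet; to the right of both, the two unit
masses cancel. -/
lemma testFn_eq_zero {n : ℕ} {p q x : ℝ}
    (h : x ∉ Icc (min p q - 1 / ((n : ℝ) + 1)) (max p q + 1 / (n + 1))) : testFn n p q x = 0 := by
  have hn : (0 : ℝ) < 1 / ((n : ℝ) + 1) := by positivity
  have hz : ∀ y ∉ Icc (min p q - 1 / ((n : ℝ) + 1)) (max p q + 1 / (n + 1)),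
      moll n (y - p) - moll n (y - q) = 0 := by
    intro y hy
    rw [mem_Icc, not_and_or, not_le, not_le] at hy
    have : 1 / ((n : ℝ) + 1) < |y - p| ∧ 1 / ((n : ℝ) + 1) < |y - q| := by
      rw [lt_abs, lt_abs]
      rcases hy with hy | hy
      · have h1 := min_le_left p q
        have h2 := min_le_right p q
        constructor <;> right <;> linarith
      · have h1 := le_max_left p q
        have h2 := le_max_right p q
        constructor <;> left <;> linarith
    rw [moll_eq_zero this.1, moll_eq_zero this.2, sub_zero]
  rw [mem_Icc, not_and_or, not_le, not_le] at h
  unfold testFn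
  rcases h with h | h
  · rw [intervalIntegral.integral_symm, intervalIntegral.integral_of_le h.le,
      integral_Ioc_eq_integral_Ioo, neg_eq_zero]
    refine setIntegral_eq_zero_of_forall_eq_zero fun y hy => hz y ?_
    simp only [mem_Icc, not_and_or, not_le]
    exact Or.inl hy.2
  · have hle : min p q - 1 / ((n : ℝ) + 1) ≤ x := by
      have := min_le_max (a := p) (b := q)
      linarith
    rw [intervalIntegral.integral_of_le hle, ← integral_Icc_eq_integral_Ioc,
      setIntegral_eq_integral_of_forall_compl_eq_zero, integral_sub (integrable_moll_sub n p)
      (integrable_moll_sub n q), integral_moll_sub, integral_moll_sub, sub_self]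
    intro y hy
    refine hz y fun hy' => hy ⟨hy'.1, hy'.2.trans h.le⟩

lemma tsupport_testFn (n : ℕ) (p q : ℝ) :
    tsupport (testFn n p q) ⊆ Icc (min p q - 1 / ((n : ℝ) + 1)) (max p q + 1 / (n + 1)) :=
  closure_minimal (fun _ hx => by_contra fun h => hx (testFn_eq_zero h)) isClosed_Icc

lemma hasCompactSupport_testFn (n : ℕ) (p q : ℝ) : HasCompactSupport (testFn n p q) :=
  isCompact_Icc.of_isClosed_subset (isClosed_tsupport _) (tsupport_testFn n p q)

/-- Only the two balls have to lie in `s`: as `s` is an interval, it contains everything between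
them. -/
lemma IsLeft.tsupport_testFn_subset {s : Set ℝ} {a : ℝ} (hs : IsLeft s a) {n : ℕ} {p q : ℝ}
    (hp : Metric.closedBall p (1 / ((n : ℝ) + 1)) ⊆ s)
    (hq : Metric.closedBall q (1 / ((n : ℝ) + 1)) ⊆ s) : tsupport (testFn n p q) ⊆ s := by
  refine (tsupport_testFn n p q).trans fun x hx => ?_
  have hn : (0 : ℝ) < 1 / ((n : ℝ) + 1) := by positivity
  have hmem : ∀ r, Metric.closedBall r (1 / ((n : ℝ) + 1)) ⊆ s →
      a < r - 1 / (n + 1) ∧ r + 1 / ((n : ℝ) + 1) ∈ s := by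
    intro r hr
    exact ⟨hs.lt _ (hr (by rw [Metric.mem_closedBall, Real.dist_eq, abs_le]; constructor <;> linarith)),
      hr (by rw [Metric.mem_closedBall, Real.dist_eq, abs_le]; constructor <;> linarith)⟩
  have h1 := hmem p hp
  have h2 := hmem q hq
  rcases le_total p q with h | h
  · rw [min_eq_left h, max_eq_right h] at hx
    exact hs.sub _ h2.2 ⟨h1.1.trans_le hx.1, hx.2⟩
  · rw [min_eq_right h, max_eq_left h] at hx
    exact hs.sub _ h1.2 ⟨h2.1.trans_le hx.1, hx.2⟩

/-- A compact subset of `s` lies to the left of some point of `s`. -/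
lemma IsLeft.exists_right {s : Set ℝ} {a : ℝ} (hs : IsLeft s a) {K : Set ℝ} (hK : IsCompact K)
    (hKs : K ⊆ s) : ∃ b ∈ s, K ⊆ Ioo a b := by
  rcases K.eq_empty_or_nonempty with rfl | hne
  · exact ⟨hs.nonempty.some, hs.nonempty.some_mem, empty_subset _⟩
  · obtain ⟨m, hm, hmax⟩ := hK.exists_isMaxOn hne continuousOn_id
    obtain ⟨e, he, hb⟩ := Metric.isOpen_iff.1 hs.isOpen m (hKs hm)
    refine ⟨m + e / 2, hb (by simp [abs_of_pos he]; linarith), fun x hx => ⟨hs.lt x (hKs hx), ?_⟩⟩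
    have : x ≤ m := hmax hx
    linarith

/-- The primitive relation implies the weak derivative relation. -/
lemma Prim.integral_deriv_mul {s : Set ℝ} {a : ℝ} (hs : IsLeft s a) {f g : ℝ → ℝ} {c : ℝ}
    (h : Prim s a f g c) {φ : ℝ → ℝ} (hφ : ContDiff ℝ ∞ φ) (hφc : HasCompactSupport φ)
    (hφs : tsupport φ ⊆ s) : ∫ x in s, deriv φ x * f x = - ∫ x in s, φ x * g x := by
  obtain ⟨b, hb, hsub⟩ := hs.exists_right hφc hφs
  have hab : a < b := hs.lt b hb
  have hd : Continuous (deriv φ) := hφ.continuous_deriv (by simp)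
  have hz : ∀ x, x ∉ Ioo a b → φ x = 0 := fun x hx =>
    image_eq_zero_of_notMem_tsupport fun h => hx (hsub h)
  have hz' : ∀ x, x ∉ Ioo a b → deriv φ x = 0 := fun x hx =>
    image_eq_zero_of_notMem_tsupport fun h => hx (hsub (tsupport_deriv_subset h))
  have hIs : Ioo a b ⊆ s := fun x hx => hs.sub b hb ⟨hx.1, hx.2.le⟩
  -- The support of `φ` lies to the left of some `b ∈ s`, which brings both integrals back to a
  -- bounded interval where integration by parts holds without boundary terms.
  have red : ∀ k : ℝ → ℝ, (∀ x, x ∉ Ioo a b → k x = 0) → ∫ x in s, k x = ∫ x in a..b, k x := by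
    intro k hk
    rw [intervalIntegral.integral_of_le hab.le, integral_Ioc_eq_integral_Ioo,
      setIntegral_eq_integral_of_forall_compl_eq_zero (fun x hx => hk x fun h => hx (hIs h)),
      setIntegral_eq_integral_of_forall_compl_eq_zero (fun x hx => hk x hx)]
  have hφp : Prim s a φ (deriv φ) 0 := by
    refine ⟨fun x _ => hd.intervalIntegrable _ _, Filter.Eventually.of_forall fun x => ?_⟩
    rw [intervalIntegral.integral_deriv_eq_sub (fun y _ => hφ.differentiable (by simp) y)
      (hd.intervalIntegrable _ _), hz a (by simp)]
    ring
  have key := integral_primitive_mul 0 c (hd.intervalIntegrable a b) (h.int b hb)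
  have e1 : ∀ x, (0 : ℝ) + ∫ y in a..x, deriv φ y = φ x := by
    intro x
    rw [intervalIntegral.integral_deriv_eq_sub (fun y _ => hφ.differentiable (by simp) y)
      (hd.intervalIntegrable _ _), hz a (by simp)]
    ring
  simp only [e1, hz b (by simp), zero_mul, zero_add] at key
  rw [red _ (fun x hx => by rw [hz' x hx, zero_mul]), red _ (fun x hx => by rw [hz x hx, zero_mul])]
  have e2 : ∫ x in a..b, deriv φ x * f x = ∫ x in a..b, deriv φ x * (c + ∫ y in a..x, g y) := by
    apply intervalIntegral.integral_congr_ae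
    filter_upwards [Prim.ae_interval hs h.eq hb] with x hx hxm
    rw [hx hxm]
  rw [e2, eq_neg_iff_add_eq_zero, ← intervalIntegral.integral_add, key]
  · simpa [mul_comm] using
      (hd.continuousOn (s := uIcc a b)).intervalIntegrable.continuousOn_mul
        (ac_primitive c (h.int b hb)).continuousOn
  · exact (h.int b hb).continuousOn_mul hφ.continuous.continuousOn

/-- A function with a weak derivative, tested on the functions `testFn` at rational points, is a
primitive. -/
lemma exists_prim {s : Set ℝ} {a : ℝ} (hs : IsLeft s a) {f g : ℝ → ℝ}
    (hf : LocallyIntegrable (s.indicator f)) (hg : LocallyIntegrable (s.indicator g))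
    (h : ∀ (n : ℕ) (p q : ℚ), Metric.closedBall (p : ℝ) (1 / ((n : ℝ) + 1)) ⊆ s →
      Metric.closedBall (q : ℝ) (1 / ((n : ℝ) + 1)) ⊆ s →
      ∫ x in s, deriv (testFn n p q) x * f x = - ∫ x in s, testFn n p q x * g x) :
    ∃ c, Prim s a f g c := by
  have hsm := hs.isOpen.measurableSet
  -- `G` is the candidate primitive. It remains to see that `f - G` is constant almost everywhere,
  -- which is done by mollification.
  set G : ℝ → ℝ := fun x => ∫ y in a..x, s.indicator g y with hG
  have hGc : Continuous G :=
    intervalIntegral.continuous_primitive (fun x y => (LocallyIntegrable.integrableOn_isCompact hg isCompact_uIcc).intervalIntegrable) a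
  have hGi : LocallyIntegrable (s.indicator G) := by
    rw [locallyIntegrable_iff]
    intro K hK
    exact (hGc.locallyIntegrable.integrableOn_isCompact hK).indicator hsm
  have hint : ∀ x ∈ s, IntervalIntegrable g volume a x := by
    intro x hx
    refine (LocallyIntegrable.integrableOn_isCompact hg (isCompact_uIcc (a := a) (b := x))).intervalIntegrable.congr_ae ?_
    rw [Filter.EventuallyEq, ae_restrict_iff' measurableSet_uIoc]
    refine Filter.Eventually.of_forall fun y hy => ?_
    rw [uIoc_of_le (hs.lt x hx).le] at hy
    rw [indicator_of_mem (hs.sub x hx hy)]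
  have hGeq : ∀ x ∈ s, G x = ∫ y in a..x, g y := by
    intro x hx
    refine intervalIntegral.integral_congr_ae (Filter.Eventually.of_forall fun y hy => ?_)
    rw [uIoc_of_le (hs.lt x hx).le] at hy
    rw [indicator_of_mem (hs.sub x hx hy)]
  set z : ℝ → ℝ := fun x => s.indicator f x - s.indicator G x with hz
  have hzi : LocallyIntegrable z := hf.sub hGi
  have hGp : Prim s a G g 0 := ⟨hint, by
    filter_upwards [ae_restrict_mem hsm] with x hx
    rw [hGeq x hx, zero_add]⟩
  -- the mollification of `z` at a point of `s`
  have hconv : ∀ (n : ℕ) (x : ℝ),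
      convolution (moll n) z (ContinuousLinearMap.lsmul ℝ ℝ) volume x
        = ∫ y in s, moll n (y - x) * (f y - G y) := by
    intro n x
    rw [convolution_eq_swap, ← integral_indicator hsm]
    refine integral_congr_ae (Filter.Eventually.of_forall fun y => ?_)
    simp only [ContinuousLinearMap.lsmul_apply, smul_eq_mul, hz]
    rw [← moll_neg n (x - y), neg_sub]
    by_cases hy : y ∈ s <;> simp [hy]
  have hmi : ∀ (k : ℝ → ℝ), Continuous k → HasCompactSupport k →
      ∀ w : ℝ → ℝ, LocallyIntegrable (s.indicator w) → IntegrableOn (fun y => k y * w y) s := by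
    intro k hk hkc w hw
    rw [← integrable_indicator_iff hsm]
    refine (hw.integrable_smul_left_of_hasCompactSupport hk hkc).congr ?_
    refine Filter.Eventually.of_forall fun y => ?_
    by_cases hy : y ∈ s <;> simp [hy]
  have hcs : ∀ (n : ℕ) (x : ℝ), HasCompactSupport fun y => moll n (y - x) := by
    intro n x
    refine HasCompactSupport.intro (K := Icc (x - 1 / ((n : ℝ) + 1)) (x + 1 / (n + 1)))
      isCompact_Icc fun y hy => moll_eq_zero ?_
    rw [mem_Icc, not_and_or, not_le, not_le] at hy
    rw [lt_abs]
    rcases hy with hy | hy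
    · right; linarith
    · left; linarith
  -- The derivative of `testFn n p q` is the difference of two translated mollifiers, so the tested
  -- identity says exactly that the mollifications of `z` at `p` and at `q` agree.
  have hrat : ∀ (n : ℕ) (p q : ℚ), Metric.closedBall (p : ℝ) (1 / ((n : ℝ) + 1)) ⊆ s →
      Metric.closedBall (q : ℝ) (1 / ((n : ℝ) + 1)) ⊆ s →
      convolution (moll n) z (ContinuousLinearMap.lsmul ℝ ℝ) volume (p : ℝ) =
      convolution (moll n) z (ContinuousLinearMap.lsmul ℝ ℝ) volume (q : ℝ) := by
    intro n p q hp hq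
    have h1 := h n p q hp hq
    have h2 := hGp.integral_deriv_mul hs (contDiff_testFn n p q) (hasCompactSupport_testFn n p q)
      (hs.tsupport_testFn_subset hp hq)
    rw [← h2, deriv_testFn] at h1
    rw [hconv, hconv, ← sub_eq_zero]
    have hI : ∀ x : ℝ, ∀ w : ℝ → ℝ, LocallyIntegrable (s.indicator w) →
        IntegrableOn (fun y => moll n (y - x) * w y) s :=
      fun x w hw => hmi _ (contDiff_moll_sub n x).continuous (hcs n x) w hw
    simp only [sub_mul] at h1
    rw [integral_sub (hI _ f hf) (hI _ f hf), integral_sub (hI _ G hGi) (hI _ G hGi)] at h1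
    simp only [mul_sub]
    rw [integral_sub (hI _ f hf) (hI _ G hGi), integral_sub (hI _ f hf) (hI _ G hGi)]
    linarith
  have hcont : ∀ n, Continuous (convolution (moll n) z (ContinuousLinearMap.lsmul ℝ ℝ) volume) :=
    fun n => HasCompactSupport.continuous_convolution_left _ ((bump n).hasCompactSupport_normed)
      ((bump n).continuous_normed) hzi
  have hrO : Tendsto (fun n => (bump n).rOut) atTop (𝓝 0) := by
    simpa [bump] using tendsto_one_div_add_atTop_nhds_zero_nat (𝕜 := ℝ)
  have hlim : ∀ᵐ x, Tendsto (fun n => convolution (moll n) z (ContinuousLinearMap.lsmul ℝ ℝ)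
      volume x) atTop (𝓝 (z x)) := by
    refine ContDiffBump.ae_convolution_tendsto_right_of_locallyIntegrable (φ := bump) (K := 2) hrO ?_ hzi
    refine Filter.Eventually.of_forall fun n => ?_
    simp only [bump]
    field_simp
    exact le_refl _
  -- Continuity of the mollifications passes from rational to real points. The doubled radius in
  -- `hball` leaves room for a rational point near `x` whose own ball is still contained in `s`.
  have hreal : ∀ x ∈ s, ∀ y ∈ s, ∀ᶠ n in atTop,
      convolution (moll n) z (ContinuousLinearMap.lsmul ℝ ℝ) volume x =
      convolution (moll n) z (ContinuousLinearMap.lsmul ℝ ℝ) volume y := by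
    have hball : ∀ x ∈ s, ∀ᶠ n : ℕ in atTop, Metric.closedBall x (2 * (1 / ((n : ℝ) + 1))) ⊆ s := by
      intro x hx
      obtain ⟨e, he, hb⟩ := Metric.isOpen_iff.1 hs.isOpen x hx
      have ht : Tendsto (fun n : ℕ => 2 * (1 / ((n : ℝ) + 1))) atTop (𝓝 0) := by
        simpa using (tendsto_one_div_add_atTop_nhds_zero_nat (𝕜 := ℝ)).const_mul 2
      filter_upwards [ht.eventually (gt_mem_nhds he)] with n hn
      exact (Metric.closedBall_subset_ball hn).trans hb
    intro x hx y hy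
    filter_upwards [hball x hx, hball y hy] with n hnx hny
    have hn : (0 : ℝ) < 1 / ((n : ℝ) + 1) := by positivity
    have hseq : ∀ x : ℝ, Metric.closedBall x (2 * (1 / ((n : ℝ) + 1))) ⊆ s →
        ∀ v ∈ 𝓝 x, ∃ p : ℚ, (p : ℝ) ∈ v ∧ Metric.closedBall (p : ℝ) (1 / ((n : ℝ) + 1)) ⊆ s := by
      intro x hx v hv
      have hv' := Filter.inter_mem hv (Metric.ball_mem_nhds x hn)
      obtain ⟨_, ⟨p, rfl⟩, hpv, hpb⟩ := Rat.denseRange_cast.inter_nhds_nonempty hv'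
      refine ⟨p, hpv, (Metric.closedBall_subset_closedBall' ?_).trans hx⟩
      rw [Metric.mem_ball] at hpb
      linarith
    by_contra hne
    set C := convolution (moll n) z (ContinuousLinearMap.lsmul ℝ ℝ) volume with hC
    obtain ⟨U, V, hU, hV, hxU, hyV, hUV⟩ := t2_separation hne
    obtain ⟨p, hp, hps⟩ := hseq x hnx _ ((hcont n).continuousAt.preimage_mem_nhds (hU.mem_nhds hxU))
    obtain ⟨q, hq, hqs⟩ := hseq y hny _ ((hcont n).continuousAt.preimage_mem_nhds (hV.mem_nhds hyV))
    have := hrat n p q hps hqs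
    rw [← hC] at this
    exact hUV.le_bot ⟨hp, by show C p ∈ V; rw [this]; exact hq⟩
  have hne0 : (ae (volume.restrict s)).NeBot := by
    rw [ae_neBot]
    intro h
    rw [Measure.restrict_eq_zero] at h
    exact (hs.isOpen.measure_pos volume hs.nonempty).ne' h
  have hlim' : ∀ᵐ x ∂(volume.restrict s), x ∈ s ∧ Tendsto (fun n =>
      convolution (moll n) z (ContinuousLinearMap.lsmul ℝ ℝ) volume x) atTop (𝓝 (z x)) := by
    rw [ae_restrict_iff' hsm]
    filter_upwards [hlim] with x hx hxs using ⟨hxs, hx⟩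
  -- The constant is the value of `z` at one point where its mollifications converge.
  obtain ⟨x₀, hx₀, hl₀⟩ := hlim'.exists
  refine ⟨z x₀, hint, ?_⟩
  filter_upwards [hlim'] with x hx
  have : z x = z x₀ := tendsto_nhds_unique_of_eventuallyEq hx.2 hl₀ (hreal x hx.1 x₀ hx₀)
  rw [← this, ← hGeq x hx.1]
  simp [hz, hx.1]

/-! ### Weak derivatives on a strip and absolute continuity on lines -/

lemma MemLp.ae_section {α β : Type*} [MeasurableSpace α] [MeasurableSpace β] {μ : Measure α}
    {ν : Measure β} [SFinite μ] [SFinite ν] {v : α × β → ℝ} (hv : MemLp v 2 (μ.prod ν)) :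
    ∀ᵐ y ∂ν, MemLp (fun x => v (x, y)) 2 μ := by
  have hm := hv.1
  have h1 : ∀ᵐ y ∂ν, AEStronglyMeasurable (fun x => v (x, y)) μ := hm.prodMk_right
  have h2 := ((memLp_two_iff_integrable_sq hm).1 hv).prod_left_ae
  filter_upwards [h1, h2] with y hy1 hy2
  exact (memLp_two_iff_integrable_sq hy1).2 hy2

/-- For each of the countably many functions `testFn n p q`, the tested identity in `x` is a
function of `y` orthogonal to every `ψ`, so it holds for almost every `y`. Countability yields one
null set of `y`, off which `exists_prim` applies on the line. -/
lemma exists_prim_ae {s s' : Set ℝ} {a : ℝ} (hs : IsLeft s a) (hs' : IsOpen s')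
    {v w : ℝ × ℝ → ℝ} (hv : MemLp v 2 ((volume.restrict s).prod (volume.restrict s')))
    (hw : MemLp w 2 ((volume.restrict s).prod (volume.restrict s')))
    (h : ∀ φ ψ : ℝ → ℝ, ContDiff ℝ ∞ φ → HasCompactSupport φ → tsupport φ ⊆ s →
      ContDiff ℝ ∞ ψ → HasCompactSupport ψ → tsupport ψ ⊆ s' →
      ∫ p, deriv φ p.1 * ψ p.2 * v p ∂((volume.restrict s).prod (volume.restrict s'))
        = - ∫ p, φ p.1 * ψ p.2 * w p ∂((volume.restrict s).prod (volume.restrict s'))) :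
    ∃ c : ℝ → ℝ, ∀ᵐ y ∂(volume.restrict s'),
      Prim s a (fun x => v (x, y)) (fun x => w (x, y)) (c y) := by
  have hsm := hs.isOpen.measurableSet
  have hsm' := hs'.measurableSet
  have hI : ∀ (φ ψ : ℝ → ℝ), MemLp φ 2 volume → MemLp ψ 2 volume → ∀ u : ℝ × ℝ → ℝ,
      MemLp u 2 ((volume.restrict s).prod (volume.restrict s')) →
      Integrable (fun p => φ p.1 * ψ p.2 * u p)
        ((volume.restrict s).prod (volume.restrict s')) := by
    intro φ ψ hφ hψ u hu
    have h1 : MemLp (fun p : ℝ × ℝ => φ p.1 * ψ p.2) 2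
        ((volume.restrict s).prod (volume.restrict s')) := by
      have hm : AEStronglyMeasurable (fun p : ℝ × ℝ => φ p.1 * ψ p.2)
          ((volume.restrict s).prod (volume.restrict s')) :=
        (hφ.1.restrict.comp_fst).mul (hψ.1.restrict.comp_snd)
      rw [memLp_two_iff_integrable_sq hm]
      simp only [mul_pow]
      exact ((memLp_two_iff_integrable_sq hφ.1.restrict).1 (hφ.restrict s)).mul_prod
        ((memLp_two_iff_integrable_sq hψ.1.restrict).1 (hψ.restrict s'))
    exact h1.integrable_mul hu
  have hmem : ∀ k : ℝ → ℝ, Continuous k → HasCompactSupport k → MemLp k 2 volume :=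
    fun k hk hkc => hk.memLp_of_hasCompactSupport hkc
  have key : ∀ (n : ℕ) (p q : ℚ), Metric.closedBall (p : ℝ) (1 / ((n : ℝ) + 1)) ⊆ s →
      Metric.closedBall (q : ℝ) (1 / ((n : ℝ) + 1)) ⊆ s →
      ∀ᵐ y ∂(volume.restrict s'), ∫ x in s, deriv (testFn n p q) x * v (x, y)
        = - ∫ x in s, testFn n p q x * w (x, y) := by
    intro n p q hp hq
    set φ := testFn n p q with hφd
    have hφ := contDiff_testFn n p q
    have hφc := hasCompactSupport_testFn n p q
    have hφs := hs.tsupport_testFn_subset hp hq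
    have hm1 : MemLp (deriv φ) 2 volume :=
      hmem _ (hφ.continuous_deriv (by simp)) hφc.deriv
    have hm2 : MemLp φ 2 volume := hmem _ hφ.continuous hφc
    set k : ℝ → ℝ := fun y => (∫ x in s, deriv φ x * v (x, y)) + ∫ x in s, φ x * w (x, y) with hk
    have hpart : ∀ (χ : ℝ → ℝ) (u : ℝ × ℝ → ℝ), MemLp χ 2 volume →
        MemLp u 2 ((volume.restrict s).prod (volume.restrict s')) →
        LocallyIntegrableOn (fun y => ∫ x in s, χ x * u (x, y)) s' := by
      intro χ u hχ hu
      rw [locallyIntegrableOn_iff hs'.isLocallyClosed]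
      intro K hKs hK
      -- With the indicator of `K` as transverse factor, integrability on the product becomes
      -- integrability of the partial integral over `K`.
      have h1 : MemLp (K.indicator (fun _ => (1 : ℝ))) 2 volume :=
        memLp_indicator_const 2 hK.measurableSet 1 (Or.inr hK.measure_lt_top.ne)
      have h2 := (hI χ _ hχ h1 u hu).integral_prod_right
      have h3 : IntegrableOn (fun y => ∫ x in s, χ x * K.indicator (fun _ => (1 : ℝ)) y * u (x, y))
          K := IntegrableOn.mono_set h2 hKs
      refine h3.congr_fun (fun y hy => ?_) hK.measurableSet
      simp [hy]
    have hkl : LocallyIntegrableOn k s' := (hpart _ _ hm1 hv).add (hpart _ _ hm2 hw)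
    -- The fundamental lemma of the calculus of variations in `y`; the second goal checks its
    -- hypothesis with tensor test functions.
    have hz := hs'.ae_eq_zero_of_integral_contDiff_smul_eq_zero hkl ?_
    · rw [ae_restrict_iff' hsm']
      filter_upwards [hz] with y hy hys
      have := hy hys
      simp only [hk] at this
      linarith
    · intro ψ hψ hψc hψs
      have hψm := hmem ψ hψ.continuous hψc
      have e := h φ ψ hφ hφc hφs hψ hψc hψs
      rw [integral_prod_symm _ (hI _ _ hm1 hψm v hv), integral_prod_symm _ (hI _ _ hm2 hψm w hw)] at e
      have i1 := (hI _ _ hm1 hψm v hv).integral_prod_right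
      have i2 := (hI _ _ hm2 hψm w hw).integral_prod_right
      have r : ∀ (χ : ℝ → ℝ) (u : ℝ × ℝ → ℝ) (y : ℝ), ∫ x in s, χ x * ψ y * u (x, y)
          = ψ y * ∫ x in s, χ x * u (x, y) := by
        intro χ u y
        rw [← integral_const_mul]
        congr 1
        funext x
        ring
      simp only [r] at e i1 i2
      rw [← setIntegral_eq_integral_of_forall_compl_eq_zero (s := s')]
      · simp only [hk, smul_eq_mul, mul_add]
        rw [integral_add i1 i2, e]
        ring
      · intro y hy
        rw [image_eq_zero_of_notMem_tsupport fun h => hy (hψs h), zero_smul]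
  have key' : ∀ᵐ y ∂(volume.restrict s'), ∀ (n : ℕ) (p q : ℚ),
      Metric.closedBall (p : ℝ) (1 / ((n : ℝ) + 1)) ⊆ s →
      Metric.closedBall (q : ℝ) (1 / ((n : ℝ) + 1)) ⊆ s →
      ∫ x in s, deriv (testFn n p q) x * v (x, y) = - ∫ x in s, testFn n p q x * w (x, y) := by
    simp only [ae_all_iff, eventually_imp_distrib_left]
    exact key
  have hloc : ∀ u : ℝ → ℝ, MemLp u 2 (volume.restrict s) → LocallyIntegrable (s.indicator u) :=
    fun u hu => ((memLp_indicator_iff_restrict hsm).2 hu).locallyIntegrable one_le_two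
  have hex : ∀ᵐ y ∂(volume.restrict s'), ∃ c,
      Prim s a (fun x => v (x, y)) (fun x => w (x, y)) c := by
    filter_upwards [key', MemLp.ae_section hv, MemLp.ae_section hw] with y h1 h2 h3
    exact exists_prim hs (hloc _ h2) (hloc _ h3) h1
  classical
  refine ⟨fun y => if h : ∃ c, Prim s a (fun x => v (x, y)) (fun x => w (x, y)) c
    then h.choose else 0, ?_⟩
  filter_upwards [hex] with y hy
  rw [dif_pos hy]
  exact hy.choose_spec

/-- On almost every line `{r} × (0, T)`, `v` is a primitive of `w`, with value `c r` at `t = 0`. -/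
def LineT (T R : ℝ) (v w : ℝ × ℝ → ℝ) (c : ℝ → ℝ) : Prop :=
  ∀ᵐ r ∂(volume.restrict (Ioi R)), Prim (Ioo 0 T) 0 (fun t => v (t, r)) (fun t => w (t, r)) (c r)

/-- On almost every line `{t} × (R, ∞)`, `v` is a primitive of `w`, with value `c t` at `r = R`. -/
def LineR (T R : ℝ) (v w : ℝ × ℝ → ℝ) (c : ℝ → ℝ) : Prop :=
  ∀ᵐ t ∂(volume.restrict (Ioo 0 T)), Prim (Ioi R) R (fun r => v (t, r)) (fun r => w (t, r)) (c t)

/-- Lebesgue measure on the strip, as a product. -/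
noncomputable abbrev stripVol (T R : ℝ) : Measure (ℝ × ℝ) :=
  (volume.restrict (Ioo 0 T)).prod (volume.restrict (Ioi R))

lemma restrict_strip (T R : ℝ) : (volume : Measure (ℝ × ℝ)).restrict (strip T R) = stripVol T R := by
  rw [stripVol, Measure.prod_restrict, Measure.volume_eq_prod, strip]

lemma tensor_test {T R : ℝ} {φ ψ : ℝ → ℝ} (hφ : ContDiff ℝ ∞ φ) (hφc : HasCompactSupport φ)
    (hφs : tsupport φ ⊆ Ioo 0 T) (hψ : ContDiff ℝ ∞ ψ) (hψc : HasCompactSupport ψ)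
    (hψs : tsupport ψ ⊆ Ioi R) :
    ContDiff ℝ ∞ (fun p : ℝ × ℝ => φ p.1 * ψ p.2) ∧
    HasCompactSupport (fun p : ℝ × ℝ => φ p.1 * ψ p.2) ∧
    tsupport (fun p : ℝ × ℝ => φ p.1 * ψ p.2) ⊆ strip T R ∧
    (∀ p : ℝ × ℝ, fderiv ℝ (fun p : ℝ × ℝ => φ p.1 * ψ p.2) p (1, 0) = deriv φ p.1 * ψ p.2) ∧
    (∀ p : ℝ × ℝ, fderiv ℝ (fun p : ℝ × ℝ => φ p.1 * ψ p.2) p (0, 1) = φ p.1 * deriv ψ p.2) := by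
  have hts : tsupport (fun p : ℝ × ℝ => φ p.1 * ψ p.2) ⊆ tsupport φ ×ˢ tsupport ψ := by
    refine closure_minimal (fun p hp => ?_) ((isClosed_tsupport φ).prod (isClosed_tsupport ψ))
    rw [Function.mem_support, mul_ne_zero_iff] at hp
    exact ⟨subset_tsupport _ hp.1, subset_tsupport _ hp.2⟩
  have hder : ∀ p : ℝ × ℝ, HasFDerivAt (fun p : ℝ × ℝ => φ p.1 * ψ p.2)
      (φ p.1 • (deriv ψ p.2 • ContinuousLinearMap.snd ℝ ℝ ℝ)
        + ψ p.2 • (deriv φ p.1 • ContinuousLinearMap.fst ℝ ℝ ℝ)) p := by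
    intro p
    have h1 : HasFDerivAt (fun p : ℝ × ℝ => φ p.1) (deriv φ p.1 • ContinuousLinearMap.fst ℝ ℝ ℝ) p :=
      ((hφ.differentiable (by simp) p.1).hasDerivAt).comp_hasFDerivAt p hasFDerivAt_fst
    have h2 : HasFDerivAt (fun p : ℝ × ℝ => ψ p.2) (deriv ψ p.2 • ContinuousLinearMap.snd ℝ ℝ ℝ) p :=
      ((hψ.differentiable (by simp) p.2).hasDerivAt).comp_hasFDerivAt p hasFDerivAt_snd
    exact h1.mul h2
  refine ⟨(hφ.comp contDiff_fst).mul (hψ.comp contDiff_snd), ?_, ?_, fun p => ?_, fun p => ?_⟩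
  · exact (hφc.isCompact.prod hψc.isCompact).of_isClosed_subset (isClosed_tsupport _) hts
  · exact hts.trans (prod_mono hφs hψs)
  · rw [(hder p).fderiv]
    simp [mul_comm]
  · rw [(hder p).fderiv]
    simp

/-- Scalar weak derivatives on the strip. -/
def WeakPartial (T R : ℝ) (e : ℝ × ℝ) (v w : ℝ × ℝ → ℝ) : Prop :=
  ∀ φ : ℝ × ℝ → ℝ, ContDiff ℝ ∞ φ → HasCompactSupport φ → tsupport φ ⊆ strip T R →
    ∫ p, (fderiv ℝ φ p e) * v p ∂(stripVol T R) = - ∫ p, φ p * w p ∂(stripVol T R)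

lemma WeakPartial.lineT {T R : ℝ} (hT : 0 < T) {v w : ℝ × ℝ → ℝ} (hv : MemLp v 2 (stripVol T R))
    (hw : MemLp w 2 (stripVol T R)) (h : WeakPartial T R (1, 0) v w) : ∃ c, LineT T R v w c := by
  refine exists_prim_ae (isLeft_Ioo hT) isOpen_Ioi hv hw fun φ ψ hφ hφc hφs hψ hψc hψs => ?_
  obtain ⟨h1, h2, h3, h4, -⟩ := tensor_test hφ hφc hφs hψ hψc hψs
  have := h _ h1 h2 h3
  simpa only [h4] using this

lemma MemLp.swap_strip {T R : ℝ} {v : ℝ × ℝ → ℝ} (hv : MemLp v 2 (stripVol T R)) :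
    MemLp (fun p => v p.swap) 2 ((volume.restrict (Ioi R)).prod (volume.restrict (Ioo 0 T))) :=
  hv.comp_measurePreserving Measure.measurePreserving_swap

lemma WeakPartial.lineR {T R : ℝ} {v w : ℝ × ℝ → ℝ} (hv : MemLp v 2 (stripVol T R))
    (hw : MemLp w 2 (stripVol T R)) (h : WeakPartial T R (0, 1) v w) : ∃ c, LineR T R v w c := by
  refine exists_prim_ae (isLeft_Ioi R) isOpen_Ioo (MemLp.swap_strip hv) (MemLp.swap_strip hw)
    fun ψ φ hψ hψc hψs hφ hφc hφs => ?_
  obtain ⟨h1, h2, h3, -, h4⟩ := tensor_test hφ hφc hφs hψ hψc hψs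
  have := h _ h1 h2 h3
  simp only [h4] at this
  rw [← integral_prod_swap, ← integral_prod_swap (fun p : ℝ × ℝ => φ p.1 * ψ p.2 * w p)] at this
  simp only [Prod.fst_swap, Prod.snd_swap] at this
  simpa only [mul_comm (deriv ψ _), mul_comm (ψ _)] using this

/-! ### The radial measure -/

lemma radialMeasure_restrict {R r : ℝ} (h : R ≤ r) :
    (radialMeasure R).restrict (Ioi r) = radialMeasure r := by
  unfold radialMeasure
  rw [restrict_withDensity measurableSet_Ioi, Measure.restrict_restrict measurableSet_Ioi,
    inter_eq_left.2 (Ioi_subset_Ioi h)]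

lemma radialMeasure_ac (R : ℝ) : radialMeasure R ≪ volume.restrict (Ioi R) :=
  withDensity_absolutelyContinuous _ _

lemma ac_radialMeasure {R : ℝ} (hR : 0 < R) : volume.restrict (Ioi R) ≪ radialMeasure R := by
  refine withDensity_absolutelyContinuous' (by fun_prop) ?_
  filter_upwards [ae_restrict_mem measurableSet_Ioi] with r hr
  simpa using hR.trans hr

lemma ae_radialMeasure {R : ℝ} (hR : 0 < R) : ae (radialMeasure R) = ae (volume.restrict (Ioi R)) :=
  le_antisymm (radialMeasure_ac R).ae_le (ac_radialMeasure hR).ae_le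

instance (R : ℝ) : SFinite (radialMeasure R) := by unfold radialMeasure; infer_instance

lemma stripMeasure_eq_prod (T R : ℝ) :
    stripMeasure T R = (volume.restrict (Ioo 0 T)).prod (radialMeasure R) := by
  unfold stripMeasure radialMeasure
  rw [prod_withDensity_right (by fun_prop), restrict_strip]

/-- The weight `r` is at least `R > 0` on the half-line. This is what lets weighted square
integrability imply the unweighted one. -/
lemma volume_le_radial {R : ℝ} (hR : 0 < R) :
    volume.restrict (Ioi R) ≤ (ENNReal.ofReal R)⁻¹ • radialMeasure R := by
  have hne : ENNReal.ofReal R ≠ 0 := by simpa using hR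
  have h : (ENNReal.ofReal R) • volume.restrict (Ioi R) ≤ radialMeasure R := by
    unfold radialMeasure
    rw [← withDensity_const]
    refine withDensity_mono ?_
    filter_upwards [ae_restrict_mem measurableSet_Ioi] with r hr
    exact ENNReal.ofReal_le_ofReal (le_of_lt hr)
  calc volume.restrict (Ioi R)
      = (ENNReal.ofReal R)⁻¹ • (ENNReal.ofReal R) • volume.restrict (Ioi R) := by
        rw [smul_smul, ENNReal.inv_mul_cancel hne ENNReal.ofReal_ne_top, one_smul]
    _ ≤ _ := by gcongr

lemma MemLp.of_radial {R : ℝ} (hR : 0 < R) {f : ℝ → ℝ} (hf : MemLp f 2 (radialMeasure R)) :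
    MemLp f 2 (volume.restrict (Ioi R)) :=
  hf.of_measure_le_smul (ENNReal.inv_ne_top.2 (by simpa using hR)) (volume_le_radial hR)

lemma stripVol_le {R : ℝ} (hR : 0 < R) (T : ℝ) :
    stripVol T R ≤ (ENNReal.ofReal R)⁻¹ • stripMeasure T R := by
  have hne : ENNReal.ofReal R ≠ 0 := by simpa using hR
  have h : (ENNReal.ofReal R) • stripVol T R ≤ stripMeasure T R := by
    unfold stripMeasure
    rw [← restrict_strip, ← withDensity_const]
    refine withDensity_mono ?_
    filter_upwards [ae_restrict_mem (measurableSet_Ioo.prod measurableSet_Ioi)] with p hp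
    exact ENNReal.ofReal_le_ofReal (le_of_lt hp.2)
  calc stripVol T R = (ENNReal.ofReal R)⁻¹ • (ENNReal.ofReal R) • stripVol T R := by
        rw [smul_smul, ENNReal.inv_mul_cancel hne ENNReal.ofReal_ne_top, one_smul]
    _ ≤ _ := by gcongr

lemma MemLp.of_strip {T R : ℝ} (hR : 0 < R) {f : ℝ × ℝ → ℝ} (hf : MemLp f 2 (stripMeasure T R)) :
    MemLp f 2 (stripVol T R) :=
  hf.of_measure_le_smul (ENNReal.inv_ne_top.2 (by simpa using hR)) (stripVol_le hR T)

lemma ae_stripMeasure {R : ℝ} (hR : 0 < R) (T : ℝ) : ae (stripMeasure T R) = ae (stripVol T R) := by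
  refine le_antisymm ?_ ?_
  · have : stripMeasure T R ≪ stripVol T R := by
      unfold stripMeasure
      rw [restrict_strip]
      exact withDensity_absolutelyContinuous _ _
    exact this.ae_le
  · exact (Measure.absolutelyContinuous_of_le_smul (stripVol_le hR T)).ae_le

lemma integral_radial {R : ℝ} (hR : 0 < R) (f : ℝ → ℝ) :
    ∫ x, f x ∂(radialMeasure R) = ∫ x in Ioi R, x * f x := by
  unfold radialMeasure
  rw [integral_withDensity_eq_integral_toReal_smul (by fun_prop) (by simp)]
  refine setIntegral_congr_fun measurableSet_Ioi fun x hx => ?_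
  simp [ENNReal.toReal_ofReal (hR.trans hx).le]

lemma integrable_radial_iff {R : ℝ} (hR : 0 < R) (f : ℝ → ℝ) :
    Integrable f (radialMeasure R) ↔ IntegrableOn (fun x => x * f x) (Ioi R) := by
  unfold radialMeasure
  rw [integrable_withDensity_iff_integrable_smul' (by fun_prop) (by simp)]
  refine integrableOn_congr_fun (fun x hx => ?_) measurableSet_Ioi
  simp [ENNReal.toReal_ofReal (hR.trans hx).le]

/-! ### The embedding of `H¹` into bounded functions -/

lemma sq_integral_le {g : ℝ → ℝ} {r x : ℝ} (h : r ≤ x) (h1 : x ≤ r + 1)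
    (hg : IntervalIntegrable g volume r x)
    (hg2 : IntervalIntegrable (fun y => g y ^ 2) volume r x) :
    (∫ y in r..x, g y) ^ 2 ≤ ∫ y in r..x, g y ^ 2 := by
  set m := ∫ y in r..x, g y with hm
  have h0 : 0 ≤ ∫ y in r..x, (g y - m) ^ 2 :=
    intervalIntegral.integral_nonneg h fun y _ => sq_nonneg _
  have e : ∫ y in r..x, (g y - m) ^ 2
      = (∫ y in r..x, g y ^ 2) - 2 * m * m + m ^ 2 * (x - r) := by
    have e1 : ∀ y, (g y - m) ^ 2 = g y ^ 2 - (2 * m) * g y + m ^ 2 := fun y => by ring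
    simp only [e1]
    rw [intervalIntegral.integral_add (hg2.sub (hg.const_mul _)) (by simp),
      intervalIntegral.integral_sub hg2 (hg.const_mul _), intervalIntegral.integral_const_mul,
      intervalIntegral.integral_const, ← hm, smul_eq_mul]
    ring
  nlinarith [sq_nonneg m]

/-- A primitive on `(R, ∞)` is controlled at `r` by the weighted norms on `(r, ∞)`. -/
lemma Prim.sq_le {R : ℝ} (hR : 0 < R) {f g : ℝ → ℝ} {c : ℝ} (h : Prim (Ioi R) R f g c)
    (hf : MemLp f 2 (radialMeasure R)) (hg : MemLp g 2 (radialMeasure R)) {r : ℝ} (hr : R ≤ r) :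
    (c + ∫ y in R..r, g y) ^ 2 ≤
      2 / R * ∫ x, (f x ^ 2 + g x ^ 2) ∂(radialMeasure r) := by
  have hr0 : 0 < r := hR.trans_le hr
  set F : ℝ → ℝ := fun x => c + ∫ y in R..x, g y with hF
  have hfi := (memLp_two_iff_integrable_sq hf.1).1 hf
  have hgi := (memLp_two_iff_integrable_sq hg.1).1 hg
  have hsum : Integrable (fun x => f x ^ 2 + g x ^ 2) (radialMeasure r) := by
    rw [← radialMeasure_restrict hr]
    exact (hfi.add hgi).restrict
  have hint : ∀ x, R ≤ x → IntervalIntegrable g volume R x := fun x hx => by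
    rcases hx.eq_or_lt with rfl | hx
    · simp
    · exact h.int x hx
  have hvol : ∀ u : ℝ → ℝ, MemLp u 2 (radialMeasure R) →
      IntervalIntegrable (fun y => u y ^ 2) volume r (r + 1) := by
    intro u hu
    have h1 := (memLp_two_iff_integrable_sq (MemLp.of_radial hR hu).1).1 (MemLp.of_radial hR hu)
    rw [intervalIntegrable_iff_integrableOn_Ioc_of_le (by linarith)]
    exact IntegrableOn.mono_set h1 fun y hy => hr.trans_lt hy.1
  have hg1 : IntervalIntegrable g volume r (r + 1) :=
    ((hint (r + 1) (by linarith)).mono_set (by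
      rw [uIcc_of_le (by linarith), uIcc_of_le (by linarith)]; exact Icc_subset_Icc_left hr))
  -- The value at `r` is compared with every value on the unit interval to the right of `r`, and the
  -- comparison is then averaged over that interval.
  have hpt : ∀ x ∈ Icc r (r + 1), F r ^ 2 ≤ 2 * F x ^ 2 + 2 * ∫ y in r..(r + 1), g y ^ 2 := by
    intro x hx
    have hsub : uIcc r x ⊆ uIcc r (r + 1) := by
      rw [uIcc_of_le hx.1, uIcc_of_le (by linarith)]; exact Icc_subset_Icc_right hx.2
    have e : F x = F r + ∫ y in r..x, g y := by
      simp only [hF]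
      rw [add_assoc, intervalIntegral.integral_add_adjacent_intervals (hint r hr)
        (hg1.mono_set hsub)]
    have h1 := sq_integral_le hx.1 hx.2 (hg1.mono_set hsub) ((hvol g hg).mono_set hsub)
    have h2 : ∫ y in r..x, g y ^ 2 ≤ ∫ y in r..(r + 1), g y ^ 2 :=
      intervalIntegral.integral_mono_interval le_rfl hx.1 hx.2
        (Eventually.of_forall fun y => sq_nonneg _) (hvol g hg)
    have e' : F r = F x - ∫ y in r..x, g y := by rw [e]; ring
    rw [e']
    nlinarith [sq_nonneg (F x + ∫ y in r..x, g y)]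
  have hFf : ∀ᵐ x ∂(volume.restrict (Ioc r (r + 1))), F x ^ 2 = f x ^ 2 := by
    have := ae_restrict_of_ae_restrict_of_subset
      (show Ioc r (r + 1) ⊆ Ioi R from fun y hy => hr.trans_lt hy.1) h.eq
    filter_upwards [this] with x hx
    rw [hx]
  have hFi : IntervalIntegrable (fun x => F x ^ 2) volume r (r + 1) := by
    refine (hvol f hf).congr_ae ?_
    rw [uIoc_of_le (by linarith)]
    exact hFf.mono fun x hx => hx.symm
  have hkey : F r ^ 2 ≤ 2 * (∫ x in r..(r + 1), f x ^ 2) + 2 * ∫ y in r..(r + 1), g y ^ 2 := by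
    have h1 : ∫ x in r..(r + 1), F r ^ 2 ≤
        ∫ x in r..(r + 1), (2 * F x ^ 2 + 2 * ∫ y in r..(r + 1), g y ^ 2) :=
      intervalIntegral.integral_mono_on (by linarith) (by simp)
        ((hFi.const_mul 2).add (by simp)) hpt
    rw [intervalIntegral.integral_add (hFi.const_mul 2) (by simp),
      intervalIntegral.integral_const_mul] at h1
    have h2 : ∫ x in r..(r + 1), F x ^ 2 = ∫ x in r..(r + 1), f x ^ 2 := by
      rw [intervalIntegral.integral_of_le (by linarith), intervalIntegral.integral_of_le (by linarith)]
      exact integral_congr_ae hFf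
    rw [h2] at h1
    simpa using h1
  have hle : (∫ x in r..(r + 1), f x ^ 2) + ∫ y in r..(r + 1), g y ^ 2
      ≤ 1 / R * ∫ x, (f x ^ 2 + g x ^ 2) ∂(radialMeasure r) := by
    rw [← intervalIntegral.integral_add (hvol f hf) (hvol g hg), integral_radial hr0,
      ← integral_const_mul, intervalIntegral.integral_of_le (by linarith)]
    have hsum' := ((integrable_radial_iff hr0 _).1 hsum).const_mul (1 / R)
    calc ∫ x in Ioc r (r + 1), (f x ^ 2 + g x ^ 2)
        ≤ ∫ x in Ioc r (r + 1), 1 / R * (x * (f x ^ 2 + g x ^ 2)) := by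
          refine setIntegral_mono_on ?_ (IntegrableOn.mono_set hsum' Ioc_subset_Ioi_self) measurableSet_Ioc ?_
          · exact ((hvol f hf).add (hvol g hg)).1
          · intro x hx
            -- Inserting `x / R ≥ 1` produces the weight, at the price of the factor `1 / R`.
            have hx1 : 1 ≤ x / R := (one_le_div hR).2 (hr.trans hx.1.le)
            have : 0 ≤ f x ^ 2 + g x ^ 2 := by positivity
            calc f x ^ 2 + g x ^ 2 = 1 * (f x ^ 2 + g x ^ 2) := by ring
              _ ≤ x / R * (f x ^ 2 + g x ^ 2) := by gcongr
              _ = _ := by ring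
      _ ≤ ∫ x in Ioi r, 1 / R * (x * (f x ^ 2 + g x ^ 2)) := by
          refine setIntegral_mono_set hsum' ?_ (ae_of_all _ Ioc_subset_Ioi_self)
          filter_upwards [ae_restrict_mem measurableSet_Ioi] with x hx
          have : 0 < x := hr0.trans hx
          show 0 ≤ 1 / R * (x * (f x ^ 2 + g x ^ 2))
          positivity
  calc F r ^ 2 ≤ 2 * ((∫ x in r..(r + 1), f x ^ 2) + ∫ y in r..(r + 1), g y ^ 2) := by linarith
    _ ≤ 2 * (1 / R * ∫ x, (f x ^ 2 + g x ^ 2) ∂(radialMeasure r)) := by gcongr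
    _ = _ := by ring

end FloatingSW

namespace FloatingSW

open Filter Topology
open scoped ENNReal NNReal

/-! ### Families of derivatives and the Leibniz rule -/

/-- Fubini for null sets requires a measurable set, hence the passage to the strongly measurable
representative. -/
lemma ae_prod_of_ae_ae {α β : Type*} [MeasurableSpace α] [MeasurableSpace β] {μ : Measure α}
    {ν : Measure β} [SFinite μ] [SFinite ν] {w : α × β → ℝ}
    (hw : AEStronglyMeasurable w (μ.prod ν)) (h : ∀ᵐ x ∂μ, ∀ᵐ y ∂ν, w (x, y) = 0) :
    ∀ᵐ p ∂(μ.prod ν), w p = 0 := by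
  have h1 : ∀ᵐ x ∂μ, ∀ᵐ y ∂ν, w (x, y) = hw.mk w (x, y) := Measure.ae_ae_of_ae_prod hw.ae_eq_mk
  have h2 : ∀ᵐ p ∂(μ.prod ν), hw.mk w p = 0 := by
    rw [Measure.ae_prod_iff_ae_ae (measurableSet_eq_fun hw.stronglyMeasurable_mk.measurable
      measurable_const)]
    filter_upwards [h, h1] with x a b
    filter_upwards [a, b] with y c d
    rw [← d, c]
  filter_upwards [hw.ae_eq_mk, h2] with p a b
  rw [a, b]

lemma ae_ae_swap_of_ae_prod {α β : Type*} [MeasurableSpace α] [MeasurableSpace β] {μ : Measure α}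
    {ν : Measure β} [SFinite μ] [SFinite ν] {p : α × β → Prop} (h : ∀ᵐ z ∂(μ.prod ν), p z) :
    ∀ᵐ y ∂ν, ∀ᵐ x ∂μ, p (x, y) := by
  have h' : ∀ᵐ z ∂(ν.prod μ), p z.swap :=
    (Measure.measurePreserving_swap (μ := ν) (ν := μ)).quasiMeasurePreserving.ae h
  exact Measure.ae_ae_of_ae_prod h'

lemma ae_prod_of_ae_ae_swap {α β : Type*} [MeasurableSpace α] [MeasurableSpace β] {μ : Measure α}
    {ν : Measure β} [SFinite μ] [SFinite ν] {w : α × β → ℝ}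
    (hw : AEStronglyMeasurable w (μ.prod ν)) (h : ∀ᵐ y ∂ν, ∀ᵐ x ∂μ, w (x, y) = 0) :
    ∀ᵐ p ∂(μ.prod ν), w p = 0 := by
  have := ae_prod_of_ae_ae (μ := ν) (ν := μ) hw.prod_swap h
  exact (Measure.measurePreserving_swap (μ := μ) (ν := ν)).quasiMeasurePreserving.ae this

/-- A function and its derivative in time, on almost every line. -/
def DT (T R : ℝ) (v w : ℝ × ℝ → ℝ) : Prop := ∃ c, LineT T R v w c

/-- A function and its derivative in `r`, on almost every line. -/
def DR (T R : ℝ) (v w : ℝ × ℝ → ℝ) : Prop := ∃ c, LineR T R v w c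

variable {T R : ℝ} {v w v₁ w₁ v₂ w₂ : ℝ × ℝ → ℝ} {c c₁ c₂ : ℝ → ℝ}

lemma LineT.mul (hT : 0 < T) (h₁ : LineT T R v₁ w₁ c₁) (h₂ : LineT T R v₂ w₂ c₂) :
    LineT T R (fun p => v₁ p * v₂ p) (fun p => w₁ p * v₂ p + v₁ p * w₂ p)
      (fun r => c₁ r * c₂ r) := by
  filter_upwards [h₁, h₂] with r a b using a.mul b (isLeft_Ioo hT)

lemma LineT.add (hT : 0 < T) (h₁ : LineT T R v₁ w₁ c₁) (h₂ : LineT T R v₂ w₂ c₂) :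
    LineT T R (fun p => v₁ p + v₂ p) (fun p => w₁ p + w₂ p) (fun r => c₁ r + c₂ r) := by
  filter_upwards [h₁, h₂] with r a b using a.add b (isLeft_Ioo hT)

lemma LineT.const_mul (k : ℝ) (h₁ : LineT T R v₁ w₁ c₁) :
    LineT T R (fun p => k * v₁ p) (fun p => k * w₁ p) (fun r => k * c₁ r) := by
  filter_upwards [h₁] with r a using a.const_mul k

lemma LineT.const (k : ℝ) : LineT T R (fun _ => k) (fun _ => 0) (fun _ => k) :=
  Eventually.of_forall fun _ => Prim.const k

lemma LineR.mul (h₁ : LineR T R v₁ w₁ c₁) (h₂ : LineR T R v₂ w₂ c₂) :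
    LineR T R (fun p => v₁ p * v₂ p) (fun p => w₁ p * v₂ p + v₁ p * w₂ p)
      (fun r => c₁ r * c₂ r) := by
  filter_upwards [h₁, h₂] with r a b using a.mul b (isLeft_Ioi R)

lemma LineR.add (h₁ : LineR T R v₁ w₁ c₁) (h₂ : LineR T R v₂ w₂ c₂) :
    LineR T R (fun p => v₁ p + v₂ p) (fun p => w₁ p + w₂ p) (fun r => c₁ r + c₂ r) := by
  filter_upwards [h₁, h₂] with r a b using a.add b (isLeft_Ioi R)

lemma LineR.const_mul (k : ℝ) (h₁ : LineR T R v₁ w₁ c₁) :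
    LineR T R (fun p => k * v₁ p) (fun p => k * w₁ p) (fun r => k * c₁ r) := by
  filter_upwards [h₁] with r a using a.const_mul k

lemma LineR.const (k : ℝ) : LineR T R (fun _ => k) (fun _ => 0) (fun _ => k) :=
  Eventually.of_forall fun _ => Prim.const k

lemma LineT.congr (hT : 0 < T) (h : LineT T R v w c) (hv : v =ᵐ[stripVol T R] v₁)
    (hw : w =ᵐ[stripVol T R] w₁) : LineT T R v₁ w₁ c := by
  filter_upwards [h, ae_ae_swap_of_ae_prod hv, ae_ae_swap_of_ae_prod hw] with r a b d
  exact a.congr (isLeft_Ioo hT) b d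

lemma LineR.congr (h : LineR T R v w c) (hv : v =ᵐ[stripVol T R] v₁)
    (hw : w =ᵐ[stripVol T R] w₁) : LineR T R v₁ w₁ c := by
  filter_upwards [h, Measure.ae_ae_of_ae_prod hv, Measure.ae_ae_of_ae_prod hw] with r a b d
  exact a.congr (isLeft_Ioi R) b d

lemma DT.mul (hT : 0 < T) : DT T R v₁ w₁ → DT T R v₂ w₂ →
    DT T R (fun p => v₁ p * v₂ p) (fun p => w₁ p * v₂ p + v₁ p * w₂ p)
  | ⟨_, h₁⟩, ⟨_, h₂⟩ => ⟨_, h₁.mul hT h₂⟩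

lemma DT.add (hT : 0 < T) : DT T R v₁ w₁ → DT T R v₂ w₂ →
    DT T R (fun p => v₁ p + v₂ p) (fun p => w₁ p + w₂ p)
  | ⟨_, h₁⟩, ⟨_, h₂⟩ => ⟨_, h₁.add hT h₂⟩

lemma DT.const_mul (k : ℝ) : DT T R v₁ w₁ → DT T R (fun p => k * v₁ p) (fun p => k * w₁ p)
  | ⟨_, h₁⟩ => ⟨_, h₁.const_mul k⟩

lemma DR.mul : DR T R v₁ w₁ → DR T R v₂ w₂ →
    DR T R (fun p => v₁ p * v₂ p) (fun p => w₁ p * v₂ p + v₁ p * w₂ p)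
  | ⟨_, h₁⟩, ⟨_, h₂⟩ => ⟨_, h₁.mul h₂⟩

lemma DR.add : DR T R v₁ w₁ → DR T R v₂ w₂ →
    DR T R (fun p => v₁ p + v₂ p) (fun p => w₁ p + w₂ p)
  | ⟨_, h₁⟩, ⟨_, h₂⟩ => ⟨_, h₁.add h₂⟩

lemma DR.const_mul (k : ℝ) : DR T R v₁ w₁ → DR T R (fun p => k * v₁ p) (fun p => k * w₁ p)
  | ⟨_, h₁⟩ => ⟨_, h₁.const_mul k⟩

lemma DT.sum (hT : 0 < T) {ι : Type*} (s : Finset ι) {a b : ι → ℝ × ℝ → ℝ}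
    (h : ∀ i ∈ s, DT T R (a i) (b i)) :
    DT T R (fun p => ∑ i ∈ s, a i p) (fun p => ∑ i ∈ s, b i p) := by
  classical
  induction s using Finset.induction_on with
  | empty => simpa using show DT T R (fun _ => 0) (fun _ => 0) from ⟨_, LineT.const 0⟩
  | insert i s hi ih =>
    simp only [Finset.sum_insert hi]
    exact (h i (Finset.mem_insert_self _ _)).add hT
      (ih fun j hj => h j (Finset.mem_insert_of_mem hj))

lemma DR.sum {ι : Type*} (s : Finset ι) {a b : ι → ℝ × ℝ → ℝ}
    (h : ∀ i ∈ s, DR T R (a i) (b i)) :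
    DR T R (fun p => ∑ i ∈ s, a i p) (fun p => ∑ i ∈ s, b i p) := by
  classical
  induction s using Finset.induction_on with
  | empty => simpa using show DR T R (fun _ => 0) (fun _ => 0) from ⟨_, LineR.const 0⟩
  | insert i s hi ih =>
    simp only [Finset.sum_insert hi]
    exact (h i (Finset.mem_insert_self _ _)).add
      (ih fun j hj => h j (Finset.mem_insert_of_mem hj))

lemma DT.zero (hT : 0 < T) (h : DT T R v w) (hw : AEStronglyMeasurable w (stripVol T R))
    (hv : ∀ᵐ p ∂(stripVol T R), v p = 0) : ∀ᵐ p ∂(stripVol T R), w p = 0 := by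
  obtain ⟨c, h⟩ := h
  refine ae_prod_of_ae_ae_swap hw ?_
  filter_upwards [h, ae_ae_swap_of_ae_prod hv] with r a b
  exact a.deriv_eq_zero (isLeft_Ioo hT) b

lemma DR.zero (h : DR T R v w) (hw : AEStronglyMeasurable w (stripVol T R))
    (hv : ∀ᵐ p ∂(stripVol T R), v p = 0) : ∀ᵐ p ∂(stripVol T R), w p = 0 := by
  obtain ⟨c, h⟩ := h
  refine ae_prod_of_ae_ae hw ?_
  filter_upwards [h, Measure.ae_ae_of_ae_prod hv] with r a b
  exact a.deriv_eq_zero (isLeft_Ioi R) b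

/-- `v i j = ∂_t^i ∂_r^j v` for `i + j ≤ n`. -/
structure Fam (n : ℕ) (T R : ℝ) (v : ℕ → ℕ → ℝ × ℝ → ℝ) : Prop where
  meas : ∀ i j, i + j ≤ n → AEStronglyMeasurable (v i j) (stripVol T R)
  dt : ∀ i j, i + j < n → DT T R (v i j) (v (i + 1) j)
  dr : ∀ i j, i + j < n → DR T R (v i j) (v i (j + 1))

/-- The derivatives of a product, by the Leibniz rule. -/
def Leib {X : Type*} (a w : ℕ → ℕ → X → ℝ) (i j : ℕ) (p : X) : ℝ :=
  ∑ x ∈ Finset.HasAntidiagonal.antidiagonal i, ∑ y ∈ Finset.HasAntidiagonal.antidiagonal j,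
    ((i.choose x.1 * j.choose y.1 : ℕ) : ℝ) * (a x.1 y.1 p * w x.2 y.2 p)

/-- Pascal's rule in the first index. In this form the derivative of each summand is visibly given
by the product rule. -/
lemma leib_succ_left {X : Type*} (a w : ℕ → ℕ → X → ℝ) (i j : ℕ) (p : X) :
    Leib a w (i + 1) j p =
      ∑ x ∈ Finset.HasAntidiagonal.antidiagonal i, ∑ y ∈ Finset.HasAntidiagonal.antidiagonal j,
        ((i.choose x.1 * j.choose y.1 : ℕ) : ℝ) *
          (a (x.1 + 1) y.1 p * w x.2 y.2 p + a x.1 y.1 p * w (x.2 + 1) y.2 p) := by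
  have h := Finset.sum_antidiagonal_choose_succ_mul (fun m n => ∑ y ∈ Finset.HasAntidiagonal.antidiagonal j,
    (j.choose y.1 : ℝ) * (a m y.1 p * w n y.2 p)) i
  simp only [Finset.mul_sum] at h
  unfold Leib
  simp only [Nat.cast_mul, mul_assoc]
  rw [h, ← Finset.sum_add_distrib]
  refine Finset.sum_congr rfl fun x hx => ?_
  rw [← Finset.sum_add_distrib]
  refine Finset.sum_congr rfl fun y _ => ?_
  rw [Nat.choose_symm_of_eq_add (Finset.HasAntidiagonal.mem_antidiagonal.1 hx).symm]
  ring

lemma leib_swap {X : Type*} (a w : ℕ → ℕ → X → ℝ) (i j : ℕ) (p : X) :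
    Leib a w i j p = Leib (fun i j => a j i) (fun i j => w j i) j i p := by
  unfold Leib
  rw [Finset.sum_comm]
  refine Finset.sum_congr rfl fun x _ => Finset.sum_congr rfl fun y _ => ?_
  rw [mul_comm (i.choose y.1)]

lemma leib_succ_right {X : Type*} (a w : ℕ → ℕ → X → ℝ) (i j : ℕ) (p : X) :
    Leib a w i (j + 1) p =
      ∑ x ∈ Finset.HasAntidiagonal.antidiagonal i, ∑ y ∈ Finset.HasAntidiagonal.antidiagonal j,
        ((i.choose x.1 * j.choose y.1 : ℕ) : ℝ) *
          (a x.1 (y.1 + 1) p * w x.2 y.2 p + a x.1 y.1 p * w x.2 (y.2 + 1) p) := by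
  rw [leib_swap, leib_succ_left, Finset.sum_comm]
  refine Finset.sum_congr rfl fun x _ => Finset.sum_congr rfl fun y _ => ?_
  rw [mul_comm (j.choose y.1)]

lemma leib_zero {X : Type*} (a w : ℕ → ℕ → X → ℝ) (p : X) :
    Leib a w 0 0 p = a 0 0 p * w 0 0 p := by
  simp [Leib]

/-! ### Products and shifts of arrays of derivatives; differentiation of identities. -/

namespace Fam

variable {n : ℕ} {a b : ℕ → ℕ → ℝ × ℝ → ℝ}

/-- Absolute continuity on lines is preserved by products with no integrability of the products over
the strip, so no Sobolev product estimate is needed here. -/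
lemma leib (hT : 0 < T) (ha : Fam n T R a) (hb : Fam n T R b) : Fam n T R (Leib a b) := by
  have idx : ∀ {i j : ℕ} {x y : ℕ × ℕ}, x ∈ Finset.HasAntidiagonal.antidiagonal i → y ∈ Finset.HasAntidiagonal.antidiagonal j →
      x.1 + x.2 = i ∧ y.1 + y.2 = j := fun hx hy =>
    ⟨Finset.HasAntidiagonal.mem_antidiagonal.1 hx, Finset.HasAntidiagonal.mem_antidiagonal.1 hy⟩
  refine ⟨fun i j hij => ?_, fun i j hij => ?_, fun i j hij => ?_⟩
  · unfold Leib
    refine Finset.aestronglyMeasurable_fun_sum _ fun x hx =>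
      Finset.aestronglyMeasurable_fun_sum _ fun y hy => ?_
    have := idx hx hy
    exact ((ha.meas _ _ (by omega)).mul (hb.meas _ _ (by omega))).const_mul _
  · have e : Leib a b (i + 1) j = fun p => ∑ x ∈ Finset.HasAntidiagonal.antidiagonal i,
        ∑ y ∈ Finset.HasAntidiagonal.antidiagonal j, ((i.choose x.1 * j.choose y.1 : ℕ) : ℝ) *
          (a (x.1 + 1) y.1 p * b x.2 y.2 p + a x.1 y.1 p * b (x.2 + 1) y.2 p) :=
      funext fun p => leib_succ_left a b i j p
    rw [e]
    refine DT.sum hT _ fun x hx => DT.sum hT _ fun y hy => DT.const_mul _ ?_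
    have := idx hx hy
    exact (ha.dt _ _ (by omega)).mul hT (hb.dt _ _ (by omega))
  · have e : Leib a b i (j + 1) = fun p => ∑ x ∈ Finset.HasAntidiagonal.antidiagonal i,
        ∑ y ∈ Finset.HasAntidiagonal.antidiagonal j, ((i.choose x.1 * j.choose y.1 : ℕ) : ℝ) *
          (a x.1 (y.1 + 1) p * b x.2 y.2 p + a x.1 y.1 p * b x.2 (y.2 + 1) p) :=
      funext fun p => leib_succ_right a b i j p
    rw [e]
    refine DR.sum _ fun x hx => DR.sum _ fun y hy => DR.const_mul _ ?_
    have := idx hx hy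
    exact (ha.dr _ _ (by omega)).mul (hb.dr _ _ (by omega))

lemma add (hT : 0 < T) (ha : Fam n T R a) (hb : Fam n T R b) :
    Fam n T R (fun i j p => a i j p + b i j p) :=
  ⟨fun i j h => (ha.meas i j h).add (hb.meas i j h),
    fun i j h => (ha.dt i j h).add hT (hb.dt i j h), fun i j h => (ha.dr i j h).add (hb.dr i j h)⟩

lemma const_mul (k : ℝ) (ha : Fam n T R a) : Fam n T R (fun i j p => k * a i j p) :=
  ⟨fun i j h => (ha.meas i j h).const_mul k,
    fun i j h => (ha.dt i j h).const_mul k, fun i j h => (ha.dr i j h).const_mul k⟩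

lemma mono {m : ℕ} (ha : Fam n T R a) (h : m ≤ n) : Fam m T R a :=
  ⟨fun i j hij => ha.meas i j (hij.trans h), fun i j hij => ha.dt i j (hij.trans_le h),
    fun i j hij => ha.dr i j (hij.trans_le h)⟩

lemma shiftT (ha : Fam (n + 1) T R a) : Fam n T R (fun i j => a (i + 1) j) :=
  ⟨fun i j h => ha.meas _ _ (by omega), fun i j h => ha.dt _ _ (by omega),
    fun i j h => ha.dr _ _ (by omega)⟩

lemma shiftR (ha : Fam (n + 1) T R a) : Fam n T R (fun i j => a i (j + 1)) :=
  ⟨fun i j h => ha.meas _ _ (by omega), fun i j h => ha.dt _ _ (by omega),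
    fun i j h => ha.dr _ _ (by omega)⟩

/-- This is how equations are differentiated: it is applied to the difference of the two sides. The
induction goes through the `r`-derivatives at `i = 0` and then through the `t`-derivatives. -/
lemma zero (hT : 0 < T) (ha : Fam n T R a) (h : ∀ᵐ p ∂(stripVol T R), a 0 0 p = 0) :
    ∀ i j, i + j ≤ n → ∀ᵐ p ∂(stripVol T R), a i j p = 0 := by
  intro i
  induction i with
  | zero =>
    intro j
    induction j with
    | zero => intro _; exact h
    | succ j ih => intro hj; exact (ha.dr 0 j (by omega)).zero (ha.meas _ _ hj) (ih (by omega))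
  | succ i ih => intro j hj; exact (ha.dt i j (by omega)).zero hT (ha.meas _ _ hj) (ih j (by omega))

end Fam

/-! ### Bounds for the derivatives of a product at a fixed time -/

/-- The binomial weights add up to `2 ^ i * 2 ^ j`. -/
lemma eLpNorm_leib_le {ν : Measure ℝ} {A B : ℕ → ℕ → ℝ → ℝ} {i j : ℕ} {p M : ℝ≥0∞} (hp : 1 ≤ p)
    (hA : ∀ x y, x ≤ i → y ≤ j → AEStronglyMeasurable (A x y) ν)
    (hB : ∀ x y, x ≤ i → y ≤ j → AEStronglyMeasurable (B x y) ν)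
    (h : ∀ x ∈ Finset.HasAntidiagonal.antidiagonal i, ∀ y ∈ Finset.HasAntidiagonal.antidiagonal j,
      eLpNorm (fun r => A x.1 y.1 r * B x.2 y.2 r) p ν ≤ M) :
    eLpNorm (Leib A B i j) p ν ≤ 2 ^ (i + j) * M := by
  have hm : ∀ x ∈ Finset.HasAntidiagonal.antidiagonal i, ∀ y ∈ Finset.HasAntidiagonal.antidiagonal j,
      AEStronglyMeasurable (fun r => A x.1 y.1 r * B x.2 y.2 r) ν := by
    intro x hx y hy
    have h1 := Finset.HasAntidiagonal.mem_antidiagonal.1 hx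
    have h2 := Finset.HasAntidiagonal.mem_antidiagonal.1 hy
    exact (hA _ _ (by omega) (by omega)).mul (hB _ _ (by omega) (by omega))
  have e : Leib A B i j = ∑ x ∈ Finset.HasAntidiagonal.antidiagonal i, ∑ y ∈ Finset.HasAntidiagonal.antidiagonal j,
      ((i.choose x.1 * j.choose y.1 : ℕ) : ℝ) • (fun r => A x.1 y.1 r * B x.2 y.2 r) := by
    funext r
    simp [Leib, Finset.sum_apply]
  rw [e]
  calc eLpNorm _ p ν ≤ ∑ x ∈ Finset.HasAntidiagonal.antidiagonal i, eLpNorm (∑ y ∈ Finset.HasAntidiagonal.antidiagonal j,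
        ((i.choose x.1 * j.choose y.1 : ℕ) : ℝ) • (fun r => A x.1 y.1 r * B x.2 y.2 r)) p ν :=
        eLpNorm_sum_le (fun x hx => Finset.aestronglyMeasurable_sum _ fun y hy =>
          (hm x hx y hy).const_smul _) hp
    _ ≤ ∑ x ∈ Finset.HasAntidiagonal.antidiagonal i, ∑ y ∈ Finset.HasAntidiagonal.antidiagonal j,
        (((i.choose x.1 : ℕ) : ℝ≥0∞) * ((j.choose y.1 : ℕ) : ℝ≥0∞)) * M := by
        refine Finset.sum_le_sum fun x hx => (eLpNorm_sum_le (fun y hy =>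
          (hm x hx y hy).const_smul _) hp).trans (Finset.sum_le_sum fun y hy => ?_)
        rw [eLpNorm_const_smul]
        gcongr
        · rw [← Nat.cast_mul]
          simp only [Real.enorm_natCast]
          exact le_refl _
        · exact h x hx y hy
    _ = 2 ^ (i + j) * M := by
        have hs : ∀ m : ℕ, ∑ x ∈ Finset.HasAntidiagonal.antidiagonal m, ((m.choose x.1 : ℕ) : ℝ≥0∞) = 2 ^ m := by
          intro m
          rw [Finset.Nat.sum_antidiagonal_eq_sum_range_succ_mk, ← Nat.cast_sum,
            Nat.sum_range_choose]
          simp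
        simp only [← Finset.sum_mul, ← Finset.mul_sum]
        rw [hs, hs, pow_add]

/-- Bounds at a fixed time for the derivatives of order `≤ n` of a coefficient. -/
structure CoefAt (ν : Measure ℝ) (n : ℕ) (K : ℝ≥0∞) (A : ℕ → ℕ → ℝ → ℝ) : Prop where
  meas : ∀ i j, i + j ≤ n → AEStronglyMeasurable (A i j) ν
  top : ∀ i j, i + j < n → eLpNorm (A i j) ∞ ν ≤ K
  two : ∀ i j, 1 ≤ i + j → i + j ≤ n → eLpNorm (A i j) 2 ν ≤ K

lemma eLpNorm_mul_top_left {ν : Measure ℝ} {f g : ℝ → ℝ} (p : ℝ≥0∞)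
    (hg : AEStronglyMeasurable g ν) :
    eLpNorm (fun r => f r * g r) p ν ≤ eLpNorm f ∞ ν * eLpNorm g p ν := by
  have := eLpNorm_le_eLpNorm_top_mul_eLpNorm p f hg (fun a b => a * b) 1
    (Eventually.of_forall fun x => by simp)
  simpa using this

lemma eLpNorm_mul_top_right {ν : Measure ℝ} {f g : ℝ → ℝ} (p : ℝ≥0∞)
    (hf : AEStronglyMeasurable f ν) :
    eLpNorm (fun r => f r * g r) p ν ≤ eLpNorm f p ν * eLpNorm g ∞ ν := by
  have := eLpNorm_le_eLpNorm_mul_eLpNorm_top p hf g (fun a b => a * b) 1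
    (Eventually.of_forall fun x => by simp)
  simpa using this

/-! ### Stability of the bounds of coefficients under algebraic operations. -/

namespace CoefAt

variable {ν : Measure ℝ} {n : ℕ} {K L : ℝ≥0∞} {A B : ℕ → ℕ → ℝ → ℝ}

/-- If one factor carries all `n` derivatives, it is taken in `L²` and the other one,
undifferentiated, in `L^∞`; otherwise both factors are bounded and a differentiated one is taken in
`L²`. Order `0` is left out of the `L²` bounds because heights tend to `h₀ > 0` at infinity and are
not square integrable. -/
lemma leib (hn : 1 ≤ n) (hA : CoefAt ν n K A) (hB : CoefAt ν n L B) :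
    CoefAt ν n (2 ^ n * (K * L)) (Leib A B) := by
  have idx : ∀ {i j : ℕ} {x y : ℕ × ℕ}, x ∈ Finset.HasAntidiagonal.antidiagonal i → y ∈ Finset.HasAntidiagonal.antidiagonal j →
      x.1 + x.2 = i ∧ y.1 + y.2 = j := fun hx hy =>
    ⟨Finset.HasAntidiagonal.mem_antidiagonal.1 hx, Finset.HasAntidiagonal.mem_antidiagonal.1 hy⟩
  have hpow : ∀ i j : ℕ, i + j ≤ n → ∀ M : ℝ≥0∞, 2 ^ (i + j) * M ≤ 2 ^ n * M := fun i j h M => by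
    gcongr
    exact one_le_two
  refine ⟨fun i j hij => ?_, fun i j hij => ?_, fun i j h1 hij => ?_⟩
  · unfold Leib
    refine Finset.aestronglyMeasurable_fun_sum _ fun x hx =>
      Finset.aestronglyMeasurable_fun_sum _ fun y hy => ?_
    have := idx hx hy
    exact ((hA.meas _ _ (by omega)).mul (hB.meas _ _ (by omega))).const_mul _
  · refine (eLpNorm_leib_le le_top (fun x y _ _ => hA.meas _ _ (by omega))
      (fun x y _ _ => hB.meas _ _ (by omega)) fun x hx y hy => ?_).trans (hpow i j hij.le _)
    have := idx hx hy
    exact (eLpNorm_mul_top_left _ (hB.meas _ _ (by omega))).trans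
      (mul_le_mul' (hA.top _ _ (by omega)) (hB.top _ _ (by omega)))
  · refine (eLpNorm_leib_le one_le_two (fun x y _ _ => hA.meas _ _ (by omega))
      (fun x y _ _ => hB.meas _ _ (by omega)) fun x hx y hy => ?_).trans (hpow i j hij _)
    have := idx hx hy
    rcases lt_or_ge (x.1 + y.1) n with h | h
    · rcases Nat.eq_zero_or_pos (x.2 + y.2) with h' | h'
      · exact (eLpNorm_mul_top_right _ (hA.meas _ _ (by omega))).trans
          (mul_le_mul' (hA.two _ _ (by omega) (by omega)) (hB.top _ _ (by omega)))
      · exact (eLpNorm_mul_top_left _ (hB.meas _ _ (by omega))).trans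
          (mul_le_mul' (hA.top _ _ (by omega)) (hB.two _ _ (by omega) (by omega)))
    · exact (eLpNorm_mul_top_right _ (hA.meas _ _ (by omega))).trans
        (mul_le_mul' (hA.two _ _ (by omega) (by omega)) (hB.top _ _ (by omega)))

lemma add (hA : CoefAt ν n K A) (hB : CoefAt ν n L B) :
    CoefAt ν n (K + L) (fun i j r => A i j r + B i j r) :=
  ⟨fun i j h => (hA.meas i j h).add (hB.meas i j h),
    fun i j h => (eLpNorm_add_le (hA.meas i j h.le) (hB.meas i j h.le) le_top).trans
      (add_le_add (hA.top i j h) (hB.top i j h)),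
    fun i j h1 h => (eLpNorm_add_le (hA.meas i j h) (hB.meas i j h) one_le_two).trans
      (add_le_add (hA.two i j h1 h) (hB.two i j h1 h))⟩

lemma const_mul (k : ℝ) (hA : CoefAt ν n K A) :
    CoefAt ν n (‖k‖ₑ * K) (fun i j r => k * A i j r) := by
  refine ⟨fun i j h => (hA.meas i j h).const_mul k, fun i j h => ?_, fun i j h1 h => ?_⟩
  · exact (eLpNorm_const_smul k (A i j) ∞ ν).le.trans (mul_le_mul_right (hA.top i j h) _)
  · exact (eLpNorm_const_smul k (A i j) 2 ν).le.trans (mul_le_mul_right (hA.two i j h1 h) _)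

lemma mono (hA : CoefAt ν n K A) (h : K ≤ L) : CoefAt ν n L A :=
  ⟨hA.meas, fun i j hij => (hA.top i j hij).trans h, fun i j h1 hij => (hA.two i j h1 hij).trans h⟩

end CoefAt

/-- The array `A` without its entry of order `0`. -/
def dropZero {X : Type*} (A : ℕ → ℕ → X → ℝ) (i j : ℕ) (p : X) : ℝ :=
  if i = 0 ∧ j = 0 then 0 else A i j p

/-- Separates the principal term from the commutator: only the pair `(0, i)`, `(0, j)` leaves `A`
undifferentiated. -/
lemma leib_split {X : Type*} (A W : ℕ → ℕ → X → ℝ) (i j : ℕ) (p : X) :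
    Leib A W i j p = A 0 0 p * W i j p + Leib (dropZero A) W i j p := by
  have h1 : ∀ x ∈ Finset.HasAntidiagonal.antidiagonal i, ∀ y ∈ Finset.HasAntidiagonal.antidiagonal j,
      ((i.choose x.1 * j.choose y.1 : ℕ) : ℝ) * (A x.1 y.1 p * W x.2 y.2 p) =
      (if x = (0, i) then if y = (0, j) then A 0 0 p * W i j p else 0 else 0) +
      ((i.choose x.1 * j.choose y.1 : ℕ) : ℝ) * (dropZero A x.1 y.1 p * W x.2 y.2 p) := by
    rintro ⟨x1, x2⟩ hx ⟨y1, y2⟩ hy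
    rw [Finset.HasAntidiagonal.mem_antidiagonal] at hx hy
    simp only at hx hy
    by_cases hz : x1 = 0 ∧ y1 = 0
    · obtain ⟨rfl, rfl⟩ := hz
      simp only [zero_add] at hx hy
      subst hx hy
      simp [dropZero]
    · have : ¬ ((x1, x2) = (0, i) ∧ (y1, y2) = (0, j)) := fun h => hz
        ⟨(Prod.mk.inj h.1).1, (Prod.mk.inj h.2).1⟩
      rw [← ite_and, if_neg this]
      simp [dropZero, hz]
  unfold Leib
  rw [Finset.sum_congr rfl fun x hx => Finset.sum_congr rfl fun y hy => h1 x hx y hy]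
  simp only [Finset.sum_add_distrib]
  congr 1
  rw [Finset.sum_eq_single (0, i), Finset.sum_eq_single (0, j)]
  · simp
  · intro y _ hy; simp [hy]
  · intro h; simp at h
  · intro x _ hx; simp [hx]
  · intro h; simp at h

/-- The lower order terms in the derivative of a product. -/
lemma CoefAt.eLpNorm_leib_dropZero_le {ν : Measure ℝ} {s k : ℕ} {K M : ℝ≥0∞}
    {A W : ℕ → ℕ → ℝ → ℝ} (hA : CoefAt ν s K A) (hks : k ≤ s)
    (hm : ∀ i j, i + j ≤ k → AEStronglyMeasurable (W i j) ν)
    (h2 : ∀ i j, i + j < k → eLpNorm (W i j) 2 ν ≤ M)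
    (ht : s ≤ k → eLpNorm (W 0 0) ∞ ν ≤ M) {i j : ℕ} (hij : i + j ≤ k) :
    eLpNorm (Leib (dropZero A) W i j) 2 ν ≤ 2 ^ k * (K * M) := by
  have hA' : ∀ i j, i + j ≤ s → AEStronglyMeasurable (dropZero A i j) ν := by
    intro i j h
    by_cases hz : i = 0 ∧ j = 0
    · have : dropZero A i j = fun _ => 0 := by funext p; simp [dropZero, hz]
      rw [this]; exact aestronglyMeasurable_const
    · have : dropZero A i j = A i j := by funext p; simp [dropZero, hz]
      rw [this]; exact hA.meas i j h
  refine (eLpNorm_leib_le one_le_two (fun x y _ _ => hA' _ _ (by omega))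
    (fun x y _ _ => hm _ _ (by omega)) (M := K * M) fun x hx y hy => ?_).trans ?_
  · have e1 := Finset.HasAntidiagonal.mem_antidiagonal.1 hx
    have e2 := Finset.HasAntidiagonal.mem_antidiagonal.1 hy
    by_cases hz : x.1 = 0 ∧ y.1 = 0
    · simp [dropZero, hz]
    · have : dropZero A x.1 y.1 = A x.1 y.1 := by funext p; simp [dropZero, hz]
      rw [this]
      have hpos : 1 ≤ x.1 + y.1 := by omega
      rcases lt_or_ge (x.1 + y.1) s with h | h
      · exact (eLpNorm_mul_top_left _ (hm _ _ (by omega))).trans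
          (mul_le_mul' (hA.top _ _ h) (h2 _ _ (by omega)))
      -- If `A` carries at least `s` derivatives then, since `i + j ≤ k ≤ s`, none is left for `W`,
      -- and the sup bound of `W 0 0` pairs with the `L²` bound of `A`.
      · have h0 : x.2 = 0 ∧ y.2 = 0 := by omega
        rw [h0.1, h0.2]
        exact (eLpNorm_mul_top_right _ (hA.meas _ _ (by omega))).trans
          (mul_le_mul' (hA.two _ _ hpos (by omega)) (ht (by omega)))
  · gcongr
    exact one_le_two

end FloatingSW

namespace FloatingSW

open Filter Topology
open scoped ENNReal NNReal

/-! ### Curves in `L²_r` as functions on the strip -/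

/-- A coordinate of a state, as a continuous linear functional. -/
noncomputable def coordL (e : Fin 2) : State →L[ℝ] ℝ := EuclideanSpace.proj e

lemma coordL_apply (e : Fin 2) (x : State) : coordL e x = x e := rfl

lemma MemLp.coord {X : Type*} [MeasurableSpace X] {μ : Measure X} {f : X → State} {p : ℝ≥0∞}
    (hf : MemLp f p μ) (e : Fin 2) : MemLp (fun x => f x e) p μ :=
  (coordL e).comp_memLp' hf

lemma memLp_coord (R : ℝ) (f : L2r R) (e : Fin 2) : MemLp (fun r => f r e) 2 (radialMeasure R) :=
  MemLp.coord (Lp.memLp f) e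

lemma eLpNorm_coord_le {X : Type*} [MeasurableSpace X] {μ : Measure X} (f : X → State) (p : ℝ≥0∞)
    (e : Fin 2) : eLpNorm (fun x => f x e) p μ ≤ eLpNorm f p μ :=
  eLpNorm_mono fun x => PiLp.norm_apply_le (f x) e

/-- The functional is the inner product with `ψ / x` in the direction `e`: the division cancels the
weight of the measure, and `ψ / x` is in the weighted space because `x > R`. -/
lemma exists_functional {R : ℝ} (hR : 0 < R) {ψ : ℝ → ℝ} (hψ : MemLp ψ 2 (volume.restrict (Ioi R)))
    (e : Fin 2) :
    ∃ L : L2r R →L[ℝ] ℝ, ∀ f : L2r R, L f = ∫ x in Ioi R, ψ x * f x e := by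
  have hm : MemLp (fun x => ψ x / x) 2 (radialMeasure R) := by
    have hmeas : AEStronglyMeasurable (fun x => ψ x / x) (volume.restrict (Ioi R)) :=
      (hψ.1.aemeasurable.div aemeasurable_id).aestronglyMeasurable
    rw [memLp_two_iff_integrable_sq (hmeas.mono_ac (radialMeasure_ac R)), integrable_radial_iff hR]
    have h1 := ((memLp_two_iff_integrable_sq hψ.1).1 hψ).const_mul (1 / R)
    refine h1.mono' ?_ ?_
    · exact (aestronglyMeasurable_id.mul (hmeas.pow 2))
    · filter_upwards [ae_restrict_mem measurableSet_Ioi] with x hx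
      have hx0 : 0 < x := hR.trans hx
      rw [Real.norm_of_nonneg (by positivity)]
      have : x * (ψ x / x) ^ 2 = 1 / x * ψ x ^ 2 := by field_simp
      rw [this]
      gcongr
      exact le_of_lt hx
  have hm2 : MemLp (fun x => EuclideanSpace.single e (ψ x / x) : ℝ → State) 2 (radialMeasure R) := by
    refine MemLp.of_le hm ?_ (Eventually.of_forall fun x => by simp)
    have hc : Continuous fun y : ℝ => (EuclideanSpace.single e y : State) := by
      have : (fun y : ℝ => (EuclideanSpace.single e y : State))
          = fun y => y • (EuclideanSpace.single e (1 : ℝ) : State) := by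
        funext y; ext i; by_cases h : i = e <;> simp [h]
      rw [this]
      exact continuous_id.smul continuous_const
    exact hc.comp_aestronglyMeasurable hm.1
  refine ⟨innerSL ℝ (hm2.toLp _), fun f => ?_⟩
  rw [innerSL_apply_apply, L2.inner_def, ← integral_congr_ae (g := fun x => inner ℝ (hm2.toLp _ x) (f x)) (by rfl)]
  have h1 : ∀ᵐ x ∂(radialMeasure R), inner ℝ ((hm2.toLp _ : L2r R) x) (f x) = ψ x / x * f x e := by
    filter_upwards [hm2.coeFn_toLp] with x hx
    rw [hx, EuclideanSpace.inner_single_left]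
    simp
  rw [integral_congr_ae h1, integral_radial hR]
  refine setIntegral_congr_fun measurableSet_Ioi fun x hx => ?_
  have : x ≠ 0 := (hR.trans hx).ne'
  field_simp

lemma locallyIntegrable_indicator {R : ℝ} (hR : 0 < R) {f : ℝ → ℝ}
    (hf : MemLp f 2 (radialMeasure R)) : LocallyIntegrable ((Ioi R).indicator f) :=
  ((memLp_indicator_iff_restrict measurableSet_Ioi).2 (MemLp.of_radial hR hf)).locallyIntegrable
    one_le_two

/-- A continuous curve in `L²_r` has a jointly measurable representative. -/
lemma exists_joint {T R : ℝ} (hT : 0 < T) (hR : 0 < R) {V : ℝ → L2r R}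
    (hV : ContinuousOn V (Icc 0 T)) (e : Fin 2) :
    ∃ W : ℝ × ℝ → ℝ, StronglyMeasurable W ∧
      ∀ t ∈ Icc 0 T, (fun r => W (t, r)) =ᵐ[radialMeasure R] fun r => V t r e := by
  set V' : ℝ → L2r R := fun t => V (projIcc 0 T hT.le t) with hV'
  have hc : Continuous V' := hV.domRestrict.comp continuous_projIcc
  have hind : ∀ (n : ℕ) (r : ℝ), MemLp ((Ioc r (r + 1 / ((n : ℝ) + 1))).indicator
      (fun _ => (1 : ℝ))) 2 (volume.restrict (Ioi R)) := fun n r =>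
    (memLp_indicator_const 2 measurableSet_Ioc 1 (Or.inr (by simp))).restrict _
  -- Averages over `(r, r + 1 / (n + 1)]`. They are continuous in `t`, being functionals of the
  -- curve, and measurable in `r`, hence jointly measurable; by Lebesgue differentiation their limit
  -- represents the curve at every time.
  set u : ℕ → ℝ × ℝ → ℝ := fun n p => ((n : ℝ) + 1) *
    ∫ x in Ioi R, (Ioc p.2 (p.2 + 1 / ((n : ℝ) + 1))).indicator (fun _ => (1 : ℝ)) x * V' p.1 x e
    with hu
  have hrew : ∀ (n : ℕ) (t r c : ℝ), u n (t, r) = ((n : ℝ) + 1) *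
      ((∫ x in c..(r + 1 / ((n : ℝ) + 1)), (Ioi R).indicator (fun x => V' t x e) x)
        - ∫ x in c..r, (Ioi R).indicator (fun x => V' t x e) x) := by
    intro n t r c
    have hli := locallyIntegrable_indicator hR (memLp_coord R (V' t) e)
    have hii : ∀ a b, IntervalIntegrable ((Ioi R).indicator (fun x => V' t x e)) volume a b :=
      fun a b => (hli.integrableOn_isCompact isCompact_uIcc).intervalIntegrable
    have hle : r ≤ r + 1 / ((n : ℝ) + 1) := by
      have : (0 : ℝ) < 1 / ((n : ℝ) + 1) := by positivity
      linarith
    rw [intervalIntegral.integral_interval_sub_left (hii _ _) (hii _ _),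
      intervalIntegral.integral_of_le hle, ← integral_indicator measurableSet_Ioc]
    simp only [hu]
    rw [← integral_indicator measurableSet_Ioi]
    congr 2
    funext x
    by_cases h1 : x ∈ Ioi R <;> by_cases h2 : x ∈ Ioc r (r + 1 / ((n : ℝ) + 1)) <;>
      simp only [indicator_of_mem, indicator_of_notMem, h1, h2, not_false_eq_true, one_mul, zero_mul]
  have hmeas : ∀ n, StronglyMeasurable (u n) := by
    intro n
    have hcont : ∀ r, Continuous fun t => u n (t, r) := by
      intro r
      obtain ⟨L, hL⟩ := exists_functional hR (hind n r) e
      have : (fun t => u n (t, r)) = fun t => ((n : ℝ) + 1) * L (V' t) := by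
        funext t; simp only [hu, hL]
      rw [this]
      exact continuous_const.mul (L.continuous.comp hc)
    have hm : ∀ t, StronglyMeasurable fun r => u n (t, r) := by
      intro t
      have : (fun r => u n (t, r)) = fun r => ((n : ℝ) + 1) *
          ((∫ x in 0..(r + 1 / ((n : ℝ) + 1)), (Ioi R).indicator (fun x => V' t x e) x)
          - ∫ x in 0..r, (Ioi R).indicator (fun x => V' t x e) x) := funext fun r => hrew n t r 0
      rw [this]
      have hli := locallyIntegrable_indicator hR (memLp_coord R (V' t) e)
      have hp := intervalIntegral.continuous_primitive
        (fun a b => (hli.integrableOn_isCompact (isCompact_uIcc (a := a) (b := b))).intervalIntegrable) 0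
      exact (continuous_const.mul ((hp.comp (continuous_id.add continuous_const)).sub
        hp)).stronglyMeasurable
    exact stronglyMeasurable_uncurry_of_continuous_of_stronglyMeasurable hcont hm
  refine ⟨fun p => limUnder atTop fun n => u n p, StronglyMeasurable.limUnder hmeas, fun t ht => ?_⟩
  have hVt : V' t = V t := by simp only [hV']; rw [projIcc_of_mem hT.le ht]
  have hli := locallyIntegrable_indicator hR (memLp_coord R (V' t) e)
  rw [Filter.EventuallyEq, ae_radialMeasure hR, ae_restrict_iff' measurableSet_Ioi]
  filter_upwards [LocallyIntegrable.ae_hasDerivAt_integral hli] with r hr hrR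
  have h1 := (hr 0)
  have h2 : Tendsto (fun n : ℕ => r + 1 / ((n : ℝ) + 1)) atTop (𝓝[≠] r) := by
    refine tendsto_nhdsWithin_iff.2 ⟨?_, Eventually.of_forall fun n => ?_⟩
    · simpa using (tendsto_one_div_add_atTop_nhds_zero_nat (𝕜 := ℝ)).const_add r
    · have : (0 : ℝ) < 1 / ((n : ℝ) + 1) := by positivity
      simp only [mem_compl_iff, mem_singleton_iff]
      linarith
  have h3 := (hasDerivAt_iff_tendsto_slope.1 h1).comp h2
  rw [← hVt]
  refine Tendsto.limUnder_eq ?_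
  rw [indicator_of_mem hrR] at h3
  refine h3.congr fun n => ?_
  rw [hrew n t r 0, Function.comp, slope_def_field]
  have : ((n : ℝ) + 1) ≠ 0 := by positivity
  field_simp
  ring_nf

/-- Weak derivatives of vector valued functions, by components. -/
lemma IsWeakDeriv.coord {Ω : Set ℝ} {v w : ℝ → State} (h : IsWeakDeriv Ω v w)
    (hv : MemLp v 2 (volume.restrict Ω)) (hw : MemLp w 2 (volume.restrict Ω)) (e : Fin 2)
    {φ : ℝ → ℝ} (hφ : ContDiff ℝ ∞ φ) (hφc : HasCompactSupport φ) (hφs : tsupport φ ⊆ Ω) :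
    ∫ x in Ω, deriv φ x * v x e = - ∫ x in Ω, φ x * w x e := by
  have hI : ∀ (k : ℝ → ℝ) (u : ℝ → State), Continuous k → HasCompactSupport k →
      MemLp u 2 (volume.restrict Ω) → Integrable (fun x => k x • u x) (volume.restrict Ω) := by
    intro k u hk hkc hu
    have := ((hk.memLp_of_hasCompactSupport hkc (p := 2) (μ := volume)).restrict Ω)
    exact memLp_one_iff_integrable.1 (hu.smul this)
  set P := coordL e
  have h1 := congrArg P (h φ hφ hφc hφs)
  rw [map_neg, ← P.integral_comp_comm (hI _ _ (hφ.continuous_deriv (by simp)) hφc.deriv hv),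
    ← P.integral_comp_comm (hI _ _ hφ.continuous hφc hw)] at h1
  simpa [P, coordL_apply] using h1

lemma isWeakDeriv_of_coord {Ω : Set ℝ} {v w : ℝ → State} 
    (hv : MemLp v 2 (volume.restrict Ω)) (hw : MemLp w 2 (volume.restrict Ω))
    (h : ∀ e : Fin 2, ∀ φ : ℝ → ℝ, ContDiff ℝ ∞ φ → HasCompactSupport φ → tsupport φ ⊆ Ω →
      ∫ x in Ω, deriv φ x * v x e = - ∫ x in Ω, φ x * w x e) : IsWeakDeriv Ω v w := by
  intro φ hφ hφc hφs
  have hI : ∀ (k : ℝ → ℝ) (u : ℝ → State), Continuous k → HasCompactSupport k →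
      MemLp u 2 (volume.restrict Ω) → Integrable (fun x => k x • u x) (volume.restrict Ω) := by
    intro k u hk hkc hu
    have := ((hk.memLp_of_hasCompactSupport hkc (p := 2) (μ := volume)).restrict Ω)
    exact memLp_one_iff_integrable.1 (hu.smul this)
  ext e
  rw [← coordL_apply, ← coordL_apply]
  set P := coordL e
  rw [map_neg, ← P.integral_comp_comm (hI _ _ (hφ.continuous_deriv (by simp)) hφc.deriv hv),
    ← P.integral_comp_comm (hI _ _ hφ.continuous hφc hw)]
  simpa [P, coordL_apply] using h e φ hφ hφc hφs

lemma MemLp.of_radial_state {R : ℝ} (hR : 0 < R) {f : ℝ → State}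
    (hf : MemLp f 2 (radialMeasure R)) : MemLp f 2 (volume.restrict (Ioi R)) :=
  hf.of_measure_le_smul (ENNReal.inv_ne_top.2 (by simpa using hR)) (volume_le_radial hR)

lemma IsWeakDeriv.exists_prim {R : ℝ} (hR : 0 < R) {v w : L2r R} (h : IsWeakDeriv (Ioi R) v w)
    (e : Fin 2) : ∃ c, Prim (Ioi R) R (fun r => v r e) (fun r => w r e) c := by
  have hs := isLeft_Ioi R
  refine FloatingSW.exists_prim hs (locallyIntegrable_indicator hR (memLp_coord R v e))
    (locallyIntegrable_indicator hR (memLp_coord R w e)) fun n p q hp hq => ?_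
  exact h.coord (MemLp.of_radial_state hR (Lp.memLp v)) (MemLp.of_radial_state hR (Lp.memLp w)) e
    (contDiff_testFn n p q) (hasCompactSupport_testFn n p q) (hs.tsupport_testFn_subset hp hq)

lemma stronglyMeasurable_primitive {E : Type*} [NormedAddCommGroup E] [NormedSpace ℝ E]
    {w : ℝ × ℝ → E} (a : ℝ) (hw : StronglyMeasurable w) :
    StronglyMeasurable fun p : ℝ × ℝ => ∫ τ in a..p.1, w (τ, p.2) := by
  have h : ∀ (S : ℝ → Set ℝ), (∀ t, MeasurableSet (S t)) →
      MeasurableSet {x : ℝ × ℝ | x.2 ∈ S x.1} →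
      StronglyMeasurable fun p : ℝ × ℝ => ∫ τ in S p.1, w (τ, p.2) := by
    intro S hSt hS
    have h1 : StronglyMeasurable fun x : (ℝ × ℝ) × ℝ =>
        {x : (ℝ × ℝ) × ℝ | x.2 ∈ S x.1.1}.indicator (fun x => w (x.2, x.1.2)) x := by
      refine StronglyMeasurable.indicator ?_ ?_
      · exact hw.comp_measurable (by fun_prop)
      · have : Measurable fun x : (ℝ × ℝ) × ℝ => (x.1.1, x.2) := by fun_prop
        exact this hS
    have h2 := h1.integral_prod_right' (ν := volume)
    have e : (fun p : ℝ × ℝ => ∫ τ in S p.1, w (τ, p.2)) = fun p => ∫ τ,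
        {x : (ℝ × ℝ) × ℝ | x.2 ∈ S x.1.1}.indicator (fun x => w (x.2, x.1.2)) (p, τ) := by
      funext p
      rw [← integral_indicator (hSt p.1)]
      rfl
    rw [e]
    exact h2
  have m1 : MeasurableSet {x : ℝ × ℝ | x.2 ∈ Ioc a x.1} :=
    (measurableSet_lt measurable_const measurable_snd).inter
      (measurableSet_le measurable_snd measurable_fst)
  have m2 : MeasurableSet {x : ℝ × ℝ | x.2 ∈ Ioc x.1 a} :=
    (measurableSet_lt measurable_fst measurable_snd).inter
      (measurableSet_le measurable_snd measurable_const)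
  exact (h (fun t => Ioc a t) (fun _ => measurableSet_Ioc) m1).sub
    (h (fun t => Ioc t a) (fun _ => measurableSet_Ioc) m2)

lemma memLp_strip_of_bound {T R : ℝ} {W : ℝ × ℝ → ℝ} {M : ℝ≥0∞} (hM : M ≠ ⊤)
    (hW : AEStronglyMeasurable W (stripMeasure T R))
    (h : ∀ᵐ t ∂(volume.restrict (Ioo 0 T)), eLpNorm (fun r => W (t, r)) 2 (radialMeasure R) ≤ M) :
    MemLp W 2 (stripMeasure T R) := by
  refine ⟨hW, ?_⟩
  rw [eLpNorm_lt_top_iff_lintegral_rpow_enorm_lt_top (by simp) (by simp)]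
  rw [stripMeasure_eq_prod] at hW ⊢
  rw [lintegral_prod _ (by fun_prop)]
  calc _ ≤ ∫⁻ t in Ioo 0 T, M ^ (2 : ℝ) := by
        refine lintegral_mono_ae ?_
        filter_upwards [h] with t ht
        rw [eLpNorm_eq_lintegral_rpow_enorm_toReal (by simp) (by simp)] at ht
        have := ENNReal.rpow_le_rpow ht (z := 2) (by norm_num)
        rw [← ENNReal.rpow_mul] at this
        simpa using this
    _ < ⊤ := by
        rw [setLIntegral_const]
        exact ENNReal.mul_lt_top (ENNReal.rpow_lt_top_of_nonneg (by norm_num) hM) (by simp)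

/-! ### The coefficients as functions on the strip -/

lemma ContinuousOn.exists_norm_le {T : ℝ} {E : Type*} [NormedAddCommGroup E] {V : ℝ → E}
    (hV : ContinuousOn V (Icc 0 T)) : ∃ M, 0 ≤ M ∧ ∀ t ∈ Icc 0 T, ‖V t‖ ≤ M := by
  obtain ⟨M, hM⟩ := isCompact_Icc.exists_bound_of_continuousOn hV
  exact ⟨max M 0, le_max_right _ _, fun t ht => (hM t ht).trans (le_max_left _ _)⟩

lemma eLpNorm_rep_le {R : ℝ} {W : ℝ → ℝ} {V : L2r R} {e : Fin 2} {M : ℝ}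
    (h : W =ᵐ[radialMeasure R] fun r => V r e) (hM : ‖V‖ ≤ M) :
    eLpNorm W 2 (radialMeasure R) ≤ ENNReal.ofReal M := by
  rw [eLpNorm_congr_ae h]
  refine (eLpNorm_coord_le _ 2 e).trans ?_
  rw [← ENNReal.ofReal_toReal (Lp.eLpNorm_ne_top V), ← Lp.norm_def]
  exact ENNReal.ofReal_le_ofReal hM

lemma ae_ae_of_forall {T R : ℝ} {D : ℝ × ℝ → ℝ} (hD : StronglyMeasurable D)
    (h : ∀ t ∈ Ioo 0 T, ∀ᵐ r ∂(volume.restrict (Ioi R)), D (t, r) = 0) :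
    ∀ᵐ r ∂(volume.restrict (Ioi R)), ∀ᵐ t ∂(volume.restrict (Ioo 0 T)), D (t, r) = 0 := by
  have h1 : ∀ᵐ p ∂(stripVol T R), D p = 0 := by
    refine ae_prod_of_ae_ae hD.aestronglyMeasurable ?_
    filter_upwards [ae_restrict_mem measurableSet_Ioo] with t ht using h t ht
  exact ae_ae_swap_of_ae_prod h1

/-- A differentiable curve in `L²_r` is a primitive of its derivative on almost every line. -/
lemma lineT_of_curve {T R : ℝ} (hT : 0 < T) (hR : 0 < R) {V V' : ℝ → L2r R}
    (hc : ContinuousOn V' (Icc 0 T))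
    (hd : ∀ t ∈ Icc 0 T, HasDerivWithinAt V (V' t) (Icc 0 T) t) (e : Fin 2) {W W' : ℝ × ℝ → ℝ}
    (hWm : StronglyMeasurable W) (hWm' : StronglyMeasurable W')
    (hW : ∀ t ∈ Icc 0 T, (fun r => W (t, r)) =ᵐ[radialMeasure R] fun r => V t r e)
    (hW' : ∀ t ∈ Icc 0 T, (fun r => W' (t, r)) =ᵐ[radialMeasure R] fun r => V' t r e) :
    LineT T R W W' (fun r => W (0, r)) := by
  obtain ⟨M, hM0, hM⟩ := ContinuousOn.exists_norm_le hc
  have h0T : (0 : ℝ) ∈ Icc 0 T := ⟨le_rfl, hT.le⟩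
  have hL2 : MemLp W' 2 (stripVol T R) := by
    refine MemLp.of_strip hR (memLp_strip_of_bound (M := ENNReal.ofReal M) ENNReal.ofReal_ne_top
      hWm'.aestronglyMeasurable ?_)
    filter_upwards [ae_restrict_mem measurableSet_Ioo] with t ht
    exact eLpNorm_rep_le (hW' t (Ioo_subset_Icc_self ht)) (hM t (Ioo_subset_Icc_self ht))
  have hJ : ∀ t ∈ Ioo 0 T, ∀ ψ : ℝ → ℝ, MemLp ψ 2 (volume.restrict (Ioi R)) →
      Integrable (fun p : ℝ × ℝ => ψ p.2 * W' p)
        ((volume.restrict (Ioc 0 t)).prod (volume.restrict (Ioi R))) := by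
    intro t ht ψ hψ
    have hle : (volume.restrict (Ioc 0 t)).prod (volume.restrict (Ioi R)) ≤ stripVol T R := by
      have hsub : Ioc 0 t ⊆ Ioo 0 T := fun x hx => ⟨hx.1, hx.2.trans_lt ht.2⟩
      exact Measure.prod_mono (Measure.restrict_mono hsub le_rfl) le_rfl
    have h1 : MemLp (fun p : ℝ × ℝ => ψ p.2) 2
        ((volume.restrict (Ioc 0 t)).prod (volume.restrict (Ioi R))) := hψ.comp_snd _
    exact h1.integrable_mul (hL2.mono_measure hle)
  have hWi : ∀ t ∈ Icc 0 T, MemLp (fun r => W (t, r)) 2 (volume.restrict (Ioi R)) := fun t ht =>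
    MemLp.of_radial hR ((memLp_congr_ae (hW t ht)).2 (memLp_coord R (V t) e))
  have hWae : ∀ t ∈ Icc 0 T, (fun r => W (t, r)) =ᵐ[volume.restrict (Ioi R)] fun r => V t r e := by
    intro t ht
    have := hW t ht
    rwa [Filter.EventuallyEq, ae_radialMeasure hR] at this
  have hWae' : ∀ t ∈ Icc 0 T, (fun r => W' (t, r)) =ᵐ[volume.restrict (Ioi R)]
      fun r => V' t r e := by
    intro t ht
    have := hW' t ht
    rwa [Filter.EventuallyEq, ae_radialMeasure hR] at this
  -- At fixed `t`, testing against `ψ` reduces the identity to the fundamental theorem of calculus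
  -- for the real function `τ ↦ L (V τ)`, followed by Fubini.
  have key : ∀ t ∈ Ioo 0 T, ∀ᵐ r ∂(volume.restrict (Ioi R)),
      W (t, r) - W (0, r) - ∫ τ in 0..t, W' (τ, r) = 0 := by
    intro t ht
    have htm : t ∈ Icc 0 T := Ioo_subset_Icc_self ht
    rw [ae_restrict_iff' measurableSet_Ioi]
    refine isOpen_Ioi.ae_eq_zero_of_integral_contDiff_smul_eq_zero ?_ ?_
    · rw [locallyIntegrableOn_iff isOpen_Ioi.isLocallyClosed]
      intro K hKs hK
      have hfin : ∀ u : ℝ → ℝ, MemLp u 2 (volume.restrict (Ioi R)) → IntegrableOn u K := by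
        intro u hu
        have hu' := hu.mono_measure (Measure.restrict_mono hKs le_rfl)
        have : IsFiniteMeasure (volume.restrict K) := ⟨by simpa using hK.measure_lt_top⟩
        exact hu'.integrable one_le_two
      refine ((hfin _ (hWi t htm)).sub (hfin _ (hWi 0 h0T))).sub ?_
      have h1 : MemLp (K.indicator (fun _ => (1 : ℝ))) 2 (volume.restrict (Ioi R)) :=
        (memLp_indicator_const 2 hK.measurableSet 1 (Or.inr hK.measure_lt_top.ne)).restrict _
      have h2 := (hJ t ht _ h1).integral_prod_right
      have h3 : IntegrableOn (fun y => ∫ x in Ioc 0 t, K.indicator (fun _ => (1 : ℝ)) y * W' (x, y))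
          K := IntegrableOn.mono_set h2 hKs
      refine h3.congr_fun (fun y hy => ?_) hK.measurableSet
      simp [hy, intervalIntegral.integral_of_le ht.1.le]
    · intro ψ hψ hψc hψs
      have hψm : MemLp ψ 2 (volume.restrict (Ioi R)) :=
        (hψ.continuous.memLp_of_hasCompactSupport hψc).restrict _
      obtain ⟨L, hL⟩ := exists_functional hR hψm e
      have hftc : ∫ τ in 0..t, L (V' τ) = L (V t) - L (V 0) := by
        have hder : ∀ x ∈ Icc 0 T, HasDerivWithinAt (fun τ => L (V τ)) (L (V' x)) (Icc 0 T) x :=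
          fun x hx => L.hasFDerivAt.comp_hasDerivWithinAt x (hd x hx)
        refine intervalIntegral.integral_eq_sub_of_hasDerivAt_of_le (f := fun τ => L (V τ)) ht.1.le
          ?_ ?_ ?_
        · exact fun x hx => ((hder x ⟨hx.1, hx.2.trans ht.2.le⟩).continuousWithinAt).mono
            (Icc_subset_Icc_right ht.2.le)
        · exact fun x hx => (hder x ⟨hx.1.le, hx.2.le.trans ht.2.le⟩).hasDerivAt
            (Icc_mem_nhds hx.1 (hx.2.trans ht.2))
        · refine ContinuousOn.intervalIntegrable_of_Icc ht.1.le ?_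
          exact (L.continuous.comp_continuousOn hc).mono (Icc_subset_Icc_right ht.2.le)
      have hLW : ∀ x ∈ Icc 0 T, L (V x) = ∫ r in Ioi R, ψ r * W (x, r) := by
        intro x hx
        rw [hL]
        refine integral_congr_ae ?_
        filter_upwards [hWae x hx] with r hr
        rw [hr]
      have hLW' : ∀ x ∈ Icc 0 T, L (V' x) = ∫ r in Ioi R, ψ r * W' (x, r) := by
        intro x hx
        rw [hL]
        refine integral_congr_ae ?_
        filter_upwards [hWae' x hx] with r hr
        rw [hr]
      have hI := hJ t ht ψ hψm
      have hfub : ∫ r in Ioi R, ψ r * ∫ τ in 0..t, W' (τ, r) = L (V t) - L (V 0) := by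
        rw [← hftc, intervalIntegral.integral_of_le ht.1.le]
        have e1 : ∫ τ in Ioc 0 t, L (V' τ) = ∫ τ in Ioc 0 t, ∫ r in Ioi R, ψ r * W' (τ, r) :=
          setIntegral_congr_fun measurableSet_Ioc fun τ hτ =>
            hLW' τ ⟨hτ.1.le, hτ.2.trans ht.2.le⟩
        rw [e1, integral_integral_swap hI]
        refine integral_congr_ae (Eventually.of_forall fun r => ?_)
        simp only [intervalIntegral.integral_of_le ht.1.le, integral_const_mul]
      have i1 : ∀ x ∈ Icc 0 T, IntegrableOn (fun r => ψ r * W (x, r)) (Ioi R) := fun x hx =>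
        hψm.integrable_mul (hWi x hx)
      have i2 : IntegrableOn (fun r => ψ r * ∫ τ in 0..t, W' (τ, r)) (Ioi R) := by
        have := hI.integral_prod_right
        refine this.congr (Eventually.of_forall fun r => ?_)
        simp only [intervalIntegral.integral_of_le ht.1.le, integral_const_mul]
      rw [← setIntegral_eq_integral_of_forall_compl_eq_zero (s := Ioi R)]
      · simp only [smul_eq_mul, mul_sub]
        have i3 : IntegrableOn (fun r => ψ r * W (t, r) - ψ r * W (0, r)) (Ioi R) :=
          (i1 t htm).sub (i1 0 h0T)
        rw [integral_sub i3 i2, integral_sub (i1 t htm) (i1 0 h0T), hfub,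
          hLW t htm, hLW 0 h0T]
        ring
      · intro r hr
        rw [image_eq_zero_of_notMem_tsupport fun h => hr (hψs h), zero_smul]
  have hDm : StronglyMeasurable fun p : ℝ × ℝ => W p - W (0, p.2) - ∫ τ in 0..p.1, W' (τ, p.2) :=
    (hWm.sub (hWm.comp_measurable (by fun_prop))).sub (stronglyMeasurable_primitive 0 hWm')
  -- The exceptional `r` in `key` depend on `t`; joint measurability permits exchanging the two
  -- quantifiers.
  have h1 := ae_ae_of_forall (T := T) (R := R) hDm key
  filter_upwards [h1, MemLp.ae_section hL2] with r a b
  refine ⟨fun x hx => ?_, ?_⟩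
  · have : IntegrableOn (fun t => W' (t, r)) (Ioo 0 T) := b.integrable one_le_two
    rw [intervalIntegrable_iff_integrableOn_Ioc_of_le hx.1.le]
    exact this.mono_set fun y hy => ⟨hy.1, hy.2.trans_lt hx.2⟩
  · filter_upwards [a] with t ht
    have ht' : W (t, r) - W (0, r) - ∫ τ in 0..t, W' (τ, r) = 0 := ht
    linarith

/-- The components of the curves of an `X^n` family, as functions on the strip. -/
lemma IsXFamily.exists_fam {n : ℕ} {T R : ℝ} (hT : 0 < T) (hR : 0 < R) {v : ℝ × ℝ → State}
    {V : ℕ → ℕ → ℝ → L2r R} (h : IsXFamily n T R v V) (e : Fin 2) :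
    ∃ W : ℕ → ℕ → ℝ × ℝ → ℝ, Fam n T R W ∧ ∀ i j, i + j ≤ n → StronglyMeasurable (W i j) ∧
      ∀ t ∈ Icc 0 T, (fun r => W i j (t, r)) =ᵐ[radialMeasure R] fun r => V i j t r e := by
  have hex : ∀ i j, ∃ W : ℝ × ℝ → ℝ, i + j ≤ n → StronglyMeasurable W ∧
      ∀ t ∈ Icc 0 T, (fun r => W (t, r)) =ᵐ[radialMeasure R] fun r => V i j t r e := by
    intro i j
    by_cases hij : i + j ≤ n
    · obtain ⟨W, hW⟩ := exists_joint hT hR (h.cont i j hij) e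
      exact ⟨W, fun _ => hW⟩
    · exact ⟨fun _ => 0, fun h => absurd h hij⟩
  choose W hW using hex
  refine ⟨W, ⟨fun i j hij => (hW i j hij).1.aestronglyMeasurable, fun i j hij => ?_,
    fun i j hij => ?_⟩, hW⟩
  · have h1 := hW i j (by omega)
    have h2 := hW (i + 1) j (by omega)
    exact ⟨_, lineT_of_curve hT hR (h.cont (i + 1) j (by omega)) (h.dt i j hij) e h1.1 h2.1 h1.2 h2.2⟩
  · have h1 := hW i j (by omega)
    have h2 := hW i (j + 1) (by omega)
    have hp : ∀ t, ∃ c, t ∈ Ioo 0 T →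
        Prim (Ioi R) R (fun r => W i j (t, r)) (fun r => W i (j + 1) (t, r)) c := by
      intro t
      by_cases ht : t ∈ Ioo 0 T
      · have ht' := Ioo_subset_Icc_self ht
        obtain ⟨c, hc⟩ := (h.dr i j hij t ht').exists_prim hR e
        refine ⟨c, fun _ => hc.congr (isLeft_Ioi R) ?_ ?_⟩
        · exact ((ac_radialMeasure hR).ae_eq (h1.2 t ht')).symm
        · exact ((ac_radialMeasure hR).ae_eq (h2.2 t ht')).symm
      · exact ⟨0, fun h => absurd h ht⟩
    choose c hc using hp
    refine ⟨c, ?_⟩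
    filter_upwards [ae_restrict_mem measurableSet_Ioo] with t ht using hc t ht

/-! ### Square integrable functions on the strip with a time derivative, as curves in `L²_r` -/

lemma lintegral_sq_lt_top {X E : Type*} [MeasurableSpace X] [NormedAddCommGroup E] {μ : Measure X}
    {f : X → E} (hf : MemLp f 2 μ) : ∫⁻ x, ‖f x‖ₑ ^ 2 ∂μ < ⊤ := by
  have := (eLpNorm_lt_top_iff_lintegral_rpow_enorm_lt_top (by simp) (by simp)).1 hf.2
  simpa using this

lemma memLp_of_lintegral_sq {X E : Type*} [MeasurableSpace X] [NormedAddCommGroup E]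
    {μ : Measure X} {f : X → E} (hm : AEStronglyMeasurable f μ) (hf : ∫⁻ x, ‖f x‖ₑ ^ 2 ∂μ < ⊤) :
    MemLp f 2 μ :=
  ⟨hm, (eLpNorm_lt_top_iff_lintegral_rpow_enorm_lt_top (by simp) (by simp)).2 (by simpa using hf)⟩

lemma eLpNorm_two_sq {X E : Type*} [MeasurableSpace X] [NormedAddCommGroup E] {μ : Measure X}
    (f : X → E) : eLpNorm f 2 μ ^ 2 = ∫⁻ x, ‖f x‖ₑ ^ 2 ∂μ := by
  rw [eLpNorm_eq_lintegral_rpow_enorm_toReal (by simp) (by simp), ← ENNReal.rpow_natCast,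
    ← ENNReal.rpow_mul]
  simp

lemma MemLp.ae_section_left {α β E : Type*} [MeasurableSpace α] [MeasurableSpace β]
    [NormedAddCommGroup E] {μ : Measure α} {ν : Measure β} [SFinite μ] [SFinite ν] {v : α × β → E}
    (hv : MemLp v 2 (μ.prod ν)) : ∀ᵐ x ∂μ, MemLp (fun y => v (x, y)) 2 ν := by
  have h1 : ∀ᵐ x ∂μ, AEStronglyMeasurable (fun y => v (x, y)) ν := hv.1.prodMk_left
  have h2 := lintegral_sq_lt_top hv
  have hm : AEMeasurable (fun p => ‖v p‖ₑ ^ 2) (μ.prod ν) := hv.1.enorm.pow_const 2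
  rw [lintegral_prod _ hm] at h2
  have h3 := ae_lt_top' hm.lintegral_prod_right' h2.ne
  filter_upwards [h1, h3] with x a b
  exact memLp_of_lintegral_sq a b

lemma MemLp.ae_section_right {α β E : Type*} [MeasurableSpace α] [MeasurableSpace β]
    [NormedAddCommGroup E] {μ : Measure α} {ν : Measure β} [SFinite μ] [SFinite ν] {v : α × β → E}
    (hv : MemLp v 2 (μ.prod ν)) : ∀ᵐ y ∂ν, MemLp (fun x => v (x, y)) 2 μ :=
  MemLp.ae_section_left (hv.comp_measurePreserving (Measure.measurePreserving_swap (μ := ν) (ν := μ)))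

/-- The Cauchy–Schwarz inequality for the integral of a function of two variables. -/
lemma lintegral_sq_integral_le {E : Type*} [NormedAddCommGroup E] [NormedSpace ℝ E] {R : ℝ}
    {w : ℝ × ℝ → E} (hw : StronglyMeasurable w) {s t : ℝ} (hst : s ≤ t) :
    ∫⁻ r, ‖∫ τ in s..t, w (τ, r)‖ₑ ^ 2 ∂(radialMeasure R) ≤
      ENNReal.ofReal (t - s) * ∫⁻ τ in Ioc s t, ∫⁻ r, ‖w (τ, r)‖ₑ ^ 2 ∂(radialMeasure R) := by
  have h1 : ∀ r, ‖∫ τ in s..t, w (τ, r)‖ₑ ^ 2 ≤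
      ENNReal.ofReal (t - s) * ∫⁻ τ in Ioc s t, ‖w (τ, r)‖ₑ ^ 2 := by
    intro r
    have hm : AEMeasurable (fun τ => ‖w (τ, r)‖ₑ) (volume.restrict (Ioc s t)) :=
      (hw.comp_measurable (by fun_prop : Measurable fun τ : ℝ => (τ, r))).enorm.aemeasurable
    have h2 : ‖∫ τ in s..t, w (τ, r)‖ₑ ≤ ∫⁻ τ in Ioc s t, ‖w (τ, r)‖ₑ := by
      rw [intervalIntegral.integral_of_le hst]
      exact enorm_integral_le_lintegral_enorm _
    have h3 := ENNReal.lintegral_mul_le_Lp_mul_Lq (volume.restrict (Ioc s t))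
      Real.HolderConjugate.two_two (f := fun _ => 1) (g := fun τ => ‖w (τ, r)‖ₑ)
      aemeasurable_const hm
    simp only [Pi.mul_apply, one_mul, ENNReal.one_rpow, lintegral_const, Measure.restrict_apply,
      MeasurableSet.univ, univ_inter, Real.volume_Ioc] at h3
    calc _ ≤ (∫⁻ τ in Ioc s t, ‖w (τ, r)‖ₑ) ^ 2 := by gcongr
      _ ≤ ((ENNReal.ofReal (t - s)) ^ (1 / (2 : ℝ)) *
          (∫⁻ τ in Ioc s t, ‖w (τ, r)‖ₑ ^ (2 : ℝ)) ^ (1 / (2 : ℝ))) ^ 2 := by gcongr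
      _ = _ := by
        rw [mul_pow, ← ENNReal.rpow_natCast, ← ENNReal.rpow_mul, ← ENNReal.rpow_natCast,
          ← ENNReal.rpow_mul]
        simp
  refine (lintegral_mono h1).trans_eq ?_
  rw [lintegral_const_mul' _ _ ENNReal.ofReal_ne_top]
  congr 1
  · refine lintegral_lintegral_swap ?_
    · have : Measurable fun p : ℝ × ℝ => ‖w (p.2, p.1)‖ₑ ^ 2 :=
        ((hw.comp_measurable (by fun_prop : Measurable fun p : ℝ × ℝ => (p.2, p.1))).enorm).pow_const 2
      exact this.aemeasurable

lemma intervalIntegrable_section {T t : ℝ} (ht : t ∈ Icc 0 T) {E : Type*} [NormedAddCommGroup E]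
    {w : ℝ → E} (hw : MemLp w 2 (volume.restrict (Ioo 0 T))) : IntervalIntegrable w volume 0 t := by
  have h : IntegrableOn w (Ioo 0 T) := hw.integrable one_le_two
  rw [intervalIntegrable_iff_integrableOn_Ioo_of_le ht.1]
  exact h.mono_set (Ioo_subset_Ioo_right ht.2)

/-- A function on the strip with a time derivative is `C(r) + ∫_0^t w'(τ, r) dτ`. -/
lemma exists_initial {T R : ℝ} (hT : 0 < T) (hR : 0 < R) {v w : ℝ × ℝ → State}
    (hv : MemLp v 2 (stripMeasure T R)) (hw : MemLp w 2 (stripMeasure T R))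
    (h : ∀ e, DT T R (fun p => v p e) (fun p => w p e)) :
    ∃ (C : ℝ → State) (w' : ℝ × ℝ → State), StronglyMeasurable w' ∧ MemLp w' 2 (stripMeasure T R) ∧
      w =ᵐ[stripVol T R] w' ∧ MemLp C 2 (radialMeasure R) ∧
      (∀ e, LineT T R (fun p => v p e) (fun p => w p e) (fun r => C r e)) ∧
      (∀ t ∈ Icc 0 T, MemLp (fun r => C r + ∫ τ in 0..t, w' (τ, r)) 2 (radialMeasure R)) ∧
      ∀ᵐ t ∂(volume.restrict (Ioo 0 T)), (fun r => v (t, r)) =ᵐ[radialMeasure R]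
        fun r => C r + ∫ τ in 0..t, w' (τ, r) := by
  have hae := ae_stripMeasure hR T
  set v' := hv.1.mk v with hv'
  set w' := hw.1.mk w with hw'
  have hvm : StronglyMeasurable v' := hv.1.stronglyMeasurable_mk
  have hwm : StronglyMeasurable w' := hw.1.stronglyMeasurable_mk
  have hvv : v =ᵐ[stripVol T R] v' := by
    have := hv.1.ae_eq_mk; rwa [Filter.EventuallyEq, hae] at this
  have hww : w =ᵐ[stripVol T R] w' := by
    have := hw.1.ae_eq_mk; rwa [Filter.EventuallyEq, hae] at this
  have hv2 : MemLp v' 2 (stripMeasure T R) := (memLp_congr_ae hv.1.ae_eq_mk).1 hv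
  have hw2 : MemLp w' 2 (stripMeasure T R) := (memLp_congr_ae hw.1.ae_eq_mk).1 hw
  have hPm : StronglyMeasurable fun p : ℝ × ℝ => ∫ τ in 0..p.1, w' (τ, p.2) :=
    stronglyMeasurable_primitive 0 hwm
  have hDm : StronglyMeasurable fun p : ℝ × ℝ => v' p - ∫ τ in 0..p.1, w' (τ, p.2) := hvm.sub hPm
  -- For almost every `r` the integrand does not depend on `t`, so its time average is the initial
  -- value. The average has the advantage of being visibly measurable in `r`.
  set C : ℝ → State := fun r => T⁻¹ • ∫ t in Ioo 0 T, (v' (t, r) - ∫ τ in 0..t, w' (τ, r)) with hC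
  have hCm : StronglyMeasurable C := by
    have := (hDm.integral_prod_left' (μ := volume.restrict (Ioo 0 T))).const_smul T⁻¹
    exact this
  rw [stripMeasure_eq_prod] at hv2 hw2
  have hsec : ∀ᵐ r ∂(volume.restrict (Ioi R)), MemLp (fun t => w' (t, r)) 2 (volume.restrict (Ioo 0 T)) := by
    have := MemLp.ae_section_right hw2
    rwa [ae_radialMeasure hR] at this
  have hCeq : ∀ᵐ r ∂(volume.restrict (Ioi R)), (∀ᵐ t ∂(volume.restrict (Ioo 0 T)),
      v' (t, r) = C r + ∫ τ in 0..t, w' (τ, r)) ∧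
      ∀ e, Prim (Ioo 0 T) 0 (fun t => v (t, r) e) (fun t => w (t, r) e) (C r e) := by
    choose c hc using h
    filter_upwards [hc 0, hc 1, ae_ae_swap_of_ae_prod hvv, ae_ae_swap_of_ae_prod hww, hsec]
      with r h0 h1 a b hs
    have hp : ∀ e, Prim (Ioo 0 T) 0 (fun t => v (t, r) e) (fun t => w (t, r) e) (c e r) := by
      intro e; fin_cases e
      · exact h0
      · exact h1
    have hcoord : ∀ e, ∀ᵐ t ∂(volume.restrict (Ioo 0 T)),
        v' (t, r) e = c e r + (∫ τ in 0..t, w' (τ, r)) e := by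
      intro e
      have hp' := (hp e).congr (isLeft_Ioo hT) (f₁ := fun t => v' (t, r) e)
        (g₁ := fun t => w' (t, r) e) (by filter_upwards [a] with t ht; rw [ht])
        (by filter_upwards [b] with t ht; rw [ht])
      filter_upwards [hp'.eq, ae_restrict_mem measurableSet_Ioo] with t ht htm
      rw [ht]
      congr 1
      exact (coordL e).intervalIntegral_comp_comm
        (intervalIntegrable_section (Ioo_subset_Icc_self htm) hs)
    have hvec : ∀ᵐ t ∂(volume.restrict (Ioo 0 T)),
        v' (t, r) - ∫ τ in 0..t, w' (τ, r) = !₂[c 0 r, c 1 r] := by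
      filter_upwards [hcoord 0, hcoord 1] with t t0 t1
      ext e
      fin_cases e
      · simp [t0]
      · simp [t1]
    have hCr : C r = !₂[c 0 r, c 1 r] := by
      simp only [hC]
      rw [integral_congr_ae hvec, integral_const, smul_smul]
      simp [hT.le, hT.ne']
    refine ⟨?_, fun e => ?_⟩
    · filter_upwards [hvec] with t ht
      rw [hCr, ← ht]
      abel
    · have : C r e = c e r := by rw [hCr]; fin_cases e <;> simp
      rw [this]
      exact hp e
  have hswap : ∀ᵐ t ∂(volume.restrict (Ioo 0 T)), ∀ᵐ r ∂(volume.restrict (Ioi R)),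
      v' (t, r) = C r + ∫ τ in 0..t, w' (τ, r) := by
    have hz : ∀ᵐ p ∂(stripVol T R), ‖v' p - C p.2 - ∫ τ in 0..p.1, w' (τ, p.2)‖ = 0 := by
      refine ae_prod_of_ae_ae_swap ?_ ?_
      · exact ((hvm.sub (hCm.comp_measurable measurable_snd)).sub hPm).norm.aestronglyMeasurable
      · filter_upwards [hCeq] with r hr
        filter_upwards [hr.1] with t ht
        simp only [ht]
        rw [norm_eq_zero]
        abel
    filter_upwards [Measure.ae_ae_of_ae_prod hz] with t ht
    filter_upwards [ht] with r hr
    rw [norm_eq_zero] at hr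
    rw [← sub_eq_zero, ← hr]
    abel
  have hprim : ∀ t ∈ Icc 0 T, MemLp (fun r => ∫ τ in 0..t, w' (τ, r)) 2 (radialMeasure R) := by
    intro t ht
    refine memLp_of_lintegral_sq
      (hPm.comp_measurable (by fun_prop : Measurable fun r : ℝ => (t, r))).aestronglyMeasurable ?_
    refine (lintegral_sq_integral_le hwm ht.1).trans_lt (ENNReal.mul_lt_top (by simp) ?_)
    have h1 := lintegral_sq_lt_top hw2
    rw [lintegral_prod _ (hwm.enorm.pow_const 2).aemeasurable] at h1
    refine lt_of_le_of_lt ?_ h1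
    rw [Measure.restrict_congr_set Ioo_ae_eq_Ioc.symm]
    exact lintegral_mono_set (Ioo_subset_Ioo_right ht.2)
  have hCL : MemLp C 2 (radialMeasure R) := by
    have hne : (ae (volume.restrict (Ioo 0 T))).NeBot := by
      rw [ae_neBot, Ne, Measure.restrict_eq_zero]
      simp [hT]
    -- Square integrability of `C` is read off at a single good time, as the difference of two
    -- square integrable functions.
    obtain ⟨t, ⟨ht1, ht2⟩, ht3⟩ :=
      ((hswap.and (MemLp.ae_section_left hv2)).and (ae_restrict_mem measurableSet_Ioo)).exists
    refine (memLp_congr_ae ?_).1 (ht2.sub (hprim t (Ioo_subset_Icc_self ht3)))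
    rw [Filter.EventuallyEq, ae_radialMeasure hR]
    filter_upwards [ht1] with r hr
    simp [hr]
  refine ⟨C, w', hwm, ?_, hww, hCL, fun e => ?_, fun t ht => hCL.add (hprim t ht), ?_⟩
  · rw [stripMeasure_eq_prod]; exact hw2
  · filter_upwards [hCeq] with r hr using hr.2 e
  · filter_upwards [hswap, Measure.ae_ae_of_ae_prod hvv] with t a b
    rw [Filter.EventuallyEq, ae_radialMeasure hR]
    filter_upwards [a, b] with r c d
    rw [← c, ← d]

/-! ### Functions of class `H^k` as curves in `L²_r` -/

lemma IsStripFamily.memLp_coord {n : ℕ} {T R : ℝ} {v : ℝ × ℝ → State}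
    {d : ℕ → ℕ → ℝ × ℝ → State} (h : IsStripFamily n T R v d) (e : Fin 2) {i j : ℕ}
    (hij : i + j ≤ n) : MemLp (fun p => d i j p e) 2 (stripMeasure T R) :=
  MemLp.coord (h.memLp i j hij) e

lemma IsWeakPartialDeriv.coord {T R : ℝ} {v w : ℝ × ℝ → State} {d : ℝ × ℝ}
    (h : IsWeakPartialDeriv (strip T R) d v w)
    (hv : MemLp v 2 (stripVol T R)) (hw : MemLp w 2 (stripVol T R)) (e : Fin 2) :
    WeakPartial T R d (fun p => v p e) (fun p => w p e) := by
  intro φ hφ hφc hφs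
  have hI : ∀ (k : ℝ × ℝ → ℝ) (u : ℝ × ℝ → State), Continuous k → HasCompactSupport k →
      MemLp u 2 (stripVol T R) → Integrable (fun x => k x • u x) (stripVol T R) := by
    intro k u hk hkc hu
    have h1 : MemLp k 2 (stripVol T R) := by
      rw [← restrict_strip]
      exact (hk.memLp_of_hasCompactSupport hkc).restrict _
    exact memLp_one_iff_integrable.1 (hu.smul h1)
  have hd : Continuous fun p => fderiv ℝ φ p d :=
    (hφ.continuous_fderiv (by simp)).clm_apply continuous_const
  have hdc : HasCompactSupport fun p => fderiv ℝ φ p d := hφc.fderiv_apply ℝ d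
  have h1 := congrArg (coordL e) (h φ hφ hφc hφs)
  rw [restrict_strip] at h1
  rw [map_neg, ← (coordL e).integral_comp_comm (hI _ _ hd hdc hv),
    ← (coordL e).integral_comp_comm (hI _ _ hφ.continuous hφc hw)] at h1
  simpa [coordL_apply] using h1

lemma MemLp.of_strip_state {T R : ℝ} (hR : 0 < R) {f : ℝ × ℝ → State}
    (hf : MemLp f 2 (stripMeasure T R)) : MemLp f 2 (stripVol T R) :=
  hf.of_measure_le_smul (ENNReal.inv_ne_top.2 (by simpa using hR)) (stripVol_le hR T)

/-- The components of an `H^n` family. -/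
lemma IsStripFamily.fam {n : ℕ} {T R : ℝ} (hT : 0 < T) (hR : 0 < R) {v : ℝ × ℝ → State}
    {d : ℕ → ℕ → ℝ × ℝ → State} (h : IsStripFamily n T R v d) (e : Fin 2) :
    Fam n T R (fun i j p => d i j p e) := by
  have hm : ∀ i j, i + j ≤ n → MemLp (fun p => d i j p e) 2 (stripVol T R) := fun i j hij =>
    MemLp.of_strip hR (h.memLp_coord e hij)
  refine ⟨fun i j hij => (hm i j hij).1, fun i j hij => ?_, fun i j hij => ?_⟩
  · exact ((h.dt i j hij).coord (MemLp.of_strip_state hR (h.memLp i j hij.le))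
      (MemLp.of_strip_state hR (h.memLp (i + 1) j (by omega))) e).lineT hT (hm i j hij.le)
      (hm (i + 1) j (by omega))
  · exact ((h.dr i j hij).coord (MemLp.of_strip_state hR (h.memLp i j hij.le))
      (MemLp.of_strip_state hR (h.memLp i (j + 1) (by omega))) e).lineR (hm i j hij.le)
      (hm i (j + 1) (by omega))

lemma norm_toLp_le {R : ℝ} {f : L2r R} {g : ℝ → State} (h : f =ᵐ[radialMeasure R] g) {M : ℝ}
    (hM : 0 ≤ M) (hg : ∫⁻ r, ‖g r‖ₑ ^ 2 ∂(radialMeasure R) ≤ ENNReal.ofReal (M ^ 2)) : ‖f‖ ≤ M := by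
  rw [Lp.norm_def, eLpNorm_congr_ae h]
  refine ENNReal.toReal_le_of_le_ofReal hM ?_
  rw [← eLpNorm_two_sq, ENNReal.ofReal_pow hM] at hg
  exact (ENNReal.pow_le_pow_left_iff two_ne_zero).1 hg

lemma lintegral_sq_eq {R : ℝ} (f : L2r R) :
    ∫⁻ r, ‖f r‖ₑ ^ 2 ∂(radialMeasure R) = ENNReal.ofReal (‖f‖ ^ 2) := by
  rw [← eLpNorm_two_sq, ENNReal.ofReal_pow (norm_nonneg f), Lp.norm_def,
    ENNReal.ofReal_toReal (Lp.eLpNorm_ne_top f)]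

/-! ### Continuity and differentiability in `L²_r` of curves `t ↦ C + ∫₀ᵗ w'`. -/

section Curve

variable {T R : ℝ} {C : ℝ → State} {w' : ℝ × ℝ → State} {V : ℝ → L2r R}

lemma section_ae (hw2 : MemLp w' 2 (stripMeasure T R)) :
    ∀ᵐ r ∂(radialMeasure R), MemLp (fun t => w' (t, r)) 2 (volume.restrict (Ioo 0 T)) := by
  rw [stripMeasure_eq_prod] at hw2
  exact MemLp.ae_section_right hw2

lemma curve_sub (hw2 : MemLp w' 2 (stripMeasure T R))
    (hV : ∀ t ∈ Icc 0 T, V t =ᵐ[radialMeasure R] fun r => C r + ∫ τ in 0..t, w' (τ, r))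
    {a b : ℝ} (ha : a ∈ Icc 0 T) (hb : b ∈ Icc 0 T) :
    (V b - V a : L2r R) =ᵐ[radialMeasure R] fun r => ∫ τ in a..b, w' (τ, r) := by
  filter_upwards [hV a ha, hV b hb, section_ae hw2, Lp.coeFn_sub (V b) (V a)] with r h1 h2 h3 h4
  rw [h4, Pi.sub_apply, h1, h2, ← intervalIntegral.integral_interval_sub_left
    (intervalIntegrable_section hb h3) (intervalIntegrable_section ha h3)]
  abel

/-- A mean value inequality: the difference is `∫ (w' - g)` over `[a, b]`, and Cauchy–Schwarz in
time bounds its norm. It is used with `g` the derivative at a fixed time. -/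
lemma curve_sub_sub_le (hwm : StronglyMeasurable w') (hw2 : MemLp w' 2 (stripMeasure T R))
    (hV : ∀ t ∈ Icc 0 T, V t =ᵐ[radialMeasure R] fun r => C r + ∫ τ in 0..t, w' (τ, r))
    {V' : ℝ → L2r R}
    (hV' : ∀ᵐ τ ∂(volume.restrict (Ioo 0 T)), (fun r => w' (τ, r)) =ᵐ[radialMeasure R] V' τ)
    {a b : ℝ} (ha : a ∈ Icc 0 T) (hb : b ∈ Icc 0 T) (hab : a ≤ b) (g : L2r R) {ε : ℝ} (hε : 0 ≤ ε)
    (h : ∀ τ ∈ Ioo a b, ‖V' τ - g‖ ≤ ε) : ‖V b - V a - (b - a) • g‖ ≤ (b - a) * ε := by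
  set g' := (Lp.aestronglyMeasurable g).mk g with hg'
  have hgm : StronglyMeasurable g' := (Lp.aestronglyMeasurable g).stronglyMeasurable_mk
  have hgg : g =ᵐ[radialMeasure R] g' := (Lp.aestronglyMeasurable g).ae_eq_mk
  have hab0 : 0 ≤ b - a := sub_nonneg.2 hab
  have hae : (V b - V a - (b - a) • g : L2r R) =ᵐ[radialMeasure R]
      fun r => ∫ τ in a..b, (w' (τ, r) - g' r) := by
    filter_upwards [curve_sub hw2 hV ha hb, section_ae hw2, hgg,
      Lp.coeFn_sub (V b - V a) ((b - a) • g), Lp.coeFn_smul (b - a) g] with r h1 h2 h3 h4 h5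
    rw [h4, Pi.sub_apply, h1, h5, Pi.smul_apply, h3, intervalIntegral.integral_sub]
    · simp
    · exact (intervalIntegrable_section ha h2).symm.trans (intervalIntegrable_section hb h2)
    · simp
  refine norm_toLp_le hae (mul_nonneg hab0 hε) ?_
  have hWm : StronglyMeasurable fun p : ℝ × ℝ => w' p - g' p.2 :=
    hwm.sub (hgm.comp_measurable measurable_snd)
  refine (lintegral_sq_integral_le hWm hab).trans ?_
  have hsub : Ioo a b ⊆ Ioo 0 T := Ioo_subset_Ioo ha.1 hb.2
  have h1 : ∫⁻ τ in Ioc a b, ∫⁻ r, ‖w' (τ, r) - g' r‖ₑ ^ 2 ∂(radialMeasure R) ≤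
      ∫⁻ τ in Ioc a b, ENNReal.ofReal (ε ^ 2) := by
    rw [Measure.restrict_congr_set Ioo_ae_eq_Ioc.symm]
    refine lintegral_mono_ae ?_
    filter_upwards [ae_restrict_of_ae_restrict_of_subset hsub hV', ae_restrict_mem measurableSet_Ioo]
      with τ hτ hτm
    have e : ∫⁻ r, ‖w' (τ, r) - g' r‖ₑ ^ 2 ∂(radialMeasure R)
        = ∫⁻ r, ‖(V' τ - g : L2r R) r‖ₑ ^ 2 ∂(radialMeasure R) := by
      refine lintegral_congr_ae ?_
      filter_upwards [hτ, hgg, Lp.coeFn_sub (V' τ) g] with r k1 k2 k3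
      rw [k3, Pi.sub_apply, k1, k2]
    rw [e, lintegral_sq_eq]
    refine ENNReal.ofReal_le_ofReal ?_
    have := h τ hτm
    gcongr
  calc _ ≤ ENNReal.ofReal (b - a) * ∫⁻ τ in Ioc a b, ENNReal.ofReal (ε ^ 2) := by
        gcongr
    _ = ENNReal.ofReal (((b - a) * ε) ^ 2) := by
        rw [setLIntegral_const, Real.volume_Ioc, ← ENNReal.ofReal_mul (by positivity),
          ← ENNReal.ofReal_mul hab0]
        congr 1
        ring

/-- Cauchy–Schwarz in time gives Hölder continuity of exponent `1 / 2`. -/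
lemma curve_continuousOn (hwm : StronglyMeasurable w') (hw2 : MemLp w' 2 (stripMeasure T R))
    (hV : ∀ t ∈ Icc 0 T, V t =ᵐ[radialMeasure R] fun r => C r + ∫ τ in 0..t, w' (τ, r)) :
    ContinuousOn V (Icc 0 T) := by
  set A := ∫⁻ τ in Ioo 0 T, ∫⁻ r, ‖w' (τ, r)‖ₑ ^ 2 ∂(radialMeasure R) with hA
  have hAfin : A < ⊤ := by
    have h1 := lintegral_sq_lt_top hw2
    rwa [stripMeasure_eq_prod, lintegral_prod _ (hwm.enorm.pow_const 2).aemeasurable] at h1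
  have hle : ∀ a ∈ Icc 0 T, ∀ b ∈ Icc 0 T, a ≤ b → ‖V b - V a‖ ≤ √((b - a) * A.toReal) := by
    intro a ha b hb hab
    have hab0 : 0 ≤ b - a := sub_nonneg.2 hab
    refine norm_toLp_le (curve_sub hw2 hV ha hb) (Real.sqrt_nonneg _) ?_
    rw [Real.sq_sqrt (by positivity), ENNReal.ofReal_mul hab0, ENNReal.ofReal_toReal hAfin.ne]
    refine (lintegral_sq_integral_le hwm hab).trans ?_
    gcongr
    rw [Measure.restrict_congr_set Ioo_ae_eq_Ioc.symm]
    exact lintegral_mono_set (Ioo_subset_Ioo ha.1 hb.2)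
  have hle' : ∀ a ∈ Icc 0 T, ∀ b ∈ Icc 0 T, ‖V b - V a‖ ≤ √(|b - a| * A.toReal) := by
    intro a ha b hb
    rcases le_total a b with hab | hab
    · rw [abs_of_nonneg (sub_nonneg.2 hab)]
      exact hle a ha b hb hab
    · rw [abs_of_nonpos (sub_nonpos.2 hab), norm_sub_rev, neg_sub]
      exact hle b hb a ha hab
  intro a ha
  rw [ContinuousWithinAt, tendsto_iff_norm_sub_tendsto_zero]
  have hlim : Tendsto (fun b => √(|b - a| * A.toReal)) (𝓝[Icc 0 T] a) (𝓝 0) := by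
    have : Continuous fun b => √(|b - a| * A.toReal) := by fun_prop
    have h := this.tendsto a
    simp only [sub_self, abs_zero, zero_mul, Real.sqrt_zero] at h
    exact h.mono_left nhdsWithin_le_nhds
  refine squeeze_zero' (Eventually.of_forall fun _ => norm_nonneg _) ?_ hlim
  filter_upwards [self_mem_nhdsWithin] with b hb using hle' a ha b hb

lemma curve_hasDerivWithinAt (hwm : StronglyMeasurable w') (hw2 : MemLp w' 2 (stripMeasure T R))
    (hV : ∀ t ∈ Icc 0 T, V t =ᵐ[radialMeasure R] fun r => C r + ∫ τ in 0..t, w' (τ, r))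
    {V' : ℝ → L2r R}
    (hV' : ∀ᵐ τ ∂(volume.restrict (Ioo 0 T)), (fun r => w' (τ, r)) =ᵐ[radialMeasure R] V' τ)
    (hc : ContinuousOn V' (Icc 0 T)) {t : ℝ} (ht : t ∈ Icc 0 T) :
    HasDerivWithinAt V (V' t) (Icc 0 T) t := by
  rw [hasDerivWithinAt_iff_isLittleO, Asymptotics.isLittleO_iff]
  intro ε hε
  obtain ⟨η, hη, hball⟩ := Metric.continuousWithinAt_iff.1 (hc t ht) ε hε
  have hnear : ∀ τ ∈ Icc 0 T, |τ - t| < η → ‖V' τ - V' t‖ ≤ ε := fun τ hτ h => by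
    rw [← dist_eq_norm]
    exact (hball hτ (by rwa [Real.dist_eq])).le
  filter_upwards [self_mem_nhdsWithin, nhdsWithin_le_nhds (Metric.ball_mem_nhds t hη)] with b hb hbt
  rw [Metric.mem_ball, Real.dist_eq, abs_lt] at hbt
  rcases le_total t b with h | h
  · rw [Real.norm_of_nonneg (sub_nonneg.2 h), mul_comm]
    refine curve_sub_sub_le hwm hw2 hV hV' ht hb h _ hε.le fun τ hτ => hnear τ ?_ ?_
    · exact ⟨ht.1.trans hτ.1.le, hτ.2.le.trans hb.2⟩
    · rw [abs_lt]; constructor <;> linarith [hτ.1, hτ.2, hbt.1, hbt.2]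
  · have h1 := curve_sub_sub_le hwm hw2 hV hV' hb ht h (V' t) hε.le fun τ hτ => hnear τ
      ⟨hb.1.trans hτ.1.le, hτ.2.le.trans ht.2⟩
      (by rw [abs_lt]; constructor <;> linarith [hτ.1, hτ.2, hbt.1, hbt.2])
    rw [Real.norm_of_nonpos (sub_nonpos.2 h), neg_sub, mul_comm, ← norm_neg]
    convert! h1 using 2
    rw [← neg_sub t b, neg_smul]
    abel

end Curve

/-- Two continuous functions that agree almost everywhere agree up to the end points; taken at `x =
a`, this identifies the abstract left value `c` with a genuine trace. -/
lemma Prim.congr_continuousOn {s : Set ℝ} {a : ℝ} {f g : ℝ → ℝ} {c : ℝ}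
    (h : Prim s a f g c) {b : ℝ} (hsub : Ioo a b ⊆ s) (hab : a < b)
    (hg : IntervalIntegrable g volume a b) (hf : ContinuousOn f (Icc a b)) :
    ∀ x ∈ Icc a b, f x = c + ∫ y in a..x, g y := by
  have h1 : ContinuousOn (fun x => c + ∫ y in a..x, g y) (Icc a b) := by
    have := (ac_primitive c hg).continuousOn
    rwa [uIcc_of_le hab.le] at this
  refine Measure.eqOn_Icc_of_ae_eq volume hab.ne ?_ hf h1
  rw [Measure.restrict_congr_set Ioo_ae_eq_Icc.symm]
  exact ae_restrict_of_ae_restrict_of_subset hsub h.eq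

/-- A family of class `H^{k+1}` on the strip defines a family of class `X^k`. -/
lemma IsStripFamily.exists_XFamily {k : ℕ} {T R : ℝ} (hT : 0 < T) (hR : 0 < R)
    {u : ℝ × ℝ → State} {U : ℕ → ℕ → ℝ × ℝ → State} (h : IsStripFamily (k + 1) T R u U)
    (hu : ContinuousOn u (closedStrip T R)) :
    ∃ V : ℕ → ℕ → ℝ → L2r R, IsXFamily k T R u V ∧
      (∀ i j e, i + j ≤ k →
        LineT T R (fun p => U i j p e) (fun p => U (i + 1) j p e) (fun r => V i j 0 r e)) ∧
      ∀ᵐ t ∂(volume.restrict (Ioo 0 T)), ∀ i j, i + j ≤ k →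
        (fun r => U i j (t, r)) =ᵐ[radialMeasure R] V i j t := by
  -- Each curve of order `i + j ≤ k` is built from its time derivative, which has order at most `k +
  -- 1`: this is the loss of one derivative between `H^{k+1}` and `X^k`.
  have hex : ∀ i j, ∃ (C : ℝ → State) (w' : ℝ × ℝ → State) (V : ℝ → L2r R), i + j ≤ k →
      StronglyMeasurable w' ∧ MemLp w' 2 (stripMeasure T R) ∧ U (i + 1) j =ᵐ[stripVol T R] w' ∧
      (∀ e, LineT T R (fun p => U i j p e) (fun p => U (i + 1) j p e) (fun r => C r e)) ∧
      (∀ t ∈ Icc 0 T, V t =ᵐ[radialMeasure R] fun r => C r + ∫ τ in 0..t, w' (τ, r)) ∧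
      ∀ᵐ t ∂(volume.restrict (Ioo 0 T)), (fun r => U i j (t, r)) =ᵐ[radialMeasure R] V t := by
    intro i j
    by_cases hij : i + j ≤ k
    · obtain ⟨C, w', h1, h2, h3, h4, h5, h6, h7⟩ := exists_initial hT hR (h.memLp i j (by omega))
        (h.memLp (i + 1) j (by omega)) (fun e => (h.fam hT hR e).dt i j (by omega))
      classical
      refine ⟨C, w', fun t => if ht : t ∈ Icc 0 T then (h6 t ht).toLp _ else 0, fun _ =>
        ⟨h1, h2, h3, h5, fun t ht => ?_, ?_⟩⟩
      · simp only [dif_pos ht]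
        exact (h6 t ht).coeFn_toLp
      · filter_upwards [h7, ae_restrict_mem measurableSet_Ioo] with t a ht
        simp only [dif_pos (Ioo_subset_Icc_self ht)]
        exact a.trans (h6 t (Ioo_subset_Icc_self ht)).coeFn_toLp.symm
    · exact ⟨fun _ => 0, fun _ => 0, fun _ => 0, fun h => absurd h hij⟩
  choose C w' V hV using hex
  have hcont : ∀ i j, i + j ≤ k → ContinuousOn (V i j) (Icc 0 T) := by
    intro i j hij
    obtain ⟨h1, h2, -, -, h5, -⟩ := hV i j hij
    exact curve_continuousOn h1 h2 h5
  have hall : ∀ᵐ t ∂(volume.restrict (Ioo 0 T)), ∀ i j, i + j ≤ k →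
      (fun r => U i j (t, r)) =ᵐ[radialMeasure R] V i j t := by
    simp only [ae_all_iff, eventually_imp_distrib_left]
    exact fun i j hij => (hV i j hij).2.2.2.2.2
  refine ⟨V, ⟨fun t ht => ?_, hcont, fun i j hij t ht => ?_, fun i j hij t ht => ?_⟩,
    fun i j e hij => ?_, hall⟩
  · obtain ⟨h1, h2, h3, h4, h5, -⟩ := hV 0 0 (by omega)
    have hrep : U 0 0 =ᵐ[stripVol T R] u := by
      have := h.repr; rwa [restrict_strip] at this
    -- Continuity of `u` is what makes the representation valid at every time `t`, and not only at
    -- almost every one.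
    have hcoord : ∀ e, ∀ᵐ r ∂(radialMeasure R), u (t, r) e = C 0 0 r e + (∫ τ in 0..t, w' 0 0 (τ, r)) e := by
      intro e
      rw [ae_radialMeasure hR]
      have hl := (h4 e).congr hT (v₁ := fun p => u p e) (w₁ := fun p => w' 0 0 p e)
        (by filter_upwards [hrep] with p hp; rw [hp]) (by filter_upwards [h3] with p hp; rw [hp])
      have hs := section_ae h2
      rw [ae_radialMeasure hR] at hs
      filter_upwards [hl, hs, ae_restrict_mem measurableSet_Ioi] with r a b hr
      have hi : IntervalIntegrable (fun t => w' 0 0 (t, r)) volume 0 T :=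
        intervalIntegrable_section ⟨hT.le, le_rfl⟩ b
      have hi' : IntervalIntegrable (fun t => w' 0 0 (t, r) e) volume 0 T :=
        ⟨(coordL e).integrable_comp hi.1, (coordL e).integrable_comp hi.2⟩
      have hcu : ContinuousOn (fun t => u (t, r) e) (Icc 0 T) := by
        refine (coordL e).continuous.comp_continuousOn (hu.comp (by fun_prop) ?_)
        exact fun x hx => ⟨hx, (show R ≤ r from le_of_lt hr)⟩
      rw [a.congr_continuousOn subset_rfl hT hi' hcu t ht]
      congr 1
      exact (coordL e).intervalIntegral_comp_comm (intervalIntegrable_section ht b)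
    filter_upwards [h5 t ht, hcoord 0, hcoord 1] with r a b0 b1
    rw [a]
    ext e
    fin_cases e
    · simpa using b0.symm
    · simpa using b1.symm
  · obtain ⟨h1, h2, h3, -, h5, -⟩ := hV i j hij.le
    refine curve_hasDerivWithinAt h1 h2 h5 ?_ (hcont (i + 1) j (by omega)) ht
    filter_upwards [(hV (i + 1) j (by omega)).2.2.2.2.2, Measure.ae_ae_of_ae_prod h3] with τ a b
    have b' := (radialMeasure_ac R).ae_eq b
    exact b'.symm.trans a
  · have hVm : ∀ j', i + j' ≤ k → MemLp (V i j' t) 2 (volume.restrict (Ioi R)) := fun j' hj' =>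
      MemLp.of_radial_state hR (Lp.memLp _)
    refine isWeakDeriv_of_coord (hVm j hij.le) (hVm (j + 1) (by omega)) fun e φ hφ hφc hφs => ?_
    have hφm : MemLp φ 2 (volume.restrict (Ioi R)) :=
      (hφ.continuous.memLp_of_hasCompactSupport hφc).restrict _
    have hφm' : MemLp (deriv φ) 2 (volume.restrict (Ioi R)) :=
      ((hφ.continuous_deriv (by simp)).memLp_of_hasCompactSupport hφc.deriv).restrict _
    obtain ⟨L, hL⟩ := exists_functional hR hφm e
    obtain ⟨L', hL'⟩ := exists_functional hR hφm' e
    -- The weak derivative relation is known at almost every time; both sides are continuous in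
    -- time, so it holds at all times.
    have hz : EqOn (fun t => L' (V i j t)) (fun t => - L (V i (j + 1) t)) (Icc 0 T) := by
      refine Measure.eqOn_Icc_of_ae_eq volume hT.ne ?_
        (L'.continuous.comp_continuousOn (hcont i j hij.le))
        (L.continuous.comp_continuousOn (hcont i (j + 1) (by omega))).neg
      rw [Measure.restrict_congr_set Ioo_ae_eq_Icc.symm]
      obtain ⟨c, hc⟩ := (h.fam hT hR e).dr i j (by omega)
      filter_upwards [hc, hall] with τ a b
      have k1 := a.integral_deriv_mul (isLeft_Ioi R) hφ hφc hφs
      rw [hL, hL']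
      have b1 := (ac_radialMeasure hR).ae_eq (b i j hij.le)
      have b2 := (ac_radialMeasure hR).ae_eq (b i (j + 1) (by omega))
      have e1 : ∫ x in Ioi R, deriv φ x * V i j τ x e = ∫ x in Ioi R, deriv φ x * U i j (τ, x) e :=
        integral_congr_ae (by filter_upwards [b1] with x hx; rw [← hx])
      have e2 : ∫ x in Ioi R, φ x * V i (j + 1) τ x e =
          ∫ x in Ioi R, φ x * U i (j + 1) (τ, x) e :=
        integral_congr_ae (by filter_upwards [b2] with x hx; rw [← hx])
      rw [e1, e2]
      exact k1
    have := hz ht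
    simp only [hL, hL'] at this
    exact this
  · obtain ⟨h1, h2, h3, h4, h5, -⟩ := hV i j hij
    have h0 := (ac_radialMeasure hR).ae_eq (h5 0 ⟨le_rfl, hT.le⟩)
    filter_upwards [h4 e, h0] with r a b
    rw [b]
    simpa using a

/-! ### Traces at `r = R` -/

/-- Measurability of the trace comes from writing it as the average of `v - ∫ w` over `R < r < R +
1`; the bound is `Prim.sq_le` at `r = R`, integrated in time. -/
lemma LineR.memLp {T R : ℝ} (hR : 0 < R) {v w : ℝ × ℝ → ℝ} {c : ℝ → ℝ}
    (hv : MemLp v 2 (stripMeasure T R)) (hw : MemLp w 2 (stripMeasure T R))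
    (h : LineR T R v w c) : MemLp c 2 (volume.restrict (Ioo 0 T)) := by
  have hae := ae_stripMeasure hR T
  set v' := hv.1.mk v with hv'
  set w' := hw.1.mk w with hw'
  have hvm : StronglyMeasurable v' := hv.1.stronglyMeasurable_mk
  have hwm : StronglyMeasurable w' := hw.1.stronglyMeasurable_mk
  have hvv : v =ᵐ[stripVol T R] v' := by
    have := hv.1.ae_eq_mk; rwa [Filter.EventuallyEq, hae] at this
  have hww : w =ᵐ[stripVol T R] w' := by
    have := hw.1.ae_eq_mk; rwa [Filter.EventuallyEq, hae] at this
  have hPm : StronglyMeasurable fun p : ℝ × ℝ => ∫ y in R..p.2, w' (p.1, y) :=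
    (stronglyMeasurable_primitive (w := fun p => w' (p.2, p.1)) R
      (hwm.comp_measurable (by fun_prop))).comp_measurable
      (by fun_prop : Measurable fun p : ℝ × ℝ => (p.2, p.1))
  have hDm : StronglyMeasurable fun p : ℝ × ℝ => v' p - ∫ y in R..p.2, w' (p.1, y) := hvm.sub hPm
  have hCm := hDm.integral_prod_right' (ν := volume.restrict (Ioo R (R + 1)))
  have hc : AEStronglyMeasurable c (volume.restrict (Ioo 0 T)) := by
    refine ⟨_, hCm, ?_⟩
    filter_upwards [h.congr hvv hww] with t ht
    have e : ∫ r in Ioo R (R + 1), (v' (t, r) - ∫ y in R..r, w' (t, y)) =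
        ∫ r in Ioo R (R + 1), c t := by
      refine integral_congr_ae ?_
      filter_upwards [ae_restrict_of_ae_restrict_of_subset Ioo_subset_Ioi_self ht.eq] with r hr
      rw [hr]; ring
    rw [e]
    simp
  have hv2 := (memLp_two_iff_integrable_sq hv.1).1 hv
  have hw2 := (memLp_two_iff_integrable_sq hw.1).1 hw
  rw [stripMeasure_eq_prod] at hv2 hw2 hv hw
  rw [memLp_two_iff_integrable_sq hc]
  refine Integrable.mono' ((hv2.add hw2).integral_prod_left.const_mul (2 / R)) (hc.pow 2) ?_
  filter_upwards [h, MemLp.ae_section_left hv, MemLp.ae_section_left hw] with t a b d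
  rw [Real.norm_of_nonneg (sq_nonneg _)]
  simpa using a.sq_le hR b d le_rfl

/-- The trace of the time derivative is the derivative of the trace. The trace is written as `v(t,
r) - ∫_R^r v_r`, and integration by parts in `t` is carried out on the line through `r` and under
the integral. -/
lemma LineR.integral_deriv_mul {T R : ℝ} (hR : 0 < R) {v vt vr vtr : ℝ × ℝ → ℝ}
    {c d : ℝ → ℝ} (hv : MemLp v 2 (stripMeasure T R)) (hvt : MemLp vt 2 (stripMeasure T R))
    (hvr : MemLp vr 2 (stripMeasure T R)) (hvtr : MemLp vtr 2 (stripMeasure T R))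
    (hT : 0 < T) (h1 : LineR T R v vr c) (h2 : LineR T R vt vtr d) (h3 : DT T R v vt)
    (h4 : DT T R vr vtr) {φ : ℝ → ℝ} (hφ : ContDiff ℝ ∞ φ) (hφc : HasCompactSupport φ)
    (hφs : tsupport φ ⊆ Ioo 0 T) :
    ∫ t in Ioo 0 T, deriv φ t * c t = -∫ t in Ioo 0 T, φ t * d t := by
  have hcm := h1.memLp hR hv hvr
  have hdm := h2.memLp hR hvt hvtr
  have hφm : MemLp φ 2 (volume.restrict (Ioo 0 T)) :=
    (hφ.continuous.memLp_of_hasCompactSupport hφc).restrict _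
  have hφm' : MemLp (deriv φ) 2 (volume.restrict (Ioo 0 T)) :=
    ((hφ.continuous_deriv (by simp)).memLp_of_hasCompactSupport hφc.deriv).restrict _
  have key : ∀ {ψ : ℝ → ℝ} {f g : ℝ × ℝ → ℝ} {a : ℝ → ℝ}, MemLp ψ 2 (volume.restrict (Ioo 0 T)) →
      MemLp f 2 (stripMeasure T R) → MemLp g 2 (stripMeasure T R) → LineR T R f g a →
      ∀ᵐ r ∂(volume.restrict (Ioi R)), ∫ t in Ioo 0 T, ψ t * a t =
        (∫ t in Ioo 0 T, ψ t * f (t, r)) - ∫ y in Ioc R r, ∫ t in Ioo 0 T, ψ t * g (t, y) := by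
    intro ψ f g a hψ hf hg hl
    have ha := hl.memLp hR hf hg
    have hg' := MemLp.of_strip hR hg
    have hf' := MemLp.of_strip hR hf
    have hpt : ∀ᵐ p ∂(stripVol T R), f p - (a p.1 + ∫ y in R..p.2, hg'.1.mk g (p.1, y)) = 0 := by
      refine ae_prod_of_ae_ae ?_ ?_
      · refine hf'.1.sub (AEStronglyMeasurable.add ?_ ?_)
        · exact ha.1.comp_fst
        · exact ((stronglyMeasurable_primitive (w := fun p => hg'.1.mk g (p.2, p.1)) R
            (hg'.1.stronglyMeasurable_mk.comp_measurable (by fun_prop))).comp_measurable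
            (by fun_prop : Measurable fun p : ℝ × ℝ => (p.2, p.1))).aestronglyMeasurable
      · filter_upwards [hl.congr (ae_eq_refl _) hg'.1.ae_eq_mk] with t ht
        filter_upwards [ht.eq] with r hr
        rw [hr]; ring
    have hgg := Measure.ae_ae_of_ae_prod hg'.1.ae_eq_mk
    filter_upwards [ae_ae_swap_of_ae_prod hpt, MemLp.ae_section_right hf', ae_restrict_mem measurableSet_Ioi]
      with r hr hfr hrR
    have hI : Integrable (fun p : ℝ × ℝ => ψ p.1 * g p)
        ((volume.restrict (Ioo 0 T)).prod (volume.restrict (Ioc R r))) := by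
      have hψ2 : MemLp (fun p : ℝ × ℝ => ψ p.1) 2
          ((volume.restrict (Ioo 0 T)).prod (volume.restrict (Ioc R r))) := hψ.comp_fst _
      have hle : (volume.restrict (Ioo 0 T)).prod (volume.restrict (Ioc R r)) ≤ stripVol T R :=
        Measure.prod_mono le_rfl (Measure.restrict_mono Ioc_subset_Ioi_self le_rfl)
      exact hψ2.integrable_mul (hg'.mono_measure hle)
    rw [← integral_integral_swap (f := fun t y => ψ t * g (t, y)) hI, ← integral_sub]
    · refine integral_congr_ae ?_
      filter_upwards [hr, hgg] with t ht htg
      rw [integral_const_mul, show f (t, r) = a t + ∫ y in R..r, hg'.1.mk g (t, y) by linarith,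
        intervalIntegral.integral_of_le (le_of_lt hrR)]
      have : ∫ y in Ioc R r, g (t, y) = ∫ y in Ioc R r, hg'.1.mk g (t, y) :=
        integral_congr_ae (ae_restrict_of_ae_restrict_of_subset Ioc_subset_Ioi_self htg)
      rw [this]; ring
    · exact hψ.integrable_mul hfr
    · exact hI.integral_prod_left
  have hne : (ae (volume.restrict (Ioi R))).NeBot := by
    rw [ae_neBot]
    intro h
    rw [Measure.restrict_eq_zero] at h
    exact (isOpen_Ioi.measure_pos volume nonempty_Ioi).ne' h
  obtain ⟨_, h3⟩ := h3
  obtain ⟨_, h4⟩ := h4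
  -- A single value of `r`, good for all three almost sure statements, is enough.
  obtain ⟨r, k1, k2, k3⟩ := ((key hφm' hv hvr h1).and ((key hφm hvt hvtr h2).and h3)).exists
  rw [k1, k2, k3.integral_deriv_mul (isLeft_Ioo hT) hφ hφc hφs]
  have : ∫ y in Ioc R r, ∫ t in Ioo 0 T, deriv φ t * vr (t, y) =
      ∫ y in Ioc R r, -∫ t in Ioo 0 T, φ t * vtr (t, y) := by
    refine integral_congr_ae (ae_restrict_of_ae_restrict_of_subset Ioc_subset_Ioi_self ?_)
    filter_upwards [h4] with y hy
    exact hy.integral_deriv_mul (isLeft_Ioo hT) hφ hφc hφs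
  rw [this, integral_neg]
  ring

/-- The traces at `r = R` of a family of class `H^{k+1}` on the strip are of class `H^k`. -/
lemma IsStripFamily.exists_trace {k : ℕ} {T R : ℝ} (hT : 0 < T) (hR : 0 < R)
    {u : ℝ × ℝ → State} {U : ℕ → ℕ → ℝ × ℝ → State} (h : IsStripFamily (k + 1) T R u U)
    (hu : ContinuousOn u (closedStrip T R)) :
    ∃ b : ℕ → ℝ → State, IsHFamily k T (fun t => u (t, R)) b ∧
      ∀ i ≤ k, ∀ e, LineR T R (fun p => U i 0 p e) (fun p => U i 1 p e) (fun t => b i t e) := by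
  have hex : ∀ i (e : Fin 2), ∃ c : ℝ → ℝ, i ≤ k →
      LineR T R (fun p => U i 0 p e) (fun p => U i 1 p e) c := by
    intro i e
    by_cases hi : i ≤ k
    · obtain ⟨c, hc⟩ := (h.fam hT hR e).dr i 0 (by omega)
      exact ⟨c, fun _ => hc⟩
    · exact ⟨0, fun h => absurd h hi⟩
  choose c hc using hex
  have hb : ∀ i e t, (![c i 0 t, c i 1 t] : Fin 2 → ℝ) e = c i e t := by
    intro i e t; fin_cases e <;> simp
  have hcm : ∀ i ≤ k, ∀ e, MemLp (c i e) 2 (volume.restrict (Ioo 0 T)) := fun i hi e =>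
    (hc i e hi).memLp hR (h.memLp_coord e (by omega)) (h.memLp_coord e (by omega))
  have hbm : ∀ i ≤ k, MemLp (fun t => (!₂[c i 0 t, c i 1 t] : State)) 2
      (volume.restrict (Ioo 0 T)) := by
    intro i hi
    rw [memLp_piLp_iff]
    intro e
    simpa only [hb] using hcm i hi e
  refine ⟨fun i t => !₂[c i 0 t, c i 1 t], ⟨?_, hbm, fun i hi => ?_⟩, fun i hi e => ?_⟩
  · have hrep : U 0 0 =ᵐ[stripVol T R] u := by
      have := h.repr; rwa [restrict_strip] at this
    have hcoord : ∀ e, ∀ᵐ t ∂(volume.restrict (Ioo 0 T)), c 0 e t = u (t, R) e := by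
      intro e
      have hl := (hc 0 e (by omega)).congr (v₁ := fun p => u p e) (w₁ := fun p => U 0 1 p e)
        (by filter_upwards [hrep] with p hp; rw [hp]) (ae_eq_refl _)
      filter_upwards [hl, ae_restrict_mem measurableSet_Ioo] with t a ht
      have hcu : ContinuousOn (fun r => u (t, r) e) (Icc R (R + 1)) :=
        (coordL e).continuous.comp_continuousOn (hu.comp (by fun_prop)
          fun x hx => ⟨Ioo_subset_Icc_self ht, hx.1⟩)
      have := a.congr_continuousOn Ioo_subset_Ioi_self (by linarith) (a.int _ (by simp)) hcu R
        ⟨le_rfl, by linarith⟩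
      simpa using this.symm
    filter_upwards [hcoord 0, hcoord 1] with t h0 h1
    ext e
    simp only [hb]
    fin_cases e
    · exact h0
    · exact h1
  · refine isWeakDeriv_of_coord (hbm i hi.le) (hbm (i + 1) hi) fun e φ hφ hφc hφs => ?_
    simp only [hb]
    exact LineR.integral_deriv_mul hR (h.memLp_coord e (by omega)) (h.memLp_coord e (by omega))
      (h.memLp_coord e (by omega)) (h.memLp_coord e (by omega)) hT (hc i e hi.le)
      (hc (i + 1) e hi) ((h.fam hT hR e).dt i 0 (by omega)) ((h.fam hT hR e).dt i 1 (by omega))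
      hφ hφc hφs
  · simpa only [hb] using hc i e hi

/-- Weak derivatives of a given order are determined almost everywhere. -/
lemma IsHFamily.ae_eq {k : ℕ} {T : ℝ} (hT : 0 < T) {v : ℝ → State} {b : ℕ → ℝ → State}
    {g : ℝ → ℝ} {G : ℕ → ℝ → ℝ} {e : Fin 2} (hb : IsHFamily k T v b) (hG : IsHFamily k T g G)
    (h : ∀ᵐ t ∂(volume.restrict (Ioo 0 T)), v t e = g t) :
    ∀ i ≤ k, ∀ᵐ t ∂(volume.restrict (Ioo 0 T)), b i t e = G i t := by
  intro i
  induction i with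
  | zero =>
    intro _
    filter_upwards [hb.repr, hG.repr, h] with t h1 h2 h3
    rw [h1, h2, h3]
  | succ i ih =>
    intro hi
    have hint : ∀ {f : ℝ → ℝ}, MemLp f 2 (volume.restrict (Ioo 0 T)) → IntegrableOn f (Ioo 0 T) :=
      fun hf => hf.integrable one_le_two
    have hli : ∀ {f : ℝ → ℝ}, MemLp f 2 (volume.restrict (Ioo 0 T)) →
      LocallyIntegrable ((Ioo 0 T).indicator f) := fun hf =>
        ((integrable_indicator_iff measurableSet_Ioo).2 (hint hf)).locallyIntegrable
    have b0 := MemLp.coord (hb.memLp i (by omega)) e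
    have b1 := MemLp.coord (hb.memLp (i + 1) hi) e
    obtain ⟨c1, p1⟩ := exists_prim (isLeft_Ioo hT) (hli b0) (hli b1) fun n p q hp hq =>
      (hb.deriv i hi).coord (hb.memLp i (by omega)) (hb.memLp (i + 1) hi) e (contDiff_testFn n p q)
        (hasCompactSupport_testFn n p q) ((isLeft_Ioo hT).tsupport_testFn_subset hp hq)
    obtain ⟨c2, p2⟩ := exists_prim (isLeft_Ioo hT) (hli (hG.memLp i (by omega)))
      (hli (hG.memLp (i + 1) hi)) fun n p q hp hq => by
        simpa using hG.deriv i hi _ (contDiff_testFn n p q)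
          (hasCompactSupport_testFn n p q) ((isLeft_Ioo hT).tsupport_testFn_subset hp hq)
    have h0 := (p1.add (p2.const_mul (-1)) (isLeft_Ioo hT)).deriv_eq_zero (isLeft_Ioo hT)
      (by filter_upwards [ih (by omega)] with t ht; rw [ht]; simp)
    filter_upwards [h0] with t ht
    simp only [Pi.zero_apply] at ht
    linarith

/-! ### Sobolev bounds -/

/-- The constant of the embedding of `H¹_r` in `L^∞`. -/
noncomputable def sobC (R : ℝ) : ℝ := 1 + 2 / √R

lemma one_le_sobC (R : ℝ) : 1 ≤ sobC R := by
  unfold sobC; have : 0 ≤ 2 / √R := by positivity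
  linarith

lemma sobC_sq {R : ℝ} (hR : 0 < R) : 4 / R ≤ sobC R ^ 2 := by
  have h : (2 / √R) ^ 2 = 4 / R := by rw [div_pow, Real.sq_sqrt hR.le]; norm_num
  have h0 : 0 ≤ 2 / √R := by positivity
  unfold sobC
  nlinarith

lemma integral_sq_eq_eLpNorm {X : Type*} [MeasurableSpace X] {μ : Measure X} {f : X → ℝ}
    (hf : MemLp f 2 μ) : ENNReal.ofReal (∫ x, f x ^ 2 ∂μ) = eLpNorm f 2 μ ^ 2 := by
  rw [eLpNorm_two_sq, ofReal_integral_eq_lintegral_ofReal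
    ((memLp_two_iff_integrable_sq hf.1).1 hf) (Eventually.of_forall fun x => sq_nonneg _)]
  refine lintegral_congr fun x => ?_
  rw [← ofReal_norm, ← ENNReal.ofReal_pow (norm_nonneg _), Real.norm_eq_abs, sq_abs]

lemma integral_sq_le_of_eLpNorm_le {X : Type*} [MeasurableSpace X] {μ : Measure X} {f : X → ℝ}
    (hf : AEStronglyMeasurable f μ) {M : ℝ} (hM : 0 ≤ M) (h : eLpNorm f 2 μ ≤ ENNReal.ofReal M) :
    ∫ x, f x ^ 2 ∂μ ≤ M ^ 2 := by
  have hf2 : MemLp f 2 μ := ⟨hf, h.trans_lt ENNReal.ofReal_lt_top⟩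
  have h1 := integral_sq_eq_eLpNorm hf2
  rw [← ENNReal.ofReal_le_ofReal_iff (by positivity), h1, ENNReal.ofReal_pow hM]
  gcongr

lemma eLpNorm_le_of_integral_sq_le {X : Type*} [MeasurableSpace X] {μ : Measure X} {f : X → ℝ}
    (hf : MemLp f 2 μ) {M : ℝ} (hM : 0 ≤ M) (h : ∫ x, f x ^ 2 ∂μ ≤ M ^ 2) :
    eLpNorm f 2 μ ≤ ENNReal.ofReal M := by
  rw [← ENNReal.pow_le_pow_left_iff two_ne_zero, ← integral_sq_eq_eLpNorm hf,
    ← ENNReal.ofReal_pow hM]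
  exact ENNReal.ofReal_le_ofReal h

/-- The Sobolev embedding, for a primitive on `(R, ∞)`. -/
lemma Prim.eLpNorm_top_le {R : ℝ} (hR : 0 < R) {f g : ℝ → ℝ} {c M : ℝ} (hM : 0 ≤ M)
    (h : Prim (Ioi R) R f g c) (hfm : AEStronglyMeasurable f (radialMeasure R))
    (hgm : AEStronglyMeasurable g (radialMeasure R))
    (hf : eLpNorm f 2 (radialMeasure R) ≤ ENNReal.ofReal M)
    (hg : eLpNorm g 2 (radialMeasure R) ≤ ENNReal.ofReal M) :
    eLpNorm f ⊤ (radialMeasure R) ≤ ENNReal.ofReal (sobC R * M) := by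
  have hf2 : MemLp f 2 (radialMeasure R) := ⟨hfm, hf.trans_lt ENNReal.ofReal_lt_top⟩
  have hg2 : MemLp g 2 (radialMeasure R) := ⟨hgm, hg.trans_lt ENNReal.ofReal_lt_top⟩
  have h1 := integral_sq_le_of_eLpNorm_le hfm hM hf
  have h2 := integral_sq_le_of_eLpNorm_le hgm hM hg
  rw [eLpNorm_exponent_top]
  refine eLpNormEssSup_le_of_ae_bound ?_
  rw [ae_radialMeasure hR]
  filter_upwards [h.eq, ae_restrict_mem measurableSet_Ioi] with r hr hrR
  have hfi := (memLp_two_iff_integrable_sq hfm).1 hf2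
  have hgi := (memLp_two_iff_integrable_sq hgm).1 hg2
  have h3 := h.sq_le hR hf2 hg2 (le_of_lt hrR)
  rw [← hr, ← radialMeasure_restrict (le_of_lt hrR)] at h3
  have h4 : ∫ x in Ioi r, (f x ^ 2 + g x ^ 2) ∂(radialMeasure R) ≤
      ∫ x, (f x ^ 2 + g x ^ 2) ∂(radialMeasure R) :=
    setIntegral_le_integral (hfi.add hgi) (Eventually.of_forall fun x => by positivity)
  rw [integral_add hfi hgi] at h4
  rw [Real.norm_eq_abs]
  refine abs_le_of_sq_le_sq ?_ (mul_nonneg (zero_le_one.trans (one_le_sobC R)) hM)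
  calc f r ^ 2 ≤ 2 / R * (M ^ 2 + M ^ 2) := h3.trans (by gcongr; linarith)
    _ = 4 / R * M ^ 2 := by ring
    _ ≤ _ := by rw [mul_pow]; gcongr; exact sobC_sq hR

/-! ### Pointwise bounds for functions of class `X^n`. -/

namespace IsXFamily

variable {n : ℕ} {T R : ℝ} {v : ℝ × ℝ → State} {V : ℕ → ℕ → ℝ → L2r R}

/-- The continuous representative of a function of class `X^n`, `n ≥ 1`, is a primitive. -/
lemma exists_prim (hR : 0 < R) (h : IsXFamily n T R v V) (hn : 1 ≤ n)
    (hv : ContinuousOn v (closedStrip T R)) {t : ℝ} (ht : t ∈ Icc 0 T) (e : Fin 2) :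
    ∃ c, Prim (Ioi R) R (fun r => V 0 0 t r e) (fun r => V 0 1 t r e) c ∧
      ∀ r, R ≤ r → v (t, r) e = c + ∫ y in R..r, V 0 1 t y e := by
  obtain ⟨c, hc⟩ := (h.dr 0 0 (by omega) t ht).exists_prim hR e
  refine ⟨c, hc, fun r hr => ?_⟩
  have hrep := (ac_radialMeasure hR).ae_eq (h.repr t ht)
  have hc' := hc.congr (isLeft_Ioi R) (f₁ := fun r => v (t, r) e)
    (by filter_upwards [hrep] with r hr; rw [hr]) (ae_eq_refl _)
  have hcu : ContinuousOn (fun r => v (t, r) e) (Icc R (r + 1)) :=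
    (coordL e).continuous.comp_continuousOn (hv.comp (by fun_prop) fun x hx => ⟨ht, hx.1⟩)
  exact hc'.congr_continuousOn Ioo_subset_Ioi_self (by linarith)
    (hc.int _ (show R < r + 1 by linarith)) hcu r ⟨hr, by linarith⟩

/-- The Sobolev embedding, with the norms over `(r, ∞)`. -/
lemma sq_le (hR : 0 < R) (h : IsXFamily n T R v V) (hn : 1 ≤ n)
    (hv : ContinuousOn v (closedStrip T R)) {t : ℝ} (ht : t ∈ Icc 0 T) (e : Fin 2) {r : ℝ}
    (hr : R ≤ r) : v (t, r) e ^ 2 ≤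
      2 / R * ∫ x, (V 0 0 t x e ^ 2 + V 0 1 t x e ^ 2) ∂(radialMeasure r) := by
  obtain ⟨c, hc, hc'⟩ := h.exists_prim hR hn hv ht e
  rw [hc' r hr]
  exact hc.sq_le hR (memLp_coord R _ e) (memLp_coord R _ e) hr

lemma _root_.FloatingSW.integral_coord_sq_le (f : L2r R) (e : Fin 2) :
    ∫ x, f x e ^ 2 ∂(radialMeasure R) ≤ ‖f‖ ^ 2 := by
  refine integral_sq_le_of_eLpNorm_le (memLp_coord R f e).1 (norm_nonneg f) ?_
  refine (eLpNorm_coord_le f 2 e).trans ?_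
  rw [Lp.norm_def, ENNReal.ofReal_toReal (Lp.eLpNorm_ne_top f)]

lemma abs_le (hR : 0 < R) (h : IsXFamily n T R v V) (hn : 1 ≤ n)
    (hv : ContinuousOn v (closedStrip T R)) {t : ℝ} (ht : t ∈ Icc 0 T) (e : Fin 2) {r : ℝ}
    (hr : R ≤ r) {M : ℝ} (h0 : ‖V 0 0 t‖ ≤ M) (h1 : ‖V 0 1 t‖ ≤ M) : |v (t, r) e| ≤ sobC R * M := by
  have hM : 0 ≤ M := (norm_nonneg _).trans h0
  have h3 := h.sq_le hR hn hv ht e hr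
  have hi : ∀ j, Integrable (fun x => V 0 j t x e ^ 2) (radialMeasure R) := fun j =>
    (memLp_two_iff_integrable_sq (memLp_coord R _ e).1).1 (memLp_coord R _ e)
  rw [← radialMeasure_restrict hr] at h3
  have h4 : ∫ x in Ioi r, (V 0 0 t x e ^ 2 + V 0 1 t x e ^ 2) ∂(radialMeasure R) ≤
      ∫ x, (V 0 0 t x e ^ 2 + V 0 1 t x e ^ 2) ∂(radialMeasure R) :=
    setIntegral_le_integral ((hi 0).add (hi 1)) (Eventually.of_forall fun x => by positivity)
  rw [integral_add (hi 0) (hi 1)] at h4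
  have h5 := integral_coord_sq_le (V 0 0 t) e
  have h6 := integral_coord_sq_le (V 0 1 t) e
  have h7 : ‖V 0 0 t‖ ^ 2 ≤ M ^ 2 := by gcongr
  have h8 : ‖V 0 1 t‖ ^ 2 ≤ M ^ 2 := by gcongr
  refine abs_le_of_sq_le_sq ?_ (mul_nonneg (zero_le_one.trans (one_le_sobC R)) hM)
  calc v (t, r) e ^ 2 ≤ 2 / R * (M ^ 2 + M ^ 2) := h3.trans (by gcongr; linarith)
    _ = 4 / R * M ^ 2 := by ring
    _ ≤ _ := by rw [mul_pow]; gcongr; exact sobC_sq hR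

/-- The mean value inequality. It bounds the coefficients at time `t` by their initial norm plus `K
t`, so that only initial norms survive in the final prefactor. -/
lemma norm_le_add (h : IsXFamily n T R v V) {i j : ℕ} (hij : i + j < n) {K : ℝ}
    (hK : ∀ t ∈ Icc 0 T, ‖V (i + 1) j t‖ ≤ K) {t : ℝ} (ht : t ∈ Icc 0 T) :
    ‖V i j t‖ ≤ ‖V i j 0‖ + K * t := by
  have h0 : (0 : ℝ) ∈ Icc 0 T := ⟨le_rfl, ht.1.trans ht.2⟩
  have := (convex_Icc 0 T).norm_image_sub_le_of_norm_hasDerivWithin_le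
    (fun x hx => h.dt i j hij x hx) hK h0 ht
  rw [sub_zero, Real.norm_of_nonneg ht.1] at this
  calc ‖V i j t‖ = ‖V i j 0 + (V i j t - V i j 0)‖ := by rw [add_sub_cancel]
    _ ≤ _ := (norm_add_le _ _).trans (by gcongr)

/-- The components of a function of class `X^n` as a family on the strip, with bounds at almost
every time; the first member is the continuous representative. -/
lemma exists_coef (hT : 0 < T) (hR : 0 < R) (h : IsXFamily n T R v V) (hn : 1 ≤ n)
    (hv : ContinuousOn v (closedStrip T R)) {K : ℝ} (hK0 : 0 ≤ K)
    (hK : ∀ i j, i + j ≤ n → ∀ t ∈ Icc 0 T, ‖V i j t‖ ≤ K) (e : Fin 2) :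
    ∃ W, Fam n T R W ∧ (W 0 0 = fun p => v p e) ∧ ∀ᵐ t ∂(volume.restrict (Ioo 0 T)),
      CoefAt (radialMeasure R) n (ENNReal.ofReal (sobC R * K)) (fun i j r => W i j (t, r)) := by
  obtain ⟨W, hW, hWV⟩ := h.exists_fam hT hR e
  have hvm : AEStronglyMeasurable (fun p => v p e) (stripVol T R) := by
    rw [← restrict_strip]
    refine ContinuousOn.aestronglyMeasurable ((coordL e).continuous.comp_continuousOn (hv.mono ?_))
      (measurableSet_Ioo.prod measurableSet_Ioi)
    exact prod_mono Ioo_subset_Icc_self Ioi_subset_Ici_self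
  have hWv : W 0 0 =ᵐ[stripVol T R] fun p => v p e := by
    have : ∀ᵐ p ∂(stripVol T R), W 0 0 p - v p e = 0 := by
      refine ae_prod_of_ae_ae ((hW.meas 0 0 (by omega)).sub hvm) ?_
      filter_upwards [ae_restrict_mem measurableSet_Ioo] with t ht
      have ht' := Ioo_subset_Icc_self ht
      have h1 := (hWV 0 0 (by omega)).2 t ht'
      have h2 := h.repr t ht'
      refine (ac_radialMeasure hR).ae_le ?_
      filter_upwards [h1, h2] with r a b
      rw [a, b]; simp
    filter_upwards [this] with p hp
    linarith
  -- Only the undifferentiated entry is exchanged for the continuous representative, so that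
  -- pointwise hypotheses and traces apply to it.
  set W' : ℕ → ℕ → ℝ × ℝ → ℝ := fun i j => if i = 0 ∧ j = 0 then fun p => v p e else W i j with hW'
  have hae : ∀ i j, W i j =ᵐ[stripVol T R] W' i j := by
    intro i j
    by_cases hz : i = 0 ∧ j = 0
    · simp only [hW', if_pos hz]; rw [hz.1, hz.2]; exact hWv
    · simp only [hW', if_neg hz]; exact ae_eq_refl _
  have hF : Fam n T R W' := by
    refine ⟨fun i j hij => (hW.meas i j hij).congr (hae i j), fun i j hij => ?_, fun i j hij => ?_⟩
    · obtain ⟨c, hc⟩ := hW.dt i j hij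
      exact ⟨c, hc.congr hT (hae i j) (hae (i + 1) j)⟩
    · obtain ⟨c, hc⟩ := hW.dr i j hij
      exact ⟨c, hc.congr (hae i j) (hae i (j + 1))⟩
  refine ⟨W', hF, by simp [hW'], ?_⟩
  have hslice : ∀ᵐ t ∂(volume.restrict (Ioo 0 T)), ∀ i j, i + j ≤ n →
      AEStronglyMeasurable (fun r => W' i j (t, r)) (radialMeasure R) ∧
      eLpNorm (fun r => W' i j (t, r)) 2 (radialMeasure R) ≤ ENNReal.ofReal K := by
    have : ∀ᵐ t ∂(volume.restrict (Ioo 0 T)), ∀ i j, ∀ᵐ r ∂(volume.restrict (Ioi R)),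
        W i j (t, r) = W' i j (t, r) := by
      simp only [ae_all_iff]
      exact fun i j => Measure.ae_ae_of_ae_prod (hae i j)
    filter_upwards [this, ae_restrict_mem measurableSet_Ioo] with t h1 ht i j hij
    have ht' := Ioo_subset_Icc_self ht
    have h2 := (hWV i j hij).2 t ht'
    have h3 := (radialMeasure_ac R).ae_le (h1 i j)
    have h4 : (fun r => V i j t r e) =ᵐ[radialMeasure R] fun r => W' i j (t, r) := by
      filter_upwards [h2, h3] with r a b
      rw [← b, a]
    refine ⟨(memLp_coord R (V i j t) e).1.congr h4, ?_⟩
    rw [← eLpNorm_congr_ae h4]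
    refine (eLpNorm_coord_le _ 2 e).trans ?_
    rw [← ENNReal.ofReal_toReal (Lp.eLpNorm_ne_top (V i j t)), ← Lp.norm_def]
    exact ENNReal.ofReal_le_ofReal (hK i j hij t ht')
  have hprim : ∀ᵐ t ∂(volume.restrict (Ioo 0 T)), ∀ i j, i + j < n →
      ∃ c, Prim (Ioi R) R (fun r => W' i j (t, r)) (fun r => W' i (j + 1) (t, r)) c := by
    simp only [ae_all_iff, eventually_imp_distrib_left]
    intro i j hij
    obtain ⟨c, hc⟩ := hF.dr i j hij
    filter_upwards [hc] with t ht using ⟨_, ht⟩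
  filter_upwards [hslice, hprim] with t h1 h2
  refine ⟨fun i j hij => (h1 i j hij).1, fun i j hij => ?_, fun i j _ hij => ?_⟩
  · obtain ⟨c, hc⟩ := h2 i j hij
    exact hc.eLpNorm_top_le hR hK0 (h1 i j hij.le).1 (h1 i (j + 1) (by omega)).1 (h1 i j hij.le).2
      (h1 i (j + 1) (by omega)).2
  · refine (h1 i j hij).2.trans (ENNReal.ofReal_le_ofReal ?_)
    exact le_mul_of_one_le_left hK0 (one_le_sobC R)

end IsXFamily

/-! ### The coefficients of the system and the differentiated equations -/

/-- The derivatives of a constant. -/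
def constArr {X : Type*} (k : ℝ) (i j : ℕ) (_ : X) : ℝ := if i = 0 ∧ j = 0 then k else 0

lemma fam_constArr (n : ℕ) (T R k : ℝ) : Fam n T R (constArr k) := by
  have h : ∀ i j, (constArr k i j : ℝ × ℝ → ℝ) = fun _ => if i = 0 ∧ j = 0 then k else 0 :=
    fun i j => rfl
  refine ⟨fun i j _ => ?_, fun i j _ => ?_, fun i j _ => ?_⟩
  · rw [h]; exact aestronglyMeasurable_const
  · rw [h, h, if_neg (show ¬ (i + 1 = 0 ∧ j = 0) by omega)]; exact ⟨_, LineT.const _⟩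
  · rw [h, h, if_neg (show ¬ (i = 0 ∧ j + 1 = 0) by omega)]; exact ⟨_, LineR.const _⟩

lemma coefAt_constArr (ν : Measure ℝ) (n : ℕ) (k : ℝ) : CoefAt ν n ‖k‖ₑ (constArr k) := by
  have h : ∀ i j, (constArr k i j : ℝ → ℝ) = fun _ => if i = 0 ∧ j = 0 then k else 0 :=
    fun i j => rfl
  refine ⟨fun i j _ => ?_, fun i j _ => ?_, fun i j h1 _ => ?_⟩
  · rw [h]; exact aestronglyMeasurable_const
  · rw [h, eLpNorm_exponent_top]
    refine (eLpNormEssSup_le_of_ae_bound (C := ‖k‖) (Eventually.of_forall fun x => ?_)).trans_eq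
      (ofReal_norm k)
    split_ifs <;> simp
  · rw [h, if_neg (by omega)]; simp

/-- The derivatives of `1 / r`. -/
noncomputable def rhoArr (i j : ℕ) (p : ℝ × ℝ) : ℝ :=
  if i = 0 then (-1) ^ j * j.factorial / p.2 ^ (j + 1) else 0

lemma continuousOn_rho {R : ℝ} (hR : 0 < R) (c : ℝ) (j : ℕ) (b : ℝ) :
    ContinuousOn (fun r : ℝ => c / r ^ j) (Icc R b) := by
  refine continuousOn_const.div (by fun_prop) fun r hr => ?_
  have : 0 < r := hR.trans_le hr.1
  positivity

lemma fam_rhoArr (n : ℕ) {R : ℝ} (T : ℝ) (hR : 0 < R) : Fam n T R rhoArr := by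
  refine ⟨fun i j _ => ?_, fun i j _ => ⟨fun r => rhoArr i j (0, r), ?_⟩, fun i j _ => ?_⟩
  · refine Measurable.aestronglyMeasurable ?_
    unfold rhoArr
    by_cases hi : i = 0
    · simp only [hi, if_true]; fun_prop
    · simp only [hi, if_false]; fun_prop
  · refine Eventually.of_forall fun r => ?_
    simpa [rhoArr] using Prim.const (s := Ioo 0 T) (a := 0) (rhoArr i j (0, r))
  · by_cases hi : i = 0
    · refine ⟨fun _ => (-1) ^ j * j.factorial / R ^ (j + 1), Eventually.of_forall fun t => ?_⟩
      simp only [rhoArr, hi, if_true]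
      have hcont : ∀ b, ContinuousOn (fun r : ℝ => (-1 : ℝ) ^ (j + 1) * (j + 1).factorial / r ^ (j + 1 + 1)) (Icc R b) :=
        fun b => continuousOn_rho hR _ _ b
      have hint : ∀ b, R ≤ b → IntervalIntegrable
          (fun r : ℝ => (-1 : ℝ) ^ (j + 1) * (j + 1).factorial / r ^ (j + 1 + 1)) volume R b := fun b hb => by
        refine ContinuousOn.intervalIntegrable ?_
        rw [uIcc_of_le hb]; exact hcont b
      refine ⟨fun b hb => hint b (le_of_lt hb), ?_⟩
      filter_upwards [ae_restrict_mem measurableSet_Ioi] with b hb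
      have hb' : R ≤ b := le_of_lt hb
      rw [intervalIntegral.integral_eq_sub_of_hasDerivAt (f := fun r : ℝ => (-1 : ℝ) ^ j * j.factorial / r ^ (j + 1))
        (fun x hx => ?_) (hint b hb')]
      · ring
      · rw [uIcc_of_le hb'] at hx
        have hx0 : 0 < x := hR.trans_le hx.1
        have h1 := ((hasDerivAt_pow (j + 1) x).inv (by positivity)).const_mul ((-1 : ℝ) ^ j * j.factorial)
        convert! h1 using 1
        · simp only [add_tsub_cancel_right, Nat.factorial_succ]
          push_cast
          field_simp
          ring
    · refine ⟨fun _ => 0, Eventually.of_forall fun t => ?_⟩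
      simp only [rhoArr, hi, if_false]
      exact Prim.const 0

lemma exists_rho_bound (n : ℕ) {R : ℝ} (hR : 0 < R) : ∃ L : ℝ≥0∞, L ≠ ⊤ ∧ ∀ t : ℝ, ∀ i j, i + j ≤ n →
    AEStronglyMeasurable (fun r => rhoArr i j (t, r)) (radialMeasure R) ∧
    eLpNorm (fun r => rhoArr i j (t, r)) ⊤ (radialMeasure R) ≤ L := by
  refine ⟨∑ j ∈ Finset.range (n + 1), ENNReal.ofReal (j.factorial / R ^ (j + 1)),
    (ENNReal.sum_lt_top.2 fun _ _ => ENNReal.ofReal_lt_top).ne, fun t i j hij => ⟨?_, ?_⟩⟩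
  · refine Measurable.aestronglyMeasurable ?_
    unfold rhoArr
    by_cases hi : i = 0
    · simp only [hi, if_true]; fun_prop
    · simp only [hi, if_false]; fun_prop
  · refine le_trans ?_ (Finset.single_le_sum
      (f := fun j => ENNReal.ofReal ((j.factorial : ℝ) / R ^ (j + 1))) (fun _ _ => zero_le)
      (Finset.mem_range.2 (show j < n + 1 by omega)))
    rw [eLpNorm_exponent_top]
    refine eLpNormEssSup_le_of_ae_bound ?_
    rw [ae_radialMeasure hR]
    filter_upwards [ae_restrict_mem measurableSet_Ioi] with r hr
    have hr' : R < r := hr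
    have hr0 : 0 < r := hR.trans hr'
    unfold rhoArr
    split_ifs
    · rw [norm_div, norm_mul, norm_pow, norm_neg, norm_one, one_pow, one_mul, norm_pow,
        Real.norm_of_nonneg (by positivity), Real.norm_of_nonneg hr0.le]
      gcongr
    · simp only [norm_zero]; positivity

/-! ### The polynomial coefficients of the equations, of the energy and of its flux. -/

section Arrays

variable {X : Type*} (grav ε : ℝ) (H Q : ℕ → ℕ → X → ℝ)

/-- `h²` and its derivatives. -/
def arr0 (i j : ℕ) (p : X) : ℝ := Leib H H i j p

/-- `g h³ - q²` and its derivatives. -/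
def arr1 (i j : ℕ) (p : X) : ℝ := grav * Leib H (arr0 H) i j p + (-1) * Leib Q Q i j p

/-- `2 q h` and its derivatives. -/
def arr2 (i j : ℕ) (p : X) : ℝ := 2 * Leib Q H i j p

/-- The coefficients of the energy. -/
def ene11 (i j : ℕ) (p : X) : ℝ := Leib (arr0 H) (arr1 grav H Q) i j p

/-- The coefficients of the energy. -/
def ene12 (i j : ℕ) (p : X) : ℝ := -ε * Leib (arr0 H) (arr1 grav H Q) i j p

/-- The coefficients of the energy. -/
def ene22 (i j : ℕ) (p : X) : ℝ := Leib (arr0 H) (arr0 H) i j p + -ε * Leib (arr0 H) (arr2 H Q) i j p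

/-- The coefficients of the energy flux. -/
def flx11 (i j : ℕ) (p : X) : ℝ := -ε * Leib (arr1 grav H Q) (arr1 grav H Q) i j p

/-- The coefficients of the energy flux. -/
def flx12 (i j : ℕ) (p : X) : ℝ :=
  Leib (arr0 H) (arr1 grav H Q) i j p + -ε * Leib (arr1 grav H Q) (arr2 H Q) i j p

/-- The coefficients of the energy flux. -/
def flx22 (i j : ℕ) (p : X) : ℝ :=
  Leib (arr0 H) (arr2 H Q) i j p +
    -ε * (Leib (arr1 grav H Q) (arr0 H) i j p + Leib (arr2 H Q) (arr2 H Q) i j p)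

end Arrays

section FamArrays

variable {n : ℕ} {T R : ℝ} {H Q : ℕ → ℕ → ℝ × ℝ → ℝ} (grav ε : ℝ)

lemma Fam.arr0 (hT : 0 < T) (hH : Fam n T R H) : Fam n T R (arr0 H) := hH.leib hT hH

lemma Fam.arr1 (hT : 0 < T) (hH : Fam n T R H) (hQ : Fam n T R Q) : Fam n T R (arr1 grav H Q) :=
  ((hH.leib hT (hH.arr0 hT)).const_mul grav).add hT ((hQ.leib hT hQ).const_mul (-1))

lemma Fam.arr2 (hT : 0 < T) (hH : Fam n T R H) (hQ : Fam n T R Q) : Fam n T R (arr2 H Q) :=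
  (hQ.leib hT hH).const_mul 2

lemma Fam.energy (hT : 0 < T) (hH : Fam n T R H) (hQ : Fam n T R Q) :
    Fam n T R (ene11 grav H Q) ∧ Fam n T R (ene12 grav ε H Q) ∧ Fam n T R (ene22 ε H Q) ∧
    Fam n T R (flx11 grav ε H Q) ∧ Fam n T R (flx12 grav ε H Q) ∧ Fam n T R (flx22 grav ε H Q) := by
  have h0 := hH.arr0 hT
  have h1 := hH.arr1 grav hT hQ
  have h2 := hH.arr2 hT hQ
  exact ⟨h0.leib hT h1, (h0.leib hT h1).const_mul _,
    (h0.leib hT h0).add hT ((h0.leib hT h2).const_mul _), (h1.leib hT h1).const_mul _,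
    (h0.leib hT h1).add hT ((h1.leib hT h2).const_mul _),
    (h0.leib hT h2).add hT (((h1.leib hT h0).add hT (h2.leib hT h2)).const_mul _)⟩

/-- Bounds for all the coefficients, in terms of bounds for `h` and `q`. -/
lemma exists_coef_bound (hn : 1 ≤ n) {K : ℝ≥0∞} (hK : K ≠ ⊤) : ∃ L : ℝ≥0∞, L ≠ ⊤ ∧
    ∀ (ν : Measure ℝ) (H Q : ℕ → ℕ → ℝ → ℝ) (ε : ℝ), |ε| ≤ 1 → CoefAt ν n K H → CoefAt ν n K Q →
      (CoefAt ν n L (arr0 H) ∧ CoefAt ν n L (arr1 grav H Q) ∧ CoefAt ν n L (arr2 H Q) ∧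
        CoefAt ν n L (Leib Q H)) ∧
      (CoefAt ν n L (ene11 grav H Q) ∧ CoefAt ν n L (ene12 grav ε H Q) ∧
        CoefAt ν n L (ene22 ε H Q)) ∧
      CoefAt ν n L (flx11 grav ε H Q) ∧ CoefAt ν n L (flx12 grav ε H Q) ∧
        CoefAt ν n L (flx22 grav ε H Q) := by
  set a0 : ℝ≥0∞ := 2 ^ n * (K * K)
  set a1 : ℝ≥0∞ := ‖grav‖ₑ * (2 ^ n * (K * a0)) + ‖(-1 : ℝ)‖ₑ * (2 ^ n * (K * K))
  set a2 : ℝ≥0∞ := ‖(2 : ℝ)‖ₑ * (2 ^ n * (K * K))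
  have e0 : a0 ≠ ⊤ := by finiteness
  have e1 : a1 ≠ ⊤ := by finiteness
  have e2 : a2 ≠ ⊤ := by finiteness
  set b : ℝ≥0∞ := a0 + a1 + a2
  have eb : b ≠ ⊤ := by finiteness
  have l0 : a0 ≤ b := le_self_add.trans le_self_add
  have l1 : a1 ≤ b := le_add_self.trans le_self_add
  have l2 : a2 ≤ b := le_add_self
  set d : ℝ≥0∞ := 2 ^ n * (b * b)
  have ed : d ≠ ⊤ := by finiteness
  refine ⟨b + (d + (d + d)), by finiteness, fun ν H Q ε hε hH hQ => ?_⟩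
  have c0 : CoefAt ν n a0 (arr0 H) := hH.leib hn hH
  have c1 : CoefAt ν n a1 (arr1 grav H Q) :=
    ((hH.leib hn c0).const_mul grav).add ((hQ.leib hn hQ).const_mul (-1))
  have c2 : CoefAt ν n a2 (arr2 H Q) := (hQ.leib hn hH).const_mul 2
  have cb : CoefAt ν n a0 (Leib Q H) := hQ.leib hn hH
  -- Since `|ε| ≤ 1`, factors `-ε` cost nothing and the bound `L` is independent of `ε`, which will
  -- later depend on `Λ`.
  have hε' : ∀ x : ℝ≥0∞, ‖-ε‖ₑ * x ≤ x := fun x => by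
    refine mul_le_of_le_one_left' ?_
    rw [← ofReal_norm, norm_neg, Real.norm_eq_abs]
    simpa using hε
  have t : ∀ {A B : ℕ → ℕ → ℝ → ℝ}, CoefAt ν n b A → CoefAt ν n b B → CoefAt ν n d (Leib A B) :=
    fun hA hB => hA.leib hn hB
  have te : ∀ {A : ℕ → ℕ → ℝ → ℝ} {x : ℝ≥0∞}, CoefAt ν n x A →
      CoefAt ν n x (fun i j r => -ε * A i j r) := fun hA => (hA.const_mul _).mono (hε' _)
  have d0 := c0.mono l0
  have d1 := c1.mono l1
  have d2 := c2.mono l2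
  have m1 : d ≤ b + (d + (d + d)) := le_self_add.trans le_add_self
  have m2 : d + d ≤ b + (d + (d + d)) := le_add_self.trans le_add_self
  have m3 : d + (d + d) ≤ b + (d + (d + d)) := le_add_self
  exact ⟨⟨d0.mono le_self_add, d1.mono le_self_add, d2.mono le_self_add,
      (cb.mono l0).mono le_self_add⟩,
    ⟨(t d0 d1).mono m1, (te (t d0 d1)).mono m1, ((t d0 d0).add (te (t d0 d2))).mono m2⟩,
    (te (t d1 d1)).mono m1, ((t d0 d1).add (te (t d1 d2))).mono m2,
    ((t d0 d2).add (te ((t d1 d0).add (t d2 d2)))).mono m3⟩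

end FamArrays

/-! ### The differentiated equations. -/

section Equations

variable {k : ℕ} {T R : ℝ} {z q f : ℕ → ℕ → ℝ × ℝ → ℝ}

/-- The differentiated equation of mass conservation. -/
lemma mass_eq (hT : 0 < T) (hR : 0 < R) (hz : Fam (k + 1) T R z) (hq : Fam (k + 1) T R q)
    (hf : Fam k T R f)
    (h : ∀ᵐ p ∂(stripVol T R), z 1 0 p + q 0 1 p + p.2⁻¹ * q 0 0 p = f 0 0 p) :
    ∀ i j, i + j ≤ k → ∀ᵐ p ∂(stripVol T R),
      z (i + 1) j p + q i (j + 1) p = f i j p - Leib rhoArr q i j p := by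
  -- The difference of the two sides as an array of derivatives; its first entry vanishes, hence by
  -- `Fam.zero` all of them do.
  have hfam := ((hz.shiftT.add hT hq.shiftR).add hT
    ((fam_rhoArr k T hR).leib hT (hq.mono (Nat.le_succ k)))).add hT (hf.const_mul (-1))
  intro i j hij
  filter_upwards [hfam.zero hT (by
    filter_upwards [h] with p hp
    simp only [leib_zero, rhoArr]
    simp only [if_true, pow_zero, Nat.factorial_zero, Nat.cast_one, zero_add, pow_one, one_mul,
      one_div]
    linarith) i j hij] with p hp
  linarith

variable {H Q : ℕ → ℕ → ℝ × ℝ → ℝ} (grav : ℝ)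

/-- The lower order terms of the differentiated momentum equation. -/
noncomputable def momRhs {X : Type*} (H Q ρ z q f : ℕ → ℕ → X → ℝ) (i j : ℕ) (p : X) : ℝ :=
  Leib (arr0 H) f i j p - Leib (dropZero (arr0 H)) (fun i j => q (i + 1) j) i j p
    - Leib (dropZero (arr1 grav H Q)) (fun i j => z i (j + 1)) i j p
    - Leib (dropZero (arr2 H Q)) (fun i j => q i (j + 1)) i j p
    - Leib (Leib Q H) (Leib ρ q) i j p

/-- The differentiated momentum equation. -/
lemma momentum_eq (hT : 0 < T) (hR : 0 < R) (hH : Fam k T R H) (hQ : Fam k T R Q)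
    (hz : Fam (k + 1) T R z) (hq : Fam (k + 1) T R q) (hf : Fam k T R f)
    (h : ∀ᵐ p ∂(stripVol T R), arr0 H 0 0 p * q 1 0 p + arr1 grav H Q 0 0 p * z 0 1 p
      + arr2 H Q 0 0 p * q 0 1 p + Q 0 0 p * H 0 0 p * (p.2⁻¹ * q 0 0 p)
      = arr0 H 0 0 p * f 0 0 p) :
    ∀ i j, i + j ≤ k → ∀ᵐ p ∂(stripVol T R),
      arr0 H 0 0 p * q (i + 1) j p + arr1 grav H Q 0 0 p * z i (j + 1) p
        + arr2 H Q 0 0 p * q i (j + 1) p = momRhs grav H Q rhoArr z q f i j p := by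
  have h0 := hH.arr0 hT
  have hfam := ((((h0.leib hT hq.shiftT).add hT ((hH.arr1 grav hT hQ).leib hT hz.shiftR)).add hT
    ((hH.arr2 hT hQ).leib hT hq.shiftR)).add hT ((hQ.leib hT hH).leib hT
      ((fam_rhoArr k T hR).leib hT (hq.mono (Nat.le_succ k))))).add hT
        ((h0.leib hT hf).const_mul (-1))
  intro i j hij
  filter_upwards [hfam.zero hT (by
    filter_upwards [h] with p hp
    simp only [leib_zero]
    have e : rhoArr 0 0 p = p.2⁻¹ := by simp [rhoArr]
    rw [e]
    linarith) i j hij] with p hp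
  -- The three top order products keep their principal terms on the left; the commutators go to
  -- `momRhs`.
  rw [leib_split (arr0 H) (fun i j => q (i + 1) j), leib_split (arr1 grav H Q),
    leib_split (arr2 H Q)] at hp
  unfold momRhs
  linarith

end Equations

/-! ### Bounds of the right-hand sides of the differentiated equations at a fixed time. -/

/-- Bounds at a fixed time for the derivatives of order `≤ k` of the solution or of the data. -/
structure SolAt (ν : Measure ℝ) (k : ℕ) (M : ℝ≥0∞) (w : ℕ → ℕ → ℝ → ℝ) : Prop where
  meas : ∀ i j, i + j ≤ k → AEStronglyMeasurable (w i j) ν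
  two : ∀ i j, i + j ≤ k → eLpNorm (w i j) 2 ν ≤ M
  top : ∀ i j, i + j < k → eLpNorm (w i j) ⊤ ν ≤ M

/-- All derivatives of `ρ` are bounded, so each product keeps the exponent of its factor from `w`;
both kinds of bound are inherited. -/
lemma SolAt.leib_left {ν : Measure ℝ} {k : ℕ} {L M : ℝ≥0∞} {ρ w : ℕ → ℕ → ℝ → ℝ}
    (hw : SolAt ν k M w) (hm : ∀ i j, i + j ≤ k → AEStronglyMeasurable (ρ i j) ν)
    (ht : ∀ i j, i + j ≤ k → eLpNorm (ρ i j) ⊤ ν ≤ L) : SolAt ν k (2 ^ k * (L * M)) (Leib ρ w) := by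
  have key : ∀ i j, i + j ≤ k → ∀ p : ℝ≥0∞, 1 ≤ p →
      (∀ a b, a + b ≤ i + j → eLpNorm (w a b) p ν ≤ M) →
      eLpNorm (Leib ρ w i j) p ν ≤ 2 ^ k * (L * M) := by
    intro i j hij p hp h
    refine (eLpNorm_leib_le hp (fun x y _ _ => hm _ _ (by omega))
      (fun x y _ _ => hw.meas _ _ (by omega)) (M := L * M) fun x hx y hy => ?_).trans ?_
    · have e1 := Finset.HasAntidiagonal.mem_antidiagonal.1 hx
      have e2 := Finset.HasAntidiagonal.mem_antidiagonal.1 hy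
      exact (eLpNorm_mul_top_left _ (hw.meas _ _ (by omega))).trans
        (mul_le_mul' (ht _ _ (by omega)) (h _ _ (by omega)))
    · gcongr
      exact one_le_two
  refine ⟨fun i j hij => ?_, fun i j hij => key i j hij 2 one_le_two fun a b hab =>
    hw.two a b (by omega), fun i j hij => key i j hij.le ⊤ le_top fun a b hab => hw.top a b (by omega)⟩
  unfold Leib
  refine Finset.aestronglyMeasurable_fun_sum _ fun x hx =>
    Finset.aestronglyMeasurable_fun_sum _ fun y hy => ?_
  have e1 := Finset.HasAntidiagonal.mem_antidiagonal.1 hx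
  have e2 := Finset.HasAntidiagonal.mem_antidiagonal.1 hy
  exact ((hm _ _ (by omega)).mul (hw.meas _ _ (by omega))).const_mul _

lemma CoefAt.eLpNorm_leib_le {ν : Measure ℝ} {s k : ℕ} {K M : ℝ≥0∞} {A w : ℕ → ℕ → ℝ → ℝ}
    (hA : CoefAt ν s K A) (hs : 1 ≤ s) (hks : k ≤ s) (hw : SolAt ν k M w) {i j : ℕ}
    (hij : i + j ≤ k) : eLpNorm (Leib A w i j) 2 ν ≤ K * M + 2 ^ k * (K * M) ∧
      AEStronglyMeasurable (Leib A w i j) ν := by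
  have h1 := hA.eLpNorm_leib_dropZero_le hks hw.meas (fun i j h => hw.two i j h.le)
    (fun _ => hw.top 0 0 (by omega)) hij
  have hm : AEStronglyMeasurable (Leib A w i j) ν := by
    unfold Leib
    refine Finset.aestronglyMeasurable_fun_sum _ fun x hx =>
      Finset.aestronglyMeasurable_fun_sum _ fun y hy => ?_
    have e1 := Finset.HasAntidiagonal.mem_antidiagonal.1 hx
    have e2 := Finset.HasAntidiagonal.mem_antidiagonal.1 hy
    exact ((hA.meas _ _ (by omega)).mul (hw.meas _ _ (by omega))).const_mul _
  have hm0 : AEStronglyMeasurable (fun p => A 0 0 p * w i j p) ν :=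
    (hA.meas 0 0 (by omega)).mul (hw.meas i j hij)
  have e : Leib A w i j = (fun p => A 0 0 p * w i j p) + Leib (dropZero A) w i j :=
    funext fun p => leib_split A w i j p
  have hm1 : AEStronglyMeasurable (Leib (dropZero A) w i j) ν := by
    have : Leib (dropZero A) w i j = Leib A w i j - (fun p => A 0 0 p * w i j p) := by
      rw [e]; simp
    rw [this]; exact hm.sub hm0
  refine ⟨?_, hm⟩
  rw [e]
  refine (eLpNorm_add_le hm0 hm1 one_le_two).trans (add_le_add ?_ h1)
  exact (eLpNorm_mul_top_left _ (hw.meas i j hij)).trans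
    (mul_le_mul' (hA.top 0 0 (by omega)) (hw.two i j hij))

/-- In a commutator at least one derivative falls on the coefficient, so only derivatives of order
at most `k` of the solution remain. When `s ≤ k`, a coefficient may receive all `k` derivatives and
is then only in `L²`; first derivatives of the solution must be bounded, which needs `k ≥ 2`. This
is the role of `hsk`. -/
lemma exists_rhs_bound (grav : ℝ) {k s : ℕ} (hs : 2 ≤ s) (hks : k ≤ s) (hsk : s ≤ k → 2 ≤ k)
    {K L : ℝ≥0∞} (hK : K ≠ ⊤) (hL : L ≠ ⊤) :
    ∃ C : ℝ≥0∞, C ≠ ⊤ ∧ ∀ (ν : Measure ℝ) (H Q ρ z q f₁ f₂ : ℕ → ℕ → ℝ → ℝ) (M : ℝ≥0∞),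
      CoefAt ν s K H → CoefAt ν s K Q →
      (∀ i j, i + j ≤ k → AEStronglyMeasurable (ρ i j) ν) →
      (∀ i j, i + j ≤ k → eLpNorm (ρ i j) ⊤ ν ≤ L) → SolAt ν k M z → SolAt ν k M q →
      (∀ i j, i + j ≤ k + 1 → AEStronglyMeasurable (z i j) ν) →
      (∀ i j, i + j ≤ k + 1 → AEStronglyMeasurable (q i j) ν) →
      SolAt ν k M f₁ → SolAt ν k M f₂ → ∀ i j, i + j ≤ k →
      eLpNorm (fun r => f₁ i j r - Leib ρ q i j r) 2 ν ≤ C * M ∧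
      eLpNorm (momRhs grav H Q ρ z q f₂ i j) 2 ν ≤ C * M := by
  obtain ⟨B, hB, hBb⟩ := exists_coef_bound (n := s) grav (by omega) hK
  set m : ℝ≥0∞ := 2 ^ k * L
  set a : ℝ≥0∞ := B + 2 ^ k * B
  have ha : a ≠ ⊤ := by finiteness
  have hm : m ≠ ⊤ := by finiteness
  refine ⟨(1 + m) + (a + 2 ^ k * B + 2 ^ k * B + 2 ^ k * B + a * m), by finiteness,
    fun ν H Q ρ z q f₁ f₂ M hH hQ hρm hρ hz hq hzm hqm hf₁ hf₂ i j hij => ?_⟩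
  obtain ⟨⟨c0, c1, c2, cb⟩, -⟩ := hBb ν H Q 0 (by simp) hH hQ
  have hρq := hq.leib_left hρm hρ
  constructor
  · refine (eLpNorm_sub_le (hf₁.meas i j hij) (hρq.meas i j hij) one_le_two).trans ?_
    calc _ ≤ M + 2 ^ k * (L * M) := add_le_add (hf₁.two i j hij) (hρq.two i j hij)
      _ = (1 + m) * M := by ring
      _ ≤ _ := mul_le_mul' le_self_add le_rfl
  · have t1 := c0.eLpNorm_leib_le (by omega) hks hf₂ hij
    have t5 := cb.eLpNorm_leib_le (by omega) hks hρq hij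
    have key : ∀ {A w : ℕ → ℕ → ℝ → ℝ}, CoefAt ν s B A →
        (∀ i j, i + j ≤ k → AEStronglyMeasurable (w i j) ν) →
        (∀ i j, i + j < k → eLpNorm (w i j) 2 ν ≤ M) → (s ≤ k → eLpNorm (w 0 0) ⊤ ν ≤ M) →
        eLpNorm (Leib (dropZero A) w i j) 2 ν ≤ 2 ^ k * (B * M) ∧
        AEStronglyMeasurable (Leib (dropZero A) w i j) ν := by
      intro A w hA hwm hw2 hwt
      refine ⟨hA.eLpNorm_leib_dropZero_le hks hwm hw2 hwt hij, ?_⟩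
      unfold Leib
      refine Finset.aestronglyMeasurable_fun_sum _ fun x hx =>
        Finset.aestronglyMeasurable_fun_sum _ fun y hy => ?_
      have e1 := Finset.HasAntidiagonal.mem_antidiagonal.1 hx
      have e2 := Finset.HasAntidiagonal.mem_antidiagonal.1 hy
      refine (AEStronglyMeasurable.mul ?_ (hwm _ _ (by omega))).const_mul _
      by_cases hz : x.1 = 0 ∧ y.1 = 0
      · have : dropZero A x.1 y.1 = fun _ => 0 := by funext p; simp [dropZero, hz]
        rw [this]; exact aestronglyMeasurable_const
      · have : dropZero A x.1 y.1 = A x.1 y.1 := by funext p; simp [dropZero, hz]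
        rw [this]; exact hA.meas _ _ (by omega)
    have t2 := key c0 (w := fun i j => q (i + 1) j) (fun i j h => hqm _ _ (by omega))
      (fun i j h => hq.two _ _ (by omega)) fun h => hq.top _ _ (by have := hsk h; omega)
    have t3 := key c1 (w := fun i j => z i (j + 1)) (fun i j h => hzm _ _ (by omega))
      (fun i j h => hz.two _ _ (by omega)) fun h => hz.top _ _ (by have := hsk h; omega)
    have t4 := key c2 (w := fun i j => q i (j + 1)) (fun i j h => hqm _ _ (by omega))
      (fun i j h => hq.two _ _ (by omega)) fun h => hq.top _ _ (by have := hsk h; omega)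
    have hm2 := t1.2.sub t2.2
    have hm3 := hm2.sub t3.2
    have hm4 := hm3.sub t4.2
    have s1 := eLpNorm_sub_le t1.2 t2.2 one_le_two
    have s2 := eLpNorm_sub_le hm2 t3.2 one_le_two
    have s3 := eLpNorm_sub_le hm3 t4.2 one_le_two
    have s4 := eLpNorm_sub_le hm4 t5.2 one_le_two
    have e : momRhs grav H Q ρ z q f₂ i j = Leib (arr0 H) f₂ i j
      - Leib (dropZero (arr0 H)) (fun i j => q (i + 1) j) i j
      - Leib (dropZero (arr1 grav H Q)) (fun i j => z i (j + 1)) i j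
      - Leib (dropZero (arr2 H Q)) (fun i j => q i (j + 1)) i j
      - Leib (Leib Q H) (Leib ρ q) i j := rfl
    rw [e]
    calc _ ≤ (B * M + 2 ^ k * (B * M)) + 2 ^ k * (B * M) + 2 ^ k * (B * M) + 2 ^ k * (B * M)
          + (B * (2 ^ k * (L * M)) + 2 ^ k * (B * (2 ^ k * (L * M)))) :=
          s4.trans (add_le_add (s3.trans (add_le_add (s2.trans (add_le_add (s1.trans
            (add_le_add t1.1 t2.1)) t3.1)) t4.1)) t5.1)
      _ = (a + 2 ^ k * B + 2 ^ k * B + 2 ^ k * B + a * m) * M := by ring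
      _ ≤ _ := mul_le_mul' le_add_self le_rfl

/-! ### The energy identity -/

lemma stripMeasure_ac (T R : ℝ) : stripMeasure T R ≪ stripVol T R := by
  unfold stripMeasure
  rw [restrict_strip]
  exact withDensity_absolutelyContinuous _ _

lemma integrable_strip_iff {R : ℝ} (hR : 0 < R) (T : ℝ) (f : ℝ × ℝ → ℝ) :
    Integrable f (stripMeasure T R) ↔ Integrable (fun p => p.2 * f p) (stripVol T R) := by
  unfold stripMeasure
  rw [← restrict_strip,
    integrable_withDensity_iff_integrable_smul' (by fun_prop) (by simp)]
  refine integrableOn_congr_fun (fun x hx => ?_) (measurableSet_Ioo.prod measurableSet_Ioi)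
  have : 0 < x.2 := hR.trans hx.2
  simp [ENNReal.toReal_ofReal this.le]

/-- Exchanges "almost every line, almost every time" for "almost every time, almost every line"; the
measurable representative of `et` makes the defect jointly measurable. -/
lemma LineT.ae_eq {T R : ℝ} (hT : 0 < T) {e et : ℝ × ℝ → ℝ} {e0 : ℝ → ℝ} (h : LineT T R e et e0)
    (hem : AEStronglyMeasurable e (stripVol T R)) (hetm : AEStronglyMeasurable et (stripVol T R))
    (he0 : AEStronglyMeasurable e0 (volume.restrict (Ioi R))) :
    ∀ᵐ t ∂(volume.restrict (Ioo 0 T)), ∀ᵐ r ∂(volume.restrict (Ioi R)),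
      e (t, r) = e0 r + ∫ τ in 0..t, et (τ, r) := by
  have h1 : ∀ᵐ p ∂(stripVol T R), e p - (e0 p.2 + ∫ τ in 0..p.1, hetm.mk et (τ, p.2)) = 0 := by
    refine ae_prod_of_ae_ae_swap ?_ ?_
    · exact hem.sub (he0.comp_snd.add (stronglyMeasurable_primitive 0
        hetm.stronglyMeasurable_mk).aestronglyMeasurable)
    · filter_upwards [h.congr hT (ae_eq_refl _) hetm.ae_eq_mk] with r hr
      filter_upwards [hr.eq] with t ht
      rw [ht]; ring
  have h2 := ae_ae_swap_of_ae_prod hetm.ae_eq_mk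
  filter_upwards [Measure.ae_ae_of_ae_prod h1, ae_restrict_mem measurableSet_Ioo] with t a ht
  filter_upwards [a, h2] with r b c
  have : ∫ τ in 0..t, et (τ, r) = ∫ τ in 0..t, hetm.mk et (τ, r) :=
    intervalIntegral.integral_congr_ae (Prim.ae_interval (isLeft_Ioo hT) c ht)
  rw [this]
  linarith

/-- With `g` integrable the primitive has a limit at infinity, and with `f` integrable this limit is
`0`: there is no boundary term at infinity. -/
lemma Prim.integral_Ioi {R : ℝ} {f g : ℝ → ℝ} {c : ℝ} (h : Prim (Ioi R) R f g c)
    (hf : IntegrableOn f (Ioi R)) (hg : IntegrableOn g (Ioi R)) : ∫ r in Ioi R, g r = -c := by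
  have h1 : Tendsto (fun r => c + ∫ y in R..r, g y) atTop (𝓝 (c + ∫ r in Ioi R, g r)) :=
    (intervalIntegral_tendsto_integral_Ioi R hg tendsto_id).const_add c
  have h2 : IntegrableOn (fun r => c + ∫ y in R..r, g y) (Ioi R) := hf.congr h.eq
  have h3 : IntegrableAtFilter (fun r => c + ∫ y in R..r, g y) atTop volume :=
    ⟨Ioi R, Ioi_mem_atTop R, h2⟩
  have := h3.eq_zero_of_tendsto (fun s hs => by
    obtain ⟨b, hb⟩ := mem_atTop_sets.1 hs
    rw [← top_le_iff, ← Real.volume_Ici (a := b)]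
    exact measure_mono fun x hx => hb x hx) h1
  linarith

/-- The integrated form of a conservation law with a source. -/
lemma integral_conservation {T R : ℝ} (hT : 0 < T) {e et p pr : ℝ × ℝ → ℝ} {e0 pR : ℝ → ℝ}
    (h1 : LineT T R e et e0) (h2 : LineR T R p pr pR) (he : AEStronglyMeasurable e (stripVol T R))
    (het : Integrable et (stripVol T R)) (hp : Integrable p (stripVol T R))
    (hpr : Integrable pr (stripVol T R)) (he0 : IntegrableOn e0 (Ioi R)) :
    IntegrableOn pR (Ioo 0 T) ∧ ∀ᵐ t ∂(volume.restrict (Ioo 0 T)),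
      ∫ r in Ioi R, e (t, r) = (∫ r in Ioi R, e0 r) +
        ∫ τ in Ioo 0 t, (pR τ + ∫ r in Ioi R, (et (τ, r) + pr (τ, r))) := by
  have hpR : ∀ᵐ t ∂(volume.restrict (Ioo 0 T)), ∫ r in Ioi R, pr (t, r) = -pR t := by
    filter_upwards [h2, hp.prod_right_ae, hpr.prod_right_ae] with t a b c
    exact a.integral_Ioi b c
  have hint : IntegrableOn pR (Ioo 0 T) := by
    refine hpr.integral_prod_left.neg.congr ?_
    filter_upwards [hpR] with t ht
    simp only [Pi.neg_apply, ht, neg_neg]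
  refine ⟨hint, ?_⟩
  -- Adding and subtracting `pr` turns the source into `et + pr`, in which the top order derivatives
  -- will cancel, and leaves the flux through `r = R`.
  have hsum : ∀ᵐ t ∂(volume.restrict (Ioo 0 T)),
      ∫ r in Ioi R, et (t, r) = pR t + ∫ r in Ioi R, (et (t, r) + pr (t, r)) := by
    filter_upwards [hpR, het.prod_right_ae, hpr.prod_right_ae] with t a b c
    rw [integral_add b c, a]; ring
  filter_upwards [h1.ae_eq hT he het.1 he0.1, ae_restrict_mem measurableSet_Ioo] with t ht htm
  have hI : Integrable et ((volume.restrict (Ioo 0 t)).prod (volume.restrict (Ioi R))) :=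
    het.mono_measure (Measure.prod_mono (Measure.restrict_mono (Ioo_subset_Ioo_right htm.2.le) le_rfl)
      le_rfl)
  have e1 : ∀ r, ∫ τ in 0..t, et (τ, r) = ∫ τ in Ioo 0 t, et (τ, r) := fun r => by
    rw [intervalIntegral.integral_of_le htm.1.le, integral_Ioc_eq_integral_Ioo]
  rw [integral_congr_ae ht]
  simp only [e1]
  rw [integral_add he0 hI.integral_prod_right, ← integral_integral_swap (f := fun τ r => et (τ, r)) hI]
  congr 1
  exact integral_congr_ae (ae_restrict_of_ae_restrict_of_subset (Ioo_subset_Ioo_right htm.2.le) hsum)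

/-- A quadratic form in two variables. -/
def quad (a b c x y : ℝ) : ℝ := a * x ^ 2 + 2 * (b * (x * y)) + c * y ^ 2

lemma abs_quad_le {a b c x y L : ℝ} (ha : |a| ≤ L) (hb : |b| ≤ L) (hc : |c| ≤ L) :
    |quad a b c x y| ≤ 2 * L * (x ^ 2 + y ^ 2) := by
  rw [abs_le] at *
  unfold quad
  constructor <;> nlinarith [mul_nonneg (sub_nonneg.2 ha.2) (sq_nonneg x),
    mul_nonneg (sub_nonneg.2 hc.2) (sq_nonneg y), mul_nonneg (sub_nonneg.2 hb.2) (sq_nonneg (x + y)),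
    mul_nonneg (sub_nonneg.2 hb.2) (sq_nonneg (x - y)),
    mul_nonneg (neg_le_iff_add_nonneg.1 ha.1) (sq_nonneg x),
    mul_nonneg (neg_le_iff_add_nonneg.1 hc.1) (sq_nonneg y),
    mul_nonneg (neg_le_iff_add_nonneg.1 hb.1) (sq_nonneg (x + y)),
    mul_nonneg (neg_le_iff_add_nonneg.1 hb.1) (sq_nonneg (x - y))]

lemma cauchy_two (a b x y : ℝ) : (a * x + b * y) ^ 2 ≤ (a ^ 2 + b ^ 2) * (x ^ 2 + y ^ 2) :=
  sub_nonneg.1 ((sq_nonneg (a * y - b * x)).trans_eq (by ring))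

/-- The pointwise bound of the production of energy. -/
lemma energy_source_le {R r L ε : ℝ} (hR : 0 < R) (hr : R ≤ r) (hL : 0 ≤ L) (hε : |ε| ≤ 1)
    {a St P Pr : Fin 3 → ℝ} {S : Fin 3 → ℝ} (ha : ∀ m, |a m| ≤ L) (hS : ∀ m, |S m| ≤ L)
    (hSt : ∀ m, |St m| ≤ L)
    (hP : ∀ m, |P m| ≤ L) (hPr : ∀ m, |Pr m| ≤ L) (s0 : S 0 = a 0 * a 1) (s1 : S 1 = -ε * (a 0 * a 1))
    (s2 : S 2 = a 0 * a 0 + -ε * (a 0 * a 2)) (p0 : P 0 = -ε * (a 1 * a 1))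
    (p1 : P 1 = a 0 * a 1 + -ε * (a 1 * a 2))
    (p2 : P 2 = a 0 * a 2 + -ε * (a 1 * a 0 + a 2 * a 2)) (z zt zr q qt qr : ℝ) :
    (r * quad (St 0) (St 1) (St 2) z q
      + r * (2 * (S 0 * (z * zt) + S 1 * (zt * q + z * qt) + S 2 * (q * qt))))
    + (quad (P 0) (P 1) (P 2) z q + r * quad (Pr 0) (Pr 1) (Pr 2) z q
      + r * (2 * (P 0 * (z * zr) + P 1 * (zr * q + z * qr) + P 2 * (q * qr)))) ≤
    r * ((2 * L / R + 4 * L + 10 * L ^ 2 + 1) *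
      (z ^ 2 + q ^ 2 + (zt + qr) ^ 2 + (a 0 * qt + a 1 * zr + a 2 * qr) ^ 2)) := by
  have hr0 : 0 < r := hR.trans_le hr
  set F1 := zt + qr with hF1
  set F2 := a 0 * qt + a 1 * zr + a 2 * qr with hF2
  set l1 := S 0 * z + S 1 * q with hl1
  set l2 := -ε * a 1 * z + (a 0 + -ε * a 2) * q with hl2
  -- The core of the energy method. By symmetry of `S` and of `P = S A`, the derivatives of the
  -- solution enter only through `F1` and `F2`, which the equations control. Here `l2` is the second
  -- component of `S (z, q)` divided by `a₀`.
  have key : r * (2 * (S 0 * (z * zt) + S 1 * (zt * q + z * qt) + S 2 * (q * qt)))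
      + r * (2 * (P 0 * (z * zr) + P 1 * (zr * q + z * qr) + P 2 * (q * qr)))
      = r * (2 * (l1 * F1 + l2 * F2)) := by
    rw [hl1, hl2, hF1, hF2, s0, s1, s2, p0, p1, p2]; ring
  have h1 := (abs_le.1 (abs_quad_le (x := z) (y := q) (hSt 0) (hSt 1) (hSt 2))).2
  have h2 := (abs_le.1 (abs_quad_le (x := z) (y := q) (hPr 0) (hPr 1) (hPr 2))).2
  have h3 := (abs_le.1 (abs_quad_le (x := z) (y := q) (hP 0) (hP 1) (hP 2))).2
  set w := z ^ 2 + q ^ 2 with hw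
  have hw0 : 0 ≤ w := by positivity
  have sq_le : ∀ {x : ℝ} {M : ℝ}, |x| ≤ M → x ^ 2 ≤ M ^ 2 := fun {x M} h => by
    rw [← sq_abs]; gcongr
  have h4 : l1 ^ 2 ≤ 2 * L ^ 2 * w := by
    have := sq_le (hS 0); have := sq_le (hS 1)
    have c : l1 ^ 2 ≤ (S 0 ^ 2 + S 1 ^ 2) * w :=
      cauchy_two _ _ _ _
    refine c.trans (mul_le_mul_of_nonneg_right ?_ hw0)
    linarith
  have h5 : l2 ^ 2 ≤ 8 * L ^ 2 * w := by
    have e1 : |-ε * a 1| ≤ L := by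
      rw [abs_mul, abs_neg]
      exact (mul_le_mul hε (ha 1) (abs_nonneg _) zero_le_one).trans_eq (one_mul _)
    have e2 : |a 0 + -ε * a 2| ≤ 2 * L := by
      refine (abs_add_le _ _).trans ?_
      rw [abs_mul, abs_neg]
      have := (mul_le_mul hε (ha 2) (abs_nonneg _) zero_le_one)
      linarith [ha 0]
    have i1 := sq_le e1
    have i2 := sq_le e2
    have c : l2 ^ 2 ≤ ((-ε * a 1) ^ 2 + (a 0 + -ε * a 2) ^ 2) * w :=
      cauchy_two _ _ _ _
    refine c.trans (mul_le_mul_of_nonneg_right ?_ hw0)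
    linarith [sq_nonneg L]
  have h6 : 2 * (l1 * F1 + l2 * F2) ≤ 10 * L ^ 2 * w + F1 ^ 2 + F2 ^ 2 := by
    have i1 := two_mul_le_add_sq l1 F1
    have i2 := two_mul_le_add_sq l2 F2
    clear_value w F1 F2 l1 l2
    linarith
  -- The derivative of the weight `r` in the flux leaves a term without weight; `1 ≤ r / R` restores
  -- it.
  have h7 : quad (P 0) (P 1) (P 2) z q ≤ r * (2 * L / R * w) := by
    have : 1 ≤ r / R := by rw [le_div_iff₀ hR]; linarith
    calc _ ≤ 2 * L * w := h3
      _ ≤ r / R * (2 * L * w) := le_mul_of_one_le_left (by positivity) this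
      _ = _ := by ring
  have h8 : 2 * L / R * w + 2 * L * w + 2 * L * w + (10 * L ^ 2 * w + F1 ^ 2 + F2 ^ 2) ≤
      (2 * L / R + 4 * L + 10 * L ^ 2 + 1) * (w + F1 ^ 2 + F2 ^ 2) := by
    clear_value w F1 F2
    have h : 0 ≤ (2 * L / R + 4 * L + 10 * L ^ 2) * (F1 ^ 2 + F2 ^ 2) + w := by positivity
    refine sub_nonneg.1 (h.trans_eq ?_)
    ring
  have h9 := mul_le_mul_of_nonneg_left h8 hr0.le
  have h1' := mul_le_mul_of_nonneg_left h1 hr0.le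
  have h2' := mul_le_mul_of_nonneg_left h2 hr0.le
  have h6' := mul_le_mul_of_nonneg_left h6 hr0.le
  clear_value w F1 F2 l1 l2
  linarith

variable {T R : ℝ}

lemma integrable_bdd_mul (hR : 0 < R) {L : ℝ} {a x y : ℝ × ℝ → ℝ}
    (ham : AEStronglyMeasurable a (stripVol T R)) (ha : ∀ᵐ p ∂(stripVol T R), |a p| ≤ L)
    (hx : MemLp x 2 (stripMeasure T R)) (hy : MemLp y 2 (stripMeasure T R)) :
    Integrable (fun p => a p * (x p * y p)) (stripMeasure T R) := by
  refine (hx.integrable_mul hy).bdd_mul (c := L) (ham.mono_ac (stripMeasure_ac T R)) ?_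
  rw [ae_stripMeasure hR]
  exact ha

lemma Prim.id (R : ℝ) : Prim (Ioi R) R (fun r => r) (fun _ => 1) R :=
  ⟨fun _ _ => by simp, Eventually.of_forall fun r => by simp⟩

/-- The energy inequality for a pair `(z, q)`, with coefficients of the energy `S` and of the
flux `P`. -/
lemma energy_le (hT : 0 < T) (hR : 0 < R) {L ε : ℝ} (hL : 0 ≤ L) (hε : |ε| ≤ 1)
    {a S St P Pr : Fin 3 → ℝ × ℝ → ℝ} {cS bP : Fin 3 → ℝ → ℝ}
    (ham : ∀ m, AEStronglyMeasurable (a m) (stripVol T R))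
    (hSm : ∀ m, AEStronglyMeasurable (S m) (stripVol T R))
    (hStm : ∀ m, AEStronglyMeasurable (St m) (stripVol T R))
    (hPm : ∀ m, AEStronglyMeasurable (P m) (stripVol T R))
    (hPrm : ∀ m, AEStronglyMeasurable (Pr m) (stripVol T R))
    (hb : ∀ᵐ p ∂(stripVol T R), ∀ m, |a m p| ≤ L ∧ |S m p| ≤ L ∧ |St m p| ≤ L ∧ |P m p| ≤ L ∧
      |Pr m p| ≤ L)
    (hS : ∀ m, LineT T R (S m) (St m) (cS m)) (hP : ∀ m, LineR T R (P m) (Pr m) (bP m))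
    (s0 : ∀ p, S 0 p = a 0 p * a 1 p) (s1 : ∀ p, S 1 p = -ε * (a 0 p * a 1 p))
    (s2 : ∀ p, S 2 p = a 0 p * a 0 p + -ε * (a 0 p * a 2 p))
    (p0 : ∀ p, P 0 p = -ε * (a 1 p * a 1 p)) (p1 : ∀ p, P 1 p = a 0 p * a 1 p + -ε * (a 1 p * a 2 p))
    (p2 : ∀ p, P 2 p = a 0 p * a 2 p + -ε * (a 1 p * a 0 p + a 2 p * a 2 p))
    {z zt zr q qt qr : ℝ × ℝ → ℝ} {cz cq bz bq : ℝ → ℝ}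
    (hz : MemLp z 2 (stripMeasure T R)) (hzt : MemLp zt 2 (stripMeasure T R))
    (hzr : MemLp zr 2 (stripMeasure T R)) (hq : MemLp q 2 (stripMeasure T R))
    (hqt : MemLp qt 2 (stripMeasure T R)) (hqr : MemLp qr 2 (stripMeasure T R))
    (lz : LineT T R z zt cz) (lq : LineT T R q qt cq) (rz : LineR T R z zr bz)
    (rq : LineR T R q qr bq)
    (h0 : Integrable (fun r => quad (cS 0 r) (cS 1 r) (cS 2 r) (cz r) (cq r)) (radialMeasure R)) :
    IntegrableOn (fun t => quad (bP 0 t) (bP 1 t) (bP 2 t) (bz t) (bq t)) (Ioo 0 T) ∧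
    Integrable (fun p => z p ^ 2 + q p ^ 2 + (zt p + qr p) ^ 2 +
      (a 0 p * qt p + a 1 p * zr p + a 2 p * qr p) ^ 2) (stripMeasure T R) ∧
    ∀ᵐ t ∂(volume.restrict (Ioo 0 T)),
      ∫ r, quad (S 0 (t, r)) (S 1 (t, r)) (S 2 (t, r)) (z (t, r)) (q (t, r)) ∂(radialMeasure R) ≤
        (∫ r, quad (cS 0 r) (cS 1 r) (cS 2 r) (cz r) (cq r) ∂(radialMeasure R)) +
        ∫ τ in Ioo 0 t, (R * quad (bP 0 τ) (bP 1 τ) (bP 2 τ) (bz τ) (bq τ) +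
          (2 * L / R + 4 * L + 10 * L ^ 2 + 1) *
          ∫ r, (z (τ, r) ^ 2 + q (τ, r) ^ 2 + (zt (τ, r) + qr (τ, r)) ^ 2 +
            (a 0 (τ, r) * qt (τ, r) + a 1 (τ, r) * zr (τ, r) + a 2 (τ, r) * qr (τ, r)) ^ 2)
            ∂(radialMeasure R)) := by
  have bd : ∀ (f : (Fin 3 → ℝ × ℝ → ℝ)) (m : Fin 3),
      (f = a ∨ f = S ∨ f = St ∨ f = P ∨ f = Pr) →
      AEStronglyMeasurable (f m) (stripVol T R) ∧ ∀ᵐ p ∂(stripVol T R), |f m p| ≤ L := by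
    rintro f m (rfl | rfl | rfl | rfl | rfl)
    · exact ⟨ham m, hb.mono fun p hp => (hp m).1⟩
    · exact ⟨hSm m, hb.mono fun p hp => (hp m).2.1⟩
    · exact ⟨hStm m, hb.mono fun p hp => (hp m).2.2.1⟩
    · exact ⟨hPm m, hb.mono fun p hp => (hp m).2.2.2.1⟩
    · exact ⟨hPrm m, hb.mono fun p hp => (hp m).2.2.2.2⟩
  have int : ∀ (f : Fin 3 → ℝ × ℝ → ℝ), (f = a ∨ f = S ∨ f = St ∨ f = P ∨ f = Pr) → ∀ m
      {x y : ℝ × ℝ → ℝ}, MemLp x 2 (stripMeasure T R) → MemLp y 2 (stripMeasure T R) →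
      Integrable (fun p => f m p * (x p * y p)) (stripMeasure T R) := fun f hf m x y hx hy =>
    integrable_bdd_mul hR (bd f m hf).1 (bd f m hf).2 hx hy
  have iq : ∀ (f : Fin 3 → ℝ × ℝ → ℝ), (f = a ∨ f = S ∨ f = St ∨ f = P ∨ f = Pr) →
      Integrable (fun p => quad (f 0 p) (f 1 p) (f 2 p) (z p) (q p)) (stripMeasure T R) := by
    intro f hf
    simp only [quad, pow_two]
    exact ((int f hf 0 hz hz).add ((int f hf 1 hz hq).const_mul 2)).add (int f hf 2 hq hq)
  have ic : ∀ (f : Fin 3 → ℝ × ℝ → ℝ), (f = a ∨ f = S ∨ f = St ∨ f = P ∨ f = Pr) → ∀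
      {x y : ℝ × ℝ → ℝ}, MemLp x 2 (stripMeasure T R) → MemLp y 2 (stripMeasure T R) →
      Integrable (fun p => 2 * (f 0 p * (z p * x p) + f 1 p * (x p * q p + z p * y p)
        + f 2 p * (q p * y p))) (stripMeasure T R) := by
    intro f hf x y hx hy
    simp only [mul_add (f 1 _)]
    exact (((int f hf 0 hz hx).add ((int f hf 1 hx hq).add (int f hf 1 hz hy))).add
      (int f hf 2 hq hy)).const_mul 2
  -- The weight `r` is part of the density and of the flux, so that the conservation law is written
  -- for Lebesgue measure.
  set e : ℝ × ℝ → ℝ := fun p => p.2 * quad (S 0 p) (S 1 p) (S 2 p) (z p) (q p) with he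
  set et : ℝ × ℝ → ℝ := fun p => p.2 * quad (St 0 p) (St 1 p) (St 2 p) (z p) (q p) +
    p.2 * (2 * (S 0 p * (z p * zt p) + S 1 p * (zt p * q p + z p * qt p) + S 2 p * (q p * qt p)))
    with het
  set φ : ℝ × ℝ → ℝ := fun p => p.2 * quad (P 0 p) (P 1 p) (P 2 p) (z p) (q p) with hφ
  set φr : ℝ × ℝ → ℝ := fun p => quad (P 0 p) (P 1 p) (P 2 p) (z p) (q p) +
    p.2 * quad (Pr 0 p) (Pr 1 p) (Pr 2 p) (z p) (q p) +
    p.2 * (2 * (P 0 p * (z p * zr p) + P 1 p * (zr p * q p + z p * qr p) + P 2 p * (q p * qr p)))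
    with hφr
  have hle : LineT T R e et (fun r => r * quad (cS 0 r) (cS 1 r) (cS 2 r) (cz r) (cq r)) := by
    filter_upwards [hS 0, hS 1, hS 2, lz, lq] with r h0 h1 h2 h3 h4
    have hs := isLeft_Ioo hT
    have := ((((h0.mul (h3.mul h3 hs) hs).add ((h1.mul (h3.mul h4 hs) hs).const_mul 2) hs).add
      (h2.mul (h4.mul h4 hs) hs) hs).const_mul r)
    simp only [he, het, quad, pow_two]
    convert! this using 2
    ring
  have hlp : LineR T R φ φr (fun t => R * quad (bP 0 t) (bP 1 t) (bP 2 t) (bz t) (bq t)) := by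
    filter_upwards [hP 0, hP 1, hP 2, rz, rq] with t h0 h1 h2 h3 h4
    have hs := isLeft_Ioi R
    have := (Prim.id R).mul (((h0.mul (h3.mul h3 hs) hs).add
      ((h1.mul (h3.mul h4 hs) hs).const_mul 2) hs).add (h2.mul (h4.mul h4 hs) hs) hs) hs
    simp only [hφ, hφr, quad, pow_two]
    convert! this using 2
    ring
  have mono : ∀ {f : ℝ × ℝ → ℝ}, Integrable f (stripMeasure T R) → Integrable f (stripVol T R) :=
    fun hf => hf.of_measure_le_smul (ENNReal.inv_ne_top.2 (by simpa using hR)) (stripVol_le hR T)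
  have wt : ∀ {f : ℝ × ℝ → ℝ}, Integrable f (stripMeasure T R) →
      Integrable (fun p => p.2 * f p) (stripVol T R) := fun hf => (integrable_strip_iff hR T _).1 hf
  have iet : Integrable et (stripVol T R) :=
    (wt (iq St (by simp))).add (wt (ic S (by simp) hzt hqt))
  have iφ : Integrable φ (stripVol T R) := wt (iq P (by simp))
  have iφr : Integrable φr (stripVol T R) :=
    ((mono (iq P (by simp))).add (wt (iq Pr (by simp)))).add (wt (ic P (by simp) hzr hqr))
  have bmul : ∀ (m : Fin 3) {x : ℝ × ℝ → ℝ}, MemLp x 2 (stripMeasure T R) →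
      MemLp (fun p => a m p * x p) 2 (stripMeasure T R) := by
    intro m x hx
    refine MemLp.of_le_mul (c := L) hx (((ham m).mono_ac (stripMeasure_ac T R)).mul hx.1) ?_
    rw [ae_stripMeasure hR]
    filter_upwards [(bd a m (by simp)).2] with p hp
    rw [norm_mul]
    gcongr
    exact hp
  have hF1 : MemLp (fun p => zt p + qr p) 2 (stripMeasure T R) := hzt.add hqr
  have hF2 : MemLp (fun p => a 0 p * qt p + a 1 p * zr p + a 2 p * qr p) 2 (stripMeasure T R) :=
    ((bmul 0 hqt).add (bmul 1 hzr)).add (bmul 2 hqr)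
  have sqi : ∀ {x : ℝ × ℝ → ℝ}, MemLp x 2 (stripMeasure T R) →
      Integrable (fun p => x p ^ 2) (stripMeasure T R) := fun hx =>
    (memLp_two_iff_integrable_sq hx.1).1 hx
  have isrc : Integrable (fun p => z p ^ 2 + q p ^ 2 + (zt p + qr p) ^ 2 +
      (a 0 p * qt p + a 1 p * zr p + a 2 p * qr p) ^ 2) (stripMeasure T R) :=
    (((sqi hz).add (sqi hq)).add (sqi hF1)).add (sqi hF2)
  obtain ⟨hpR, hcons⟩ := integral_conservation hT hle hlp (wt (iq S (by simp))).1 iet iφ iφr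
    ((integrable_radial_iff hR _).1 h0)
  -- The trace of the weighted flux carries the factor `R > 0`, which is divided out.
  have hpR' : IntegrableOn (fun t => quad (bP 0 t) (bP 1 t) (bP 2 t) (bz t) (bq t)) (Ioo 0 T) := by
    have := hpR.const_mul R⁻¹
    refine this.congr (Eventually.of_forall fun t => ?_)
    simp only
    field_simp
  refine ⟨hpR', isrc, ?_⟩
  set C := 2 * L / R + 4 * L + 10 * L ^ 2 + 1 with hC
  set src : ℝ × ℝ → ℝ := fun p => z p ^ 2 + q p ^ 2 + (zt p + qr p) ^ 2 +
      (a 0 p * qt p + a 1 p * zr p + a 2 p * qr p) ^ 2 with hsrc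
  have hpt : ∀ᵐ τ ∂(volume.restrict (Ioo 0 T)), ∫ r in Ioi R, (et (τ, r) + φr (τ, r)) ≤
      C * ∫ r, src (τ, r) ∂(radialMeasure R) := by
    filter_upwards [Measure.ae_ae_of_ae_prod hb, iet.prod_right_ae, iφr.prod_right_ae,
      (wt isrc).prod_right_ae] with τ h1 h2 h3 h4
    rw [integral_radial hR, ← integral_const_mul]
    refine integral_mono_ae (h2.add h3) (h4.const_mul C) ?_
    filter_upwards [h1, ae_restrict_mem measurableSet_Ioi] with r h5 hr
    have := energy_source_le (a := fun m => a m (τ, r)) (S := fun m => S m (τ, r))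
      (St := fun m => St m (τ, r)) (P := fun m => P m (τ, r)) (Pr := fun m => Pr m (τ, r)) hR
      (le_of_lt hr) hL hε (fun m => (h5 m).1) (fun m => (h5 m).2.1) (fun m => (h5 m).2.2.1)
      (fun m => (h5 m).2.2.2.1) (fun m => (h5 m).2.2.2.2) (s0 _) (s1 _) (s2 _) (p0 _) (p1 _) (p2 _)
      (z (τ, r)) (zt (τ, r)) (zr (τ, r)) (q (τ, r)) (qt (τ, r)) (qr (τ, r))
    simp only [het, hφr, hsrc]
    linarith
  have isl : IntegrableOn (fun τ => ∫ r, src (τ, r) ∂(radialMeasure R)) (Ioo 0 T) := by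
    have := isrc
    rw [stripMeasure_eq_prod] at this
    exact this.integral_prod_left
  filter_upwards [hcons, ae_restrict_mem measurableSet_Ioo] with t ht htm
  rw [integral_radial hR, integral_radial hR]
  refine ht.le.trans (add_le_add le_rfl ?_)
  have hsub : Ioo 0 t ⊆ Ioo 0 T := Ioo_subset_Ioo_right htm.2.le
  refine integral_mono_ae ((hpR.mono_set hsub).add ?_)
    ((IntegrableOn.mono_set (hpR'.const_mul R) hsub).add
      (IntegrableOn.mono_set (isl.const_mul C) hsub)) ?_
  · exact IntegrableOn.mono_set (iet.add iφr).integral_prod_left hsub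
  · filter_upwards [ae_restrict_of_ae_restrict_of_subset hsub hpt] with τ hτ
    exact add_le_add le_rfl hτ

end FloatingSW

namespace FloatingSW

open Filter Topology
open scoped ENNReal NNReal

/-! ### The scalar form of the linear system -/

/-- The sum over the indices `(i, j)` with `i + j ≤ k`. -/
def dsum (k : ℕ) (a : ℕ → ℕ → ℝ) : ℝ :=
  ∑ i ∈ Finset.range (k + 1), ∑ j ∈ Finset.range (k - i + 1), a i j

lemma dsum_nonneg {k : ℕ} {a : ℕ → ℕ → ℝ} (h : ∀ i j, i + j ≤ k → 0 ≤ a i j) : 0 ≤ dsum k a :=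
  Finset.sum_nonneg fun i hi => Finset.sum_nonneg fun j hj => h i j (by
    rw [Finset.mem_range] at hi hj; omega)

lemma le_dsum {k : ℕ} {a : ℕ → ℕ → ℝ} (h : ∀ i j, i + j ≤ k → 0 ≤ a i j) {i j : ℕ}
    (hij : i + j ≤ k) : a i j ≤ dsum k a := by
  have hn : ∀ i ∈ Finset.range (k + 1), ∀ j ∈ Finset.range (k - i + 1), 0 ≤ a i j := by
    intro i hi j hj
    rw [Finset.mem_range] at hi hj
    exact h i j (by omega)
  calc a i j ≤ ∑ j ∈ Finset.range (k - i + 1), a i j :=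
        Finset.single_le_sum (f := fun j => a i j) (hn i (by simp; omega)) (by simp; omega)
    _ ≤ _ := Finset.single_le_sum (f := fun i => ∑ j ∈ Finset.range (k - i + 1), a i j)
        (fun i hi => Finset.sum_nonneg (hn i hi)) (by simp; omega)

lemma dsum_congr {k : ℕ} {a b : ℕ → ℕ → ℝ} (h : ∀ i j, i + j ≤ k → a i j = b i j) :
    dsum k a = dsum k b :=
  Finset.sum_congr rfl fun i hi => Finset.sum_congr rfl fun j hj => h i j (by
    rw [Finset.mem_range] at hi hj; omega)

/-- The square of the norm of `w(t)` in `L²_r`. -/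
noncomputable def nsq (R : ℝ) (w : ℝ × ℝ → ℝ) (t : ℝ) : ℝ := ∫ r, w (t, r) ^ 2 ∂(radialMeasure R)

lemma nsq_nonneg (R : ℝ) (w : ℝ × ℝ → ℝ) (t : ℝ) : 0 ≤ nsq R w t :=
  integral_nonneg fun _ => sq_nonneg _

lemma integrableOn_nsq {T R : ℝ} {w : ℝ × ℝ → ℝ} (hw : MemLp w 2 (stripMeasure T R)) :
    IntegrableOn (nsq R w) (Ioo 0 T) := by
  have := (memLp_two_iff_integrable_sq hw.1).1 hw
  rw [stripMeasure_eq_prod] at this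
  exact this.integral_prod_left

/-- The scalar form of the differentiated linear mixed problem: `H`, `Q` are the arrays of
derivatives of the coefficients, `z`, `q` those of the solution, `f₁`, `f₂` those of the source,
and `cz`, `cq`, `bz`, `bq` are the traces of the solution at `t = 0` and at `r = R`. -/
structure LinSys (grav δ T R : ℝ) (k s : ℕ) (K : ℝ≥0∞) (H Q z q f₁ f₂ : ℕ → ℕ → ℝ × ℝ → ℝ)
    (cz cq : ℕ → ℕ → ℝ → ℝ) (bz bq : ℕ → ℝ → ℝ) : Prop where
  T_pos : 0 < T
  R_pos : 0 < R
  two_le : 2 ≤ s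
  k_le : k ≤ s
  famH : Fam s T R H
  famQ : Fam s T R Q
  coefH : ∀ᵐ t ∂(volume.restrict (Ioo 0 T)), CoefAt (radialMeasure R) s K (fun i j r => H i j (t, r))
  coefQ : ∀ᵐ t ∂(volume.restrict (Ioo 0 T)), CoefAt (radialMeasure R) s K (fun i j r => Q i j (t, r))
  contH : ContinuousOn (H 0 0) (closedStrip T R)
  contQ : ContinuousOn (Q 0 0) (closedStrip T R)
  subsonic : ∀ p ∈ closedStrip T R, δ ≤ grav * H 0 0 p - Q 0 0 p ^ 2 / H 0 0 p ^ 2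
  famz : Fam (k + 1) T R z
  famq : Fam (k + 1) T R q
  famf₁ : Fam k T R f₁
  famf₂ : Fam k T R f₂
  memz : ∀ i j, i + j ≤ k + 1 → MemLp (z i j) 2 (stripMeasure T R)
  memq : ∀ i j, i + j ≤ k + 1 → MemLp (q i j) 2 (stripMeasure T R)
  memf₁ : ∀ i j, i + j ≤ k → MemLp (f₁ i j) 2 (stripMeasure T R)
  memf₂ : ∀ i j, i + j ≤ k → MemLp (f₂ i j) 2 (stripMeasure T R)
  mass : ∀ᵐ p ∂(stripVol T R), z 1 0 p + q 0 1 p + p.2⁻¹ * q 0 0 p = f₁ 0 0 p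
  momentum : ∀ᵐ p ∂(stripVol T R), arr0 H 0 0 p * q 1 0 p + arr1 grav H Q 0 0 p * z 0 1 p
    + arr2 H Q 0 0 p * q 0 1 p + Q 0 0 p * H 0 0 p * (p.2⁻¹ * q 0 0 p) = arr0 H 0 0 p * f₂ 0 0 p
  tracez : ∀ i j, i + j ≤ k → LineT T R (z i j) (z (i + 1) j) (cz i j)
  traceq : ∀ i j, i + j ≤ k → LineT T R (q i j) (q (i + 1) j) (cq i j)
  memcz : ∀ i j, i + j ≤ k → MemLp (cz i j) 2 (radialMeasure R)
  memcq : ∀ i j, i + j ≤ k → MemLp (cq i j) 2 (radialMeasure R)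
  boundz : ∀ i ≤ k, LineR T R (z i 0) (z i 1) (bz i)
  boundq : ∀ i ≤ k, LineR T R (q i 0) (q i 1) (bq i)

/-- The sum of the squares of the norms of the derivatives of order `≤ k` of the solution. -/
noncomputable def solN (k : ℕ) (R : ℝ) (z q : ℕ → ℕ → ℝ × ℝ → ℝ) (t : ℝ) : ℝ :=
  dsum k fun i j => nsq R (z i j) t + nsq R (q i j) t

lemma solN_nonneg (k : ℕ) (R : ℝ) (z q : ℕ → ℕ → ℝ × ℝ → ℝ) (t : ℝ) : 0 ≤ solN k R z q t :=
  dsum_nonneg fun _ _ _ => add_nonneg (nsq_nonneg _ _ _) (nsq_nonneg _ _ _)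

/-- The first combination of derivatives controlled by the equations. -/
def red1 (z q : ℕ → ℕ → ℝ × ℝ → ℝ) (i j : ℕ) (p : ℝ × ℝ) : ℝ := z (i + 1) j p + q i (j + 1) p

/-- The second combination of derivatives controlled by the equations. -/
def red2 (grav : ℝ) (H Q z q : ℕ → ℕ → ℝ × ℝ → ℝ) (i j : ℕ) (p : ℝ × ℝ) : ℝ :=
  arr0 H 0 0 p * q (i + 1) j p + arr1 grav H Q 0 0 p * z i (j + 1) p + arr2 H Q 0 0 p * q i (j + 1) p

/-! ### From bounds on the strip to bounds at almost every time, and back. -/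

section Slices

variable {T R : ℝ} {k : ℕ} {w : ℕ → ℕ → ℝ × ℝ → ℝ}

/-- The bounds at almost every time of the derivatives of a function of class `H^k`. -/
lemma ae_solAt (hR : 0 < R) (hw : Fam k T R w)
    (hm : ∀ i j, i + j ≤ k → MemLp (w i j) 2 (stripMeasure T R)) {Y : ℝ → ℝ}
    (hY : ∀ i j, i + j ≤ k → ∀ t, nsq R (w i j) t ≤ Y t) : ∀ᵐ t ∂(volume.restrict (Ioo 0 T)),
      SolAt (radialMeasure R) k (ENNReal.ofReal (sobC R * √(Y t))) (fun i j r => w i j (t, r)) := by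
  have h1 : ∀ᵐ t ∂(volume.restrict (Ioo 0 T)), ∀ i j, i + j ≤ k →
      MemLp (fun r => w i j (t, r)) 2 (radialMeasure R) := by
    simp only [ae_all_iff, eventually_imp_distrib_left]
    intro i j hij
    have := hm i j hij
    rw [stripMeasure_eq_prod] at this
    exact MemLp.ae_section_left this
  have h2 : ∀ᵐ t ∂(volume.restrict (Ioo 0 T)), ∀ i j, i + j < k →
      ∃ c, Prim (Ioi R) R (fun r => w i j (t, r)) (fun r => w i (j + 1) (t, r)) c := by
    simp only [ae_all_iff, eventually_imp_distrib_left]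
    intro i j hij
    obtain ⟨c, hc⟩ := hw.dr i j hij
    filter_upwards [hc] with t ht using ⟨_, ht⟩
  filter_upwards [h1, h2] with t a b
  have two : ∀ i j, i + j ≤ k →
      eLpNorm (fun r => w i j (t, r)) 2 (radialMeasure R) ≤ ENNReal.ofReal √(Y t) := by
    intro i j hij
    refine eLpNorm_le_of_integral_sq_le (a i j hij) (Real.sqrt_nonneg _) ?_
    rw [Real.sq_sqrt ((nsq_nonneg R (w i j) t).trans (hY i j hij t))]
    exact hY i j hij t
  refine ⟨fun i j hij => (a i j hij).1, fun i j hij => (two i j hij).trans ?_, fun i j hij => ?_⟩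
  · exact ENNReal.ofReal_le_ofReal (le_mul_of_one_le_left (Real.sqrt_nonneg _) (one_le_sobC R))
  · obtain ⟨c, hc⟩ := b i j hij
    exact hc.eLpNorm_top_le hR (Real.sqrt_nonneg _) (a i j hij.le).1 (a i (j + 1) (by omega)).1
      (two i j hij.le) (two i (j + 1) (by omega))

lemma ae_slice_meas (hw : Fam k T R w) : ∀ᵐ t ∂(volume.restrict (Ioo 0 T)), ∀ i j, i + j ≤ k →
    AEStronglyMeasurable (fun r => w i j (t, r)) (radialMeasure R) := by
  simp only [ae_all_iff, eventually_imp_distrib_left]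
  intro i j hij
  filter_upwards [(hw.meas i j hij).prodMk_left] with t ht
  exact ht.mono_ac (radialMeasure_ac R)

/-- A function of bounded slices is bounded. -/
lemma ae_bound_of_slices {a : ℝ × ℝ → ℝ} {L : ℝ≥0∞} (hR : 0 < R) (hL : L ≠ ⊤)
    (ha : AEStronglyMeasurable a (stripVol T R))
    (h : ∀ᵐ t ∂(volume.restrict (Ioo 0 T)), eLpNorm (fun r => a (t, r)) ⊤ (radialMeasure R) ≤ L) :
    ∀ᵐ p ∂(stripVol T R), |a p| ≤ L.toReal := by
  have : ∀ᵐ p ∂(stripVol T R), max (|a p| - L.toReal) 0 = 0 := by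
    refine ae_prod_of_ae_ae ?_ ?_
    · exact (continuous_abs.comp_aestronglyMeasurable ha |>.sub aestronglyMeasurable_const).sup
        aestronglyMeasurable_const
    · filter_upwards [h] with t ht
      rw [eLpNorm_exponent_top] at ht
      have h1 := (ac_radialMeasure hR).ae_le (ae_le_eLpNormEssSup (f := fun r => a (t, r)) (μ := radialMeasure R))
      filter_upwards [h1] with r hr
      rw [max_eq_right_iff, sub_nonpos]
      have h2 := hr.trans ht
      rw [← ofReal_norm, Real.norm_eq_abs] at h2
      exact (ENNReal.ofReal_le_iff_le_toReal hL).1 h2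
  filter_upwards [this] with p hp
  rw [max_eq_right_iff] at hp
  linarith

end Slices

/-- The right-hand sides of the differentiated equations are controlled by the solution and the
data, with a constant that depends only on the bounds of the coefficients. -/
lemma exists_red_bound (grav : ℝ) {R : ℝ} (hR : 0 < R) (k : ℕ) {K : ℝ≥0∞} (hK : K ≠ ⊤) :
    ∃ C : ℝ, 0 ≤ C ∧ ∀ (δ T : ℝ) (H Q z q f₁ f₂ : ℕ → ℕ → ℝ × ℝ → ℝ) (cz cq : ℕ → ℕ → ℝ → ℝ)
      (bz bq : ℕ → ℝ → ℝ), LinSys grav δ T R k (max k 2) K H Q z q f₁ f₂ cz cq bz bq →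
      ∀ᵐ t ∂(volume.restrict (Ioo 0 T)), ∀ i j, i + j ≤ k →
        nsq R (red1 z q i j) t ≤ C * (solN k R z q t + solN k R f₁ f₂ t) ∧
        nsq R (red2 grav H Q z q i j) t ≤ C * (solN k R z q t + solN k R f₁ f₂ t) := by
  obtain ⟨Lρ, hLρ, hρ⟩ := exists_rho_bound k hR
  obtain ⟨C, hC, hCb⟩ := exists_rhs_bound grav (k := k) (s := max k 2) (le_max_right _ _)
    (le_max_left _ _) (fun h => (le_max_right _ _).trans h) hK hLρ
  refine ⟨(C.toReal * sobC R) ^ 2, by positivity, fun δ T H Q z q f₁ f₂ cz cq bz bq h => ?_⟩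
  -- `Y` dominates every derivative of order at most `k` of the solution and of the source, so one
  -- bound `sobC R * √Y` serves for all four arrays.
  set Y : ℝ → ℝ := fun t => solN k R z q t + solN k R f₁ f₂ t with hY
  have hYz : ∀ (w : ℕ → ℕ → ℝ × ℝ → ℝ), (w = z ∨ w = q ∨ w = f₁ ∨ w = f₂) →
      ∀ i j, i + j ≤ k → ∀ t, nsq R (w i j) t ≤ Y t := by
    intro w hw i j hij t
    have nn : ∀ (a b : ℕ → ℕ → ℝ × ℝ → ℝ) (i j : ℕ), i + j ≤ k →
      0 ≤ nsq R (a i j) t + nsq R (b i j) t := fun a b i j _ =>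
        add_nonneg (nsq_nonneg _ _ _) (nsq_nonneg _ _ _)
    have e1 := le_dsum (nn z q) hij
    have e2 := le_dsum (nn f₁ f₂) hij
    have n1 := nsq_nonneg R (z i j) t
    have n2 := nsq_nonneg R (q i j) t
    have n3 := nsq_nonneg R (f₁ i j) t
    have n4 := nsq_nonneg R (f₂ i j) t
    simp only [hY, solN]
    rcases hw with rfl | rfl | rfl | rfl <;> linarith
  have sz := ae_solAt hR (h.famz.mono (Nat.le_succ k)) (fun i j hij => h.memz i j (by omega))
    (hYz z (by simp))
  have sq := ae_solAt hR (h.famq.mono (Nat.le_succ k)) (fun i j hij => h.memq i j (by omega))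
    (hYz q (by simp))
  have s1 := ae_solAt hR h.famf₁ h.memf₁ (hYz f₁ (by simp))
  have s2 := ae_solAt hR h.famf₂ h.memf₂ (hYz f₂ (by simp))
  have e1 : ∀ᵐ t ∂(volume.restrict (Ioo 0 T)), ∀ i j, i + j ≤ k → ∀ᵐ r ∂(radialMeasure R),
      red1 z q i j (t, r) = f₁ i j (t, r) - Leib rhoArr q i j (t, r) := by
    simp only [ae_all_iff, eventually_imp_distrib_left]
    intro i j hij
    have := Measure.ae_ae_of_ae_prod (mass_eq h.T_pos hR h.famz h.famq h.famf₁ h.mass i j hij)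
    filter_upwards [this] with t ht using (radialMeasure_ac R).ae_le ht
  have e2 : ∀ᵐ t ∂(volume.restrict (Ioo 0 T)), ∀ i j, i + j ≤ k → ∀ᵐ r ∂(radialMeasure R),
      red2 grav H Q z q i j (t, r) = momRhs grav H Q rhoArr z q f₂ i j (t, r) := by
    simp only [ae_all_iff, eventually_imp_distrib_left]
    intro i j hij
    have := Measure.ae_ae_of_ae_prod (momentum_eq grav h.T_pos hR (h.famH.mono h.k_le)
      (h.famQ.mono h.k_le) h.famz h.famq h.famf₂ h.momentum i j hij)
    filter_upwards [this] with t ht using (radialMeasure_ac R).ae_le ht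
  filter_upwards [sz, sq, s1, s2, h.coefH, h.coefQ, ae_slice_meas h.famz, ae_slice_meas h.famq,
    e1, e2] with t sz sq s1 s2 cH cQ mz mq e1 e2 i j hij
  have hb := hCb _ _ _ (fun i j r => rhoArr i j (t, r)) _ _ _ _ _ cH cQ (fun i j h => (hρ t i j h).1)
    (fun i j h => (hρ t i j h).2) sz sq mz mq s1 s2 i j hij
  have hY0 : 0 ≤ Y t := add_nonneg (solN_nonneg _ _ _ _ _) (solN_nonneg _ _ _ _ _)
  have conv : ∀ {g : ℝ → ℝ}, AEStronglyMeasurable g (radialMeasure R) →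
      eLpNorm g 2 (radialMeasure R) ≤ C * ENNReal.ofReal (sobC R * √(Y t)) →
      ∫ r, g r ^ 2 ∂(radialMeasure R) ≤ (C.toReal * sobC R) ^ 2 * Y t := by
    intro g hg hgb
    have hs : 0 ≤ sobC R := zero_le_one.trans (one_le_sobC R)
    rw [← ENNReal.ofReal_toReal hC, ← ENNReal.ofReal_mul ENNReal.toReal_nonneg] at hgb
    refine (integral_sq_le_of_eLpNorm_le hg (by positivity) hgb).trans_eq ?_
    rw [← mul_assoc, mul_pow, Real.sq_sqrt hY0]
  obtain ⟨B, -, hB⟩ := exists_coef_bound (n := max k 2) grav (by have := h.two_le; omega) hK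
  obtain ⟨⟨c0, c1, c2, -⟩, -⟩ := hB _ _ _ 0 (by simp) cH cQ
  constructor
  · refine conv ((mz (i + 1) j (by omega)).add (mq i (j + 1) (by omega))) ?_
    rw [eLpNorm_congr_ae (e1 i j hij)]
    exact hb.1
  · refine conv ((((c0.meas 0 0 (by omega)).mul (mq (i + 1) j (by omega))).add
      ((c1.meas 0 0 (by omega)).mul (mz i (j + 1) (by omega)))).add
      ((c2.meas 0 0 (by omega)).mul (mq i (j + 1) (by omega)))) ?_
    rw [eLpNorm_congr_ae (e2 i j hij)]
    exact hb.2

/-! ### Positivity of the energy and dissipativity of the flux -/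

section Pointwise

variable {grav δ x y : ℝ}

lemma height_pos_of_margin (hg : 0 < grav) (hδ : 0 < δ) (h : δ ≤ grav * x - y ^ 2 / x ^ 2) :
    0 < x ∧ δ / grav ≤ x := by
  have h1 : δ ≤ grav * x := h.trans (sub_le_self _ (by positivity))
  have h2 : δ / grav ≤ x := by rw [div_le_iff₀ hg]; linarith
  exact ⟨(div_pos hδ hg).trans_le h2, h2⟩

/-- After multiplication by `x²`, the second bound is `y² ≤ x² (g x)` together with `4 g x ≤ (1 + g
x)²`, which avoids square roots. -/
lemma margin_bounds (hg : 0 < grav) (hδ : 0 < δ) (h : δ ≤ grav * x - y ^ 2 / x ^ 2) :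
    δ * x ^ 2 ≤ grav * x ^ 3 - y ^ 2 ∧ |y| ≤ x * (1 + grav * x) / 2 := by
  obtain ⟨hx, -⟩ := height_pos_of_margin hg hδ h
  have h1 : δ * x ^ 2 ≤ grav * x ^ 3 - y ^ 2 := by
    have := mul_le_mul_of_nonneg_right h (sq_nonneg x)
    have e : (grav * x - y ^ 2 / x ^ 2) * x ^ 2 = grav * x ^ 3 - y ^ 2 := by field_simp
    linarith
  refine ⟨h1, abs_le_of_sq_le_sq ?_ (by positivity)⟩
  have h2 : 0 ≤ δ * x ^ 2 := by positivity
  have h3 : 0 ≤ x ^ 2 * (1 - grav * x) ^ 2 := by positivity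
  nlinarith

/-- The parameter of the energy, for heights at most `Λ`. -/
noncomputable def epsOf (grav Λ : ℝ) : ℝ := 1 / (8 * (1 + grav * Λ))

lemma epsOf_pos {Λ : ℝ} (hg : 0 < grav) (hΛ : 1 ≤ Λ) : 0 < epsOf grav Λ := by
  unfold epsOf; positivity

lemma epsOf_mul {Λ : ℝ} (hg : 0 < grav) (hΛ : 1 ≤ Λ) : epsOf grav Λ * (1 + grav * Λ) = 1 / 8 := by
  unfold epsOf
  have : 0 < 1 + grav * Λ := by positivity
  field_simp

lemma epsOf_le {Λ : ℝ} (hg : 0 < grav) (hΛ : 1 ≤ Λ) : epsOf grav Λ ≤ 1 / 8 := by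
  rw [← epsOf_mul hg hΛ]
  exact le_mul_of_one_le_right (epsOf_pos hg hΛ).le (by nlinarith)

/-- The energy density is positive definite. -/
lemma energy_ge (hg : 0 < grav) (hδ : 0 < δ) (h : δ ≤ grav * x - y ^ 2 / x ^ 2) {Λ : ℝ}
    (hΛ : 1 ≤ Λ) (hx : x ≤ Λ) (z q : ℝ) :
    1 / 2 * (δ / grav) ^ 4 * min δ 1 * (z ^ 2 + q ^ 2) ≤
      quad (x ^ 2 * (grav * x ^ 3 - y ^ 2)) (-epsOf grav Λ * (x ^ 2 * (grav * x ^ 3 - y ^ 2)))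
        (x ^ 2 * x ^ 2 + -epsOf grav Λ * (x ^ 2 * (2 * (y * x)))) z q := by
  obtain ⟨hx0, hxd⟩ := height_pos_of_margin hg hδ h
  obtain ⟨h1, h2⟩ := margin_bounds hg hδ h
  set ε := epsOf grav Λ with hε
  have e0 : 0 < ε := epsOf_pos hg hΛ
  have e1 : ε * (1 + grav * Λ) = 1 / 8 := epsOf_mul hg hΛ
  have e2 : ε ≤ 1 / 8 := epsOf_le hg hΛ
  have hgx : grav * x ≤ grav * Λ := by gcongr
  have e3 : ε * (1 + grav * x) ≤ 1 / 8 := by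
    rw [← e1]; gcongr
  set a1 := grav * x ^ 3 - y ^ 2 with ha1
  have ha1g : a1 ≤ x ^ 2 * (grav * x) := by rw [ha1]; nlinarith [sq_nonneg y]
  have ha0 : 0 ≤ a1 := (by positivity : (0 : ℝ) ≤ δ * x ^ 2).trans h1
  -- Here `epsOf` shows its purpose: `ε (1 + g x) ≤ 1 / 8` makes both perturbations of the
  -- coefficient of `q²` small against `x²`.
  have t1 : ε * (2 * (y * x)) ≤ x ^ 2 / 8 := by
    have : 2 * (y * x) ≤ x ^ 2 * (1 + grav * x) := by
      have := (le_abs_self y).trans h2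
      nlinarith
    calc ε * (2 * (y * x)) ≤ ε * (x ^ 2 * (1 + grav * x)) := by gcongr
      _ = x ^ 2 * (ε * (1 + grav * x)) := by ring
      _ ≤ x ^ 2 * (1 / 8) := by gcongr
      _ = _ := by ring
  have t2 : ε ^ 2 * a1 ≤ x ^ 2 / 64 := by
    have e4 : ε * (grav * x) ≤ 1 / 8 := by nlinarith
    calc ε ^ 2 * a1 ≤ ε ^ 2 * (x ^ 2 * (grav * x)) := by gcongr
      _ = x ^ 2 * (ε * (ε * (grav * x))) := by ring
      _ ≤ x ^ 2 * (1 / 8 * (1 / 8)) := by gcongr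
      _ = _ := by ring
  have key : 1 / 2 * (δ * x ^ 2 * z ^ 2 + x ^ 2 * q ^ 2) ≤
      a1 * z ^ 2 - 2 * ε * a1 * (z * q) + (x ^ 2 - ε * (2 * (y * x))) * q ^ 2 := by
    -- Half of this square absorbs the cross term, using `a1 z² / 2` and `2 ε² a1 q²`.
    have k1 : 0 ≤ a1 * (z - 2 * ε * q) ^ 2 := by positivity
    have k2 := mul_le_mul_of_nonneg_right h1 (sq_nonneg z)
    have k3 := mul_le_mul_of_nonneg_right t1 (sq_nonneg q)
    have k4 := mul_le_mul_of_nonneg_right t2 (sq_nonneg q)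
    have k5 : 0 ≤ x ^ 2 * q ^ 2 := by positivity
    nlinarith
  have hm : min δ 1 * (z ^ 2 + q ^ 2) ≤ δ * z ^ 2 + q ^ 2 := by
    have := mul_le_mul_of_nonneg_right (min_le_left δ 1) (sq_nonneg z)
    have := mul_le_mul_of_nonneg_right (min_le_right δ 1) (sq_nonneg q)
    linarith
  have hpow : (δ / grav) ^ 4 ≤ x ^ 4 := by gcongr
  have hm0 : 0 ≤ min δ 1 * (z ^ 2 + q ^ 2) := mul_nonneg (le_min hδ.le zero_le_one) (by positivity)
  calc 1 / 2 * (δ / grav) ^ 4 * min δ 1 * (z ^ 2 + q ^ 2)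
      = 1 / 2 * (δ / grav) ^ 4 * (min δ 1 * (z ^ 2 + q ^ 2)) := by ring
    _ ≤ 1 / 2 * x ^ 4 * (δ * z ^ 2 + q ^ 2) := by gcongr
    _ = x ^ 2 * (1 / 2 * (δ * x ^ 2 * z ^ 2 + x ^ 2 * q ^ 2)) := by ring
    _ ≤ x ^ 2 * (a1 * z ^ 2 - 2 * ε * a1 * (z * q) + (x ^ 2 - ε * (2 * (y * x))) * q ^ 2) := by
        gcongr
    _ = _ := by unfold quad; ring

lemma coef_bounds (hg : 0 < grav) (hδ : 0 < δ) (h : δ ≤ grav * x - y ^ 2 / x ^ 2) {Λ : ℝ}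
    (hΛ : 1 ≤ Λ) (hx : x ≤ Λ) (hy : |y| ≤ Λ) :
    |x ^ 2| ≤ (grav + 2) * Λ ^ 3 ∧ |grav * x ^ 3 - y ^ 2| ≤ (grav + 2) * Λ ^ 3 ∧
      |2 * (y * x)| ≤ (grav + 2) * Λ ^ 3 := by
  obtain ⟨hx0, hxd⟩ := height_pos_of_margin hg hδ h
  obtain ⟨h1, h2⟩ := margin_bounds hg hδ h
  have hp : Λ ^ 2 ≤ Λ ^ 3 := pow_le_pow_right₀ hΛ (by norm_num)
  have hx2 : x ^ 2 ≤ Λ ^ 2 := by gcongr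
  have hx3 : x ^ 3 ≤ Λ ^ 3 := by gcongr
  have hg0 : 0 ≤ grav * Λ ^ 3 := by positivity
  have hl3 : 0 ≤ Λ ^ 3 := by positivity
  refine ⟨?_, ?_, ?_⟩
  · rw [abs_of_nonneg (sq_nonneg x)]; nlinarith
  · rw [abs_of_nonneg ((by positivity : (0 : ℝ) ≤ δ * x ^ 2).trans h1)]
    have : grav * x ^ 3 ≤ grav * Λ ^ 3 := by gcongr
    nlinarith [sq_nonneg y]
  · rw [abs_mul, abs_mul, abs_two, abs_of_pos hx0]
    have : |y| * x ≤ Λ * Λ := by gcongr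
    nlinarith

lemma abs_mul_le_of {a b B : ℝ} (ha : |a| ≤ B) (hb : |b| ≤ B) : |a * b| ≤ B ^ 2 := by
  rw [abs_mul, pow_two]
  exact mul_le_mul ha hb (abs_nonneg _) ((abs_nonneg _).trans ha)

lemma energy_upper {a0 a1 a2 B ε : ℝ} (h0 : |a0| ≤ B) (h1 : |a1| ≤ B) (h2 : |a2| ≤ B)
    (hε : |ε| ≤ 1) (z q : ℝ) :
    |quad (a0 * a1) (-ε * (a0 * a1)) (a0 * a0 + -ε * (a0 * a2)) z q| ≤
      4 * B ^ 2 * (z ^ 2 + q ^ 2) := by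
  have hB : 0 ≤ B := (abs_nonneg _).trans h0
  have he : ∀ {c : ℝ}, |c| ≤ B ^ 2 → |-ε * c| ≤ B ^ 2 := fun {c} hc => by
    rw [abs_mul, abs_neg]
    exact (mul_le_mul hε hc (abs_nonneg _) zero_le_one).trans_eq (one_mul _)
  have p0 := abs_mul_le_of h0 h1
  have p1 := abs_mul_le_of h0 h0
  have p2 := abs_mul_le_of h0 h2
  have := abs_quad_le (x := z) (y := q) (c := a0 * a0 + -ε * (a0 * a2)) (L := 2 * B ^ 2) (p0.trans (by nlinarith)) ((he p0).trans (by nlinarith))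
    ((abs_add_le _ _).trans (by linarith [he p2]))
  linarith

/-- The energy flux at the boundary. -/
lemma flux_le (hg : 0 < grav) (hδ : 0 < δ) (h : δ ≤ grav * x - y ^ 2 / x ^ 2) {Λ : ℝ}
    (hΛ : 1 ≤ Λ) (hx : x ≤ Λ) (hy : |y| ≤ Λ) {a0 a1 a2 : ℝ} (h0 : a0 = x ^ 2)
    (h1 : a1 = grav * x ^ 3 - y ^ 2) (h2 : a2 = 2 * (y * x)) (z q : ℝ) :
    quad (-epsOf grav Λ * (a1 * a1)) (a0 * a1 + -epsOf grav Λ * (a1 * a2))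
        (a0 * a2 + -epsOf grav Λ * (a1 * a0 + a2 * a2)) z q ≤
      (64 * (1 + grav) + 1) * (grav + 2) ^ 2 * Λ ^ 7 * q ^ 2 -
        (δ * (δ / grav) ^ 2) ^ 2 / (16 * (1 + grav)) / Λ * z ^ 2 := by
  obtain ⟨hx0, hxd⟩ := height_pos_of_margin hg hδ h
  obtain ⟨b0, b1, b2⟩ := coef_bounds hg hδ h hΛ hx hy
  have hm1 := (margin_bounds hg hδ h).1
  rw [← h0] at b0
  rw [← h1] at b1 hm1
  rw [← h2] at b2
  have a1m : δ * (δ / grav) ^ 2 ≤ a1 := le_trans (by gcongr) hm1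
  set B := (grav + 2) * Λ ^ 3 with hB
  set ε := epsOf grav Λ with hε
  have e0 : 0 < ε := epsOf_pos hg hΛ
  have e1 : ε * (1 + grav * Λ) = 1 / 8 := epsOf_mul hg hΛ
  have e2 : ε ≤ 1 / 8 := epsOf_le hg hΛ
  have hB0 : 0 ≤ B := by positivity
  have ha0 : 0 ≤ a0 := by rw [h0]; positivity
  have ha1 : 0 ≤ a1 := le_trans (by positivity) a1m
  have c1 : |a0 - ε * a2| ≤ 2 * B := by
    have : |ε * a2| ≤ B := by
      rw [abs_mul, abs_of_pos e0]
      exact (mul_le_mul_of_nonneg_left b2 e0.le).trans (mul_le_of_le_one_left hB0 (by linarith))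
    exact (abs_sub _ _).trans (by linarith)
  have c2 : (a0 - ε * a2) ^ 2 ≤ 4 * B ^ 2 := by
    rw [← sq_abs]
    calc _ ≤ (2 * B) ^ 2 := by gcongr
      _ = _ := by ring
  have c3 : a0 * a2 ≤ B ^ 2 := (le_abs_self _).trans (abs_mul_le_of b0 b2)
  have inv : 1 / ε = 8 * (1 + grav * Λ) := by
    rw [hε, epsOf, one_div_one_div]
  -- The inverse of `ε` costs one power of `Λ`, which added to the six powers in `B²` gives the
  -- exponent `7`.
  have inv' : 1 / ε ≤ 8 * (1 + grav) * Λ := by rw [inv]; linarith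
  -- Half of the good term `-ε a1² z²` pays for the cross term; the other half is the dissipation
  -- that remains.
  have young : 2 * ((a0 - ε * a2) * a1 * (z * q)) ≤
      ε / 2 * a1 ^ 2 * z ^ 2 + 2 * (1 / ε) * (a0 - ε * a2) ^ 2 * q ^ 2 := by
    have k : 0 ≤ 1 / (2 * ε) * (ε * a1 * z - 2 * (a0 - ε * a2) * q) ^ 2 := by positivity
    have e : 1 / (2 * ε) * (ε * a1 * z - 2 * (a0 - ε * a2) * q) ^ 2 =
        ε / 2 * a1 ^ 2 * z ^ 2 + 2 * (1 / ε) * (a0 - ε * a2) ^ 2 * q ^ 2 -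
        2 * ((a0 - ε * a2) * a1 * (z * q)) := by
      field_simp
      ring
    linarith
  have d1 : 2 * (1 / ε) * (a0 - ε * a2) ^ 2 * q ^ 2 ≤
      2 * (8 * (1 + grav) * Λ) * (4 * B ^ 2) * q ^ 2 := by gcongr
  have d2 : (a0 * a2 + -ε * (a1 * a0 + a2 * a2)) * q ^ 2 ≤ B ^ 2 * Λ * q ^ 2 := by
    gcongr
    have i1 : 0 ≤ ε * (a1 * a0 + a2 * a2) :=
      mul_nonneg e0.le (add_nonneg (by positivity) (mul_self_nonneg _))
    have i2 : B ^ 2 ≤ B ^ 2 * Λ := le_mul_of_one_le_right (by positivity) hΛ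
    linarith
  have d3 : (δ * (δ / grav) ^ 2) ^ 2 / (16 * (1 + grav)) / Λ * z ^ 2 ≤ ε / 2 * a1 ^ 2 * z ^ 2 := by
    gcongr ?_ * z ^ 2
    have f1 : (δ * (δ / grav) ^ 2) ^ 2 ≤ a1 ^ 2 := by gcongr
    have f2 : 1 / (16 * (1 + grav)) / Λ ≤ ε / 2 := by
      rw [div_div, div_le_iff₀ (by positivity)]
      have : ε * (1 + grav * Λ) ≤ ε * ((1 + grav) * Λ) :=
        mul_le_mul_of_nonneg_left (by linarith) e0.le
      linarith
    calc _ = 1 / (16 * (1 + grav)) / Λ * (δ * (δ / grav) ^ 2) ^ 2 := by ring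
      _ ≤ _ := by gcongr
  have hBsq : B ^ 2 = (grav + 2) ^ 2 * Λ ^ 6 := by rw [hB]; ring
  have d4 : 2 * (8 * (1 + grav) * Λ) * (4 * B ^ 2) * q ^ 2 + B ^ 2 * Λ * q ^ 2 =
      (64 * (1 + grav) + 1) * (grav + 2) ^ 2 * Λ ^ 7 * q ^ 2 := by rw [hBsq]; ring
  have e : quad (-ε * (a1 * a1)) (a0 * a1 + -ε * (a1 * a2))
        (a0 * a2 + -ε * (a1 * a0 + a2 * a2)) z q = -(ε * a1 ^ 2 * z ^ 2) +
        2 * ((a0 - ε * a2) * a1 * (z * q)) + (a0 * a2 + -ε * (a1 * a0 + a2 * a2)) * q ^ 2 := by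
    unfold quad; ring
  rw [e]
  linarith

end Pointwise

/-! ### Growth in time of square integrable functions -/

/-- The growth of the norm of a function with a time derivative. -/
lemma nsq_growth {T R : ℝ} (hT : 0 < T) (hR : 0 < R) {w wt : ℝ × ℝ → ℝ} {c : ℝ → ℝ}
    (hw : MemLp w 2 (stripMeasure T R)) (hwt : MemLp wt 2 (stripMeasure T R))
    (hc : MemLp c 2 (radialMeasure R)) (h : LineT T R w wt c) :
    ∀ᵐ t ∂(volume.restrict (Ioo 0 T)), nsq R w t ≤
      (∫ r, c r ^ 2 ∂(radialMeasure R)) + ∫ τ in Ioo 0 t, (nsq R w τ + nsq R wt τ) := by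
  have hs := isLeft_Ioo hT
  have hsq : LineT T R (fun p => w p * w p) (fun p => wt p * w p + w p * wt p)
      (fun r => c r * c r) := h.mul hT h
  have hi1 : Integrable (fun p => wt p * w p + w p * wt p) (stripMeasure T R) :=
    (hwt.integrable_mul hw).add (hw.integrable_mul hwt)
  have hi2 : Integrable (fun p => w p ^ 2 + wt p ^ 2) (stripMeasure T R) :=
    ((memLp_two_iff_integrable_sq hw.1).1 hw).add ((memLp_two_iff_integrable_sq hwt.1).1 hwt)
  have hwm := (MemLp.of_strip hR hw).1
  have hwtm := (MemLp.of_strip hR hwt).1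
  have hcm := (MemLp.of_radial hR hc).1
  have hci := (memLp_two_iff_integrable_sq hc.1).1 hc
  have hsec : ∀ᵐ r ∂(volume.restrict (Ioi R)),
      IntegrableOn (fun τ => wt (τ, r) * w (τ, r) + w (τ, r) * wt (τ, r)) (Ioo 0 T) ∧
      IntegrableOn (fun τ => w (τ, r) ^ 2 + wt (τ, r) ^ 2) (Ioo 0 T) := by
    rw [← ae_radialMeasure hR]
    rw [stripMeasure_eq_prod] at hi1 hi2
    filter_upwards [hi1.prod_left_ae, hi2.prod_left_ae] with r a b using ⟨a, b⟩
  filter_upwards [hsq.ae_eq hT (hwm.mul hwm) ((hwtm.mul hwm).add (hwm.mul hwtm)) (hcm.mul hcm),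
    ae_restrict_mem measurableSet_Ioo, MemLp.ae_section_left (stripMeasure_eq_prod T R ▸ hw)]
    with t ht htm hwt2
  have hsub : Ioo 0 t ⊆ Ioo 0 T := Ioo_subset_Ioo_right htm.2.le
  have hI : Integrable (fun p => w p ^ 2 + wt p ^ 2)
      ((volume.restrict (Ioo 0 t)).prod (radialMeasure R)) := by
    rw [stripMeasure_eq_prod] at hi2
    exact hi2.mono_measure (Measure.prod_mono (Measure.restrict_mono hsub le_rfl) le_rfl)
  have hpt : ∀ᵐ r ∂(radialMeasure R), w (t, r) ^ 2 ≤
      c r ^ 2 + ∫ τ in Ioo 0 t, (w (τ, r) ^ 2 + wt (τ, r) ^ 2) := by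
    rw [ae_radialMeasure hR]
    filter_upwards [ht, hsec] with r hr hrs
    rw [pow_two, hr, pow_two, intervalIntegral.integral_of_le htm.1.le, integral_Ioc_eq_integral_Ioo]
    refine add_le_add le_rfl (integral_mono (hrs.1.mono_set hsub) (hrs.2.mono_set hsub) fun τ => ?_)
    have := two_mul_le_add_sq (w (τ, r)) (wt (τ, r))
    simp only
    linarith
  have h1 := integral_mono_ae ((memLp_two_iff_integrable_sq hwt2.1).1 hwt2)
    (hci.add hI.integral_prod_right) hpt
  have h2 := integral_add hci hI.integral_prod_right
  simp only [Pi.add_apply] at h1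
  rw [h2,
    ← integral_integral_swap (f := fun τ r => w (τ, r) ^ 2 + wt (τ, r) ^ 2) hI] at h1
  refine h1.trans_eq ?_
  congr 1
  refine integral_congr_ae (ae_restrict_of_ae_restrict_of_subset hsub ?_)
  have m1 := MemLp.ae_section_left (stripMeasure_eq_prod T R ▸ hw)
  have m2 := MemLp.ae_section_left (stripMeasure_eq_prod T R ▸ hwt)
  filter_upwards [m1, m2] with τ a b
  exact integral_add ((memLp_two_iff_integrable_sq a.1).1 a) ((memLp_two_iff_integrable_sq b.1).1 b)

/-- The trace at `t = 0` of a continuous function. -/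
lemma LineT.trace_eq {T R : ℝ} (hT : 0 < T) {e et : ℝ × ℝ → ℝ} {c : ℝ → ℝ} (h : LineT T R e et c)
    (he : ContinuousOn e (closedStrip T R)) : LineT T R e et (fun r => e (0, r)) := by
  filter_upwards [h, ae_restrict_mem measurableSet_Ioi] with r a hr
  have hr' : R ≤ r := le_of_lt hr
  have hcu : ContinuousOn (fun t => e (t, r)) (Icc 0 (T / 2)) :=
    he.comp (by fun_prop) fun t ht => ⟨⟨ht.1, ht.2.trans (by linarith)⟩, hr'⟩
  have := a.congr_continuousOn (b := T / 2) (Ioo_subset_Ioo_right (by linarith)) (by linarith)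
    (a.int _ ⟨by linarith, by linarith⟩) hcu 0 ⟨le_rfl, by linarith⟩
  simp only [intervalIntegral.integral_same, add_zero] at this
  simpa only [this] using a

/-- The trace at `r = R` of a continuous function. -/
lemma LineR.trace_eq {T R : ℝ} {e er : ℝ × ℝ → ℝ} {c : ℝ → ℝ} (h : LineR T R e er c)
    (he : ContinuousOn e (closedStrip T R)) : LineR T R e er (fun t => e (t, R)) := by
  filter_upwards [h, ae_restrict_mem measurableSet_Ioo] with t a ht
  have hcu : ContinuousOn (fun r => e (t, r)) (Icc R (R + 1)) :=
    he.comp (by fun_prop) fun r hr => ⟨Ioo_subset_Icc_self ht, hr.1⟩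
  have := a.congr_continuousOn (b := R + 1) Ioo_subset_Ioi_self (by linarith)
    (a.int _ (by simp)) hcu R ⟨le_rfl, by linarith⟩
  simp only [intervalIntegral.integral_same, add_zero] at this
  simpa only [this] using a

/-! ### Estimates with constants polynomial in the coefficients -/

/-- The functions that enter the scalar form of the linear mixed problem. -/
structure SysData where
  T : ℝ
  H : ℕ → ℕ → ℝ × ℝ → ℝ
  Q : ℕ → ℕ → ℝ × ℝ → ℝ
  z : ℕ → ℕ → ℝ × ℝ → ℝ
  q : ℕ → ℕ → ℝ × ℝ → ℝ
  f₁ : ℕ → ℕ → ℝ × ℝ → ℝ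
  f₂ : ℕ → ℕ → ℝ × ℝ → ℝ
  cz : ℕ → ℕ → ℝ → ℝ
  cq : ℕ → ℕ → ℝ → ℝ
  bz : ℕ → ℝ → ℝ
  bq : ℕ → ℝ → ℝ

/-- The functions `D` form a solution of the linear mixed problem. -/
abbrev SysData.IsSys (D : SysData) (grav δ R : ℝ) (k : ℕ) (K : ℝ≥0∞) : Prop :=
  LinSys grav δ D.T R k (max k 2) K D.H D.Q D.z D.q D.f₁ D.f₂ D.cz D.cq D.bz D.bq

/-- The coefficients are bounded by `Λ` up to the time `ts`. -/
structure SysData.BddBy (D : SysData) (R Λ ts : ℝ) : Prop where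
  one_le : 1 ≤ Λ
  nonneg : 0 ≤ ts
  bound : ∀ p ∈ closedStrip D.T R, p.1 ≤ ts → D.H 0 0 p ≤ Λ ∧ |D.Q 0 0 p| ≤ Λ

/-- The sum of the norms of the solution and of the source. -/
noncomputable def SysData.src (D : SysData) (k : ℕ) (R t : ℝ) : ℝ :=
  solN k R D.z D.q t + solN k R D.f₁ D.f₂ t

/-- The initial norm. -/
noncomputable def SysData.ini (D : SysData) (k : ℕ) (R : ℝ) : ℝ :=
  dsum k fun i j => (∫ r, D.cz i j r ^ 2 ∂(radialMeasure R)) + ∫ r, D.cq i j r ^ 2 ∂(radialMeasure R)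

/-- The right-hand side of the estimates. -/
noncomputable def SysData.rhs (D : SysData) (k : ℕ) (R C t : ℝ) : ℝ :=
  D.ini k R + (∫ τ in Ioo 0 t, ∑ i ∈ Finset.range (k + 1), D.bq i τ ^ 2) +
    C * ∫ τ in Ioo 0 t, D.src k R τ

namespace SysData

variable {D : SysData} {k : ℕ} {R : ℝ}

lemma src_nonneg (D : SysData) (k : ℕ) (R t : ℝ) : 0 ≤ D.src k R t :=
  add_nonneg (solN_nonneg _ _ _ _ _) (solN_nonneg _ _ _ _ _)

lemma integral_src_nonneg (D : SysData) (k : ℕ) (R t : ℝ) : 0 ≤ ∫ τ in Ioo 0 t, D.src k R τ :=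
  integral_nonneg fun _ => D.src_nonneg k R _

lemma ini_nonneg (D : SysData) (k : ℕ) (R : ℝ) : 0 ≤ D.ini k R :=
  dsum_nonneg fun _ _ _ => add_nonneg (integral_nonneg fun _ => sq_nonneg _)
    (integral_nonneg fun _ => sq_nonneg _)

lemma integral_bq_nonneg (D : SysData) (k : ℕ) (t : ℝ) :
    0 ≤ ∫ τ in Ioo 0 t, ∑ i ∈ Finset.range (k + 1), D.bq i τ ^ 2 :=
  integral_nonneg fun _ => Finset.sum_nonneg fun _ _ => sq_nonneg _

lemma rhs_nonneg (D : SysData) (k : ℕ) (R t : ℝ) {C : ℝ} (hC : 0 ≤ C) : 0 ≤ D.rhs k R C t :=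
  add_nonneg (add_nonneg (D.ini_nonneg k R) (D.integral_bq_nonneg k t))
    (mul_nonneg hC (D.integral_src_nonneg k R t))

lemma rhs_mono (D : SysData) (k : ℕ) (R t : ℝ) {C C' : ℝ} (h : C ≤ C') :
    D.rhs k R C t ≤ D.rhs k R C' t := by
  unfold rhs
  gcongr
  exact D.integral_src_nonneg k R t

lemma integrableOn_solN {T : ℝ} {z q : ℕ → ℕ → ℝ × ℝ → ℝ}
    (hz : ∀ i j, i + j ≤ k → MemLp (z i j) 2 (stripMeasure T R))
    (hq : ∀ i j, i + j ≤ k → MemLp (q i j) 2 (stripMeasure T R)) :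
    IntegrableOn (solN k R z q) (Ioo 0 T) := by
  unfold solN dsum
  refine integrable_finsetSum _ fun i hi => integrable_finsetSum _ fun j hj => ?_
  rw [Finset.mem_range] at hi hj
  exact (integrableOn_nsq (hz i j (by omega))).add (integrableOn_nsq (hq i j (by omega)))

lemma integrableOn_src {grav δ : ℝ} {K : ℝ≥0∞} (h : D.IsSys grav δ R k K) :
    IntegrableOn (D.src k R) (Ioo 0 D.T) :=
  (integrableOn_solN (fun i j hij => h.memz i j (by omega)) fun i j hij => h.memq i j (by omega)).add
    (integrableOn_solN h.memf₁ h.memf₂)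

end SysData

/-- An estimate of a quantity `lhs` in which the prefactor is polynomial in the bound `Λ` of the
coefficients, while the factor of the integrals depends on the bounds of their derivatives. -/
def Est (grav δ R : ℝ) (k : ℕ) (lhs : SysData → ℝ → ℝ) : Prop :=
  ∃ (A : ℝ) (n : ℕ), 0 ≤ A ∧ ∀ K : ℝ≥0∞, K ≠ ⊤ → ∃ C : ℝ, 0 ≤ C ∧
    ∀ (D : SysData) (Λ ts : ℝ), D.IsSys grav δ R k K → D.BddBy R Λ ts →
      ∀ᵐ t ∂(volume.restrict (Ioo 0 D.T)), t ≤ ts → lhs D t ≤ A * Λ ^ n * D.rhs k R C t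

/-! ### Combination of estimates. -/

namespace Est

variable {grav δ R : ℝ} {k : ℕ} {u v w : SysData → ℝ → ℝ}

/-- The comparison factor must be chosen before `K`; it can then be absorbed in the prefactor and
`C` is unchanged. -/
lemma of_le (A : ℝ) (n : ℕ) (hA : 0 ≤ A) (hv : Est grav δ R k v)
    (h : ∀ K : ℝ≥0∞, K ≠ ⊤ → ∀ (D : SysData) (Λ ts : ℝ), D.IsSys grav δ R k K → D.BddBy R Λ ts →
      ∀ᵐ t ∂(volume.restrict (Ioo 0 D.T)), t ≤ ts → u D t ≤ A * Λ ^ n * v D t) :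
    Est grav δ R k u := by
  obtain ⟨A', n', hA', hv⟩ := hv
  refine ⟨A * A', n + n', by positivity, fun K hK => ?_⟩
  obtain ⟨C, hC, hv⟩ := hv K hK
  refine ⟨C, hC, fun D Λ ts hD hΛ => ?_⟩
  have h1 := hΛ.one_le
  filter_upwards [hv D Λ ts hD hΛ, h K hK D Λ ts hD hΛ] with t a b ht
  calc u D t ≤ A * Λ ^ n * v D t := b ht
    _ ≤ A * Λ ^ n * (A' * Λ ^ n' * D.rhs k R C t) := by gcongr; exact a ht
    _ = _ := by ring

lemma add (hu : Est grav δ R k u) (hv : Est grav δ R k v) :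
    Est grav δ R k (fun D t => u D t + v D t) := by
  obtain ⟨A, n, hA, hu⟩ := hu
  obtain ⟨A', n', hA', hv⟩ := hv
  refine ⟨A + A', n + n', by positivity, fun K hK => ?_⟩
  obtain ⟨C, hC, hu⟩ := hu K hK
  obtain ⟨C', hC', hv⟩ := hv K hK
  refine ⟨C + C', by positivity, fun D Λ ts hD hΛ => ?_⟩
  have h1 := hΛ.one_le
  filter_upwards [hu D Λ ts hD hΛ, hv D Λ ts hD hΛ] with t a b ht
  have r0 := D.rhs_nonneg k R t hC
  have r0' := D.rhs_nonneg k R t hC'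
  have e1 : Λ ^ n ≤ Λ ^ (n + n') := pow_le_pow_right₀ h1 (by omega)
  have e2 : Λ ^ n' ≤ Λ ^ (n + n') := pow_le_pow_right₀ h1 (by omega)
  calc u D t + v D t ≤ A * Λ ^ n * D.rhs k R C t + A' * Λ ^ n' * D.rhs k R C' t :=
        add_le_add (a ht) (b ht)
    _ ≤ A * Λ ^ (n + n') * D.rhs k R (C + C') t + A' * Λ ^ (n + n') * D.rhs k R (C + C') t := by
        gcongr
        · exact D.rhs_mono k R t (by linarith)
        · exact D.rhs_mono k R t (by linarith)
    _ = _ := by ring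

lemma zero : Est grav δ R k (fun _ _ => 0) :=
  ⟨0, 0, le_rfl, fun _ _ => ⟨0, le_rfl, fun _ _ _ _ _ => Eventually.of_forall fun _ _ => by simp⟩⟩

lemma sum {ι : Type*} (s : Finset ι) {f : ι → SysData → ℝ → ℝ}
    (h : ∀ i ∈ s, Est grav δ R k (f i)) : Est grav δ R k (fun D t => ∑ i ∈ s, f i D t) := by
  classical
  induction s using Finset.induction_on with
  | empty => simpa using zero
  | insert i s hi ih =>
    simp only [Finset.sum_insert hi]
    exact (h i (Finset.mem_insert_self _ _)).add (ih fun j hj => h j (Finset.mem_insert_of_mem hj))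

end Est

/-! ### Values and bounds of the coefficients -/

section Values

variable {X : Type*} (grav ε : ℝ) (H Q : ℕ → ℕ → X → ℝ) (p : X)

lemma arr0_zero : arr0 H 0 0 p = H 0 0 p ^ 2 := by simp only [arr0, leib_zero]; ring

lemma arr1_zero : arr1 grav H Q 0 0 p = grav * H 0 0 p ^ 3 - Q 0 0 p ^ 2 := by
  simp only [arr1, leib_zero, arr0_zero]; ring

lemma arr2_zero : arr2 H Q 0 0 p = 2 * (Q 0 0 p * H 0 0 p) := by simp only [arr2, leib_zero]

end Values

/-- The coefficients of the equations. -/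
def coefA (grav : ℝ) (H Q : ℕ → ℕ → ℝ × ℝ → ℝ) : Fin 3 → ℕ → ℕ → ℝ × ℝ → ℝ :=
  ![arr0 H, arr1 grav H Q, arr2 H Q]

/-- The coefficients of the energy. -/
def coefS (grav ε : ℝ) (H Q : ℕ → ℕ → ℝ × ℝ → ℝ) : Fin 3 → ℕ → ℕ → ℝ × ℝ → ℝ :=
  ![ene11 grav H Q, ene12 grav ε H Q, ene22 ε H Q]

/-- The coefficients of the energy flux. -/
def coefP (grav ε : ℝ) (H Q : ℕ → ℕ → ℝ × ℝ → ℝ) : Fin 3 → ℕ → ℕ → ℝ × ℝ → ℝ :=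
  ![flx11 grav ε H Q, flx12 grav ε H Q, flx22 grav ε H Q]

/-! ### The coefficients along a solution of the scalar system. -/

section Coefficients

variable {grav δ R : ℝ} {k : ℕ} {K : ℝ≥0∞} {D : SysData}

lemma fam_coef (h : D.IsSys grav δ R k K) (ε : ℝ) (m : Fin 3) :
    Fam (max k 2) D.T R (coefA grav D.H D.Q m) ∧ Fam (max k 2) D.T R (coefS grav ε D.H D.Q m) ∧
      Fam (max k 2) D.T R (coefP grav ε D.H D.Q m) := by
  obtain ⟨e1, e2, e3, e4, e5, e6⟩ := h.famH.energy grav ε h.T_pos h.famQ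
  have a0 := h.famH.arr0 h.T_pos
  have a1 := h.famH.arr1 grav h.T_pos h.famQ
  have a2 := h.famH.arr2 h.T_pos h.famQ
  fin_cases m
  · exact ⟨a0, e1, e4⟩
  · exact ⟨a1, e2, e5⟩
  · exact ⟨a2, e3, e6⟩

/-- The energy identity differentiates the coefficients once, and orders at most `1` are below `max
k 2`, hence bounded: this is why the coefficient needs at least the regularity `X²`. -/
lemma exists_coef_bdd (grav δ R : ℝ) (k : ℕ) (hK : K ≠ ⊤) : ∃ L : ℝ, 0 ≤ L ∧
    ∀ (D : SysData), D.IsSys grav δ R k K → ∀ ε : ℝ, |ε| ≤ 1 → ∀ i j, i + j ≤ 1 →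
      ∀ᵐ p ∂(stripVol D.T R), ∀ m, |coefA grav D.H D.Q m i j p| ≤ L ∧
        |coefS grav ε D.H D.Q m i j p| ≤ L ∧ |coefP grav ε D.H D.Q m i j p| ≤ L := by
  have h2 : 2 ≤ max k 2 := le_max_right _ _
  obtain ⟨B, hB, hBb⟩ := exists_coef_bound (n := max k 2) grav (by omega) hK
  refine ⟨B.toReal, ENNReal.toReal_nonneg, fun D h ε hε i j hij => ?_⟩
  have hb : ∀ m, (∀ᵐ t ∂(volume.restrict (Ioo 0 D.T)),
      eLpNorm (fun r => coefA grav D.H D.Q m i j (t, r)) ⊤ (radialMeasure R) ≤ B ∧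
      eLpNorm (fun r => coefS grav ε D.H D.Q m i j (t, r)) ⊤ (radialMeasure R) ≤ B ∧
      eLpNorm (fun r => coefP grav ε D.H D.Q m i j (t, r)) ⊤ (radialMeasure R) ≤ B) := by
    intro m
    filter_upwards [h.coefH, h.coefQ] with t cH cQ
    obtain ⟨⟨a0, a1, a2, -⟩, ⟨s0, s1, s2⟩, p0, p1, p2⟩ := hBb _ _ _ ε hε cH cQ
    have hlt : i + j < max k 2 := by omega
    fin_cases m
    · exact ⟨a0.top i j hlt, s0.top i j hlt, p0.top i j hlt⟩
    · exact ⟨a1.top i j hlt, s1.top i j hlt, p1.top i j hlt⟩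
    · exact ⟨a2.top i j hlt, s2.top i j hlt, p2.top i j hlt⟩
  rw [ae_all_iff]
  intro m
  have hf := fam_coef h ε m
  have hlt : i + j ≤ max k 2 := by omega
  filter_upwards [ae_bound_of_slices h.R_pos hB (hf.1.meas i j hlt) ((hb m).mono fun t ht => ht.1),
    ae_bound_of_slices h.R_pos hB (hf.2.1.meas i j hlt) ((hb m).mono fun t ht => ht.2.1),
    ae_bound_of_slices h.R_pos hB (hf.2.2.meas i j hlt) ((hb m).mono fun t ht => ht.2.2)]
    with p a b c using ⟨a, b, c⟩

/-- For the matrix with rows `(0, 1)` and `(a₁/a₀, a₂/a₀)`, these are the entries of `S` and of the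
symmetric product `P = S A`, in a form free of division. -/
lemma coef_rel (grav ε : ℝ) (H Q : ℕ → ℕ → ℝ × ℝ → ℝ) (p : ℝ × ℝ) :
    (coefS grav ε H Q 0 0 0 p = coefA grav H Q 0 0 0 p * coefA grav H Q 1 0 0 p) ∧
    (coefS grav ε H Q 1 0 0 p = -ε * (coefA grav H Q 0 0 0 p * coefA grav H Q 1 0 0 p)) ∧
    (coefS grav ε H Q 2 0 0 p = coefA grav H Q 0 0 0 p * coefA grav H Q 0 0 0 p +
      -ε * (coefA grav H Q 0 0 0 p * coefA grav H Q 2 0 0 p)) ∧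
    (coefP grav ε H Q 0 0 0 p = -ε * (coefA grav H Q 1 0 0 p * coefA grav H Q 1 0 0 p)) ∧
    (coefP grav ε H Q 1 0 0 p = coefA grav H Q 0 0 0 p * coefA grav H Q 1 0 0 p +
      -ε * (coefA grav H Q 1 0 0 p * coefA grav H Q 2 0 0 p)) ∧
    (coefP grav ε H Q 2 0 0 p = coefA grav H Q 0 0 0 p * coefA grav H Q 2 0 0 p +
      -ε * (coefA grav H Q 1 0 0 p * coefA grav H Q 0 0 0 p +
        coefA grav H Q 2 0 0 p * coefA grav H Q 2 0 0 p)) := by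
  refine ⟨?_, ?_, ?_, ?_, ?_, ?_⟩ <;>
    simp only [coefS, coefP, coefA, Matrix.cons_val_zero, Matrix.cons_val_one, Matrix.cons_val,
      ene11, ene12, ene22, flx11, flx12, flx22, leib_zero]

lemma coefA_zero (grav : ℝ) (H Q : ℕ → ℕ → ℝ × ℝ → ℝ) (p : ℝ × ℝ) :
    (coefA grav H Q 0 0 0 p = H 0 0 p ^ 2) ∧
    (coefA grav H Q 1 0 0 p = grav * H 0 0 p ^ 3 - Q 0 0 p ^ 2) ∧
    (coefA grav H Q 2 0 0 p = 2 * (Q 0 0 p * H 0 0 p)) :=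
  ⟨arr0_zero H p, arr1_zero grav H Q p, arr2_zero H Q p⟩

lemma continuousOn_coef (h : D.IsSys grav δ R k K) (ε : ℝ) (m : Fin 3) :
    ContinuousOn (coefA grav D.H D.Q m 0 0) (closedStrip D.T R) ∧
    ContinuousOn (coefS grav ε D.H D.Q m 0 0) (closedStrip D.T R) ∧
    ContinuousOn (coefP grav ε D.H D.Q m 0 0) (closedStrip D.T R) := by
  have hH := h.contH
  have hQ := h.contQ
  have hA : ∀ m, ContinuousOn (coefA grav D.H D.Q m 0 0) (closedStrip D.T R) := by
    intro m
    fin_cases m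
    · exact (hH.pow 2).congr fun p _ => arr0_zero D.H p
    · exact (((hH.pow 3).const_mul grav).sub (hQ.pow 2)).congr fun p _ => arr1_zero grav D.H D.Q p
    · exact ((hQ.mul hH).const_mul 2).congr fun p _ => arr2_zero D.H D.Q p
  have a0 := hA 0
  have a1 := hA 1
  have a2 := hA 2
  refine ⟨hA m, ?_, ?_⟩
  · fin_cases m
    · exact (a0.mul a1).congr fun p _ => (coef_rel grav ε D.H D.Q p).1
    · exact ((a0.mul a1).const_mul (-ε)).congr fun p _ => (coef_rel grav ε D.H D.Q p).2.1
    · exact ((a0.mul a0).add ((a0.mul a2).const_mul (-ε))).congr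
        fun p _ => (coef_rel grav ε D.H D.Q p).2.2.1
  · fin_cases m
    · exact ((a1.mul a1).const_mul (-ε)).congr fun p _ => (coef_rel grav ε D.H D.Q p).2.2.2.1
    · exact ((a0.mul a1).add ((a1.mul a2).const_mul (-ε))).congr
        fun p _ => (coef_rel grav ε D.H D.Q p).2.2.2.2.1
    · exact ((a0.mul a2).add (((a1.mul a0).add (a2.mul a2)).const_mul (-ε))).congr
        fun p _ => (coef_rel grav ε D.H D.Q p).2.2.2.2.2

/-- The pointwise bounds of the coefficients of the equations. -/
lemma coefA_le (hg : 0 < grav) (hδ : 0 < δ) (h : D.IsSys grav δ R k K) {Λ ts : ℝ}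
    (hΛ : D.BddBy R Λ ts) {p : ℝ × ℝ} (hp : p ∈ closedStrip D.T R) (hts : p.1 ≤ ts) (m : Fin 3) :
    |coefA grav D.H D.Q m 0 0 p| ≤ (grav + 2) * Λ ^ 3 := by
  obtain ⟨h1, h2⟩ := hΛ.bound p hp hts
  obtain ⟨b0, b1, b2⟩ := coef_bounds hg hδ (h.subsonic p hp) hΛ.one_le h1 h2
  obtain ⟨e0, e1, e2⟩ := coefA_zero grav D.H D.Q p
  fin_cases m
  · exact e0 ▸ b0
  · exact e1 ▸ b1
  · exact e2 ▸ b2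

end Coefficients

/-! ### The energy estimate for time derivatives -/

lemma integrable_quad {X : Type*} [MeasurableSpace X] {μ : Measure X} {a b c x y : X → ℝ} {L : ℝ}
    (ha : AEStronglyMeasurable a μ) (hb : AEStronglyMeasurable b μ) (hc : AEStronglyMeasurable c μ)
    (hx : MemLp x 2 μ) (hy : MemLp y 2 μ)
    (h : ∀ᵐ p ∂μ, |quad (a p) (b p) (c p) (x p) (y p)| ≤ L * (x p ^ 2 + y p ^ 2)) :
    Integrable (fun p => quad (a p) (b p) (c p) (x p) (y p)) μ := by
  have hxi := (memLp_two_iff_integrable_sq hx.1).1 hx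
  have hyi := (memLp_two_iff_integrable_sq hy.1).1 hy
  refine Integrable.mono' ((hxi.add hyi).const_mul L) ?_ h
  unfold quad
  exact ((ha.mul (hx.1.pow 2)).add ((hb.mul (hx.1.mul hy.1)).const_mul 2)).add (hc.mul (hy.1.pow 2))

lemma measurable_slice_left {T R : ℝ} (hT : 0 < T) {e : ℝ × ℝ → ℝ}
    (he : ContinuousOn e (closedStrip T R)) :
    AEStronglyMeasurable (fun r => e (0, r)) (radialMeasure R) := by
  refine AEStronglyMeasurable.mono_ac (radialMeasure_ac R) ?_
  refine ContinuousOn.aestronglyMeasurable ?_ measurableSet_Ioi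
  exact he.comp (by fun_prop) fun r hr => ⟨⟨le_rfl, hT.le⟩, le_of_lt (show R < r from hr)⟩

section

variable {grav δ R : ℝ} {k : ℕ} {K : ℝ≥0∞} {D : SysData}

lemma ae_mem_slices (h : D.IsSys grav δ R k K) : ∀ᵐ t ∂(volume.restrict (Ioo 0 D.T)),
    ∀ i j, i + j ≤ k + 1 → MemLp (fun r => D.z i j (t, r)) 2 (radialMeasure R) ∧
      MemLp (fun r => D.q i j (t, r)) 2 (radialMeasure R) := by
  simp only [ae_all_iff, eventually_imp_distrib_left]
  intro i j hij
  have a := h.memz i j hij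
  have b := h.memq i j hij
  rw [stripMeasure_eq_prod] at a b
  filter_upwards [MemLp.ae_section_left a, MemLp.ae_section_left b] with t a b using ⟨a, b⟩

lemma le_solN (z q : ℕ → ℕ → ℝ × ℝ → ℝ) (R t : ℝ) {i j : ℕ} (hij : i + j ≤ k) :
    nsq R (z i j) t + nsq R (q i j) t ≤ solN k R z q t :=
  le_dsum (a := fun i j => nsq R (z i j) t + nsq R (q i j) t)
    (fun _ _ _ => add_nonneg (nsq_nonneg _ _ _) (nsq_nonneg _ _ _)) hij

lemma le_ini (D : SysData) (R : ℝ) {i j : ℕ} (hij : i + j ≤ k) :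
    (∫ r, D.cz i j r ^ 2 ∂(radialMeasure R)) + ∫ r, D.cq i j r ^ 2 ∂(radialMeasure R) ≤ D.ini k R :=
  le_dsum (a := fun i j => (∫ r, D.cz i j r ^ 2 ∂(radialMeasure R)) +
      ∫ r, D.cq i j r ^ 2 ∂(radialMeasure R))
    (fun _ _ _ => add_nonneg (integral_nonneg fun _ => sq_nonneg _)
      (integral_nonneg fun _ => sq_nonneg _)) hij

lemma mem_bz (h : D.IsSys grav δ R k K) {i : ℕ} (hi : i ≤ k) :
    MemLp (D.bz i) 2 (volume.restrict (Ioo 0 D.T)) ∧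
      MemLp (D.bq i) 2 (volume.restrict (Ioo 0 D.T)) :=
  ⟨(h.boundz i hi).memLp h.R_pos (h.memz i 0 (by omega)) (h.memz i 1 (by omega)),
    (h.boundq i hi).memLp h.R_pos (h.memq i 0 (by omega)) (h.memq i 1 (by omega))⟩

lemma integral_bq_le (h : D.IsSys grav δ R k K) {i : ℕ} (hi : i ≤ k) {t : ℝ} (ht : t ≤ D.T) :
    ∫ τ in Ioo 0 t, D.bq i τ ^ 2 ≤
      ∫ τ in Ioo 0 t, ∑ i ∈ Finset.range (k + 1), D.bq i τ ^ 2 := by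
  have hsub : Ioo 0 t ⊆ Ioo 0 D.T := Ioo_subset_Ioo_right ht
  have hint : ∀ i ≤ k, IntegrableOn (fun τ => D.bq i τ ^ 2) (Ioo 0 t) := fun i hi =>
    IntegrableOn.mono_set ((memLp_two_iff_integrable_sq (mem_bz h hi).2.1).1 (mem_bz h hi).2) hsub
  refine integral_mono (hint i hi) (integrable_finsetSum _ fun j hj => hint j (by
    rw [Finset.mem_range] at hj; omega)) fun τ => ?_
  exact Finset.single_le_sum (f := fun i => D.bq i τ ^ 2) (fun j _ => sq_nonneg _)
    (Finset.mem_range.2 (by omega))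

/-- The estimate of the pure time derivatives and of their traces. -/
lemma est_energy (hg : 0 < grav) (hδ : 0 < δ) (hR : 0 < R) {i : ℕ} (hi : i ≤ k) :
    Est grav δ R k (fun D t => nsq R (D.z i 0) t + nsq R (D.q i 0) t +
      ∫ τ in Ioo 0 t, (D.bz i τ ^ 2 + D.bq i τ ^ 2)) := by
  set m := 1 / 2 * (δ / grav) ^ 4 * min δ 1 with hm
  set m₂ := (δ * (δ / grav) ^ 2) ^ 2 / (16 * (1 + grav)) with hm₂
  set A₇ := (64 * (1 + grav) + 1) * (grav + 2) ^ 2 with hA₇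
  have hm0 : 0 < m := by
    have : 0 < min δ 1 := lt_min hδ one_pos
    positivity
  have hm₂0 : 0 < m₂ := by positivity
  -- `m` is the coercivity of the energy and `m₂ / Λ` the dissipation in the flux; dividing by `μ /
  -- Λ` raises the exponent `7` of the flux bound to `8`.
  set μ := min m (R * m₂) with hμ
  have hμ0 : 0 < μ := lt_min hm0 (by positivity)
  refine ⟨1 / μ * (4 * (grav + 2) ^ 2 + R * (A₇ + m₂) + 1), 8, by positivity, fun K hK => ?_⟩
  obtain ⟨L, hL, hLb⟩ := exists_coef_bdd grav δ R k hK
  obtain ⟨C₁, hC₁, hred⟩ := exists_red_bound grav hR k hK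
  set C₂ := 2 * L / R + 4 * L + 10 * L ^ 2 + 1 with hC₂
  have hC₂0 : 0 ≤ C₂ := by positivity
  refine ⟨C₂ * (1 + 2 * C₁), by positivity, fun D Λ ts h hΛ => ?_⟩
  have hΛ1 := hΛ.one_le
  have hΛ0 : 0 < Λ := zero_lt_one.trans_le hΛ1
  have hT := h.T_pos
  -- `ε` depends on `Λ`, which is chosen after `K`; since `|ε| ≤ 1`, the bounds from
  -- `exists_coef_bdd` do not see it.
  set ε := epsOf grav Λ with hε
  have hε0 : 0 < ε := epsOf_pos hg hΛ1
  have hε1 : |ε| ≤ 1 := by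
    rw [abs_of_pos hε0]; exact (epsOf_le hg hΛ1).trans (by norm_num)
  set a := coefA grav D.H D.Q with ha
  set S := coefS grav ε D.H D.Q with hS
  set P := coefP grav ε D.H D.Q with hP
  have hm1 : (0 : ℕ) + 0 ≤ max k 2 := by omega
  have hlt : (0 : ℕ) + 0 < max k 2 := by have := h.two_le; omega
  have hm2 : (1 : ℕ) + 0 ≤ max k 2 := by have := h.two_le; omega
  have hm3 : (0 : ℕ) + 1 ≤ max k 2 := by have := h.two_le; omega
  have hfam := fam_coef h ε
  have hcon := continuousOn_coef h ε
  -- As the coefficients are continuous, their traces at `t = 0` and at `r = R` are their values, to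
  -- which the pointwise bounds apply.
  have lS : ∀ m, LineT D.T R (S m 0 0) (S m 1 0) (fun r => S m 0 0 (0, r)) := fun m => by
    obtain ⟨c, hc⟩ := (hfam m).2.1.dt 0 0 hlt
    exact hc.trace_eq hT (hcon m).2.1
  have lP : ∀ m, LineR D.T R (P m 0 0) (P m 0 1) (fun t => P m 0 0 (t, R)) := fun m => by
    obtain ⟨c, hc⟩ := (hfam m).2.2.dr 0 0 hlt
    exact hc.trace_eq (hcon m).2.2
  set B := (grav + 2) * Λ ^ 3 with hB
  have rel := coef_rel grav ε D.H D.Q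
  have val := coefA_zero grav D.H D.Q
  have hup : ∀ p ∈ closedStrip D.T R, p.1 ≤ ts → ∀ x y : ℝ,
      |quad (S 0 0 0 p) (S 1 0 0 p) (S 2 0 0 p) x y| ≤ 4 * B ^ 2 * (x ^ 2 + y ^ 2) := by
    intro p hp hts x y
    rw [hS, (rel p).1, (rel p).2.1, (rel p).2.2.1]
    exact energy_upper (coefA_le hg hδ h hΛ hp hts 0) (coefA_le hg hδ h hΛ hp hts 1)
      (coefA_le hg hδ h hΛ hp hts 2) hε1 x y
  have hlow : ∀ p ∈ closedStrip D.T R, p.1 ≤ ts → ∀ x y : ℝ,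
      m * (x ^ 2 + y ^ 2) ≤ quad (S 0 0 0 p) (S 1 0 0 p) (S 2 0 0 p) x y := by
    intro p hp hts x y
    rw [hS, (rel p).1, (rel p).2.1, (rel p).2.2.1, (val p).1, (val p).2.1, (val p).2.2]
    exact energy_ge hg hδ (h.subsonic p hp) hΛ1 (hΛ.bound p hp hts).1 x y
  have hflux : ∀ p ∈ closedStrip D.T R, p.1 ≤ ts → ∀ x y : ℝ,
      quad (P 0 0 0 p) (P 1 0 0 p) (P 2 0 0 p) x y ≤ A₇ * Λ ^ 7 * y ^ 2 - m₂ / Λ * x ^ 2 := by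
    intro p hp hts x y
    rw [hP, (rel p).2.2.2.1, (rel p).2.2.2.2.1, (rel p).2.2.2.2.2]
    exact flux_le hg hδ (h.subsonic p hp) hΛ1 (hΛ.bound p hp hts).1 (hΛ.bound p hp hts).2
      (val p).1 (val p).2.1 (val p).2.2 x y
  have hcz := h.memcz i 0 (by omega)
  have hcq := h.memcq i 0 (by omega)
  have hin0 : ∀ᵐ r ∂(radialMeasure R), ((0 : ℝ), r) ∈ closedStrip D.T R := by
    rw [ae_radialMeasure hR]
    filter_upwards [ae_restrict_mem measurableSet_Ioi] with r hr
    exact ⟨⟨le_rfl, hT.le⟩, le_of_lt (show R < r from hr)⟩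
  have h0 : Integrable (fun r => quad (S 0 0 0 (0, r)) (S 1 0 0 (0, r)) (S 2 0 0 (0, r))
      (D.cz i 0 r) (D.cq i 0 r)) (radialMeasure R) :=
    integrable_quad (L := 4 * B ^ 2) (measurable_slice_left hT (hcon 0).2.1)
      (measurable_slice_left hT (hcon 1).2.1) (measurable_slice_left hT (hcon 2).2.1) hcz hcq
      (hin0.mono fun r hr => hup _ hr hΛ.nonneg _ _)
  have hE := energy_le hT hR hL hε1 (a := fun m => a m 0 0) (S := fun m => S m 0 0)
    (St := fun m => S m 1 0) (P := fun m => P m 0 0) (Pr := fun m => P m 0 1)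
    (fun m => (hfam m).1.meas 0 0 hm1) (fun m => (hfam m).2.1.meas 0 0 hm1)
    (fun m => (hfam m).2.1.meas 1 0 hm2) (fun m => (hfam m).2.2.meas 0 0 hm1)
    (fun m => (hfam m).2.2.meas 0 1 hm3)
    (by
      filter_upwards [hLb D h ε hε1 0 0 (by omega), hLb D h ε hε1 1 0 (by omega),
        hLb D h ε hε1 0 1 (by omega)] with p b0 b1 b2 m
      exact ⟨(b0 m).1, (b0 m).2.1, (b1 m).2.1, (b0 m).2.2, (b2 m).2.2⟩)
    lS lP (fun p => (rel p).1) (fun p => (rel p).2.1) (fun p => (rel p).2.2.1)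
    (fun p => (rel p).2.2.2.1) (fun p => (rel p).2.2.2.2.1) (fun p => (rel p).2.2.2.2.2)
    (h.memz i 0 (by omega)) (h.memz (i + 1) 0 (by omega)) (h.memz i 1 (by omega))
    (h.memq i 0 (by omega)) (h.memq (i + 1) 0 (by omega)) (h.memq i 1 (by omega))
    (h.tracez i 0 (by omega)) (h.traceq i 0 (by omega)) (h.boundz i hi) (h.boundq i hi) h0
  obtain ⟨hflint, hsrc, hE⟩ := hE
  have hbz := (memLp_two_iff_integrable_sq (mem_bz h hi).1.1).1 (mem_bz h hi).1
  have hbq := (memLp_two_iff_integrable_sq (mem_bz h hi).2.1).1 (mem_bz h hi).2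
  -- The last two squares are those of `red1` and `red2`; `exists_red_bound` controls each of them
  -- by `C₁` times the source.
  have hsrcle : ∀ᵐ τ ∂(volume.restrict (Ioo 0 D.T)),
      ∫ r, (D.z i 0 (τ, r) ^ 2 + D.q i 0 (τ, r) ^ 2 + (D.z (i + 1) 0 (τ, r) + D.q i 1 (τ, r)) ^ 2 +
        (a 0 0 0 (τ, r) * D.q (i + 1) 0 (τ, r) + a 1 0 0 (τ, r) * D.z i 1 (τ, r) +
          a 2 0 0 (τ, r) * D.q i 1 (τ, r)) ^ 2) ∂(radialMeasure R) ≤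
      (1 + 2 * C₁) * D.src k R τ := by
    have hred2m : MemLp (red2 grav D.H D.Q D.z D.q i 0) 2 (stripMeasure D.T R) := by
      have bm : ∀ (m : Fin 3) {x : ℝ × ℝ → ℝ}, MemLp x 2 (stripMeasure D.T R) →
          MemLp (fun p => a m 0 0 p * x p) 2 (stripMeasure D.T R) := by
        intro m x hx
        refine MemLp.of_le_mul (c := L) hx ((((hfam m).1.meas 0 0 hm1).mono_ac
          (stripMeasure_ac D.T R)).mul hx.1) ?_
        rw [ae_stripMeasure hR]
        filter_upwards [hLb D h ε hε1 0 0 (by omega)] with p hp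
        rw [norm_mul]
        gcongr
        exact (hp m).1
      exact ((bm 0 (h.memq (i + 1) 0 (by omega))).add (bm 1 (h.memz i 1 (by omega)))).add
        (bm 2 (h.memq i 1 (by omega)))
    have m2 := MemLp.ae_section_left (stripMeasure_eq_prod D.T R ▸ hred2m)
    filter_upwards [hred δ D.T D.H D.Q D.z D.q D.f₁ D.f₂ D.cz D.cq D.bz D.bq h, ae_mem_slices h, m2]
      with τ b c d
    have sq : ∀ {x : ℝ → ℝ}, MemLp x 2 (radialMeasure R) → Integrable (fun r => x r ^ 2) (radialMeasure R) :=
      fun hx => (memLp_two_iff_integrable_sq hx.1).1 hx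
    have i1 := sq (c i 0 (by omega)).1
    have i2 := sq (c i 0 (by omega)).2
    have i3 := sq ((c (i + 1) 0 (by omega)).1.add (c i 1 (by omega)).2)
    have i4 := sq d
    have e := integral_add ((i1.add i2).add i3) i4
    have e' := integral_add (i1.add i2) i3
    have e'' := integral_add i1 i2
    simp only [Pi.add_apply] at e e' e''
    refine e.trans_le ?_
    rw [e', e'']
    obtain ⟨b1, b2⟩ := b i 0 (by omega)
    have b3 := le_solN (k := k) D.z D.q R τ (i := i) (j := 0) (by omega)
    have b4 := solN_nonneg k R D.f₁ D.f₂ τ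
    have : (1 + 2 * C₁) * D.src k R τ = solN k R D.z D.q τ + solN k R D.f₁ D.f₂ τ
      + C₁ * (solN k R D.z D.q τ + solN k R D.f₁ D.f₂ τ)
      + C₁ * (solN k R D.z D.q τ + solN k R D.f₁ D.f₂ τ) := by
        unfold SysData.src; ring
    rw [this]
    unfold nsq red1 at b1
    unfold nsq at b2 b3
    linarith
  have hSm : ∀ᵐ t ∂(volume.restrict (Ioo 0 D.T)), ∀ m,
      AEStronglyMeasurable (fun r => S m 0 0 (t, r)) (radialMeasure R) := by
    rw [ae_all_iff]
    intro m
    filter_upwards [((hfam m).2.1.meas 0 0 hm1).prodMk_left] with t ht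
    exact ht.mono_ac (radialMeasure_ac R)
  have hsrci : IntegrableOn (fun τ => ∫ r, (D.z i 0 (τ, r) ^ 2 + D.q i 0 (τ, r) ^ 2 +
        (D.z (i + 1) 0 (τ, r) + D.q i 1 (τ, r)) ^ 2 +
        (a 0 0 0 (τ, r) * D.q (i + 1) 0 (τ, r) + a 1 0 0 (τ, r) * D.z i 1 (τ, r) +
          a 2 0 0 (τ, r) * D.q i 1 (τ, r)) ^ 2) ∂(radialMeasure R)) (Ioo 0 D.T) := by
    rw [stripMeasure_eq_prod] at hsrc
    exact hsrc.integral_prod_left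
  filter_upwards [hE, hSm, ae_mem_slices h, ae_restrict_mem measurableSet_Ioo] with t hEt hSt hmt ht hts
  have hsub : Ioo 0 t ⊆ Ioo 0 D.T := Ioo_subset_Ioo_right ht.2.le
  obtain ⟨hzt, hqt⟩ := hmt i 0 (by omega)
  have hzi := (memLp_two_iff_integrable_sq hzt.1).1 hzt
  have hqi := (memLp_two_iff_integrable_sq hqt.1).1 hqt
  have hint : ∀ᵐ r ∂(radialMeasure R), (t, r) ∈ closedStrip D.T R := by
    rw [ae_radialMeasure hR]
    filter_upwards [ae_restrict_mem measurableSet_Ioi] with r hr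
    exact ⟨Ioo_subset_Icc_self ht, le_of_lt (show R < r from hr)⟩
  have low : m * (nsq R (D.z i 0) t + nsq R (D.q i 0) t) ≤
      ∫ r, quad (S 0 0 0 (t, r)) (S 1 0 0 (t, r)) (S 2 0 0 (t, r)) (D.z i 0 (t, r)) (D.q i 0 (t, r))
        ∂(radialMeasure R) := by
    unfold nsq
    rw [← integral_add hzi hqi, ← integral_const_mul]
    refine integral_mono_ae ((hzi.add hqi).const_mul m)
      (integrable_quad (L := 4 * B ^ 2) (hSt 0) (hSt 1) (hSt 2) hzt hqt
        (hint.mono fun r hr => hup _ hr hts _ _)) ?_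
    exact hint.mono fun r hr => hlow _ hr hts _ _
  have hczi := (memLp_two_iff_integrable_sq hcz.1).1 hcz
  have hcqi := (memLp_two_iff_integrable_sq hcq.1).1 hcq
  have up0 : ∫ r, quad (S 0 0 0 (0, r)) (S 1 0 0 (0, r)) (S 2 0 0 (0, r)) (D.cz i 0 r) (D.cq i 0 r)
        ∂(radialMeasure R) ≤ 4 * B ^ 2 * D.ini k R := by
    have hle := le_ini (k := k) D R (i := i) (j := 0) (by omega)
    rw [← integral_add hczi hcqi] at hle
    refine le_trans ?_ (mul_le_mul_of_nonneg_left hle (by positivity))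
    rw [← integral_const_mul]
    refine integral_mono_ae h0 ((hczi.add hcqi).const_mul _) ?_
    exact hin0.mono fun r hr => (le_abs_self _).trans (hup _ hr hΛ.nonneg _ _)
  have bz0 := IntegrableOn.mono_set hbz hsub
  have bq0 := IntegrableOn.mono_set hbq hsub
  have hIs := (SysData.integrableOn_src h).mono_set hsub
  have src0 : ∫ τ in Ioo 0 t, (R * quad (P 0 0 0 (τ, R)) (P 1 0 0 (τ, R)) (P 2 0 0 (τ, R))
        (D.bz i τ) (D.bq i τ) + C₂ * ∫ r, (D.z i 0 (τ, r) ^ 2 + D.q i 0 (τ, r) ^ 2 +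
        (D.z (i + 1) 0 (τ, r) + D.q i 1 (τ, r)) ^ 2 +
        (a 0 0 0 (τ, r) * D.q (i + 1) 0 (τ, r) + a 1 0 0 (τ, r) * D.z i 1 (τ, r) +
          a 2 0 0 (τ, r) * D.q i 1 (τ, r)) ^ 2) ∂(radialMeasure R)) ≤
      ∫ τ in Ioo 0 t, (R * (A₇ * Λ ^ 7 * D.bq i τ ^ 2 - m₂ / Λ * D.bz i τ ^ 2) +
        C₂ * ((1 + 2 * C₁) * D.src k R τ)) := by
    refine integral_mono_ae ?_ ?_ ?_
    · exact (IntegrableOn.mono_set (hflint.const_mul R) hsub).add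
        (IntegrableOn.mono_set (hsrci.const_mul C₂) hsub)
    · exact (((bq0.const_mul _).sub (bz0.const_mul _)).const_mul R).add
        ((hIs.const_mul _).const_mul _)
    · filter_upwards [ae_restrict_of_ae_restrict_of_subset hsub hsrcle,
        ae_restrict_mem measurableSet_Ioo] with τ hτ hτm
      refine add_le_add (mul_le_mul_of_nonneg_left ?_ hR.le) (mul_le_mul_of_nonneg_left hτ hC₂0)
      exact hflux (τ, R) ⟨Ioo_subset_Icc_self (hsub hτm), self_mem_Ici⟩ (hτm.2.le.trans hts) _ _
  have esrc : ∫ τ in Ioo 0 t, (R * (A₇ * Λ ^ 7 * D.bq i τ ^ 2 - m₂ / Λ * D.bz i τ ^ 2) +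
        C₂ * ((1 + 2 * C₁) * D.src k R τ)) =
      R * (A₇ * Λ ^ 7 * (∫ τ in Ioo 0 t, D.bq i τ ^ 2) - m₂ / Λ * ∫ τ in Ioo 0 t, D.bz i τ ^ 2) +
        C₂ * ((1 + 2 * C₁) * ∫ τ in Ioo 0 t, D.src k R τ) := by
    have e1 := integral_add (((bq0.const_mul (A₇ * Λ ^ 7)).sub (bz0.const_mul (m₂ / Λ))).const_mul R)
        ((hIs.const_mul (1 + 2 * C₁)).const_mul C₂)
    have e2 := integral_sub (bq0.const_mul (A₇ * Λ ^ 7)) (bz0.const_mul (m₂ / Λ))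
    simp only [Pi.sub_apply] at e1 e2
    rw [e1, integral_const_mul, e2, integral_const_mul, integral_const_mul, integral_const_mul,
      integral_const_mul]
  have ebb := integral_add bz0 bq0
  have hbqle := integral_bq_le h hi ht.2.le
  have nz : 0 ≤ ∫ τ in Ioo 0 t, D.bz i τ ^ 2 := integral_nonneg fun _ => sq_nonneg _
  have nq : 0 ≤ ∫ τ in Ioo 0 t, D.bq i τ ^ 2 := integral_nonneg fun _ => sq_nonneg _
  have nI := D.integral_src_nonneg k R t
  have n0 := D.ini_nonneg k R
  set N := nsq R (D.z i 0) t + nsq R (D.q i 0) t with hN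
  have hN0 : 0 ≤ N := add_nonneg (nsq_nonneg _ _ _) (nsq_nonneg _ _ _)
  rw [ebb]
  unfold SysData.rhs
  set Z := ∫ τ in Ioo 0 t, D.bz i τ ^ 2
  set Bq := ∫ τ in Ioo 0 t, D.bq i τ ^ 2
  set Sq := ∫ τ in Ioo 0 t, ∑ i ∈ Finset.range (k + 1), D.bq i τ ^ 2
  set I := ∫ τ in Ioo 0 t, D.src k R τ
  -- The dissipative part of the flux moves to the left. The same multiple of the prescribed trace
  -- is added on both sides, so that the left side contains the full trace.
  have main : m * N + R * (m₂ / Λ) * (Z + Bq) ≤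
      4 * B ^ 2 * D.ini k R + R * (A₇ * Λ ^ 7 + m₂ / Λ) * Sq + C₂ * (1 + 2 * C₁) * I := by
    have s1 := low.trans (hEt.trans (add_le_add up0 (src0.trans_eq esrc)))
    have s2 : R * (A₇ * Λ ^ 7 + m₂ / Λ) * Bq ≤ R * (A₇ * Λ ^ 7 + m₂ / Λ) * Sq := by gcongr
    linarith
  have l1 : μ / Λ * (N + (Z + Bq)) ≤ m * N + R * (m₂ / Λ) * (Z + Bq) := by
    have a1 : μ / Λ ≤ m := (div_le_self hμ0.le hΛ1).trans (min_le_left _ _)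
    have a2 : μ / Λ ≤ R * (m₂ / Λ) := by
      rw [← mul_div_assoc]; gcongr; exact min_le_right _ _
    rw [mul_add]
    exact add_le_add (mul_le_mul_of_nonneg_right a1 hN0)
      (mul_le_mul_of_nonneg_right a2 (add_nonneg nz nq))
  have l2 : 4 * B ^ 2 * D.ini k R + R * (A₇ * Λ ^ 7 + m₂ / Λ) * Sq + C₂ * (1 + 2 * C₁) * I ≤
      (4 * (grav + 2) ^ 2 + R * (A₇ + m₂) + 1) * Λ ^ 7 *
        (D.ini k R + Sq + C₂ * (1 + 2 * C₁) * I) := by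
    have hS0 : 0 ≤ Sq := D.integral_bq_nonneg k t
    have p7 : 1 ≤ Λ ^ 7 := one_le_pow₀ hΛ1
    have p6 : Λ ^ 6 ≤ Λ ^ 7 := pow_le_pow_right₀ hΛ1 (by norm_num)
    set J := C₂ * (1 + 2 * C₁) * I with hJ
    have hJ0 : 0 ≤ J := by positivity
    have t1 : 4 * B ^ 2 * D.ini k R ≤ 4 * (grav + 2) ^ 2 * Λ ^ 7 * D.ini k R := by
      have : 4 * B ^ 2 = 4 * (grav + 2) ^ 2 * Λ ^ 6 := by rw [hB]; ring
      rw [this]; gcongr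
    have t2 : R * (A₇ * Λ ^ 7 + m₂ / Λ) * Sq ≤ R * (A₇ + m₂) * Λ ^ 7 * Sq := by
      have : m₂ / Λ ≤ m₂ * Λ ^ 7 :=
        (div_le_self hm₂0.le hΛ1).trans (le_mul_of_one_le_right hm₂0.le p7)
      calc R * (A₇ * Λ ^ 7 + m₂ / Λ) * Sq ≤ R * (A₇ * Λ ^ 7 + m₂ * Λ ^ 7) * Sq := by gcongr
        _ = _ := by ring
    have t3 : J ≤ 1 * Λ ^ 7 * J := by
      rw [one_mul]; exact le_mul_of_one_le_left hJ0 p7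
    have u1 : 0 ≤ (R * (A₇ + m₂) + 1) * Λ ^ 7 * D.ini k R := by positivity
    have u2 : 0 ≤ (4 * (grav + 2) ^ 2 + 1) * Λ ^ 7 * Sq := by positivity
    have u3 : 0 ≤ (4 * (grav + 2) ^ 2 + R * (A₇ + m₂)) * Λ ^ 7 * J := by positivity
    clear_value J B A₇ m₂ m μ Sq I N Z Bq
    linarith
  have l3 := l1.trans (main.trans l2)
  have : N + (Z + Bq) = Λ / μ * (μ / Λ * (N + (Z + Bq))) := by field_simp
  rw [this]
  refine (mul_le_mul_of_nonneg_left l3 (by positivity)).trans_eq ?_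
  field_simp
  try ring

end

/-! ### The estimate of all the derivatives -/

lemma sq_sum_three_le (a b c : ℝ) : (a + b + c) ^ 2 ≤ 3 * (a ^ 2 + b ^ 2 + c ^ 2) := by
  nlinarith [sq_nonneg (a - b), sq_nonneg (a - c), sq_nonneg (b - c)]

/-- The square of the norm of a combination of three functions with bounded coefficients. -/
lemma integral_comb_sq_le {X : Type*} [MeasurableSpace X] {μ : Measure X} {a x : Fin 3 → X → ℝ}
    {L : ℝ} (ham : ∀ m, AEStronglyMeasurable (a m) μ) (ha : ∀ᵐ p ∂μ, ∀ m, |a m p| ≤ L)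
    (hx : ∀ m, MemLp (x m) 2 μ) :
    MemLp (fun p => a 0 p * x 0 p + a 1 p * x 1 p + a 2 p * x 2 p) 2 μ ∧
    ∫ p, (a 0 p * x 0 p + a 1 p * x 1 p + a 2 p * x 2 p) ^ 2 ∂μ ≤
      3 * L ^ 2 * ((∫ p, x 0 p ^ 2 ∂μ) + (∫ p, x 1 p ^ 2 ∂μ) + ∫ p, x 2 p ^ 2 ∂μ) := by
  have bm : ∀ m, MemLp (fun p => a m p * x m p) 2 μ := by
    intro m
    refine MemLp.of_le_mul (c := L) (hx m) ((ham m).mul (hx m).1) ?_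
    filter_upwards [ha] with p hp
    rw [norm_mul]
    gcongr
    exact hp m
  have hm := ((bm 0).add (bm 1)).add (bm 2)
  have sq : ∀ m, Integrable (fun p => x m p ^ 2) μ := fun m =>
    (memLp_two_iff_integrable_sq (hx m).1).1 (hx m)
  refine ⟨hm, ?_⟩
  have e1 := integral_add ((sq 0).add (sq 1)) (sq 2)
  have e2 := integral_add (sq 0) (sq 1)
  simp only [Pi.add_apply] at e1 e2
  rw [← e2, ← e1, ← integral_const_mul]
  refine integral_mono_ae ((memLp_two_iff_integrable_sq hm.1).1 hm)
    ((((sq 0).add (sq 1)).add (sq 2)).const_mul _) ?_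
  filter_upwards [ha] with p hp
  refine (sq_sum_three_le _ _ _).trans ?_
  have h : ∀ m, (a m p * x m p) ^ 2 ≤ L ^ 2 * x m p ^ 2 := fun m => by
    rw [mul_pow, ← sq_abs (a m p)]
    exact mul_le_mul_of_nonneg_right (pow_le_pow_left₀ (abs_nonneg _) (hp m) 2) (sq_nonneg _)
  have := h 0
  have := h 1
  have := h 2
  linarith

lemma integral_add_sq_le {X : Type*} [MeasurableSpace X] {μ : Measure X} {x y : X → ℝ}
    (hx : MemLp x 2 μ) (hy : MemLp y 2 μ) :
    ∫ p, (x p + y p) ^ 2 ∂μ ≤ 2 * ((∫ p, x p ^ 2 ∂μ) + ∫ p, y p ^ 2 ∂μ) := by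
  have hxi := (memLp_two_iff_integrable_sq hx.1).1 hx
  have hyi := (memLp_two_iff_integrable_sq hy.1).1 hy
  have hm := hx.add hy
  rw [← integral_add hxi hyi, ← integral_const_mul]
  refine integral_mono ((memLp_two_iff_integrable_sq hm.1).1 hm) ((hxi.add hyi).const_mul 2) fun p => ?_
  change (x p + y p) ^ 2 ≤ 2 * (x p ^ 2 + y p ^ 2)
  nlinarith [sq_nonneg (x p - y p)]

section

variable {grav δ R : ℝ} {k : ℕ} {K : ℝ≥0∞} {D : SysData}

lemma integral_cz_le (D : SysData) (R : ℝ) {i j : ℕ} (hij : i + j ≤ k) :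
    ∫ r, D.cz i j r ^ 2 ∂(radialMeasure R) ≤ D.ini k R ∧
      ∫ r, D.cq i j r ^ 2 ∂(radialMeasure R) ≤ D.ini k R := by
  have h := le_ini (k := k) D R hij
  have h1 : 0 ≤ ∫ r, D.cz i j r ^ 2 ∂(radialMeasure R) := integral_nonneg fun _ => sq_nonneg _
  have h2 : 0 ≤ ∫ r, D.cq i j r ^ 2 ∂(radialMeasure R) := integral_nonneg fun _ => sq_nonneg _
  constructor <;> linarith

lemma nsq_le_src (D : SysData) (R t : ℝ) {i j : ℕ} (hij : i + j ≤ k) :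
    nsq R (D.z i j) t ≤ D.src k R t ∧ nsq R (D.q i j) t ≤ D.src k R t := by
  have h := le_solN (k := k) D.z D.q R t hij
  have h1 := solN_nonneg k R D.f₁ D.f₂ t
  have h2 := nsq_nonneg R (D.z i j) t
  have h3 := nsq_nonneg R (D.q i j) t
  unfold SysData.src
  constructor <;> linarith

/-- The growth of `∂_t z + ∂_r q`. -/
lemma est_red1 (hR : 0 < R) {i j : ℕ} (hij : i + j + 1 ≤ k) :
    Est grav δ R k (fun D t => nsq R (red1 D.z D.q i j) t) := by
  refine ⟨4, 0, by norm_num, fun K hK => ?_⟩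
  obtain ⟨C₁, hC₁, hred⟩ := exists_red_bound grav hR k hK
  refine ⟨C₁, hC₁, fun D Λ ts h hΛ => ?_⟩
  have hm : ∀ i j, i + j ≤ k → MemLp (red1 D.z D.q i j) 2 (stripMeasure D.T R) := fun i j hij =>
    (h.memz (i + 1) j (by omega)).add (h.memq i (j + 1) (by omega))
  have hl : LineT D.T R (red1 D.z D.q i j) (red1 D.z D.q (i + 1) j)
      (fun r => D.cz (i + 1) j r + D.cq i (j + 1) r) :=
    (h.tracez (i + 1) j (by omega)).add h.T_pos (h.traceq i (j + 1) (by omega))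
  have hcz := h.memcz (i + 1) j (by omega)
  have hcq := h.memcq i (j + 1) (by omega)
  have hG := nsq_growth h.T_pos hR (hm i j (by omega)) (hm (i + 1) j (by omega)) (hcz.add hcq) hl
  have hb := hred δ D.T D.H D.Q D.z D.q D.f₁ D.f₂ D.cz D.cq D.bz D.bq h
  filter_upwards [hG, ae_restrict_mem measurableSet_Ioo] with t a ht _
  have hsub : Ioo 0 t ⊆ Ioo 0 D.T := Ioo_subset_Ioo_right ht.2.le
  refine a.trans ?_
  have h1 := integral_add_sq_le hcz hcq
  have h2 := (integral_cz_le (k := k) D R (i := i + 1) (j := j) (by omega)).1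
  have h3 := (integral_cz_le (k := k) D R (i := i) (j := j + 1) (by omega)).2
  -- Under the integral the equations may be used with constants that depend on derivatives of the
  -- coefficients. One more time derivative appears, hence the restriction `i + j + 1 ≤ k`.
  have h4 : ∫ τ in Ioo 0 t, (nsq R (red1 D.z D.q i j) τ + nsq R (red1 D.z D.q (i + 1) j) τ) ≤
      ∫ τ in Ioo 0 t, 2 * C₁ * D.src k R τ := by
    refine integral_mono_ae ?_ ?_ ?_
    · exact (IntegrableOn.mono_set (integrableOn_nsq (hm i j (by omega))) hsub).add
        (IntegrableOn.mono_set (integrableOn_nsq (hm (i + 1) j (by omega))) hsub)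
    · exact Integrable.const_mul (IntegrableOn.mono_set (SysData.integrableOn_src h) hsub) _
    · filter_upwards [ae_restrict_of_ae_restrict_of_subset hsub hb] with τ hτ
      have e1 := (hτ i j (by omega)).1
      have e2 := (hτ (i + 1) j (by omega)).1
      have : 2 * C₁ * D.src k R τ = C₁ * (solN k R D.z D.q τ + solN k R D.f₁ D.f₂ τ) +
        C₁ * (solN k R D.z D.q τ + solN k R D.f₁ D.f₂ τ) := by unfold SysData.src; ring
      linarith
  rw [integral_const_mul] at h4
  have n1 := D.integral_bq_nonneg k t
  have n2 : 0 ≤ C₁ * ∫ τ in Ioo 0 t, D.src k R τ := mul_nonneg hC₁ (D.integral_src_nonneg k R t)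
  have n3 := D.ini_nonneg k R
  unfold SysData.rhs
  simp only [Pi.add_apply] at *
  linarith

/-- The growth of `α₀ ∂_t q + α₁ ∂_r z + α₂ ∂_r q`. -/
lemma est_red2 (hg : 0 < grav) (hδ : 0 < δ) (hR : 0 < R) {i j : ℕ} (hij : i + j + 1 ≤ k) :
    Est grav δ R k (fun D t => nsq R (red2 grav D.H D.Q D.z D.q i j) t) := by
  refine ⟨9 * (grav + 2) ^ 2 + 1, 6, by positivity, fun K hK => ?_⟩
  obtain ⟨C₁, hC₁, hred⟩ := exists_red_bound grav hR k hK
  obtain ⟨L, hL, hLb⟩ := exists_coef_bdd grav δ R k hK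
  refine ⟨3 * C₁ + 18 * L ^ 2, by positivity, fun D Λ ts h hΛ => ?_⟩
  have hT := h.T_pos
  have hΛ1 := hΛ.one_le
  set a := coefA grav D.H D.Q with ha
  have hfam := fun m => (fam_coef h 0 m).1
  have hs := h.two_le
  have hm1 : (0 : ℕ) + 0 ≤ max k 2 := by omega
  have hlt : (0 : ℕ) + 0 < max k 2 := by omega
  have hm2 : (1 : ℕ) + 0 ≤ max k 2 := by omega
  have lA : ∀ m, LineT D.T R (a m 0 0) (a m 1 0) (fun r => a m 0 0 (0, r)) := fun m => by
    obtain ⟨c, hc⟩ := (hfam m).dt 0 0 hlt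
    exact hc.trace_eq hT (continuousOn_coef h 0 m).1
  set x : ℕ → ℕ → Fin 3 → ℝ × ℝ → ℝ := fun i j => ![D.q (i + 1) j, D.z i (j + 1), D.q i (j + 1)] with hx
  have hxm : ∀ i j, i + j ≤ k → ∀ m, MemLp (x i j m) 2 (stripMeasure D.T R) := by
    intro i j hij m
    fin_cases m
    · exact h.memq (i + 1) j (by omega)
    · exact h.memz i (j + 1) (by omega)
    · exact h.memq i (j + 1) (by omega)
  have hb0 : ∀ᵐ p ∂(stripMeasure D.T R), ∀ m, |a m 0 0 p| ≤ L := by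
    rw [ae_stripMeasure hR]
    filter_upwards [hLb D h 0 (by simp) 0 0 (by omega)] with p hp m using (hp m).1
  have hb1 : ∀ᵐ p ∂(stripMeasure D.T R), ∀ m, |a m 1 0 p| ≤ L := by
    rw [ae_stripMeasure hR]
    filter_upwards [hLb D h 0 (by simp) 1 0 (by omega)] with p hp m using (hp m).1
  have am : ∀ m, AEStronglyMeasurable (a m 0 0) (stripMeasure D.T R) := fun m =>
    ((hfam m).meas 0 0 hm1).mono_ac (stripMeasure_ac D.T R)
  have atm : ∀ m, AEStronglyMeasurable (a m 1 0) (stripMeasure D.T R) := fun m =>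
    ((hfam m).meas 1 0 hm2).mono_ac (stripMeasure_ac D.T R)
  have hm : ∀ i j, i + j ≤ k → MemLp (red2 grav D.H D.Q D.z D.q i j) 2 (stripMeasure D.T R) :=
    fun i j hij => (integral_comb_sq_le am hb0 (hxm i j hij)).1
  -- The time derivative of `red2 i j`: the combination at `i + 1`, and the terms in which the
  -- derivative falls on a coefficient.
  set wt : ℝ × ℝ → ℝ := fun p => red2 grav D.H D.Q D.z D.q (i + 1) j p +
    (a 0 1 0 p * D.q (i + 1) j p + a 1 1 0 p * D.z i (j + 1) p + a 2 1 0 p * D.q i (j + 1) p) with hwt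
  have hrest : MemLp (fun p => a 0 1 0 p * D.q (i + 1) j p + a 1 1 0 p * D.z i (j + 1) p +
      a 2 1 0 p * D.q i (j + 1) p) 2 (stripMeasure D.T R) :=
    (integral_comb_sq_le atm hb1 (hxm i j (by omega))).1
  have hwtm : MemLp wt 2 (stripMeasure D.T R) := (hm (i + 1) j (by omega)).add hrest
  set c : ℝ → ℝ := fun r => a 0 0 0 (0, r) * D.cq (i + 1) j r + a 1 0 0 (0, r) * D.cz i (j + 1) r +
    a 2 0 0 (0, r) * D.cq i (j + 1) r with hc
  have hl : LineT D.T R (red2 grav D.H D.Q D.z D.q i j) wt c := by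
    filter_upwards [lA 0, lA 1, lA 2, h.traceq (i + 1) j (by omega), h.tracez i (j + 1) (by omega),
      h.traceq i (j + 1) (by omega)] with r a0 a1 a2 b0 b1 b2
    have hs := isLeft_Ioo hT
    have := ((a0.mul b0 hs).add (a1.mul b1 hs) hs).add (a2.mul b2 hs) hs
    refine this.congr hs (ae_eq_refl _) (Eventually.of_forall fun t => ?_)
    simp only [hwt, red2]
    have e0 : arr0 D.H 0 0 (t, r) = a 0 0 0 (t, r) := rfl
    have e1 : arr1 grav D.H D.Q 0 0 (t, r) = a 1 0 0 (t, r) := rfl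
    have e2 : arr2 D.H D.Q 0 0 (t, r) = a 2 0 0 (t, r) := rfl
    rw [e0, e1, e2]
    ring
  set B := (grav + 2) * Λ ^ 3 with hB
  have hin0 : ∀ᵐ r ∂(radialMeasure R), ((0 : ℝ), r) ∈ closedStrip D.T R := by
    rw [ae_radialMeasure hR]
    filter_upwards [ae_restrict_mem measurableSet_Ioi] with r hr
    exact ⟨⟨le_rfl, hT.le⟩, le_of_lt (show R < r from hr)⟩
  -- The initial value involves the undifferentiated coefficients only, so its bound is polynomial
  -- in `Λ`; `B²` gives the exponent `6`.
  have hcm := integral_comb_sq_le (μ := radialMeasure R) (a := fun m r => a m 0 0 (0, r)) (L := B)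
    (x := ![D.cq (i + 1) j, D.cz i (j + 1), D.cq i (j + 1)])
    (fun m => measurable_slice_left hT (continuousOn_coef h 0 m).1)
    (hin0.mono fun r hr m => coefA_le hg hδ h hΛ hr hΛ.nonneg m) (fun m => by
      fin_cases m
      · exact h.memcq (i + 1) j (by omega)
      · exact h.memcz i (j + 1) (by omega)
      · exact h.memcq i (j + 1) (by omega))
  have hG := nsq_growth hT hR (hm i j (by omega)) hwtm hcm.1 hl
  have hb := hred δ D.T D.H D.Q D.z D.q D.f₁ D.f₂ D.cz D.cq D.bz D.bq h
  have hwtle : ∀ᵐ τ ∂(volume.restrict (Ioo 0 D.T)), nsq R wt τ ≤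
      (2 * C₁ + 18 * L ^ 2) * D.src k R τ := by
    have m1 := MemLp.ae_section_left (stripMeasure_eq_prod D.T R ▸ hm (i + 1) j (by omega))
    have m2 := MemLp.ae_section_left (stripMeasure_eq_prod D.T R ▸ hrest)
    have m3 : ∀ᵐ τ ∂(volume.restrict (Ioo 0 D.T)), ∀ m,
        AEStronglyMeasurable (fun r => a m 1 0 (τ, r)) (radialMeasure R) := by
      rw [ae_all_iff]
      intro m
      filter_upwards [((hfam m).meas 1 0 hm2).prodMk_left] with t ht
      exact ht.mono_ac (radialMeasure_ac R)
    have m4 : ∀ᵐ τ ∂(volume.restrict (Ioo 0 D.T)), ∀ᵐ r ∂(radialMeasure R), ∀ m,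
        |a m 1 0 (τ, r)| ≤ L := by
      rw [stripMeasure_eq_prod] at hb1
      exact Measure.ae_ae_of_ae_prod hb1
    filter_upwards [hb, m1, m2, m3, m4, ae_mem_slices h] with τ b m1 m2 m3 m4 m5
    have e1 := integral_add_sq_le m1 m2
    have e2 := (b (i + 1) j (by omega)).2
    have e3 := (integral_comb_sq_le (a := fun m r => a m 1 0 (τ, r))
      (x := ![fun r => D.q (i + 1) j (τ, r), fun r => D.z i (j + 1) (τ, r),
        fun r => D.q i (j + 1) (τ, r)]) m3 m4 (fun m => by
        fin_cases m
        · exact (m5 (i + 1) j (by omega)).2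
        · exact (m5 i (j + 1) (by omega)).1
        · exact (m5 i (j + 1) (by omega)).2)).2
    have s1 := (nsq_le_src (k := k) D R τ (i := i + 1) (j := j) (by omega)).2
    have s2 := (nsq_le_src (k := k) D R τ (i := i) (j := j + 1) (by omega)).1
    have s3 := (nsq_le_src (k := k) D R τ (i := i) (j := j + 1) (by omega)).2
    simp only [Matrix.cons_val_zero, Matrix.cons_val_one, Matrix.cons_val] at e3
    unfold nsq at s1 s2 s3 e2
    have s4 := mul_le_mul_of_nonneg_left (add_le_add (add_le_add s1 s2) s3)
      (by positivity : 0 ≤ 3 * L ^ 2)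
    have e4 : C₁ * (solN k R D.z D.q τ + solN k R D.f₁ D.f₂ τ) = C₁ * D.src k R τ := rfl
    rw [e4] at e2
    have e5 := e3.trans s4
    refine e1.trans ?_
    linarith
  filter_upwards [hG, ae_restrict_mem measurableSet_Ioo] with t b ht _
  have hsub : Ioo 0 t ⊆ Ioo 0 D.T := Ioo_subset_Ioo_right ht.2.le
  refine b.trans ?_
  have h1 := hcm.2
  simp only [Matrix.cons_val_zero, Matrix.cons_val_one, Matrix.cons_val] at h1
  have h2 := (integral_cz_le (k := k) D R (i := i + 1) (j := j) (by omega)).2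
  have h3 := (integral_cz_le (k := k) D R (i := i) (j := j + 1) (by omega)).1
  have h3' := (integral_cz_le (k := k) D R (i := i) (j := j + 1) (by omega)).2
  have h4 : ∫ τ in Ioo 0 t, (nsq R (red2 grav D.H D.Q D.z D.q i j) τ + nsq R wt τ) ≤
      ∫ τ in Ioo 0 t, (3 * C₁ + 18 * L ^ 2) * D.src k R τ := by
    refine integral_mono_ae ?_ ?_ ?_
    · exact (IntegrableOn.mono_set (integrableOn_nsq (hm i j (by omega))) hsub).add
        (IntegrableOn.mono_set (integrableOn_nsq hwtm) hsub)
    · exact Integrable.const_mul (IntegrableOn.mono_set (SysData.integrableOn_src h) hsub) _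
    · filter_upwards [ae_restrict_of_ae_restrict_of_subset hsub hb,
        ae_restrict_of_ae_restrict_of_subset hsub hwtle] with τ hτ hτ'
      have e1 : nsq R (red2 grav D.H D.Q D.z D.q i j) τ ≤ C₁ * D.src k R τ := (hτ i j (by omega)).2
      linarith
  rw [integral_const_mul] at h4
  have n1 := D.integral_bq_nonneg k t
  have n2 : 0 ≤ (3 * C₁ + 18 * L ^ 2) * ∫ τ in Ioo 0 t, D.src k R τ :=
    mul_nonneg (by positivity) (D.integral_src_nonneg k R t)
  have n3 := D.ini_nonneg k R
  have h5 : ∫ r, c r ^ 2 ∂(radialMeasure R) ≤ 9 * (grav + 2) ^ 2 * Λ ^ 6 * D.ini k R := by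
    refine h1.trans ?_
    calc _ ≤ 3 * B ^ 2 * (D.ini k R + D.ini k R + D.ini k R) := by gcongr
      _ = _ := by rw [hB]; ring
  refine (add_le_add h5 h4).trans ?_
  unfold SysData.rhs
  set J := (3 * C₁ + 18 * L ^ 2) * ∫ τ in Ioo 0 t, D.src k R τ with hJ
  have p6 : 1 ≤ Λ ^ 6 := one_le_pow₀ hΛ1
  have u1 : J ≤ 1 * Λ ^ 6 * J := by rw [one_mul]; exact le_mul_of_one_le_left n2 p6
  have u2 : 0 ≤ Λ ^ 6 * D.ini k R := by positivity
  have u3 : 0 ≤ (9 * (grav + 2) ^ 2 + 1) * Λ ^ 6 *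
      ∫ τ in Ioo 0 t, ∑ i ∈ Finset.range (k + 1), D.bq i τ ^ 2 := by positivity
  have u4 : 0 ≤ 9 * (grav + 2) ^ 2 * Λ ^ 6 * J := by positivity
  linarith

/-- The estimate of a single derivative. -/
lemma est_deriv (hg : 0 < grav) (hδ : 0 < δ) (hR : 0 < R) (j : ℕ) : ∀ i, i + j ≤ k →
    Est grav δ R k (fun D t => nsq R (D.z i j) t + nsq R (D.q i j) t) := by
  induction j with
  | zero =>
    intro i hi
    refine (est_energy hg hδ hR (by omega : i ≤ k)).of_le 1 0 zero_le_one fun K _ D Λ ts _ _ => ?_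
    refine Eventually.of_forall fun t _ => ?_
    have : 0 ≤ ∫ τ in Ioo 0 t, (D.bz i τ ^ 2 + D.bq i τ ^ 2) :=
      integral_nonneg fun _ => by positivity
    simp only [pow_zero, mul_one, one_mul]
    linarith
  | succ j ih =>
    intro i hij
    -- `q_r = red1 - z_t`: one derivative in `r` is exchanged for one in `t`, to which the induction
    -- hypothesis applies at `i + 1`.
    have hq : Est grav δ R k (fun D t => nsq R (D.q i (j + 1)) t) := by
      refine ((est_red1 (grav := grav) (δ := δ) hR (k := k) (i := i) (j := j) (by omega)).add
        (ih (i + 1) (by omega))).of_le 2 0 zero_le_two fun K _ D Λ ts h _ => ?_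
      filter_upwards [ae_mem_slices h] with t m _
      have m1 := (m (i + 1) j (by omega)).1
      have m2 := (m i (j + 1) (by omega)).2
      have e := integral_add_sq_le (m1.add m2) (y := fun r => -D.z (i + 1) j (t, r)) m1.neg
      have e' : ∀ r, (D.z (i + 1) j (t, r) + D.q i (j + 1) (t, r) + -D.z (i + 1) j (t, r)) =
        D.q i (j + 1) (t, r) := fun r => by ring
      simp only [Pi.add_apply, e', neg_sq] at e
      have n := nsq_nonneg R (D.q (i + 1) j) t
      simp only [nsq, red1, pow_zero, mul_one] at *
      linarith
    -- `z_r` is obtained from `red2`, `q_t` and the bound of `q_r` just found, on dividing by `a₁`,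
    -- which the margin keeps above `mm`.
    have hz : Est grav δ R k (fun D t => nsq R (D.z i (j + 1)) t) := by
      set mm := δ * (δ / grav) ^ 2 with hmm
      have hmm0 : 0 < mm := by positivity
      refine (((est_red2 hg hδ hR (k := k) (i := i) (j := j) (by omega)).add
        (ih (i + 1) (by omega))).add hq).of_le (3 / mm ^ 2 * ((grav + 2) ^ 2 + 1)) 6 (by positivity)
        fun K hK D Λ ts h hΛ => ?_
      set a := coefA grav D.H D.Q with ha
      set B := (grav + 2) * Λ ^ 3 with hB
      have hΛ1 := hΛ.one_le
      have hB2 : B ^ 2 + 1 ≤ ((grav + 2) ^ 2 + 1) * Λ ^ 6 := by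
        have : 1 ≤ Λ ^ 6 := one_le_pow₀ hΛ1
        have e : B ^ 2 = (grav + 2) ^ 2 * Λ ^ 6 := by rw [hB]; ring
        rw [e]; linarith
      have m3 : ∀ᵐ τ ∂(volume.restrict (Ioo 0 D.T)), ∀ m,
          AEStronglyMeasurable (fun r => a m 0 0 (τ, r)) (radialMeasure R) := by
        rw [ae_all_iff]
        intro m
        filter_upwards [((fam_coef h 0 m).1.meas 0 0 (by omega)).prodMk_left] with t ht
        exact ht.mono_ac (radialMeasure_ac R)
      filter_upwards [ae_mem_slices h, m3, ae_restrict_mem measurableSet_Ioo] with t m m3 ht hts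
      have m0 := (m (i + 1) j (by omega)).2
      have m1 := (m i (j + 1) (by omega)).1
      have m2 := (m i (j + 1) (by omega)).2
      have hint : ∀ᵐ r ∂(radialMeasure R), (t, r) ∈ closedStrip D.T R := by
        rw [ae_radialMeasure hR]
        filter_upwards [ae_restrict_mem measurableSet_Ioi] with r hr
        exact ⟨Ioo_subset_Icc_self ht, le_of_lt (show R < r from hr)⟩
      have hred : MemLp (fun r => red2 grav D.H D.Q D.z D.q i j (t, r)) 2 (radialMeasure R) :=
        (integral_comb_sq_le (a := fun m r => a m 0 0 (t, r))
          (x := ![fun r => D.q (i + 1) j (t, r), fun r => D.z i (j + 1) (t, r),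
            fun r => D.q i (j + 1) (t, r)]) m3
          (hint.mono fun r hr m => coefA_le hg hδ h hΛ hr hts m) (fun m => by
            fin_cases m
            · exact m0
            · exact m1
            · exact m2)).1
      have sq : ∀ {x : ℝ → ℝ}, MemLp x 2 (radialMeasure R) →
          Integrable (fun r => x r ^ 2) (radialMeasure R) :=
        fun hx => (memLp_two_iff_integrable_sq hx.1).1 hx
      have hpt : ∀ᵐ r ∂(radialMeasure R), D.z i (j + 1) (t, r) ^ 2 ≤ 3 / mm ^ 2 * (B ^ 2 + 1) *
          (red2 grav D.H D.Q D.z D.q i j (t, r) ^ 2 + D.q (i + 1) j (t, r) ^ 2 +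
            D.q i (j + 1) (t, r) ^ 2) := by
        filter_upwards [hint] with r hr
        have b0 := coefA_le hg hδ h hΛ hr hts 0
        have b2 := coefA_le hg hδ h hΛ hr hts 2
        have hp := height_pos_of_margin hg hδ (h.subsonic _ hr)
        have b1 : mm ≤ a 1 0 0 (t, r) := by
          rw [ha, (coefA_zero grav D.H D.Q _).2.1]
          refine le_trans ?_ (margin_bounds hg hδ (h.subsonic _ hr)).1
          rw [hmm]
          have := hp.2
          gcongr
        have e : a 1 0 0 (t, r) * D.z i (j + 1) (t, r) = red2 grav D.H D.Q D.z D.q i j (t, r) +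
            (-(a 0 0 0 (t, r) * D.q (i + 1) j (t, r))) + (-(a 2 0 0 (t, r) * D.q i (j + 1) (t, r))) := by
          have : red2 grav D.H D.Q D.z D.q i j (t, r) = a 0 0 0 (t, r) * D.q (i + 1) j (t, r) +
            a 1 0 0 (t, r) * D.z i (j + 1) (t, r) + a 2 0 0 (t, r) * D.q i (j + 1) (t, r) := rfl
          rw [this]; ring
        have s1 : mm ^ 2 * D.z i (j + 1) (t, r) ^ 2 ≤ (a 1 0 0 (t, r) * D.z i (j + 1) (t, r)) ^ 2 := by
          rw [mul_pow (a 1 0 0 (t, r))]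
          exact mul_le_mul_of_nonneg_right (pow_le_pow_left₀ hmm0.le b1 2) (sq_nonneg _)
        rw [e] at s1
        have s2 := s1.trans (sq_sum_three_le _ _ _)
        have s3 : ∀ m, |a m 0 0 (t, r)| ≤ B → ∀ y : ℝ, (-(a m 0 0 (t, r) * y)) ^ 2 ≤ B ^ 2 * y ^ 2 := by
          intro m hm y
          rw [neg_sq, mul_pow, ← sq_abs (a m 0 0 (t, r))]
          exact mul_le_mul_of_nonneg_right (pow_le_pow_left₀ (abs_nonneg _) hm 2) (sq_nonneg _)
        have s4 := s3 0 b0 (D.q (i + 1) j (t, r))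
        have s5 := s3 2 b2 (D.q i (j + 1) (t, r))
        have s6 : mm ^ 2 * D.z i (j + 1) (t, r) ^ 2 ≤ 3 * ((B ^ 2 + 1) *
          (red2 grav D.H D.Q D.z D.q i j (t, r) ^ 2 + D.q (i + 1) j (t, r) ^ 2 +
            D.q i (j + 1) (t, r) ^ 2)) := by
          refine s2.trans (mul_le_mul_of_nonneg_left ?_ (by norm_num))
          have t1 : 0 ≤ B ^ 2 * red2 grav D.H D.Q D.z D.q i j (t, r) ^ 2 := by positivity
          have t2 := sq_nonneg (D.q (i + 1) j (t, r))
          have t3 := sq_nonneg (D.q i (j + 1) (t, r))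
          linarith
        rw [← le_div_iff₀' (by positivity)] at s6
        refine s6.trans_eq ?_
        ring
      have e := integral_mono_ae (sq m1) ((((sq hred).add (sq m0)).add (sq m2)).const_mul _) hpt
      have e1 := integral_add ((sq hred).add (sq m0)) (sq m2)
      have e2 := integral_add (sq hred) (sq m0)
      simp only [Pi.add_apply] at e e1 e2
      rw [integral_const_mul, e1, e2] at e
      have n := nsq_nonneg R (D.z (i + 1) j) t
      have n1 := nsq_nonneg R (D.q (i + 1) j) t
      have n2 := nsq_nonneg R (D.q i (j + 1)) t
      have n3 := nsq_nonneg R (red2 grav D.H D.Q D.z D.q i j) t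
      calc nsq R (D.z i (j + 1)) t ≤ 3 / mm ^ 2 * (B ^ 2 + 1) *
            (nsq R (red2 grav D.H D.Q D.z D.q i j) t + nsq R (D.q (i + 1) j) t +
              nsq R (D.q i (j + 1)) t) := e
        _ ≤ 3 / mm ^ 2 * (((grav + 2) ^ 2 + 1) * Λ ^ 6) *
            (nsq R (red2 grav D.H D.Q D.z D.q i j) t + (nsq R (D.z (i + 1) j) t +
              nsq R (D.q (i + 1) j) t) + nsq R (D.q i (j + 1)) t) := by
          gcongr
          linarith
        _ = _ := by ring
    exact hz.add hq

/-- The estimate of the whole solution and of its traces. -/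
lemma est_all (hg : 0 < grav) (hδ : 0 < δ) (hR : 0 < R) :
    Est grav δ R k (fun D t => solN k R D.z D.q t +
      ∑ i ∈ Finset.range (k + 1), ∫ τ in Ioo 0 t, (D.bz i τ ^ 2 + D.bq i τ ^ 2)) := by
  refine Est.add ?_ (Est.sum _ fun i hi => ?_)
  · unfold solN dsum
    refine Est.sum _ fun i hi => Est.sum _ fun j hj => ?_
    rw [Finset.mem_range] at hi hj
    exact est_deriv hg hδ hR j i (by omega)
  · rw [Finset.mem_range] at hi
    refine (est_energy hg hδ hR (by omega : i ≤ k)).of_le 1 0 zero_le_one fun K _ D Λ ts _ _ => ?_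
    refine Eventually.of_forall fun t _ => ?_
    have := nsq_nonneg R (D.z i 0) t
    have := nsq_nonneg R (D.q i 0) t
    simp only [pow_zero, mul_one, one_mul]
    linarith

end

/-! ### The estimate of the solution of the mixed problem -/

lemma state_norm_sq (x : State) : ‖x‖ ^ 2 = x 0 ^ 2 + x 1 ^ 2 := by
  rw [EuclideanSpace.norm_sq_eq, Fin.sum_univ_two, Real.norm_eq_abs, Real.norm_eq_abs, sq_abs, sq_abs]

lemma integral_state_norm_sq {X : Type*} [MeasurableSpace X] {μ : Measure X} {f : X → State}
    (hf : MemLp f 2 μ) : ∫ x, ‖f x‖ ^ 2 ∂μ = (∫ x, f x 0 ^ 2 ∂μ) + ∫ x, f x 1 ^ 2 ∂μ := by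
  have h : ∀ e, Integrable (fun x => f x e ^ 2) μ := fun e =>
    (memLp_two_iff_integrable_sq (MemLp.coord hf e).1).1 (MemLp.coord hf e)
  rw [← integral_add (h 0) (h 1)]
  exact integral_congr_ae (Eventually.of_forall fun x => state_norm_sq _)

lemma L2r_norm_sq {R : ℝ} (f : L2r R) : ‖f‖ ^ 2 =
    (∫ r, f r 0 ^ 2 ∂(radialMeasure R)) + ∫ r, f r 1 ^ 2 ∂(radialMeasure R) := by
  rw [← integral_state_norm_sq (Lp.memLp f)]
  have h := lintegral_sq_eq f
  have e : ∀ r, ENNReal.ofReal (‖f r‖ ^ 2) = ‖f r‖ₑ ^ 2 := fun r => by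
    rw [ENNReal.ofReal_pow (norm_nonneg _), ofReal_norm]
  have h1 : ∫ r, ‖f r‖ ^ 2 ∂(radialMeasure R) =
      (∫⁻ r, ENNReal.ofReal (‖f r‖ ^ 2) ∂(radialMeasure R)).toReal :=
    integral_eq_lintegral_of_nonneg_ae (Eventually.of_forall fun _ => by positivity)
      ((Lp.aestronglyMeasurable f).norm.pow 2)
  simp only [e, h] at h1
  rw [h1, ENNReal.toReal_ofReal (by positivity)]

/-! ### Passage from the mixed problem to its scalar form. -/

section

variable {grav h₀ δ T R : ℝ} {k : ℕ} {ubar f u : ℝ × ℝ → State} {Ubar : ℕ → ℕ → ℝ → L2r R}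
  {F U : ℕ → ℕ → ℝ × ℝ → State} {gb : ℝ → ℝ} {u₀ : ℝ → State}

/-- The rows of the system. -/
lemma IsSolution.rows (h : IsSolution grav h₀ T R ubar f gb u₀ u U) :
    ∀ᵐ p ∂(volume.restrict (strip T R)),
      U 1 0 p 0 + U 0 1 p 1 + p.2⁻¹ * u p 1 = f p 0 ∧
      U 1 0 p 1 + ((grav * height h₀ (ubar p) - ubar p 1 ^ 2 / height h₀ (ubar p) ^ 2) * U 0 1 p 0 +
        2 * ubar p 1 / height h₀ (ubar p) * U 0 1 p 1) +
        ubar p 1 / (p.2 * height h₀ (ubar p)) * u p 1 = f p 1 := by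
  filter_upwards [h.pde] with p hp
  have h0 := congrArg (fun x : State => x 0) hp
  have h1 := congrArg (fun x : State => x 1) hp
  simp [matA, matB, Matrix.toLpLin_apply, dotProduct, Fin.sum_univ_two] at h0 h1
  exact ⟨h0, h1⟩

/-- The scalar form of the mixed problem. -/
lemma exists_linSys (hg : 0 < grav) (hδ : 0 < δ) (hT : 0 < T) (hR : 0 < R)
    (hX : IsXFamily (max k 2) T R ubar Ubar) (hc : ContinuousOn ubar (closedStrip T R))
    (hsub : SubsonicWith grav h₀ T R δ ubar) {K : ℝ} (hK0 : 0 ≤ K)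
    (hK : ∀ i j, i + j ≤ max k 2 → ∀ t ∈ Icc 0 T, ‖Ubar i j t‖ ≤ K)
    (hF : IsStripFamily k T R f F) (hU : IsStripFamily (k + 1) T R u U)
    (hS : IsSolution grav h₀ T R ubar f gb u₀ u U) {V : ℕ → ℕ → ℝ → L2r R} {b : ℕ → ℝ → State}
    (hl : ∀ i j e, i + j ≤ k →
        LineT T R (fun p => U i j p e) (fun p => U (i + 1) j p e) (fun r => V i j 0 r e))
    (hb : ∀ i ≤ k, ∀ e, LineR T R (fun p => U i 0 p e) (fun p => U i 1 p e) (fun t => b i t e)) :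
    ∃ H Q, LinSys grav δ T R k (max k 2) (‖h₀‖ₑ + ENNReal.ofReal (sobC R * K)) H Q
      (fun i j p => U i j p 0) (fun i j p => U i j p 1) (fun i j p => F i j p 0)
      (fun i j p => F i j p 1) (fun i j r => V i j 0 r 0) (fun i j r => V i j 0 r 1)
      (fun i t => b i t 0) (fun i t => b i t 1) ∧
      (H 0 0 = fun p => height h₀ (ubar p)) ∧ Q 0 0 = fun p => ubar p 1 := by
  obtain ⟨Z, hZ, hZ0, hZc⟩ := hX.exists_coef hT hR (by omega) hc hK0 hK 0
  obtain ⟨Q, hQ, hQ0, hQc⟩ := hX.exists_coef hT hR (by omega) hc hK0 hK 1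
  set H : ℕ → ℕ → ℝ × ℝ → ℝ := fun i j p => constArr h₀ i j p + Z i j p with hHdef
  have hH0 : H 0 0 = fun p => height h₀ (ubar p) := by
    funext p
    simp [hHdef, constArr, hZ0, height]
  have hU0 := hU.repr
  have hF0 := hF.repr
  have hrows := hS.rows
  rw [restrict_strip] at hU0 hF0 hrows
  have hmem : ∀ᵐ p ∂(stripVol T R), p ∈ strip T R := by
    rw [← restrict_strip]
    exact ae_restrict_mem (measurableSet_Ioo.prod measurableSet_Ioi)
  have hcoord : ∀ e, Continuous fun x : State => x e := fun e => (coordL e).continuous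
  refine ⟨H, Q, ?_, hH0, hQ0⟩
  exact
  { T_pos := hT
    R_pos := hR
    two_le := by omega
    k_le := by omega
    famH := (fam_constArr _ T R h₀).add hT hZ
    famQ := hQ
    coefH := by
      filter_upwards [hZc] with t ht
      exact (coefAt_constArr (radialMeasure R) _ h₀).add ht
    coefQ := by
      filter_upwards [hQc] with t ht
      exact ht.mono le_add_self
    contH := by
      rw [hH0]
      exact continuousOn_const.add ((hcoord 0).comp_continuousOn hc)
    contQ := by
      rw [hQ0]
      exact (hcoord 1).comp_continuousOn hc
    subsonic := by
      intro p hp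
      rw [hH0, hQ0]
      exact hsub p hp
    famz := hU.fam hT hR 0
    famq := hU.fam hT hR 1
    famf₁ := hF.fam hT hR 0
    famf₂ := hF.fam hT hR 1
    memz := fun i j hij => hU.memLp_coord 0 hij
    memq := fun i j hij => hU.memLp_coord 1 hij
    memf₁ := fun i j hij => hF.memLp_coord 0 hij
    memf₂ := fun i j hij => hF.memLp_coord 1 hij
    mass := by
      filter_upwards [hrows, hU0, hF0] with p h1 h2 h3
      simp only [h2, h3]
      exact h1.1
    momentum := by
      filter_upwards [hrows, hU0, hF0, hmem] with p h1 h2 h3 h4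
      have hp : p ∈ closedStrip T R := ⟨Ioo_subset_Icc_self h4.1, Ioi_subset_Ici_self h4.2⟩
      have hpos := (height_pos_of_margin hg hδ (hsub p hp)).1
      have hr : 0 < p.2 := hR.trans h4.2
      -- The second row times `h²`, with `h > 0` and `r > 0` to clear the denominators.
      simp only [arr0_zero, arr1_zero, arr2_zero, h2, h3]
      rw [hH0, hQ0, ← h1.2]
      field_simp
      ring
    tracez := fun i j hij => hl i j 0 hij
    traceq := fun i j hij => hl i j 1 hij
    memcz := fun i j _ => memLp_coord R _ 0
    memcq := fun i j _ => memLp_coord R _ 1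
    boundz := fun i hi => hb i hi 0
    boundq := fun i hi => hb i hi 1 }

end

/-- The inequality of Gronwall, in the form in which it is used. -/
lemma gronwall_le {y N : ℝ → ℝ} {E C P P' ts : ℝ} (hy : Continuous y) (hN : ContinuousOn N (Icc 0 ts))
    (hy0 : ∀ t, 0 ≤ y t) (hN0 : ∀ t, 0 ≤ N t) (hE : 0 ≤ E) (hC : 0 ≤ C) (hP : 0 ≤ P)
    (hts : 0 ≤ ts) (h0 : y 0 + N 0 ≤ P * E)
    (h : ∀ᵐ t ∂(volume.restrict (Ioo 0 ts)), y t + N t ≤ P * (E + C * ∫ τ in Ioo 0 t, y τ) ∧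
      y t + N t ≤ P' * (E + C * ∫ τ in Ioo 0 t, y τ)) :
    y ts + N ts ≤ P * E * Real.exp (C * P' * ts) := by
  rcases hts.eq_or_lt with rfl | hts
  · simpa using h0
  have hint : ∀ t ∈ Icc 0 ts, ∫ τ in Ioo 0 t, y τ = ∫ τ in (0 : ℝ)..t, y τ := fun t ht => by
    rw [intervalIntegral.integral_of_le ht.1, integral_Ioc_eq_integral_Ioo]
  set Y : ℝ → ℝ := fun t => E + C * ∫ τ in (0 : ℝ)..t, y τ with hY
  have hYd : ∀ t, HasDerivAt Y (C * y t) t := fun t =>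
    ((intervalIntegral.integral_hasDerivAt_right (hy.intervalIntegrable _ _)
      hy.aestronglyMeasurable.stronglyMeasurableAtFilter hy.continuousAt).const_mul C).const_add E
  have hYc : Continuous Y := continuous_iff_continuousAt.2 fun t => (hYd t).continuousAt
  -- Continuity carries an inequality from almost every time to every time, including the end point
  -- `ts`.
  have ext : ∀ p : ℝ, (∀ᵐ t ∂(volume.restrict (Ioo 0 ts)),
      y t + N t ≤ p * (E + C * ∫ τ in Ioo 0 t, y τ)) → ∀ t ∈ Icc 0 ts, y t + N t ≤ p * Y t := by
    intro p hp t ht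
    have e : EqOn (fun t => max (y t + N t) (p * Y t)) (fun t => p * Y t) (Icc 0 ts) := by
      refine Measure.eqOn_Icc_of_ae_eq volume hts.ne ?_
        ((hy.continuousOn.add hN).sup (hYc.const_mul p).continuousOn) (hYc.const_mul p).continuousOn
      rw [Measure.restrict_congr_set Ioo_ae_eq_Icc.symm]
      filter_upwards [hp, ae_restrict_mem measurableSet_Ioo] with t h1 h2
      rw [hint t (Ioo_subset_Icc_self h2)] at h1
      exact max_eq_right h1
    exact max_eq_right_iff.1 (e ht)
  have h1 := ext P (h.mono fun t a => a.1)
  have h2 := ext P' (h.mono fun t a => a.2)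
  have hYn : ∀ t ∈ Icc 0 ts, 0 ≤ Y t := fun t ht =>
    add_nonneg hE (mul_nonneg hC (intervalIntegral.integral_nonneg ht.1 fun τ _ => hy0 τ))
  -- The bound with `P'` gives the rate of growth of `Y`, the one with `P` the final prefactor. They
  -- are kept apart because in the application `P` depends on `ts` and may not enter the exponent.
  have hgr := norm_le_gronwallBound_of_norm_deriv_right_le (f := Y) (f' := fun t => C * y t)
    (δ := E) (K := C * P') (ε := 0) (a := 0) (b := ts) hYc.continuousOn
    (fun t _ => (hYd t).hasDerivWithinAt) (by simp [hY, abs_of_nonneg hE]) (fun t ht => by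
      have ht' := Ico_subset_Icc_self ht
      rw [Real.norm_of_nonneg (mul_nonneg hC (hy0 t)), Real.norm_of_nonneg (hYn t ht'), add_zero,
        mul_assoc]
      have := h2 t ht'
      have := hN0 t
      gcongr
      linarith) ts ⟨hts.le, le_rfl⟩
  rw [gronwallBound_ε0, sub_zero] at hgr
  calc y ts + N ts ≤ P * Y ts := h1 ts ⟨hts.le, le_rfl⟩
    _ ≤ P * (E * Real.exp (C * P' * ts)) := by
      gcongr
      exact (le_abs_self _).trans hgr
    _ = _ := by ring

/-- The solutions of the scalar system, by the inequality of Gronwall. -/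
lemma SysData.gronwall {grav δ R A C Λ Λ' ts : ℝ} {k n : ℕ} {K : ℝ≥0∞} {D : SysData}
    (h : D.IsSys grav δ R k K) (hA : 0 ≤ A) (hC : 0 ≤ C) (hts : ts ∈ Icc 0 D.T)
    (hΛ : D.BddBy R Λ ts) (hΛ' : D.BddBy R Λ' ts)
    (hest : ∀ Λ, D.BddBy R Λ ts → ∀ᵐ t ∂(volume.restrict (Ioo 0 D.T)), t ≤ ts →
      solN k R D.z D.q t + ∑ i ∈ Finset.range (k + 1), ∫ τ in Ioo 0 t, (D.bz i τ ^ 2 + D.bq i τ ^ 2) ≤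
        A * Λ ^ n * D.rhs k R C t) {y : ℝ → ℝ} (hyc : Continuous y) (hy : ∀ t, 0 ≤ y t)
    (hsol : ∀ᵐ t ∂(volume.restrict (Ioo 0 D.T)), solN k R D.z D.q t = y t)
    (hini : y 0 = D.ini k R) :
    y ts + ∑ i ∈ Finset.range (k + 1), ∫ τ in Ioo 0 ts, (D.bz i τ ^ 2 + D.bq i τ ^ 2) ≤
      (A * Λ ^ n + 1) * (D.ini k R + (∫ τ in Ioo 0 ts, ∑ i ∈ Finset.range (k + 1), D.bq i τ ^ 2) +
        C * ∫ τ in Ioo 0 ts, solN k R D.f₁ D.f₂ τ) * Real.exp (C * (A * Λ' ^ n) * ts) := by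
  have hsubT : Ioo 0 ts ⊆ Ioo 0 D.T := Ioo_subset_Ioo_right hts.2
  set N : ℝ → ℝ := fun t => ∑ i ∈ Finset.range (k + 1), ∫ τ in Ioo 0 t, (D.bz i τ ^ 2 + D.bq i τ ^ 2)
    with hN
  have hN0 : ∀ t, 0 ≤ N t := fun t => Finset.sum_nonneg fun i _ =>
    integral_nonneg fun _ => by positivity
  have hbint : ∀ i ∈ Finset.range (k + 1), IntegrableOn (fun τ => D.bz i τ ^ 2) (Ioo 0 ts) ∧
      IntegrableOn (fun τ => D.bq i τ ^ 2) (Ioo 0 ts) := by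
    intro i hi
    rw [Finset.mem_range] at hi
    have h1 := mem_bz h (i := i) (by omega)
    exact ⟨IntegrableOn.mono_set ((memLp_two_iff_integrable_sq h1.1.1).1 h1.1) hsubT,
      IntegrableOn.mono_set ((memLp_two_iff_integrable_sq h1.2.1).1 h1.2) hsubT⟩
  have hNc : ContinuousOn N (Icc 0 ts) := by
    refine continuousOn_finsetSum _ fun i hi => ?_
    simp only [← integral_Ioc_eq_integral_Ioo]
    refine intervalIntegral.continuousOn_primitive ?_
    rw [integrableOn_Icc_iff_integrableOn_Ioo]
    exact (hbint i hi).1.add (hbint i hi).2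
  obtain ⟨J, hJ⟩ : ∃ J, J = ∫ τ in Ioo 0 ts, solN k R D.f₁ D.f₂ τ := ⟨_, rfl⟩
  have hJ0 : 0 ≤ J := hJ ▸ integral_nonneg fun _ => solN_nonneg _ _ _ _ _
  obtain ⟨β, hβ⟩ : ∃ β, β = ∫ τ in Ioo 0 ts, ∑ i ∈ Finset.range (k + 1), D.bq i τ ^ 2 := ⟨_, rfl⟩
  have hβ0 : 0 ≤ β := hβ ▸ D.integral_bq_nonneg k ts
  rw [← hJ, ← hβ]
  have hini0 := D.ini_nonneg k R
  -- The data are frozen at the final time `ts`; the right-hand sides at earlier times are bounded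
  -- by `E` plus the integral of the solution.
  set E := D.ini k R + β + C * J with hE
  have hE0 : 0 ≤ E := by positivity
  have i1 := SysData.integrableOn_solN (k := k) (z := D.z) (q := D.q) (T := D.T) (R := R)
    (fun i j hij => h.memz i j (by omega)) fun i j hij => h.memq i j (by omega)
  have i2 := SysData.integrableOn_solN (k := k) (z := D.f₁) (q := D.f₂) (T := D.T) (R := R)
    h.memf₁ h.memf₂
  have hrhs : ∀ t ∈ Ioo 0 ts, D.rhs k R C t ≤ E + C * ∫ τ in Ioo 0 t, y τ := by
    intro t ht
    have hle : Ioo 0 t ⊆ Ioo 0 ts := Ioo_subset_Ioo_right ht.2.le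
    have htT := hle.trans hsubT
    have e1 : ∫ τ in Ioo 0 t, D.src k R τ =
        (∫ τ in Ioo 0 t, y τ) + ∫ τ in Ioo 0 t, solN k R D.f₁ D.f₂ τ := by
      rw [← integral_congr_ae (ae_restrict_of_ae_restrict_of_subset htT hsol)]
      exact integral_add (IntegrableOn.mono_set i1 htT) (IntegrableOn.mono_set i2 htT)
    have e2 : ∫ τ in Ioo 0 t, solN k R D.f₁ D.f₂ τ ≤ J := by
      rw [hJ]
      exact setIntegral_mono_set (IntegrableOn.mono_set i2 hsubT)
        (Eventually.of_forall fun _ => solN_nonneg _ _ _ _ _) hle.eventuallyLE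
    have e3 : ∫ τ in Ioo 0 t, ∑ i ∈ Finset.range (k + 1), D.bq i τ ^ 2 ≤ β := by
      rw [hβ]
      exact setIntegral_mono_set (integrable_finsetSum _ fun i hi => (hbint i hi).2)
        (Eventually.of_forall fun _ => Finset.sum_nonneg fun _ _ => sq_nonneg _) hle.eventuallyLE
    unfold SysData.rhs
    rw [e1]
    have := mul_le_mul_of_nonneg_left e2 hC
    linarith
  have hae : ∀ Λ, D.BddBy R Λ ts → ∀ᵐ t ∂(volume.restrict (Ioo 0 ts)),
      y t + N t ≤ A * Λ ^ n * (E + C * ∫ τ in Ioo 0 t, y τ) := by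
    intro Λ hΛ
    filter_upwards [ae_restrict_of_ae_restrict_of_subset hsubT (hest Λ hΛ),
      ae_restrict_of_ae_restrict_of_subset hsubT hsol, ae_restrict_mem measurableSet_Ioo] with t h1 h2 h4
    have h5 := h1 h4.2.le
    rw [h2] at h5
    have := hΛ.one_le
    exact h5.trans (mul_le_mul_of_nonneg_left (hrhs t h4) (by positivity))
  -- The summand `1` makes the inequality at `t = 0` automatic, whatever `A` is.
  have hP1 : 1 ≤ A * Λ ^ n + 1 := by
    have := hΛ.one_le
    linarith [show 0 ≤ A * Λ ^ n by positivity]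
  refine gronwall_le hyc hNc hy hN0 hE0 hC (by linarith) hts.1 ?_ ?_
  · have : N 0 = 0 := by simp [hN]
    rw [this, add_zero, hini]
    have : D.ini k R ≤ E := by
      have : 0 ≤ C * J := by positivity
      linarith
    exact this.trans (le_mul_of_one_le_left hE0 hP1)
  · filter_upwards [hae _ hΛ, hae _ hΛ'] with t h1 h2
    refine ⟨h1.trans ?_, h2⟩
    have : 0 ≤ ∫ τ in Ioo 0 t, y τ := integral_nonneg hy
    exact mul_le_mul_of_nonneg_right (by linarith) (by positivity)

/-- The constants of the estimate of `SysData.gronwall`. -/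
lemma prefactor_le {A h₀ σ K K₀ ts C₀ ini β J : ℝ} {n : ℕ} (hA : 0 ≤ A) (hh₀ : 0 < h₀) (hσ : 1 ≤ σ)
    (hK : 0 ≤ K) (hK₀ : 0 ≤ K₀) (hts : 0 ≤ ts) (hC₀ : 0 ≤ C₀) (hini : 0 ≤ ini) (hβ : 0 ≤ β)
    (hJ : 0 ≤ J) :
    (A * (h₀ + 1 + σ * (K₀ + K * ts)) ^ n + 1) * (ini + β + C₀ * J) *
        Real.exp (C₀ * (A * (h₀ + 1 + σ * K) ^ n) * ts) ≤
      (A * (h₀ + 1 + σ) ^ n + 1) * (1 + K₀) ^ n *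
        Real.exp ((n * K + C₀ * (A * (h₀ + 1 + σ * K) ^ n) + C₀) * ts) *
        (ini + β + (n * K + C₀ * (A * (h₀ + 1 + σ * K) ^ n) + C₀) * J) := by
  set c₀ := h₀ + 1 + σ with hc₀
  set Λ := h₀ + 1 + σ * (K₀ + K * ts) with hΛdef
  set P' := A * (h₀ + 1 + σ * K) ^ n with hP'
  have hP'0 : 0 ≤ P' := by positivity
  have hΛ0 : 0 ≤ Λ := by positivity
  -- This converts the polynomial growth in time of the bound of the coefficients into an
  -- exponential, leaving `(1 + K₀) ^ n` as prefactor.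
  have hKt : 1 + K * ts ≤ Real.exp (K * ts) := by
    have := Real.add_one_le_exp (K * ts); linarith
  have hΛle : Λ ≤ c₀ * (1 + K₀) * Real.exp (K * ts) := by
    have h1 : Λ ≤ c₀ * (1 + K₀) * (1 + K * ts) := by
      have h4 : 0 ≤ (h₀ + 1) * (K₀ + K * ts + K₀ * (K * ts)) := by positivity
      have h5 : 0 ≤ σ * (1 + K₀ * (K * ts)) := by positivity
      have : c₀ * (1 + K₀) * (1 + K * ts) = Λ + ((h₀ + 1) * (K₀ + K * ts + K₀ * (K * ts)) +
        σ * (1 + K₀ * (K * ts))) := by rw [hc₀, hΛdef]; ring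
      linarith
    exact h1.trans (mul_le_mul_of_nonneg_left hKt (by positivity))
  have hPle : A * Λ ^ n + 1 ≤ (A * c₀ ^ n + 1) * (1 + K₀) ^ n * Real.exp (n * K * ts) := by
    have h1 : Λ ^ n ≤ c₀ ^ n * ((1 + K₀) ^ n * Real.exp (n * K * ts)) := by
      calc Λ ^ n ≤ (c₀ * (1 + K₀) * Real.exp (K * ts)) ^ n := pow_le_pow_left₀ hΛ0 hΛle n
        _ = _ := by rw [mul_pow, mul_pow, ← Real.exp_nat_mul, mul_assoc (n : ℝ), mul_assoc]
    have h2 : 1 ≤ (1 + K₀) ^ n * Real.exp (n * K * ts) :=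
      one_le_mul_of_one_le_of_one_le (one_le_pow₀ (by linarith)) (Real.one_le_exp (by positivity))
    calc A * Λ ^ n + 1 ≤ A * (c₀ ^ n * ((1 + K₀) ^ n * Real.exp (n * K * ts))) +
          (1 + K₀) ^ n * Real.exp (n * K * ts) := add_le_add (mul_le_mul_of_nonneg_left h1 hA) h2
      _ = _ := by ring
  have hexp : Real.exp (n * K * ts) * Real.exp (C₀ * P' * ts) ≤
      Real.exp ((n * K + C₀ * P' + C₀) * ts) := by
    rw [← Real.exp_add, Real.exp_le_exp]
    have : 0 ≤ C₀ * ts := by positivity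
    linarith
  have hE : ini + β + C₀ * J ≤ ini + β + (n * K + C₀ * P' + C₀) * J := by
    have : 0 ≤ (n * K + C₀ * P') * J := by positivity
    linarith
  calc (A * Λ ^ n + 1) * (ini + β + C₀ * J) * Real.exp (C₀ * P' * ts)
      ≤ ((A * c₀ ^ n + 1) * (1 + K₀) ^ n * Real.exp (n * K * ts)) *
          (ini + β + (n * K + C₀ * P' + C₀) * J) * Real.exp (C₀ * P' * ts) := by
        gcongr
    _ = (A * c₀ ^ n + 1) * (1 + K₀) ^ n * (Real.exp (n * K * ts) * Real.exp (C₀ * P' * ts)) *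
          (ini + β + (n * K + C₀ * P' + C₀) * J) := by ring
    _ ≤ _ := by gcongr

/-- The estimate of the solutions of the mixed problem, with a prefactor that depends only on the
initial value of the coefficient. -/
theorem exists_estimate {grav h₀ δ R : ℝ} (hg : 0 < grav) (hh₀ : 0 < h₀) (hδ : 0 < δ) (hR : 0 < R)
    (k : ℕ) : ∃ (A : ℝ) (n : ℕ), 1 ≤ A ∧ ∀ K : ℝ, 0 ≤ K → ∃ C : ℝ, 0 ≤ C ∧
      ∀ T : ℝ, 0 < T → ∀ (ubar : ℝ × ℝ → State) (Ubar : ℕ → ℕ → ℝ → L2r R),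
      IsXFamily (max k 2) T R ubar Ubar → ContinuousOn ubar (closedStrip T R) →
      SubsonicWith grav h₀ T R δ ubar →
      (∀ i j, i + j ≤ max k 2 → ∀ t ∈ Icc 0 T, ‖Ubar i j t‖ ≤ K) →
      ∀ (f : ℝ × ℝ → State) (F : ℕ → ℕ → ℝ × ℝ → State) (gb : ℝ → ℝ) (G : ℕ → ℝ → ℝ)
        (u₀ : ℝ → State), IsStripFamily k T R f F → IsHFamily k T gb G →
      ∀ (u : ℝ × ℝ → State) (U : ℕ → ℕ → ℝ × ℝ → State), IsStripFamily (k + 1) T R u U →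
      ContinuousOn u (closedStrip T R) → IsSolution grav h₀ T R ubar f gb u₀ u U →
      ∃ (V : ℕ → ℕ → ℝ → L2r R) (b : ℕ → ℝ → State),
        IsXFamily k T R u V ∧ IsHFamily k T (fun t => u (t, R)) b ∧
        ∀ K₀, 0 ≤ K₀ → ‖Ubar 0 0 0‖ ≤ K₀ → ‖Ubar 0 1 0‖ ≤ K₀ → ∀ t ∈ Icc 0 T,
          dsum k (fun i j => ‖V i j t‖ ^ 2) + hNormSq k b t ≤
            A * (1 + K₀) ^ n * Real.exp (C * t) *
              (dsum k (fun i j => ‖V i j 0‖ ^ 2) + hNormSq k G t +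
                C * ∫ τ in Ioo 0 t, dsum k fun i j => ∫ r, ‖F i j (τ, r)‖ ^ 2 ∂(radialMeasure R)) := by
  obtain ⟨A₀, n, hA₀, hest⟩ := est_all (k := k) hg hδ hR
  set σ := sobC R with hσ
  have hσ1 : 1 ≤ σ := one_le_sobC R
  refine ⟨A₀ * (h₀ + 1 + σ) ^ n + 1, n, by linarith [show 0 ≤ A₀ * (h₀ + 1 + σ) ^ n by positivity], fun K hK => ?_⟩
  obtain ⟨C₀, hC₀, hest⟩ := hest (‖h₀‖ₑ + ENNReal.ofReal (σ * K)) (by simp)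
  -- The three terms are the growth of the prefactor, the rate in the inequality of Gronwall and the
  -- factor of the source.
  refine ⟨n * K + C₀ * (A₀ * (h₀ + 1 + σ * K) ^ n) + C₀, by positivity, ?_⟩
  intro T hT ubar Ubar hX hc hsub hUK f F gb G u₀ hF hG u U hU hu hS
  obtain ⟨V, hV, hl, hUV⟩ := hU.exists_XFamily hT hR hu
  obtain ⟨b, hb, hbl⟩ := hU.exists_trace hT hR hu
  refine ⟨V, b, hV, hb, fun K₀ hK₀ hK00 hK01 ts hts => ?_⟩
  obtain ⟨H, Q, hsys, hH0, hQ0⟩ := exists_linSys hg hδ hT hR hX hc hsub hK hUK hF hU hS hl hbl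
  set D : SysData := ⟨T, H, Q, fun i j p => U i j p 0, fun i j p => U i j p 1, fun i j p => F i j p 0,
    fun i j p => F i j p 1, fun i j r => V i j 0 r 0, fun i j r => V i j 0 r 1,
    fun i t => b i t 0, fun i t => b i t 1⟩ with hD
  have hsysD : D.IsSys grav δ R k (‖h₀‖ₑ + ENNReal.ofReal (σ * K)) := hsys
  have hbdd : ∀ M, (∀ t ∈ Icc 0 T, t ≤ ts → ‖Ubar 0 0 t‖ ≤ M ∧ ‖Ubar 0 1 t‖ ≤ M) → 0 ≤ M →
      D.BddBy R (h₀ + 1 + σ * M) ts := by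
    intro M hM hM0
    have hσM : 0 ≤ σ * M := by positivity
    refine ⟨by linarith, hts.1, fun p hp hpt => ?_⟩
    obtain ⟨m0, m1⟩ := hM p.1 hp.1 hpt
    have h0 := hX.abs_le hR (by omega) hc hp.1 0 hp.2 m0 m1
    have h1 := hX.abs_le hR (by omega) hc hp.1 1 hp.2 m0 m1
    simp only [hD, hH0, hQ0, height]
    have := le_abs_self ((ubar p) 0)
    constructor
    · linarith [h0]
    · linarith [h1]
  -- Two bounds of the same coefficients: this one is independent of time and enters the rate, the
  -- next one starts from the initial norm and enters the prefactor.
  have hΛ' := hbdd K (fun t ht _ => ⟨hUK 0 0 (by omega) t ht, hUK 0 1 (by omega) t ht⟩) hK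
  have hΛ := hbdd (K₀ + K * ts) (fun t ht htt => by
    have e1 := hX.norm_le_add (i := 0) (j := 0) (by omega) (fun t ht => hUK 1 0 (by omega) t ht) ht
    have e2 := hX.norm_le_add (i := 0) (j := 1) (by omega) (fun t ht => hUK 1 1 (by omega) t ht) ht
    have e3 : K * t ≤ K * ts := by gcongr
    constructor <;> linarith) (by have := hts.1; positivity)
  -- The squared norm of the solution, extended by its end values so that it is continuous on the
  -- whole line.
  set y : ℝ → ℝ := IccExtend hT.le (Set.domRestrict (Icc 0 T) fun t => dsum k fun i j => ‖V i j t‖ ^ 2)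
    with hydef
  have hyIcc : ∀ t ∈ Icc 0 T, y t = dsum k fun i j => ‖V i j t‖ ^ 2 := fun t ht => by
    rw [hydef, IccExtend_of_mem _ _ ht]; rfl
  have hycont : Continuous y := by
    refine Continuous.Icc_extend' (continuousOn_iff_continuous_domRestrict.1 ?_)
    unfold dsum
    refine continuousOn_finsetSum _ fun i hi => continuousOn_finsetSum _ fun j hj => ?_
    rw [Finset.mem_range] at hi hj
    exact ((hV.cont i j (by omega)).norm).pow 2
  have hy0 : ∀ t, 0 ≤ y t := fun t => dsum_nonneg fun _ _ _ => by positivity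
  have hsol : ∀ᵐ t ∂(volume.restrict (Ioo 0 T)), solN k R D.z D.q t = y t := by
    filter_upwards [hUV, ae_restrict_mem measurableSet_Ioo] with t h1 h2
    rw [hyIcc t (Ioo_subset_Icc_self h2)]
    refine dsum_congr fun i j hij => ?_
    rw [L2r_norm_sq]
    unfold nsq
    congr 1 <;>
    · refine integral_congr_ae ?_
      filter_upwards [h1 i j hij] with r hr
      simp only [hD, hr]
  have hsrc : ∀ᵐ t ∂(volume.restrict (Ioo 0 T)), solN k R D.f₁ D.f₂ t =
      dsum k fun i j => ∫ r, ‖F i j (t, r)‖ ^ 2 ∂(radialMeasure R) := by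
    have : ∀ᵐ t ∂(volume.restrict (Ioo 0 T)), ∀ i j, i + j ≤ k →
        MemLp (fun r => F i j (t, r)) 2 (radialMeasure R) := by
      simp only [ae_all_iff, eventually_imp_distrib_left]
      intro i j hij
      have := hF.memLp i j hij
      rw [stripMeasure_eq_prod] at this
      exact MemLp.ae_section_left this
    filter_upwards [this] with t ht
    exact dsum_congr fun i j hij => (integral_state_norm_sq (ht i j hij)).symm
  have hsubT : Ioo 0 ts ⊆ Ioo 0 T := Ioo_subset_Ioo_right hts.2
  have hNb : hNormSq k b ts =
      ∑ i ∈ Finset.range (k + 1), ∫ τ in Ioo 0 ts, (b i τ 0 ^ 2 + b i τ 1 ^ 2) := by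
    unfold hNormSq
    simp only [state_norm_sq]
  -- The boundary condition: the time derivatives of the second component of the trace are those of
  -- `gb`.
  have hNG : hNormSq k G ts = ∫ τ in Ioo 0 ts, ∑ i ∈ Finset.range (k + 1), b i τ 1 ^ 2 := by
    rw [integral_finsetSum]
    · refine Finset.sum_congr rfl fun i hi => integral_congr_ae ?_
      rw [Finset.mem_range] at hi
      filter_upwards [ae_restrict_of_ae_restrict_of_subset hsubT
        (hb.ae_eq hT hG hS.boundary i (by omega))] with t ht
      rw [ht, Real.norm_eq_abs, sq_abs]
    · intro i hi
      rw [Finset.mem_range] at hi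
      have h1 := MemLp.coord (hb.memLp i (by omega)) 1
      exact IntegrableOn.mono_set ((memLp_two_iff_integrable_sq h1.1).1 h1) hsubT
  have hini : D.ini k R = dsum k fun i j => ‖V i j 0‖ ^ 2 :=
    dsum_congr fun i j _ => (L2r_norm_sq _).symm
  have hJF : ∫ τ in Ioo 0 ts, solN k R D.f₁ D.f₂ τ =
      ∫ τ in Ioo 0 ts, dsum k fun i j => ∫ r, ‖F i j (τ, r)‖ ^ 2 ∂(radialMeasure R) :=
    integral_congr_ae (ae_restrict_of_ae_restrict_of_subset hsubT hsrc)
  have hgr := SysData.gronwall hsysD hA₀ hC₀ hts hΛ hΛ'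
    (fun Λ h => hest D Λ ts hsysD h) hycont hy0 hsol
    ((hyIcc 0 ⟨le_rfl, hT.le⟩).trans hini.symm)
  rw [← hJF, hNG, hNb, ← hini, ← hyIcc ts hts]
  exact hgr.trans (prefactor_le hA₀ hh₀ hσ1 hK hK₀ hts.1 hC₀ (D.ini_nonneg k R)
    (D.integral_bq_nonneg k ts) (integral_nonneg fun _ => solN_nonneg _ _ _ _ _))

/-! ### The symmetrizer of a subsonic flow -/

lemma height_pos_of_subsonic {grav h₀ : ℝ} {v : State} (hg : 0 < grav)
    (h : v 1 ^ 2 / height h₀ v ^ 2 < grav * height h₀ v) : 0 < height h₀ v := by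
  have h1 : 0 < grav * height h₀ v := lt_of_le_of_lt (by positivity) h
  exact (mul_pos_iff_of_pos_left hg).1 h1

/-! ### The system in its eigenvector coordinates. -/

section Matrices

variable {grav h₀ : ℝ} {v : State}

/-- The companion matrix of the eigenvalues; afterwards all identities are polynomial in `λ₊`, `λ₋`
and the inverse of their difference. -/
lemma matA_eq (hg : 0 < grav) (hh : 0 < height h₀ v) : matA grav h₀ v =
    !![0, 1; -(lamPlus grav h₀ v * lamMinus grav h₀ v), lamPlus grav h₀ v + lamMinus grav h₀ v] := by
  have hs : √(grav * height h₀ v) ^ 2 = grav * height h₀ v := Real.sq_sqrt (by positivity)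
  have e1 : grav * height h₀ v - v 1 ^ 2 / height h₀ v ^ 2 =
      -(lamPlus grav h₀ v * lamMinus grav h₀ v) := by
    rw [← div_pow]
    nth_rewrite 1 [← hs]
    unfold lamPlus lamMinus
    ring
  have e2 : 2 * v 1 / height h₀ v = lamPlus grav h₀ v + lamMinus grav h₀ v := by
    unfold lamPlus lamMinus; ring
  rw [matA, e1, e2]

/-- The components of `x` along the eigenvectors of `A(v)`. -/
lemma matS_apply (hg : 0 < grav) (hh : 0 < height h₀ v) (M : ℝ) (x : Fin 2 → ℝ) :
    (matS grav h₀ M v).IsSymm ∧ (matS grav h₀ M v * matA grav h₀ v).IsSymm ∧ ∃ a b,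
      x 0 = b - a ∧ x 1 = lamPlus grav h₀ v * b - lamMinus grav h₀ v * a ∧
      x ⬝ᵥ (matS grav h₀ M v *ᵥ x) = M * ((1 + lamMinus grav h₀ v ^ 2) * a ^ 2) +
        (1 + lamPlus grav h₀ v ^ 2) * b ^ 2 ∧
      x ⬝ᵥ ((matS grav h₀ M v * matA grav h₀ v) *ᵥ x) =
        M * (lamMinus grav h₀ v * ((1 + lamMinus grav h₀ v ^ 2) * a ^ 2)) +
          lamPlus grav h₀ v * ((1 + lamPlus grav h₀ v ^ 2) * b ^ 2) := by
  have hd : lamPlus grav h₀ v - lamMinus grav h₀ v ≠ 0 := by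
    have : 0 < √(grav * height h₀ v) := Real.sqrt_pos.2 (by positivity)
    have e : lamPlus grav h₀ v - lamMinus grav h₀ v = 2 * √(grav * height h₀ v) := by
      unfold lamPlus lamMinus; ring
    rw [e]; positivity
  unfold matS projPlus projMinus
  rw [matA_eq hg hh]
  generalize lamPlus grav h₀ v = l at *
  generalize lamMinus grav h₀ v = m at *
  obtain ⟨e, he⟩ : ∃ e, e = (l - m)⁻¹ := ⟨_, rfl⟩
  have he1 : e * (l - m) = 1 := by rw [he, inv_mul_cancel₀ hd]
  rw [← he]
  have hS : M • ((-(e • (!![0, 1; -(l * m), l + m] - l • (1 : Matrix (Fin 2) (Fin 2) ℝ))))ᵀ *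
        (-(e • (!![0, 1; -(l * m), l + m] - l • (1 : Matrix (Fin 2) (Fin 2) ℝ))))) +
      (e • (!![0, 1; -(l * m), l + m] - m • (1 : Matrix (Fin 2) (Fin 2) ℝ)))ᵀ *
        (e • (!![0, 1; -(l * m), l + m] - m • (1 : Matrix (Fin 2) (Fin 2) ℝ))) =
      (e ^ 2) • !![M * (1 + m ^ 2) * l ^ 2 + (1 + l ^ 2) * m ^ 2,
        -(M * (1 + m ^ 2) * l + (1 + l ^ 2) * m); -(M * (1 + m ^ 2) * l + (1 + l ^ 2) * m),
        M * (1 + m ^ 2) + (1 + l ^ 2)] := by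
    ext i j
    fin_cases i <;> fin_cases j <;>
      simp [Matrix.mul_apply, Fin.sum_univ_two, Matrix.one_apply] <;> ring
  rw [hS]
  -- The witnesses solve `x = b (1, l) - a (1, m)`, with `e` the inverse of `l - m`.
  refine ⟨?_, ?_, (x 1 - l * x 0) * e, (x 1 - m * x 0) * e, ?_, ?_, ?_, ?_⟩
  · ext i j
    fin_cases i <;> fin_cases j <;> simp
  · ext i j
    fin_cases i <;> fin_cases j <;> simp [Matrix.mul_apply, Fin.sum_univ_two] <;> ring
  · linear_combination (-x 0) * he1
  · linear_combination (-x 1) * he1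
  · simp [Matrix.mulVec, dotProduct, Fin.sum_univ_two]; ring
  · simp [Matrix.mulVec, dotProduct, Fin.sum_univ_two]; ring

end Matrices

/-- The dissipativity of the symmetrizer with a large parameter. -/
lemma dissipation_le {μ L l m M a b : ℝ} (hμ : 0 < μ) (hl : μ ≤ l) (hlL : l ≤ L) (hm : μ ≤ -m)
    (hmL : -m ≤ L) (hM : M = 1 + (1 + 2 * (1 + L ^ 2) * L ^ 2 / μ) / μ) :
    (2 * (1 + L ^ 2) * (2 * L ^ 2 / μ ^ 2 + 1))⁻¹ * ((b - a) ^ 2 + (l * b - m * a) ^ 2) -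
      (2 / μ ^ 2 + 2 * (1 + L ^ 2) / μ) * (l * b - m * a) ^ 2 ≤
      -(M * (m * ((1 + m ^ 2) * a ^ 2)) + l * ((1 + l ^ 2) * b ^ 2)) := by
  set y := l * b - m * a with hy
  have hL : 0 < L := hμ.trans_le (hl.trans hlL)
  have hl0 : 0 < l := hμ.trans_le hl
  have hl2 : l ^ 2 ≤ L ^ 2 := by gcongr
  have hm2 : m ^ 2 ≤ L ^ 2 := by rw [← neg_sq]; gcongr; linarith
  -- The component `b` is controlled by `a` and the boundary quantity `y`, so it is enough to
  -- dominate `a²`.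
  have hb : l ^ 2 * b ^ 2 ≤ 2 * (y ^ 2 + m ^ 2 * a ^ 2) := by
    have : l * b = y + m * a := by rw [hy]; ring
    rw [← mul_pow, this]
    nlinarith [sq_nonneg (y - m * a)]
  have hb1 : b ^ 2 ≤ 2 / μ ^ 2 * y ^ 2 + 2 * L ^ 2 / μ ^ 2 * a ^ 2 := by
    have h1 : μ ^ 2 * b ^ 2 ≤ 2 * (y ^ 2 + L ^ 2 * a ^ 2) :=
      calc μ ^ 2 * b ^ 2 ≤ l ^ 2 * b ^ 2 := by gcongr
        _ ≤ 2 * (y ^ 2 + m ^ 2 * a ^ 2) := hb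
        _ ≤ _ := by gcongr
    rw [← le_div_iff₀' (by positivity)] at h1
    refine h1.trans_eq ?_
    ring
  have hb2 : l * ((1 + l ^ 2) * b ^ 2) ≤
      2 * (1 + L ^ 2) / μ * y ^ 2 + 2 * (1 + L ^ 2) * L ^ 2 / μ * a ^ 2 := by
    have h1 : μ * (l * ((1 + l ^ 2) * b ^ 2)) ≤ 2 * (1 + L ^ 2) * (y ^ 2 + L ^ 2 * a ^ 2) :=
      calc μ * (l * ((1 + l ^ 2) * b ^ 2)) ≤ l * (l * ((1 + l ^ 2) * b ^ 2)) := by gcongr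
        _ = (1 + l ^ 2) * (l ^ 2 * b ^ 2) := by ring
        _ ≤ (1 + L ^ 2) * (2 * (y ^ 2 + L ^ 2 * a ^ 2)) := by
          refine mul_le_mul (by gcongr) (hb.trans ?_) (by positivity) (by positivity)
          gcongr
        _ = _ := by ring
    rw [← le_div_iff₀' hμ] at h1
    refine h1.trans_eq ?_
    ring
  -- `M` is chosen so that the `λ₋` part exceeds by exactly `a²` the amount of `a²` lost in `hb2`.
  have hMa : (1 + 2 * (1 + L ^ 2) * L ^ 2 / μ) * a ^ 2 ≤ -(M * (m * ((1 + m ^ 2) * a ^ 2))) := by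
    have hM0 : (1 + 2 * (1 + L ^ 2) * L ^ 2 / μ) / μ ≤ M := by rw [hM]; linarith
    have hMμ : 1 + 2 * (1 + L ^ 2) * L ^ 2 / μ ≤ M * μ := by rwa [div_le_iff₀ hμ] at hM0
    have hM1 : 0 < M := lt_of_lt_of_le (by positivity) hM0
    calc (1 + 2 * (1 + L ^ 2) * L ^ 2 / μ) * a ^ 2 ≤ M * (-m) * ((1 + m ^ 2) * a ^ 2) := by
          refine mul_le_mul (hMμ.trans (by gcongr)) ?_ (sq_nonneg _) (by
            have := hμ.trans_le hm; positivity)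
          nlinarith [sq_nonneg a, mul_nonneg (sq_nonneg m) (sq_nonneg a)]
      _ = _ := by ring
  have hx : (b - a) ^ 2 + y ^ 2 ≤ 2 * (1 + L ^ 2) * (a ^ 2 + b ^ 2) := by
    have e1 : (b - a) ^ 2 ≤ 2 * (a ^ 2 + b ^ 2) := by nlinarith [sq_nonneg (a + b)]
    have e2 : y ^ 2 ≤ 2 * (L ^ 2 * b ^ 2 + L ^ 2 * a ^ 2) := by
      have : y ^ 2 ≤ 2 * (l ^ 2 * b ^ 2 + m ^ 2 * a ^ 2) := by
        rw [hy]; nlinarith [sq_nonneg (l * b + m * a)]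
      exact this.trans (by gcongr)
    linarith
  set w := 2 * L ^ 2 / μ ^ 2 + 1 with hw
  have hw0 : 1 ≤ w := by rw [hw]; have : 0 ≤ 2 * L ^ 2 / μ ^ 2 := by positivity
                         linarith
  have hx2 : (b - a) ^ 2 + y ^ 2 ≤ 2 * (1 + L ^ 2) * w * (a ^ 2 + 2 / μ ^ 2 * y ^ 2) := by
    refine hx.trans ?_
    rw [mul_assoc _ w]
    have h0 : 0 ≤ 2 / μ ^ 2 * y ^ 2 := by positivity
    have h1 : 2 / μ ^ 2 * y ^ 2 ≤ w * (2 / μ ^ 2 * y ^ 2) := le_mul_of_one_le_left h0 hw0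
    refine mul_le_mul_of_nonneg_left ?_ (by positivity)
    have : w * a ^ 2 = 2 * L ^ 2 / μ ^ 2 * a ^ 2 + a ^ 2 := by rw [hw]; ring
    linarith
  have hx3 : (2 * (1 + L ^ 2) * w)⁻¹ * ((b - a) ^ 2 + y ^ 2) ≤ a ^ 2 + 2 / μ ^ 2 * y ^ 2 := by
    rw [inv_mul_le_iff₀ (by positivity)]
    exact hx2
  linarith

/-- A subsonic flow with a margin that is bounded has symmetrizer data. -/
lemma exists_symmetrizer {grav h₀ T R δ B : ℝ} {ubar : ℝ × ℝ → State} (hg : 0 < grav) (hδ : 0 < δ)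
    (hsub : SubsonicWith grav h₀ T R δ ubar)
    (hB : ∀ p ∈ closedStrip T R, height h₀ (ubar p) ≤ B) :
    ∃ M α c₁ c₂ : ℝ, IsSymmetrizerData grav h₀ T R M α c₁ c₂ ubar := by
  -- An upper bound of `λ₊` and of `-λ₋`, as `|q / h| < √(g h)`; the maximum with `1` makes it
  -- positive.
  set L := 2 * √(grav * max B 1) with hL
  have hL0 : 0 < L := by positivity
  -- A lower bound of `λ₊` and of `-λ₋`: their product is at least `δ` and each is at most `L`.
  set μ := δ / L with hμ
  have hμ0 : 0 < μ := by positivity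
  set M := 1 + (1 + 2 * (1 + L ^ 2) * L ^ 2 / μ) / μ with hM
  have hM1 : 1 ≤ M := by
    have : 0 ≤ (1 + 2 * (1 + L ^ 2) * L ^ 2 / μ) / μ := by positivity
    linarith
  have hh : ∀ p ∈ closedStrip T R, 0 < height h₀ (ubar p) := fun p hp =>
    (height_pos_of_margin hg hδ (hsub p hp)).1
  have hlam : ∀ p ∈ closedStrip T R, μ ≤ lamPlus grav h₀ (ubar p) ∧ lamPlus grav h₀ (ubar p) ≤ L ∧
      μ ≤ -lamMinus grav h₀ (ubar p) ∧ -lamMinus grav h₀ (ubar p) ≤ L := by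
    intro p hp
    have hpos := hh p hp
    have hs : √(grav * height h₀ (ubar p)) ^ 2 = grav * height h₀ (ubar p) :=
      Real.sq_sqrt (by positivity)
    have hcL : √(grav * height h₀ (ubar p)) ≤ √(grav * max B 1) := by
      gcongr
      exact (hB p hp).trans (le_max_left _ _)
    have hd := hsub p hp
    rw [← div_pow, ← hs] at hd
    unfold lamPlus lamMinus
    generalize (ubar p) 1 / height h₀ (ubar p) = w at *
    have hc0 := Real.sqrt_nonneg (grav * height h₀ (ubar p))
    generalize √(grav * height h₀ (ubar p)) = c at *
    have hw : |w| < c := abs_lt_of_sq_lt_sq (by linarith) hc0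
    obtain ⟨w1, w2⟩ := abs_lt.1 hw
    have hprod : δ ≤ (c + w) * (c - w) := by linarith
    refine ⟨?_, by linarith, ?_, by linarith⟩
    · rw [hμ, div_le_iff₀ hL0]
      exact hprod.trans (mul_le_mul_of_nonneg_left (by linarith) (by linarith))
    · rw [hμ, div_le_iff₀ hL0]
      calc δ ≤ (c - w) * (c + w) := by linarith
        _ ≤ (c - w) * L := mul_le_mul_of_nonneg_left (by linarith) (by linarith)
        _ = _ := by ring
  have hdot : ∀ x : Fin 2 → ℝ, x ⬝ᵥ x = x 0 ^ 2 + x 1 ^ 2 := fun x => by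
    rw [dotProduct, Fin.sum_univ_two]; ring
  set c₁ := (2 * (1 + L ^ 2) * (2 * L ^ 2 / μ ^ 2 + 1))⁻¹ with hc₁
  set c₂ := 2 / μ ^ 2 + 2 * (1 + L ^ 2) / μ with hc₂
  have hc₁0 : 0 < c₁ := by positivity
  have hdiss : ∀ p ∈ closedStrip T R, ∀ x : Fin 2 → ℝ, c₁ * (x ⬝ᵥ x) - c₂ * x 1 ^ 2 ≤
      -(x ⬝ᵥ ((matS grav h₀ M (ubar p) * matA grav h₀ (ubar p)) *ᵥ x)) := by
    intro p hp x
    obtain ⟨-, -, a, b, h0, h1, -, h2⟩ := matS_apply hg (hh p hp) M x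
    obtain ⟨l1, l2, l3, l4⟩ := hlam p hp
    rw [h2, hdot, h0, h1]
    exact dissipation_le hμ0 l1 l2 l3 l4 hM
  refine ⟨M, 1 / 2, c₁, c₂, by linarith, by norm_num, hc₁0, by positivity,
    fun p hp => (matS_apply hg (hh p hp) M 0).1, fun p hp => (matS_apply hg (hh p hp) M 0).2.1, ?_, ?_,
    fun t ht x => ?_⟩
  · intro p hp x
    obtain ⟨-, -, a, b, h0, h1, h2, -⟩ := matS_apply hg (hh p hp) M x
    rw [h2, hdot, h0, h1]
    generalize lamPlus grav h₀ (ubar p) = l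
    generalize lamMinus grav h₀ (ubar p) = m
    have e1 : (1 + m ^ 2) * a ^ 2 ≤ M * ((1 + m ^ 2) * a ^ 2) :=
      le_mul_of_one_le_left (by positivity) hM1
    -- `(b - a)² ≤ 2 (a² + b²)`, and likewise for the second component: this is where `α = 1 / 2`
    -- comes from.
    nlinarith [sq_nonneg (a + b), sq_nonneg (l * b + m * a)]
  · intro p hp x hx hx0
    have h := hdiss p hp x
    rw [hx] at h
    have : 0 < x ⬝ᵥ x := by
      rw [hdot, hx]
      have : x 0 ≠ 0 := fun h => hx0 (by ext i; fin_cases i <;> simp [h, hx])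
      positivity
    have := mul_pos hc₁0 this
    linarith
  · exact hdiss (t, R) ⟨ht, le_refl R⟩ x

/-! ### The margin of a subsonic flow -/

/-- The tails of a function of `L²_r`. -/
lemma exists_tail_le {R : ℝ} (f : L2r R) (e : Fin 2) {η : ℝ} (hη : 0 < η) :
    ∃ ρ, ∀ r ≥ ρ, ∫ x in Ioi r, f x e ^ 2 ∂(radialMeasure R) ≤ η := by
  have hi : Integrable (fun x => f x e ^ 2) (radialMeasure R) :=
    (memLp_two_iff_integrable_sq (memLp_coord R f e).1).1 (memLp_coord R f e)
  have h := tendsto_setIntegral_of_antitone (μ := radialMeasure R) (s := fun r : ℝ => Ioi r)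
    (f := fun x => f x e ^ 2) (fun r => measurableSet_Ioi) (fun a b hab => Ioi_subset_Ioi hab)
    ⟨0, hi.integrableOn⟩
  have h0 : ⋂ n : ℝ, Ioi n = ∅ := by
    ext x
    simp only [mem_iInter, mem_Ioi, mem_empty_iff_false, iff_false, not_forall, not_lt]
    exact ⟨x, le_rfl⟩
  rw [h0, setIntegral_empty] at h
  obtain ⟨ρ, hρ⟩ := eventually_atTop.1 (h.eventually (ge_mem_nhds hη))
  exact ⟨ρ, hρ⟩

/-- The tails of a continuous curve in `L²_r` are uniformly small. -/
lemma exists_uniform_tail_le {T R : ℝ} {V : ℝ → L2r R} (hV : ContinuousOn V (Icc 0 T)) (e : Fin 2)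
    {η : ℝ} (hη : 0 < η) :
    ∃ ρ, ∀ t ∈ Icc 0 T, ∀ r ≥ ρ, ∫ x in Ioi r, V t x e ^ 2 ∂(radialMeasure R) ≤ η := by
  refine isCompact_Icc.induction_on
    (p := fun s => ∃ ρ, ∀ t ∈ s, ∀ r ≥ ρ, ∫ x in Ioi r, V t x e ^ 2 ∂(radialMeasure R) ≤ η)
    ⟨0, by simp⟩ ?_ ?_ ?_
  · rintro s t hst ⟨ρ, h⟩
    exact ⟨ρ, fun x hx => h x (hst hx)⟩
  · rintro s t ⟨ρ, h⟩ ⟨ρ', h'⟩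
    refine ⟨max ρ ρ', fun x hx r hr => ?_⟩
    rcases hx with hx | hx
    · exact h x hx r ((le_max_left _ _).trans hr)
    · exact h' x hx r ((le_max_right _ _).trans hr)
  · intro t ht
    -- Near `t` the tail is at most `2 (η / 4 + η / 4) = η`, from the tail at `t` and the distance
    -- of the two curve values. Compactness then gives a common `ρ`.
    obtain ⟨ρ, hρ⟩ := exists_tail_le (V t) e (show 0 < η / 4 by positivity)
    have hc := Metric.continuousWithinAt_iff.1 (hV t ht) (√(η / 4)) (by positivity)
    obtain ⟨d, hd, hball⟩ := hc
    refine ⟨Icc 0 T ∩ Metric.ball t d, inter_mem_nhdsWithin _ (Metric.ball_mem_nhds _ hd), ρ,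
      fun s hs r hr => ?_⟩
    have h1 := hball hs.1 hs.2
    rw [dist_eq_norm] at h1
    have h2 : ∫ x in Ioi r, (V s - V t : L2r R) x e ^ 2 ∂(radialMeasure R) ≤ η / 4 := by
      have hm := memLp_coord R (V s - V t) e
      refine (setIntegral_le_integral ((memLp_two_iff_integrable_sq hm.1).1 hm)
        (Eventually.of_forall fun x => sq_nonneg _)).trans ?_
      refine (integral_coord_sq_le _ e).trans ?_
      rw [← Real.sq_sqrt (show 0 ≤ η / 4 by positivity)]
      gcongr
    have h3 := integral_add_sq_le ((memLp_coord R (V t) e).restrict (Ioi r))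
      ((memLp_coord R (V s - V t) e).restrict (Ioi r))
    have h4 : ∫ x in Ioi r, V s x e ^ 2 ∂(radialMeasure R) =
        ∫ x in Ioi r, (V t x e + (V s - V t : L2r R) x e) ^ 2 ∂(radialMeasure R) := by
      refine integral_congr_ae (ae_restrict_of_ae ?_)
      filter_upwards [Lp.coeFn_sub (V s) (V t)] with x hx
      rw [hx]
      simp
    have := hρ r hr
    linarith

/-- The flow tends to rest at infinity, uniformly in time. -/
lemma IsXFamily.exists_abs_le {T R : ℝ} {n : ℕ} {v : ℝ × ℝ → State} {V : ℕ → ℕ → ℝ → L2r R}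
    (hR : 0 < R) (h : IsXFamily n T R v V) (hn : 1 ≤ n) (hv : ContinuousOn v (closedStrip T R))
    {ε : ℝ} (hε : 0 < ε) : ∃ ρ ≥ R, ∀ t ∈ Icc 0 T, ∀ r ≥ ρ, ∀ e, |v (t, r) e| ≤ ε := by
  have key : ∀ e : Fin 2, ∃ ρ ≥ R, ∀ t ∈ Icc 0 T, ∀ r ≥ ρ, |v (t, r) e| ≤ ε := by
    intro e
    -- Chosen so that `2 / R` times two such tails equals `ε²`.
    have hη : 0 < R / 4 * ε ^ 2 := by positivity
    obtain ⟨ρ₀, h₀⟩ := exists_uniform_tail_le (h.cont 0 0 (by omega)) e hη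
    obtain ⟨ρ₁, h₁⟩ := exists_uniform_tail_le (h.cont 0 1 (by omega)) e hη
    refine ⟨max R (max ρ₀ ρ₁), le_max_left _ _, fun t ht r hr => ?_⟩
    have hrR : R ≤ r := (le_max_left _ _).trans hr
    have h2 := h.sq_le hR hn hv ht e hrR
    have hi : ∀ j, Integrable (fun x => V 0 j t x e ^ 2) (radialMeasure R) := fun j =>
      (memLp_two_iff_integrable_sq (memLp_coord R _ e).1).1 (memLp_coord R _ e)
    rw [← radialMeasure_restrict hrR, integral_add (hi 0).restrict (hi 1).restrict] at h2
    have h3 := h₀ t ht r (((le_max_left _ _).trans (le_max_right _ _)).trans hr)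
    have h4 := h₁ t ht r (((le_max_right _ _).trans (le_max_right _ _)).trans hr)
    refine abs_le_of_sq_le_sq ?_ hε.le
    calc v (t, r) e ^ 2 ≤ 2 / R * (R / 4 * ε ^ 2 + R / 4 * ε ^ 2) :=
          h2.trans (mul_le_mul_of_nonneg_left (add_le_add h3 h4) (by positivity))
      _ = ε ^ 2 := by field_simp; ring
  obtain ⟨ρ, hρ, h0⟩ := key 0
  obtain ⟨ρ', hρ', h1⟩ := key 1
  refine ⟨max ρ ρ', hρ.le.trans (le_max_left _ _), fun t ht r hr e => ?_⟩
  fin_cases e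
  · exact h0 t ht r ((le_max_left _ _).trans hr)
  · exact h1 t ht r ((le_max_right _ _).trans hr)

/-- A subsonic flow has a margin, and is bounded. -/
lemma exists_margin {grav h₀ T R : ℝ} {n : ℕ} {v : ℝ × ℝ → State} {V : ℕ → ℕ → ℝ → L2r R}
    (hg : 0 < grav) (hh₀ : 0 < h₀) (hT : 0 < T) (hR : 0 < R) (h : IsXFamily n T R v V) (hn : 1 ≤ n)
    (hv : ContinuousOn v (closedStrip T R)) (hsub : Subsonic grav h₀ T R v) :
    (∃ δ > 0, SubsonicWith grav h₀ T R δ v) ∧ ∃ B, ∀ p ∈ closedStrip T R, height h₀ (v p) ≤ B := by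
  -- The first bound keeps `h ≥ h₀ / 2` far out; the second then gives `q² / h² ≤ g h₀ / 4`, so that
  -- a margin `g h₀ / 4` remains there.
  set ε := min (h₀ / 2) (√(grav * h₀ ^ 3) / 4) with hε
  have hε0 : 0 < ε := by positivity
  obtain ⟨ρ, hρR, hρ⟩ := h.exists_abs_le hR hn hv hε0
  have hcoord : ∀ e, Continuous fun x : State => x e := fun e => (coordL e).continuous
  set S := Icc 0 T ×ˢ Icc R ρ with hS
  have hSc : IsCompact S := isCompact_Icc.prod isCompact_Icc
  have hSs : S ⊆ closedStrip T R := fun p hp => ⟨hp.1, hp.2.1⟩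
  have hSn : S.Nonempty := ⟨(0, R), ⟨le_rfl, hT.le⟩, le_rfl, hρR⟩
  have hhc : ContinuousOn (fun p => height h₀ (v p)) (closedStrip T R) :=
    continuousOn_const.add ((hcoord 0).comp_continuousOn hv)
  have hpos : ∀ p ∈ closedStrip T R, 0 < height h₀ (v p) := fun p hp =>
    height_pos_of_subsonic hg (hsub p hp)
  have hmc : ContinuousOn (fun p => grav * height h₀ (v p) - v p 1 ^ 2 / height h₀ (v p) ^ 2)
      (closedStrip T R) :=
    (continuousOn_const.mul hhc).sub ((((hcoord 1).comp_continuousOn hv).pow 2).div (hhc.pow 2)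
      fun p hp => (pow_pos (hpos p hp) 2).ne')
  obtain ⟨p₀, hp₀, hmin⟩ := hSc.exists_isMinOn hSn (hmc.mono hSs)
  obtain ⟨p₁, hp₁, hmax⟩ := hSc.exists_isMaxOn hSn (hhc.mono hSs)
  have htail : ∀ p ∈ closedStrip T R, p ∉ S → |v p 0| ≤ ε ∧ |v p 1| ≤ ε := by
    intro p hp hpS
    have hr : ρ ≤ p.2 := by
      by_contra hlt
      exact hpS ⟨hp.1, hp.2, (not_le.1 hlt).le⟩
    exact ⟨hρ p.1 hp.1 p.2 hr 0, hρ p.1 hp.1 p.2 hr 1⟩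
  have hε1 : ε ≤ h₀ / 2 := min_le_left _ _
  refine ⟨⟨min (grav * height h₀ (v p₀) - v p₀ 1 ^ 2 / height h₀ (v p₀) ^ 2) (grav * h₀ / 4),
    lt_min (sub_pos.2 (hsub p₀ (hSs hp₀))) (by positivity), fun p hp => ?_⟩,
    max (height h₀ (v p₁)) (2 * h₀), fun p hp => ?_⟩
  · by_cases hpS : p ∈ S
    · exact (min_le_left _ _).trans (hmin hpS)
    · refine (min_le_right _ _).trans ?_
      obtain ⟨a, b⟩ := htail p hp hpS
      have hh : h₀ / 2 ≤ height h₀ (v p) := by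
        have := (abs_le.1 a).1
        unfold height
        linarith
      have hq : v p 1 ^ 2 ≤ grav * h₀ ^ 3 / 16 := by
        have e1 : |v p 1| ≤ √(grav * h₀ ^ 3) / 4 := b.trans (min_le_right _ _)
        rw [← sq_abs]
        calc |v p 1| ^ 2 ≤ (√(grav * h₀ ^ 3) / 4) ^ 2 := by gcongr
          _ = _ := by rw [div_pow, Real.sq_sqrt (by positivity)]; norm_num
      have h1 : v p 1 ^ 2 / height h₀ (v p) ^ 2 ≤ grav * h₀ / 4 := by
        rw [div_le_iff₀ (pow_pos (hpos p hp) 2)]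
        refine hq.trans ?_
        calc grav * h₀ ^ 3 / 16 = grav * h₀ / 4 * (h₀ / 2) ^ 2 := by ring
          _ ≤ _ := by gcongr
      have h2 : grav * (h₀ / 2) ≤ grav * height h₀ (v p) := by gcongr
      linarith
  · by_cases hpS : p ∈ S
    · exact (hmax hpS).trans (le_max_left _ _)
    · refine le_trans ?_ (le_max_right _ _)
      have := (abs_le.1 (htail p hp hpS).1).2
      unfold height
      linarith

/-! ### The norms and the constants of the statement -/

/-- On the eigenvector `(1, λ₊)` the projector `P₋` vanishes and `P₊` is the identity, so the form
of `S` there is `|x|²` for any `M`. -/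
lemma IsSymmetrizerData.alpha_le_one {grav h₀ T R M α c₁ c₂ : ℝ} {ubar : ℝ × ℝ → State}
    (h : IsSymmetrizerData grav h₀ T R M α c₁ c₂ ubar) (hg : 0 < grav) {p : ℝ × ℝ}
    (hp : p ∈ closedStrip T R) (hh : 0 < height h₀ (ubar p)) : α ≤ 1 := by
  set l := lamPlus grav h₀ (ubar p) with hl
  obtain ⟨-, -, a, b, h0, h1, h2, -⟩ := matS_apply hg hh M ![1, l]
  have hc := h.coercive p hp ![1, l]
  rw [h2] at hc
  simp only [dotProduct, Fin.sum_univ_two, Matrix.cons_val_zero, Matrix.cons_val_one] at hc h0 h1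
  have hd : 0 < l - lamMinus grav h₀ (ubar p) := by
    have : 0 < √(grav * height h₀ (ubar p)) := Real.sqrt_pos.2 (by positivity)
    rw [hl]
    unfold lamPlus lamMinus
    linarith
  have ha : (l - lamMinus grav h₀ (ubar p)) * a = 0 := by
    rw [← hl] at h1
    have hb : b = 1 + a := by linarith
    rw [hb] at h1
    linarith
  have ha0 : a = 0 := (mul_eq_zero.1 ha).resolve_left hd.ne'
  have hb : b = 1 := by linarith
  rw [ha0, hb, ← hl] at hc
  have : 0 < 1 + l ^ 2 := by positivity
  by_contra hα
  have := mul_lt_mul_of_pos_right (not_le.1 hα) this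
  linarith

/-- The sum of the square roots against the root of the sum. -/
lemma sum_sqrt_sq_bounds {n : ℕ} {a : ℕ → ℝ} (ha : ∀ i ∈ Finset.range n, 0 ≤ a i) :
    ∑ i ∈ Finset.range n, a i ≤ (∑ i ∈ Finset.range n, √(a i)) ^ 2 ∧
      (∑ i ∈ Finset.range n, √(a i)) ^ 2 ≤ n * ∑ i ∈ Finset.range n, a i := by
  have e : ∑ i ∈ Finset.range n, a i = ∑ i ∈ Finset.range n, √(a i) ^ 2 :=
    Finset.sum_congr rfl fun i hi => (Real.sq_sqrt (ha i hi)).symm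
  rw [e]
  refine ⟨Finset.sum_sq_le_sq_sum_of_nonneg (fun i _ => Real.sqrt_nonneg _), ?_⟩
  have := sq_sum_le_card_mul_sum_sq (s := Finset.range n) (f := fun i => √(a i))
  rwa [Finset.card_range] at this

section

variable {T R : ℝ} {k : ℕ} {v : ℝ × ℝ → State} {V : ℕ → ℕ → ℝ → L2r R}

lemma xNorm_nonneg (k : ℕ) (V : ℕ → ℕ → ℝ → L2r R) (t : ℝ) : 0 ≤ xNorm k V t :=
  Finset.sum_nonneg fun _ _ => Real.sqrt_nonneg _

lemma xNorm_sq_bounds (k : ℕ) (V : ℕ → ℕ → ℝ → L2r R) (t : ℝ) :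
    (dsum k fun i j => ‖V i j t‖ ^ 2) ≤ xNorm k V t ^ 2 ∧
      xNorm k V t ^ 2 ≤ (k + 1) * dsum k fun i j => ‖V i j t‖ ^ 2 := by
  have := sum_sqrt_sq_bounds (n := k + 1)
    (a := fun i => ∑ j ∈ Finset.range (k - i + 1), ‖V i j t‖ ^ 2)
    fun i _ => Finset.sum_nonneg fun j _ => sq_nonneg _
  rwa [Nat.cast_add_one] at this

lemma norm_le_xNorm (V : ℕ → ℕ → ℝ → L2r R) (t : ℝ) {i j : ℕ} (hij : i + j ≤ k) :
    ‖V i j t‖ ≤ xNorm k V t := by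
  refine (sq_le_sq₀ (norm_nonneg _) (xNorm_nonneg k V t)).1 ?_
  exact (le_dsum (a := fun i j => ‖V i j t‖ ^ 2) (fun _ _ _ => sq_nonneg _) hij).trans
    (xNorm_sq_bounds k V t).1

lemma xNorm_mono {m : ℕ} (hmk : m ≤ k) (V : ℕ → ℕ → ℝ → L2r R) (t : ℝ) :
    xNorm m V t ≤ xNorm k V t := by
  unfold xNorm
  calc _ ≤ ∑ i ∈ Finset.range (m + 1), √(∑ j ∈ Finset.range (k - i + 1), ‖V i j t‖ ^ 2) :=
        Finset.sum_le_sum fun i _ => Real.sqrt_le_sqrt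
          (Finset.sum_le_sum_of_subset_of_nonneg (Finset.range_mono (by omega))
            fun _ _ _ => sq_nonneg _)
    _ ≤ _ := Finset.sum_le_sum_of_subset_of_nonneg (Finset.range_mono (by omega))
        fun _ _ _ => Real.sqrt_nonneg _

lemma IsXFamily.xNorm_le_sup (h : IsXFamily k T R v V) {t : ℝ} (ht : t ∈ Icc 0 T) :
    xNorm k V t ≤ xNormSup k T V := by
  refine le_csSup (isCompact_Icc.bddAbove_image ?_) (mem_image_of_mem _ ht)
  unfold xNorm
  refine continuousOn_finsetSum _ fun i hi => ContinuousOn.sqrt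
    (continuousOn_finsetSum _ fun j hj => ?_)
  rw [Finset.mem_range] at hi hj
  exact ((h.cont i j (by omega)).norm).pow 2

/-- The pointwise inequality alone would not do: the Bochner integral on the right would be `0`
without integrability, which the reverse comparison with factor `k + 1` supplies. -/
lemma IsStripFamily.integral_dsum_le {f : ℝ × ℝ → State} {F : ℕ → ℕ → ℝ × ℝ → State}
    (hF : IsStripFamily k T R f F) {t : ℝ} (ht : t ≤ T) :
    ∫ τ in Ioo 0 t, (dsum k fun i j => ∫ r, ‖F i j (τ, r)‖ ^ 2 ∂(radialMeasure R)) ≤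
      ∫ τ in Ioo 0 t, stripXNorm k R F τ ^ 2 := by
  have hbd : ∀ τ, (dsum k fun i j => ∫ r, ‖F i j (τ, r)‖ ^ 2 ∂(radialMeasure R)) ≤
      stripXNorm k R F τ ^ 2 ∧ stripXNorm k R F τ ^ 2 ≤
        (k + 1) * dsum k fun i j => ∫ r, ‖F i j (τ, r)‖ ^ 2 ∂(radialMeasure R) := fun τ => by
    have := sum_sqrt_sq_bounds (n := k + 1) (a := fun i => ∑ j ∈ Finset.range (k - i + 1),
      ∫ r, ‖F i j (τ, r)‖ ^ 2 ∂(radialMeasure R))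
      fun i _ => Finset.sum_nonneg fun j _ => integral_nonneg fun _ => sq_nonneg _
    rwa [Nat.cast_add_one] at this
  have hi : ∀ i j, i + j ≤ k →
      IntegrableOn (fun τ => ∫ r, ‖F i j (τ, r)‖ ^ 2 ∂(radialMeasure R)) (Ioo 0 t) := by
    intro i j hij
    have h1 := (hF.memLp i j hij).integrable_norm_pow two_ne_zero
    rw [stripMeasure_eq_prod] at h1
    exact IntegrableOn.mono_set h1.integral_prod_left (Ioo_subset_Ioo_right ht)
  have hd : IntegrableOn (fun τ => dsum k fun i j => ∫ r, ‖F i j (τ, r)‖ ^ 2 ∂(radialMeasure R))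
      (Ioo 0 t) := by
    unfold dsum
    refine integrable_finsetSum _ fun i hi' => integrable_finsetSum _ fun j hj => ?_
    rw [Finset.mem_range] at hi' hj
    exact hi i j (by omega)
  have hm : AEStronglyMeasurable (fun τ => stripXNorm k R F τ ^ 2) (volume.restrict (Ioo 0 t)) := by
    unfold stripXNorm
    refine AEStronglyMeasurable.pow (Finset.aestronglyMeasurable_fun_sum _ fun i hi' => ?_) 2
    refine Real.continuous_sqrt.comp_aestronglyMeasurable
      (Finset.aestronglyMeasurable_fun_sum _ fun j hj => ?_)
    rw [Finset.mem_range] at hi' hj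
    exact (hi i j (by omega)).1
  refine integral_mono hd ?_ fun τ => (hbd τ).1
  refine (hd.const_mul ((k : ℝ) + 1)).mono' hm (Eventually.of_forall fun τ => ?_)
  rw [Real.norm_of_nonneg (sq_nonneg _)]
  exact (hbd τ).2

end

/-- The non-decreasing hull of the values of a function at the integers. -/
noncomputable def hull (C : ℝ → ℝ) (x : ℝ) : ℝ := ∑ m ∈ Finset.range (⌈x⌉₊ + 1), C m

lemma isNondecreasing_hull {C : ℝ → ℝ} (hC : ∀ x, 0 ≤ x → 0 ≤ C x) : IsNondecreasing (hull C) := by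
  refine ⟨fun x _ y _ hxy => ?_, fun x _ => Finset.sum_nonneg fun m _ => hC _ m.cast_nonneg⟩
  exact Finset.sum_le_sum_of_subset_of_nonneg
    (Finset.range_mono (Nat.add_le_add_right (Nat.ceil_mono hxy) 1)) fun m _ _ => hC _ m.cast_nonneg

lemma le_hull {C : ℝ → ℝ} (hC : ∀ x, 0 ≤ x → 0 ≤ C x) (x : ℝ) : C ⌈x⌉₊ ≤ hull C x :=
  Finset.single_le_sum (f := fun m : ℕ => C m) (fun m _ => hC _ m.cast_nonneg)
    (Finset.mem_range.2 (Nat.lt_succ_self _))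

/-- The comparison of the estimate with the one of the statement. -/
lemma final_bound {X X₀ N G J c C C₁ C₂ α c₁ c₂ R e e' : ℝ} (hX₀ : 0 ≤ X₀) (hG : 0 ≤ G) (hJ : 0 ≤ J)
    (hc : 0 < c) (hα0 : 0 < α) (hα : α ≤ 1) (hc₁ : 0 < c₁) (hR : 0 < R) (hC : 0 ≤ C) (hC₁ : C ≤ C₁)
    (hC₂ : c * C₁ ≤ C₂) (he0 : 0 ≤ e) (he : e ≤ e') (h : X + N ≤ c * e * (X₀ + G + C * J)) :
    X + N ≤ max c (c₂ * R) / min α (c₁ * R) * e' * (X₀ + G + C₂ / max c (c₂ * R) * J) := by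
  have hd0 : 0 < min α (c₁ * R) := lt_min hα0 (by positivity)
  have hd1 : min α (c₁ * R) ≤ 1 := (min_le_left _ _).trans hα
  have hcm : c ≤ max c (c₂ * R) := le_max_left _ _
  generalize max c (c₂ * R) = m at *
  generalize min α (c₁ * R) = d at *
  have hm : 0 < m := hc.trans_le hcm
  have hC₂0 : 0 ≤ C₂ := le_trans (by have := hC.trans hC₁; positivity) hC₂
  have hmd : c ≤ m / d := hcm.trans (le_div_self hm.le hd0 hd1)
  have hCd : C₂ ≤ C₂ / d := le_div_self hC₂0 hd0 hd1
  calc X + N ≤ c * e * (X₀ + G + C * J) := h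
    _ = e * (c * (X₀ + G) + c * C * J) := by ring
    _ ≤ e' * (m / d * (X₀ + G) + C₂ / d * J) := by
      have hCC := ((mul_le_mul_of_nonneg_left hC₁ hc.le).trans hC₂).trans hCd
      have := he0.trans he
      gcongr
    _ = _ := by field_simp

end FloatingSW

/-! ### Assembly of the proposition. -/

theorem proposition3p4 (grav h₀ R : ℝ) (hgrav : 0 < grav) (hh₀ : 0 < h₀) (hR : 0 < R) :
    -- every subsonic `ū` has a subsonic margin and constants of its symmetrizer
    (∀ (T : ℝ), 0 < T → ∀ (ubar : ℝ × ℝ → State) (Ubar : ℕ → ℕ → ℝ → FloatingSW.L2r R),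
      FloatingSW.IsXFamily 2 T R ubar Ubar →
      ContinuousOn ubar (FloatingSW.closedStrip T R) →
      FloatingSW.Subsonic grav h₀ T R ubar →
      (∃ δ > 0, FloatingSW.SubsonicWith grav h₀ T R δ ubar) ∧
      ∃ M α c₁ c₂ : ℝ, FloatingSW.IsSymmetrizerData grav h₀ T R M α c₁ c₂ ubar) ∧
    -- the estimate, with constants that are uniform for a given margin
    ∀ (δ : ℝ), 0 < δ →
      ∃ CR : ℝ → ℝ, FloatingSW.IsNondecreasing CR ∧
      ∀ (k : ℕ), 1 ≤ k →
      ∃ c C₁ C₂ : ℝ → ℝ, FloatingSW.IsNondecreasing c ∧ FloatingSW.IsNondecreasing C₁ ∧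
        FloatingSW.IsNondecreasing C₂ ∧
      ∀ (T : ℝ), 0 < T →
      -- the coefficient `ū ∈ X^s(T)`, `s = max(k, 2)`, in its continuous representative
      ∀ (ubar : ℝ × ℝ → State) (Ubar : ℕ → ℕ → ℝ → FloatingSW.L2r R),
      FloatingSW.IsXFamily (max k 2) T R ubar Ubar →
      ContinuousOn ubar (FloatingSW.closedStrip T R) →
      FloatingSW.SubsonicWith grav h₀ T R δ ubar →
      ∀ (M α c₁ c₂ : ℝ), FloatingSW.IsSymmetrizerData grav h₀ T R M α c₁ c₂ ubar →
      -- the data `f ∈ H^k_r`, `gb ∈ H^k`, `u₀`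
      ∀ (f : ℝ × ℝ → State) (F : ℕ → ℕ → ℝ × ℝ → State) (gb : ℝ → ℝ) (G : ℕ → ℝ → ℝ)
        (u₀ : ℝ → State),
      FloatingSW.IsStripFamily k T R f F →
      FloatingSW.IsHFamily k T gb G →
      -- the solution `u ∈ H^{k+1}_r`, in its continuous representative
      ∀ (u : ℝ × ℝ → State) (U : ℕ → ℕ → ℝ × ℝ → State),
      FloatingSW.IsStripFamily (k + 1) T R u U →
      ContinuousOn u (FloatingSW.closedStrip T R) →
      FloatingSW.IsSolution grav h₀ T R ubar f gb u₀ u U →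
      ∃ (V : ℕ → ℕ → ℝ → FloatingSW.L2r R) (b : ℕ → ℝ → State),
        FloatingSW.IsXFamily k T R u V ∧
        FloatingSW.IsHFamily k T (fun t => u (t, R)) b ∧
        ∀ t ∈ Set.Icc 0 T,
          FloatingSW.xNorm k V t ^ 2 + FloatingSW.hNormSq k b t ≤
            max (c (FloatingSW.xNorm 2 Ubar 0)) (c₂ * R) / min α (c₁ * R) *
            Real.exp (t * (1 + α⁻¹ * CR (FloatingSW.xNormSup 2 T Ubar)
              + α⁻¹ * (k + 1) * C₁ (FloatingSW.xNormSup (max k 2) T Ubar))) *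
            (FloatingSW.xNorm k V 0 ^ 2 + FloatingSW.hNormSq k G t
              + C₂ (FloatingSW.xNormSup (max k 2) T Ubar)
                  / max (c (FloatingSW.xNorm 2 Ubar 0)) (c₂ * R)
                * ∫ τ in Set.Ioo 0 t, FloatingSW.stripXNorm k R F τ ^ 2) := by
  refine ⟨fun T hT ubar Ubar hX hc hsub => ?_, fun δ hδ => ?_⟩
  · obtain ⟨⟨δ, hδ, hδs⟩, B, hB⟩ :=
      FloatingSW.exists_margin hgrav hh₀ hT hR hX one_le_two hc hsub
    exact ⟨⟨δ, hδ, hδs⟩, FloatingSW.exists_symmetrizer hgrav hδ hδs hB⟩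
  -- `C_R` may be zero: since `α ≤ 1`, the term with `C₁` already bounds the whole rate.
  refine ⟨fun _ => 0, ⟨fun _ _ _ _ _ => le_rfl, fun _ _ => le_rfl⟩, fun k _ => ?_⟩
  obtain ⟨A, n, hA, hest⟩ := FloatingSW.exists_estimate hgrav hh₀ hδ hR k
  have hex : ∀ K : ℝ, ∃ C : ℝ, 0 ≤ K → 0 ≤ C ∧ _ := fun K => by
    by_cases hK : 0 ≤ K
    · obtain ⟨C, hC⟩ := hest K hK
      exact ⟨C, fun _ => hC⟩
    · exact ⟨0, fun h => absurd h hK⟩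
  -- This choice need not be monotone in `K`. It will be used at integers only, where `hull`
  -- dominates it by a non-decreasing function.
  choose C hCK using hex
  have hC0 : ∀ x, 0 ≤ x → 0 ≤ C x := fun x hx => (hCK x hx).1
  -- The factor `k + 1` is the cost of passing from the sum of the squares to the square of the sum
  -- defining `xNorm`.
  set c : ℝ → ℝ := fun x => (k + 1) * (A * (1 + x) ^ n) with hc
  have hnd := FloatingSW.isNondecreasing_hull hC0
  have hcm : FloatingSW.IsNondecreasing c := by
    refine ⟨fun x hx y hy hxy => ?_, fun x hx => ?_⟩
    · have hx' : (0 : ℝ) ≤ x := hx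
      simp only [hc]
      gcongr
    · have hx' : (0 : ℝ) ≤ x := hx
      simp only [hc]
      positivity
  -- `C₂` has to contain the prefactor `c`, because the statement divides the factor of the source
  -- by the maximum that multiplies it.
  refine ⟨c, FloatingSW.hull C, fun x => c x * FloatingSW.hull C x, hcm, hnd,
    ⟨hcm.1.mul hnd.1 hcm.2 hnd.2, fun x hx => mul_nonneg (hcm.2 x hx) (hnd.2 x hx)⟩, ?_⟩
  intro T hT ubar Ubar hX hcont hsub M α c₁ c₂ hdata f F gb G u₀ hF hG u U hU hu hS
  have h0T : (0 : ℝ) ∈ Set.Icc 0 T := ⟨le_rfl, hT.le⟩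
  set Ks := FloatingSW.xNormSup (max k 2) T Ubar with hKs
  set K₀ := FloatingSW.xNorm 2 Ubar 0 with hK₀
  have hK₀0 : 0 ≤ K₀ := FloatingSW.xNorm_nonneg _ _ _
  have hK₀s : K₀ ≤ Ks :=
    (FloatingSW.xNorm_mono (le_max_right k 2) Ubar 0).trans (hX.xNorm_le_sup h0T)
  -- The norm of the coefficient is rounded up to an integer, at which `hull C Ks` dominates `C`.
  obtain ⟨V, b, hV, hb, hVb⟩ := (hCK ⌈Ks⌉₊ (Nat.cast_nonneg _)).2 T hT ubar Ubar hX hcont hsub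
    (fun i j hij t ht => ((FloatingSW.norm_le_xNorm Ubar t hij).trans (hX.xNorm_le_sup ht)).trans
      (Nat.le_ceil _)) f F gb G u₀ hF hG u U hU hu hS
  refine ⟨V, b, hV, hb, fun t ht => ?_⟩
  have h := hVb K₀ hK₀0 (FloatingSW.norm_le_xNorm Ubar 0 (by omega))
    (FloatingSW.norm_le_xNorm Ubar 0 (by omega)) t ht
  have hα : α ≤ 1 := hdata.alpha_le_one hgrav (p := (0, R)) ⟨h0T, le_refl R⟩
    (FloatingSW.height_pos_of_margin hgrav hδ (hsub (0, R) ⟨h0T, le_refl R⟩)).1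
  have hCh : C ⌈Ks⌉₊ ≤ FloatingSW.hull C Ks := FloatingSW.le_hull hC0 Ks
  have hCn := hC0 ⌈Ks⌉₊ (Nat.cast_nonneg _)
  have ht0 : 0 ≤ t := ht.1
  have hN : 0 ≤ FloatingSW.hNormSq k b t := Finset.sum_nonneg fun i _ =>
    MeasureTheory.integral_nonneg fun _ => sq_nonneg _
  have hαi : 1 ≤ α⁻¹ * (k + 1) :=
    one_le_mul_of_one_le_of_one_le ((one_le_inv₀ hdata.α_pos).2 hα) (by
      have : (0 : ℝ) ≤ k := Nat.cast_nonneg k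
      linarith)
  refine FloatingSW.final_bound (C := C ⌈Ks⌉₊) (C₁ := FloatingSW.hull C Ks)
    (e := Real.exp (C ⌈Ks⌉₊ * t)) (sq_nonneg _)
    (Finset.sum_nonneg fun i _ => MeasureTheory.integral_nonneg fun _ => sq_nonneg _)
    (MeasureTheory.integral_nonneg fun _ => sq_nonneg _) ?_ hdata.α_pos hα hdata.c₁_pos hR hCn hCh
    ?_ (Real.exp_nonneg _) ?_ ?_
  · simp only [hc]
    positivity
  · exact mul_le_mul_of_nonneg_right (hcm.1 hK₀0 (hK₀0.trans hK₀s) hK₀s) (hCn.trans hCh)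
  · rw [Real.exp_le_exp, mul_comm]
    refine mul_le_mul_of_nonneg_left ?_ ht0
    have := le_mul_of_one_le_left (hCn.trans hCh) hαi
    linarith
  · have h1 := (FloatingSW.xNorm_sq_bounds k V t).2
    have h2 := (FloatingSW.xNorm_sq_bounds k V 0).1
    have h3 := hF.integral_dsum_le ht.2
    have h4 : FloatingSW.hNormSq k b t ≤ (k + 1) * FloatingSW.hNormSq k b t :=
      le_mul_of_one_le_left hN (by
        have : (0 : ℝ) ≤ k := Nat.cast_nonneg k
        linarith)
    calc _ ≤ ((k : ℝ) + 1) * (FloatingSW.dsum k (fun i j => ‖V i j t‖ ^ 2) +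
          FloatingSW.hNormSq k b t) := by linarith
      _ ≤ (k + 1) * (A * (1 + K₀) ^ n * Real.exp (C ⌈Ks⌉₊ * t) *
          (FloatingSW.xNorm k V 0 ^ 2 + FloatingSW.hNormSq k G t +
            C ⌈Ks⌉₊ * ∫ τ in Set.Ioo 0 t, FloatingSW.stripXNorm k R F τ ^ 2)) := by
        refine mul_le_mul_of_nonneg_left (h.trans ?_) (by positivity)
        gcongr
      _ = _ := by simp only [hc]; ring
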